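/- **Conventions.** All vector spaces are over $\mathbb{Q}$; dg objects are $\mathbb{Z}$-graded with differential of degree $-1$, and the Koszul sign rule is used. Let $C$ be a coassociative, counital, graded-cocommutative dg coalgebra with comultiplication $\Delta c=\sum c_{(0)}\otimes c_{(1)}$ and counit $\epsilon$, which is $2$-reduced: $C_n=0$ for $n<0$, $\epsilon\colon C_0\cong\mathbb{Q}$, and $C_1=0$. Let $C\text{-Comod}$ be the category of (possibly unbounded) left dg $C$-comodules, and write the coaction of $M$ as $\rho_M(m)=\sum m_{(0)}\otimes m_{(1)}\in C\otimes M$. *Twisted (co)extensions.* Let $\overline C=C/C_0$ and let $\Omega C=T(\overline C[1])$ be the cobar construction: the tensor algebra on the symbols $tc=s^{-1}[c]$ of degree $|c|-1$, with the derivation differential $d(tc)=-t(dc)-\sum(-1)^{|c_{(0)}|}\,tc_{(0)}\cdot tc_{(1)}$. Let $t^!\colon C\text{-Comod}\to\Omega C\text{-Mod}$ send $N$ to $\Omega C\otimes N$ with $$d(a\otimes n)=da\otimes n+(-1)^{|a|}a\otimes dn-(-1)^{|a|}\sum a\cdot tn_{(0)}\otimes n_{(1)},$$ and let $t_*\colon\Omega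 C\text{-Mod}\to C\text{-Comod}$ send $X$ to $C\otimes X$ with coaction $\Delta\otimes X$ and $$d(c\otimes x)=dc\otimes x+(-1)^{|c|}c\otimes dx+\sum(-1)^{|c_{(0)}|}c_{(0)}\otimes tc_{(1)}\cdot x.$$ There is a natural map $\eta_N\colon N\to t_*t^!N$, $n\mapsto\sum n_{(0)}\otimes(1\otimes n_{(1)})$. A morphism $f$ of comodules is a *$t$-equivalence* if $t^!f$ is a quasi-isomorphism. Let $Q\colon C\text{-Comod}\to Ho(C\text{-Comod}_{(t)})$ be the localization at the $t$-equivalences. *Cotensor products.* The cotensor product $M\,\square_C\,N\subseteq M\otimes N$ is the equaliser of $M\otimes\rho_N$ and $\rho_M\otimes N\colon M\otimes N\to M\otimes C\otimes N$, where $M$ is viewed as a right comodule through the Koszul symmetry. It is a left comodule by $m\otimes n\mapsto\sum m_{(0)}\otimes(m_{(1)}\otimes n)$. Put $M\,\square^{\mathbf R}_C\,N:=t_*t^!M\,\square_C\,t_*t^!N$. *Cotorsion.* A comodule $A$ is *injective* if $\rho_A\colon A\to C\otimes A$ has a retraction of dg comodules, where $C\otimes A$ is the cofree comodule. An *injective resolution*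 of $M$ is a complex of comodules $0\to M\to A^0\to A^1\to\cdots$ with every $A^i$ connective (zero in negative degrees) and injective, whose underlying sequence of chain complexes of vector spaces is split exact. For complexes of comodules $A=(A^i)_{i\ge0}$ and $B=(B^j)_{j\ge0}$, $\mathrm{Tot}^{\prod}(A\,\square_C\,B)$ is the total complex whose degree $k$ part is $\prod_{i,j\ge 0}(A^i\,\square_C\,B^j)_{k+i+j}$, with differential $$(Dx)_{ij}=\delta_Ax_{i-1,j}+(-1)^i\delta_Bx_{i,j-1}+(-1)^{i+j}dx_{ij}.$$ **Theorem.** 1. *Descent.* If $f\colon M\to M'$ and $g\colon N\to N'$ are $t$-equivalences, then so is $f\,\square^{\mathbf R}_C\,g\colon M\,\square^{\mathbf R}_C\,N\to M'\,\square^{\mathbf R}_C\,N'$. 2. *Symmetric monoidal structure.* There are a symmetric monoidal structure $\otimes$ on $Ho(C\text{-Comod}_{(t)})$, a natural isomorphism $\mu\colon QM\otimes QN\cong Q(M\,\square^{\mathbf R}_C\,N)$, and an isomorphism between the monoidal unit and $Q(C)$, such that the structure isomorphisms are induced by those of the cotensor product, as follows. Let $$\lambda_{M,N}=\mu^{-1}\circ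 Q(\eta_M\,\square_C\,\eta_N)\colon Q(M\,\square_C\,N)\to QM\otimes QN.$$ * (associator) If $a\colon X\to(M\,\square_C\,N)\,\square_C\,P$ and $b\colon X\to M\,\square_C\,(N\,\square_C\,P)$ are comodule maps that agree in $M\otimes N\otimes P$, then $\alpha\circ(\lambda_{M,N}\otimes QP)\circ\lambda_{M\square N,\,P}\circ Qa=(QM\otimes\lambda_{N,P})\circ\lambda_{M,\,N\square P}\circ Qb$. * (unit) If $a\colon X\to C\,\square_C\,M$ and $b\colon X\to M$ are comodule maps with $(\epsilon\otimes M)\circ a=b$, then the composite of $\lambda_{C,M}\circ Qa$ with $QC\otimes QM\cong\mathbf 1\otimes QM\cong QM$ is $Qb$. * (symmetry) If $a\colon X\to M\,\square_C\,N$ and $b\colon X\to N\,\square_C\,M$ are comodule maps that correspond under the Koszul symmetry $M\otimes N\cong N\otimes M$, then $\beta\circ\lambda_{M,N}\circ Qa=\lambda_{N,M}\circ Qb$. 3. *Cotorsion is well defined.* Every connective comodule has an injective resolution. For all comodules $M,N$ and all injective resolutions $M\to A$ and $N\to B$, both maps $$\mathrm{Tot}^{\prod}(A\,\square_C\,N)\to\mathrm{Tot}^{\prod}(A\,\square_C\,B)\leftarrow\mathrm{Tot}^{\prod}(M\,\square_C\,B)$$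 are quasi-isomorphisms. Their common homology is the Eilenberg–Moore cotorsion $\mathrm{Cotor}^C_\bullet(M,N)$. 4. *Homology.* For connective comodules $M$ and $N$ with any injective resolutions $A$ and $B$, and every $k\in\mathbb{Z}$, there is an isomorphism $$H_k(M\,\square^{\mathbf R}_C\,N)\;\cong\;H_k\big(\mathrm{Tot}^{\prod}(A\,\square_C\,B)\big)=\mathrm{Cotor}^C_k(M,N).$$ It is natural with respect to comodule maps $f\colon M\to M'$ and $g\colon N\to N'$ and any morphisms of resolutions lying over them. -/

import Mathlib

open CategoryTheory
open scoped TensorProduct DirectSum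

universe u v w

namespace DGKoszul

noncomputable section

/-! ### Graded rational vector spaces (internally `ℤ`-graded) -/

/-- A `ℤ`-grading on a rational vector space: `V = ⨁ₙ Vₙ`. -/
class GrVect (V : Type u) [AddCommGroup V] [Module ℚ V] where
  piece : ℤ → Submodule ℚ V
  isInternal : DirectSum.IsInternal piece

/-- The homogeneous component `Vₙ` of a graded vector space. -/
abbrev gr (V : Type u) [AddCommGroup V] [Module ℚ V] [GrVect V] (n : ℤ) : Submodule ℚ V :=
  GrVect.piece n

section Graded

variable {V : Type u} [AddCommGroup V] [Module ℚ V]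

/-- A criterion for a family of subspaces to be a grading. -/
theorem isInternal_of_split (P : ℤ → Submodule ℚ V) (γ : V →ₗ[ℚ] (ℤ →₀ V))
    (hγ : ∀ n, ∀ x ∈ P n, γ x = Finsupp.single n x) (htop : iSup P = ⊤) :
    DirectSum.IsInternal P := by
  constructor
  · have key : ∀ x : ⨁ n, P n, ∀ n, γ (DirectSum.coeAddMonoidHom P x) n = (x n : V) := by
      intro x n
      induction x using DirectSum.induction_on with
      | zero => simp
      | of i x =>
        rw [DirectSum.coeAddMonoidHom_of, hγ i x x.2, DirectSum.coe_of_apply,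
          Finsupp.single_apply]
        split_ifs <;> simp
      | add x y hx hy => simp [hx, hy]
    intro x y hxy
    ext n
    rw [← key, ← key, hxy]
  · intro x
    have hx : x ∈ iSup P := htop ▸ Submodule.mem_top
    induction hx using Submodule.iSup_induction' with
    | mem i x hx => exact ⟨DirectSum.of (fun n => P n) i ⟨x, hx⟩, by simp⟩
    | zero => exact ⟨0, by simp⟩
    | add x y _ _ hx hy =>
      obtain ⟨a, ha⟩ := hx
      obtain ⟨b, hb⟩ := hy
      exact ⟨a + b, by simp [ha, hb]⟩

variable [GrVect V]

theorem gr_bijective : Function.Bijective (DirectSum.coeLinearMap (gr V)) :=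
  GrVect.isInternal (V := V)

/-- The identification `⨁ₙ Vₙ ≃ V`. -/
def gradingEquiv (V : Type u) [AddCommGroup V] [Module ℚ V] [GrVect V] :
    (⨁ n, gr V n) ≃ₗ[ℚ] V :=
  LinearEquiv.ofBijective (DirectSum.coeLinearMap (gr V)) gr_bijective

/-- The decomposition of a vector into its homogeneous components. -/
def comps : V →ₗ[ℚ] (ℤ →₀ V) :=
  (DirectSum.toModule ℚ ℤ (ℤ →₀ V) fun n => (Finsupp.lsingle n) ∘ₗ (gr V n).subtype) ∘ₗ
    (gradingEquiv V).symm.toLinearMap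

theorem comps_of_mem {n : ℤ} {x : V} (hx : x ∈ gr V n) : comps x = Finsupp.single n x := by
  have : (gradingEquiv V).symm x = DirectSum.lof ℚ ℤ (fun n => gr V n) n ⟨x, hx⟩ := by
    rw [LinearEquiv.symm_apply_eq, gradingEquiv, LinearEquiv.ofBijective_apply, DirectSum.coeLinearMap_lof]
  simp only [comps, LinearMap.comp_apply, LinearEquiv.coe_coe, this]
  simp

theorem iSup_gr : iSup (gr V) = ⊤ :=
  (GrVect.isInternal (V := V)).submodule_iSup_eq_top

/-- To prove an additive property of all vectors it suffices to treat homogeneous ones. -/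
theorem gr_induction {p : V → Prop} (x : V) (hom : ∀ n, ∀ x ∈ gr V n, p x)
    (add : ∀ x y, p x → p y → p (x + y)) : p x := by
  have hx : x ∈ iSup (gr V) := iSup_gr (V := V) ▸ Submodule.mem_top
  induction hx using Submodule.iSup_induction' with
  | mem i x hx => exact hom i x hx
  | zero => exact hom 0 0 (Submodule.zero_mem _)
  | add x y _ _ hx hy => exact add x y hx hy

/-- Two linear maps agree if they agree on homogeneous vectors. -/
theorem gr_ext {W : Type v} [AddCommGroup W] [Module ℚ W] {f g : V →ₗ[ℚ] W}
    (h : ∀ n, ∀ x ∈ gr V n, f x = g x) : f = g :=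
  LinearMap.ext fun x => gr_induction (p := fun x => f x = g x) x h
    fun x y hx hy => by simp [hx, hy]

/-- The sign operator `v ↦ (-1)^{|v|} v`. -/
def sgn : V →ₗ[ℚ] V :=
  (Finsupp.lsum ℚ fun n : ℤ => (n.negOnePow • LinearMap.id : V →ₗ[ℚ] V)) ∘ₗ comps

theorem sgn_of_mem {n : ℤ} {x : V} (hx : x ∈ gr V n) : sgn x = n.negOnePow • x := by
  simp only [sgn, LinearMap.comp_apply, comps_of_mem hx, Finsupp.lsum_single,
    LinearMap.smul_apply, LinearMap.id_apply]

theorem sgn_mem {n : ℤ} {x : V} (hx : x ∈ gr V n) : sgn x ∈ gr V n := by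
  rw [sgn_of_mem hx, Units.smul_def]
  exact zsmul_mem hx _

@[simp] theorem sgn_sgn (x : V) : sgn (sgn x) = x := by
  refine gr_induction (p := fun x => sgn (sgn x) = x) x (fun n x hx => ?_) (fun x y hx hy => ?_)
  · rw [sgn_of_mem (sgn_mem hx), sgn_of_mem hx, smul_smul, Int.units_mul_self, one_smul]
  · simp [hx, hy]

/-- Degree-preserving maps commute with the sign operators. -/
theorem sgn_map {W : Type v} [AddCommGroup W] [Module ℚ W] [GrVect W] (f : V →ₗ[ℚ] W)
    (hf : ∀ n, ∀ x ∈ gr V n, f x ∈ gr W n) (x : V) : f (sgn x) = sgn (f x) := by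
  refine gr_induction (p := fun x => f (sgn x) = sgn (f x)) x (fun n x hx => ?_)
    (fun x y hx hy => by simp [hx, hy])
  rw [sgn_of_mem hx, sgn_of_mem (hf n x hx), Units.smul_def, Units.smul_def, map_zsmul]

/-- Maps of degree `-1` anticommute with the sign operators. -/
theorem sgn_map_neg {W : Type v} [AddCommGroup W] [Module ℚ W] [GrVect W] (f : V →ₗ[ℚ] W)
    (hf : ∀ n, ∀ x ∈ gr V n, f x ∈ gr W (n - 1)) (x : V) : f (sgn x) = - sgn (f x) := by
  refine gr_induction (p := fun x => f (sgn x) = - sgn (f x)) x (fun n x hx => ?_)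
    (fun x y hx hy => by simp [hx, hy]; abel)
  rw [sgn_of_mem hx, sgn_of_mem (hf n x hx), Int.negOnePow_sub, Int.negOnePow_one,
    Units.smul_def, Units.smul_def, map_zsmul]
  simp

end Graded

section TensorGrading

variable {V : Type u} [AddCommGroup V] [Module ℚ V] [GrVect V]
variable {W : Type v} [AddCommGroup W] [Module ℚ W] [GrVect W]

/-- The degree `n` part of a tensor product, spanned by `v ⊗ w` with `|v| + |w| = n`. -/
def tensorPiece (V : Type u) [AddCommGroup V] [Module ℚ V] [GrVect V]
    (W : Type v) [AddCommGroup W] [Module ℚ W] [GrVect W] (n : ℤ) : Submodule ℚ (V ⊗[ℚ] W) :=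
  Submodule.span ℚ {z | ∃ i j : ℤ, i + j = n ∧ ∃ v ∈ gr V i, ∃ w ∈ gr W j, z = v ⊗ₜ[ℚ] w}

theorem tensorPiece_isInternal : DirectSum.IsInternal (tensorPiece V W) := by
  refine isInternal_of_split _
    ((Finsupp.lmapDomain (V ⊗[ℚ] W) ℚ (fun p : ℤ × ℤ => p.1 + p.2)) ∘ₗ
      (finsuppTensorFinsupp ℚ ℚ V W ℤ ℤ).toLinearMap ∘ₗ
      (TensorProduct.map comps comps)) ?_ ?_
  · intro n x hx
    refine Submodule.span_induction ?_ (by simp) ?_ ?_ hx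
    · rintro _ ⟨i, j, rfl, v, hv, w, hw, rfl⟩
      simp [comps_of_mem hv, comps_of_mem hw]
    · intro x y _ _ hx hy
      rw [map_add, hx, hy, Finsupp.single_add]
    · intro a x _ hx
      rw [map_smul, hx, Finsupp.smul_single]
  · rw [eq_top_iff]
    rintro z -
    induction z using TensorProduct.induction_on with
    | zero => exact Submodule.zero_mem _
    | add x y hx hy => exact Submodule.add_mem _ hx hy
    | tmul v w =>
      refine gr_induction (p := fun v => v ⊗ₜ[ℚ] w ∈ iSup (tensorPiece V W)) v
        (fun i v hv => ?_) (fun x y hx hy => by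
          rw [TensorProduct.add_tmul]; exact Submodule.add_mem _ hx hy)
      refine gr_induction (p := fun w => v ⊗ₜ[ℚ] w ∈ iSup (tensorPiece V W)) w
        (fun j w hw => ?_) (fun x y hx hy => by
          rw [TensorProduct.tmul_add]; exact Submodule.add_mem _ hx hy)
      exact Submodule.mem_iSup_of_mem (i + j) (Submodule.subset_span ⟨i, j, rfl, v, hv, w, hw, rfl⟩)

instance : GrVect (V ⊗[ℚ] W) where
  piece := tensorPiece V W
  isInternal := tensorPiece_isInternal

theorem tmul_mem {i j n : ℤ} (h : i + j = n) {v : V} (hv : v ∈ gr V i) {w : W}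
    (hw : w ∈ gr W j) : v ⊗ₜ[ℚ] w ∈ gr (V ⊗[ℚ] W) n :=
  Submodule.subset_span ⟨i, j, h, v, hv, w, hw, rfl⟩

/-- To check that a linear map on a tensor product has degree `k`, check homogeneous tensors. -/
theorem tensor_degree {X : Type w} [AddCommGroup X] [Module ℚ X] [GrVect X]
    (f : V ⊗[ℚ] W →ₗ[ℚ] X) (k : ℤ)
    (h : ∀ i j, ∀ v ∈ gr V i, ∀ w ∈ gr W j, f (v ⊗ₜ[ℚ] w) ∈ gr X (i + j + k)) (n : ℤ)
    (z : V ⊗[ℚ] W) (hz : z ∈ gr (V ⊗[ℚ] W) n) : f z ∈ gr X (n + k) := by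
  refine Submodule.span_induction (p := fun z _ => f z ∈ gr X (n + k)) ?_ (by simp) ?_ ?_ hz
  · rintro _ ⟨i, j, rfl, v, hv, w, hw, rfl⟩
    exact h i j v hv w hw
  · intro x y _ _ hx hy
    rw [map_add]; exact Submodule.add_mem _ hx hy
  · intro a x _ hx
    rw [map_smul]; exact Submodule.smul_mem _ _ hx

theorem map_mem {V' : Type u} [AddCommGroup V'] [Module ℚ V'] [GrVect V']
    {W' : Type v} [AddCommGroup W'] [Module ℚ W'] [GrVect W']
    (f : V →ₗ[ℚ] V') (g : W →ₗ[ℚ] W') (k l : ℤ) (hf : ∀ n, ∀ x ∈ gr V n, f x ∈ gr V' (n + k))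
    (hg : ∀ n, ∀ x ∈ gr W n, g x ∈ gr W' (n + l)) (n : ℤ)
    (z : V ⊗[ℚ] W) (hz : z ∈ gr (V ⊗[ℚ] W) n) :
    TensorProduct.map f g z ∈ gr (V' ⊗[ℚ] W') (n + (k + l)) :=
  tensor_degree _ _ (fun i j v hv w hw => tmul_mem (by ring) (hf i v hv) (hg j w hw)) n z hz

@[simp] theorem sgn_tmul (v : V) (w : W) : sgn (v ⊗ₜ[ℚ] w) = sgn v ⊗ₜ[ℚ] sgn w := by
  refine gr_induction (p := fun v => sgn (v ⊗ₜ[ℚ] w) = sgn v ⊗ₜ[ℚ] sgn w) v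
    (fun i v hv => ?_) (fun x y hx hy => by simp [TensorProduct.add_tmul, hx, hy])
  refine gr_induction (p := fun w => sgn (v ⊗ₜ[ℚ] w) = sgn v ⊗ₜ[ℚ] sgn w) w
    (fun j w hw => ?_) (fun x y hx hy => by simp [TensorProduct.tmul_add, hx, hy])
  rw [sgn_of_mem (tmul_mem rfl hv hw), sgn_of_mem hv, sgn_of_mem hw, Int.negOnePow_add]
  simp only [Units.smul_def, Units.val_mul, TensorProduct.smul_tmul', TensorProduct.tmul_smul,
    smul_smul]
  rw [mul_comm]

/-- The Koszul symmetry `v ⊗ w ↦ (-1)^{|v||w|} w ⊗ v`: since the sign only depends on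
parities, it is `v ⊗ w ↦ ½ (w ⊗ v + w ⊗ σv + σw ⊗ v - σw ⊗ σv)` with `σ` the sign operator
(see `swap_tmul_of_mem`). -/
def swap (V : Type u) [AddCommGroup V] [Module ℚ V] [GrVect V]
    (W : Type v) [AddCommGroup W] [Module ℚ W] [GrVect W] : V ⊗[ℚ] W →ₗ[ℚ] W ⊗[ℚ] V :=
  (2⁻¹ : ℚ) • ((LinearMap.id + TensorProduct.map LinearMap.id sgn +
    TensorProduct.map sgn LinearMap.id - TensorProduct.map sgn sgn) ∘ₗ
    (TensorProduct.comm ℚ V W).toLinearMap)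

theorem swap_tmul (v : V) (w : W) : swap V W (v ⊗ₜ w) =
    (2⁻¹ : ℚ) • (w ⊗ₜ v + w ⊗ₜ sgn v + sgn w ⊗ₜ v - sgn w ⊗ₜ sgn v) := by
  simp [swap]

theorem swap_tmul_of_mem {i j : ℤ} {v : V} (hv : v ∈ gr V i) {w : W} (hw : w ∈ gr W j) :
    swap V W (v ⊗ₜ w) = (i * j).negOnePow • (w ⊗ₜ[ℚ] v) := by
  rw [swap_tmul, sgn_of_mem hv, sgn_of_mem hw]
  rcases Int.even_or_odd i with hi | hi <;> rcases Int.even_or_odd j with hj | hj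
  · rw [Int.negOnePow_even _ hi, Int.negOnePow_even _ hj, Int.negOnePow_even _ (hi.mul_right j)]
    simp only [one_smul]
    module
  · rw [Int.negOnePow_even _ hi, Int.negOnePow_odd _ hj, Int.negOnePow_even _ (hi.mul_right j)]
    simp only [one_smul, Units.neg_smul, TensorProduct.neg_tmul]
    module
  · rw [Int.negOnePow_odd _ hi, Int.negOnePow_even _ hj, Int.negOnePow_even _ (hj.mul_left i)]
    simp only [one_smul, Units.neg_smul, TensorProduct.tmul_neg]
    module
  · rw [Int.negOnePow_odd _ hi, Int.negOnePow_odd _ hj, Int.negOnePow_odd _ (hi.mul hj)]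
    simp only [one_smul, Units.neg_smul, TensorProduct.tmul_neg, TensorProduct.neg_tmul, neg_neg]
    module

theorem swap_mem (n : ℤ) (z : V ⊗[ℚ] W) (hz : z ∈ gr (V ⊗[ℚ] W) n) :
    swap V W z ∈ gr (W ⊗[ℚ] V) n := by
  have := tensor_degree (swap V W) 0 (fun i j v hv w hw => by
    rw [swap_tmul_of_mem hv hw, Units.smul_def]
    exact zsmul_mem (tmul_mem (by ring) hw hv) _) n z hz
  simpa using this

/-- Naturality of the Koszul symmetry. -/
theorem swap_map {V' : Type u} [AddCommGroup V'] [Module ℚ V'] [GrVect V']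
    {W' : Type v} [AddCommGroup W'] [Module ℚ W'] [GrVect W']
    (f : V →ₗ[ℚ] V') (g : W →ₗ[ℚ] W') (hf : ∀ n, ∀ x ∈ gr V n, f x ∈ gr V' n)
    (hg : ∀ n, ∀ x ∈ gr W n, g x ∈ gr W' n) (z : V ⊗[ℚ] W) :
    swap V' W' (TensorProduct.map f g z) = TensorProduct.map g f (swap V W z) := by
  induction z using TensorProduct.induction_on with
  | zero => simp
  | add x y hx hy => simp [hx, hy]
  | tmul v w => simp [swap_tmul, sgn_map f hf, sgn_map g hg]

end TensorGrading

section Kernel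

variable {V : Type u} [AddCommGroup V] [Module ℚ V] [GrVect V]

/-- A subspace is homogeneous if it contains the homogeneous components of its elements. -/
def IsHomogeneous (S : Submodule ℚ V) : Prop := ∀ x ∈ S, ∀ n, comps x n ∈ S

theorem comps_apply_mem (x : V) (n : ℤ) : comps x n ∈ gr V n := by
  refine gr_induction (p := fun x => comps x n ∈ gr V n) x (fun m x hx => ?_)
    (fun x y hx hy => by simpa using Submodule.add_mem _ hx hy)
  rw [comps_of_mem hx, Finsupp.single_apply]
  split_ifs with h
  · exact h ▸ hx
  · exact Submodule.zero_mem _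

theorem sum_comps (x : V) : (comps x).sum (fun _ y => y) = x := by
  refine gr_induction (p := fun x => (comps x).sum (fun _ y => y) = x) x (fun m x hx => ?_)
    (fun x y hx hy => ?_)
  · rw [comps_of_mem hx]; simp
  · rw [map_add, Finsupp.sum_add_index' (by simp) (by simp), hx, hy]

theorem comps_map {W : Type v} [AddCommGroup W] [Module ℚ W] [GrVect W] (f : V →ₗ[ℚ] W)
    (hf : ∀ n, ∀ x ∈ gr V n, f x ∈ gr W n) (x : V) (n : ℤ) :
    comps (f x) n = f (comps x n) := by
  refine gr_induction (p := fun x => comps (f x) n = f (comps x n)) x (fun m x hx => ?_)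
    (fun x y hx hy => by simp [hx, hy])
  rw [comps_of_mem hx, comps_of_mem (hf m x hx), Finsupp.single_apply, Finsupp.single_apply]
  split_ifs <;> simp

theorem IsHomogeneous.isInternal {S : Submodule ℚ V} (hS : IsHomogeneous S) :
    DirectSum.IsInternal (fun n => (gr V n).comap S.subtype) := by
  have hsum : ∀ x : S, x ∈ ⨆ n, (gr V n).comap S.subtype := by
    intro x
    have : x = ∑ n ∈ (comps (x : V)).support, (⟨comps (x : V) n, hS x x.2 n⟩ : S) := by
      apply Subtype.ext
      rw [AddSubmonoidClass.coe_finsetSum]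
      exact (sum_comps (x : V)).symm
    rw [this]
    exact Submodule.sum_mem _ fun n _ => Submodule.mem_iSup_of_mem n (comps_apply_mem _ n)
  let γ : S →ₗ[ℚ] (ℤ →₀ S) :=
    { toFun := fun x => Finsupp.onFinset (comps (x : V)).support
        (fun n => ⟨comps (x : V) n, hS x x.2 n⟩) (fun n hn => by
          rw [Finsupp.mem_support_iff]
          exact fun h => hn (Subtype.ext h))
      map_add' := fun x y => by ext; simp
      map_smul' := fun a x => by ext; simp }
  refine isInternal_of_split _ γ ?_ (eq_top_iff.mpr fun x _ => hsum x)
  intro n x hx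
  ext m
  have : comps (x : V) m = Finsupp.single n (x : V) m := by
    rw [comps_of_mem (show (x : V) ∈ gr V n from hx)]
  simp only [γ, LinearMap.coe_mk, AddHom.coe_mk, Finsupp.onFinset_apply, this,
    Finsupp.single_apply]
  split_ifs <;> simp

theorem eqLocus_isHomogeneous {W : Type v} [AddCommGroup W] [Module ℚ W] [GrVect W]
    (f g : V →ₗ[ℚ] W) (hf : ∀ n, ∀ x ∈ gr V n, f x ∈ gr W n)
    (hg : ∀ n, ∀ x ∈ gr V n, g x ∈ gr W n) : IsHomogeneous (LinearMap.eqLocus f g) := by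
  intro x hx n
  rw [LinearMap.mem_eqLocus] at hx ⊢
  rw [← comps_map f hf, ← comps_map g hg, hx]

end Kernel

/-! ### Differential graded vector spaces, coalgebras and algebras -/

/-- A dg vector space: a graded vector space with a square-zero differential of degree `-1`. -/
class DGVect (V : Type u) [AddCommGroup V] [Module ℚ V] extends GrVect V where
  d : V →ₗ[ℚ] V
  d_mem : ∀ n, ∀ x ∈ piece n, d x ∈ piece (n - 1)
  d_d : ∀ x, d (d x) = 0

/-- The differential of a dg vector space. -/
abbrev dif (V : Type u) [AddCommGroup V] [Module ℚ V] [DGVect V] : V →ₗ[ℚ] V := DGVect.d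

/-- A chain map between dg vector spaces. -/
@[ext] structure DGHom (V : Type u) [AddCommGroup V] [Module ℚ V] [DGVect V]
    (W : Type v) [AddCommGroup W] [Module ℚ W] [DGVect W] where
  toLin : V →ₗ[ℚ] W
  map_mem : ∀ n, ∀ x ∈ gr V n, toLin x ∈ gr W n
  map_d : ∀ x, toLin (dif V x) = dif W (toLin x)

section DG

variable {V : Type u} [AddCommGroup V] [Module ℚ V] [DGVect V]
variable {W : Type v} [AddCommGroup W] [Module ℚ W] [DGVect W]

theorem dif_sgn (x : V) : dif V (sgn x) = - sgn (dif V x) := sgn_map_neg _ DGVect.d_mem x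

@[simp] theorem dif_dif (x : V) : dif V (dif V x) = 0 := DGVect.d_d x

/-- The differential `d(v ⊗ w) = dv ⊗ w + (-1)^{|v|} v ⊗ dw` of a tensor product. -/
def dTens (V : Type u) [AddCommGroup V] [Module ℚ V] [DGVect V]
    (W : Type v) [AddCommGroup W] [Module ℚ W] [DGVect W] : V ⊗[ℚ] W →ₗ[ℚ] V ⊗[ℚ] W :=
  TensorProduct.map (dif V) LinearMap.id + TensorProduct.map sgn (dif W)

@[simp] theorem dTens_tmul (v : V) (w : W) :
    dTens V W (v ⊗ₜ w) = dif V v ⊗ₜ w + sgn v ⊗ₜ dif W w := rfl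

theorem dTens_mem (n : ℤ) (z : V ⊗[ℚ] W) (hz : z ∈ gr (V ⊗[ℚ] W) n) :
    dTens V W z ∈ gr (V ⊗[ℚ] W) (n - 1) :=
  tensor_degree (dTens V W) (-1) (fun i j v hv w hw => Submodule.add_mem _
    (tmul_mem (by ring) (DGVect.d_mem i v hv) hw)
    (tmul_mem (by ring) (sgn_mem hv) (DGVect.d_mem j w hw))) n z hz

theorem dTens_dTens (z : V ⊗[ℚ] W) : dTens V W (dTens V W z) = 0 := by
  induction z using TensorProduct.induction_on with
  | zero => simp
  | add x y hx hy => simp [hx, hy]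
  | tmul v w => simp [dif_sgn, TensorProduct.neg_tmul]

theorem dTens_map {V' : Type u} [AddCommGroup V'] [Module ℚ V'] [DGVect V']
    {W' : Type v} [AddCommGroup W'] [Module ℚ W'] [DGVect W']
    (f : DGHom V V') (g : DGHom W W') (z : V ⊗[ℚ] W) :
    TensorProduct.map f.toLin g.toLin (dTens V W z) =
      dTens V' W' (TensorProduct.map f.toLin g.toLin z) := by
  induction z using TensorProduct.induction_on with
  | zero => simp
  | add x y hx hy => simp [hx, hy]
  | tmul v w => simp [f.map_d, g.map_d, sgn_map f.toLin f.map_mem]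

theorem dTens_swap (z : V ⊗[ℚ] W) : swap V W (dTens V W z) = dTens W V (swap V W z) := by
  induction z using TensorProduct.induction_on with
  | zero => simp
  | add x y hx hy => simp [hx, hy]
  | tmul v w =>
    simp only [dTens_tmul, map_add, swap_tmul, dif_sgn, TensorProduct.tmul_neg, map_smul,
      map_sub, TensorProduct.neg_tmul, sgn_sgn]
    module

end DG

/-- A dg coalgebra: a dg vector space with a coassociative counital coalgebra structure whose
comultiplication and counit are chain maps (with `ℚ` in degree zero). -/
class DGCoalgebra (C : Type u) [AddCommGroup C] [Module ℚ C] [Coalgebra ℚ C] [DGVect C] :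
    Prop where
  comul_mem : ∀ n, ∀ x ∈ gr C n, Coalgebra.comul (R := ℚ) x ∈ gr (C ⊗[ℚ] C) n
  comul_d : ∀ x : C, Coalgebra.comul (R := ℚ) (dif C x) = dTens C C (Coalgebra.comul x)
  counit_of_ne : ∀ n, n ≠ 0 → ∀ x ∈ gr C n, Coalgebra.counit (R := ℚ) x = 0
  counit_d : ∀ x : C, Coalgebra.counit (R := ℚ) (dif C x) = 0

/-- Graded cocommutativity: the comultiplication is invariant under the Koszul symmetry. -/
class GradedCocomm (C : Type u) [AddCommGroup C] [Module ℚ C] [Coalgebra ℚ C] [DGVect C] :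
    Prop where
  swap_comul : ∀ x : C, swap C C (Coalgebra.comul x) = Coalgebra.comul x

/-- `2`-reducedness: `C` is non-negatively graded, `C₀ = ℚ` (via the counit) and `C₁ = 0`. -/
class TwoReduced (C : Type u) [AddCommGroup C] [Module ℚ C] [Coalgebra ℚ C] [DGVect C] :
    Prop where
  gr_neg : ∀ n < 0, gr C n = ⊥
  gr_one : gr C 1 = ⊥
  counit_bijective :
    Function.Bijective fun x : gr C 0 => Coalgebra.counit (R := ℚ) (x : C)

/-- A dg algebra. -/
class DGAlgebra (A : Type u) [Ring A] [Algebra ℚ A] [DGVect A] : Prop where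
  one_mem : (1 : A) ∈ gr A 0
  mul_mem : ∀ m n, ∀ x ∈ gr A m, ∀ y ∈ gr A n, x * y ∈ gr A (m + n)
  d_mul : ∀ x y : A, dif A (x * y) = dif A x * y + sgn x * dif A y

section DGA

variable {A : Type u} [Ring A] [Algebra ℚ A] [DGVect A] [DGAlgebra A]

theorem sgn_one : sgn (1 : A) = 1 := by
  rw [sgn_of_mem DGAlgebra.one_mem]; simp

theorem dif_one : dif A 1 = 0 := by
  have := DGAlgebra.d_mul (1 : A) 1
  rw [mul_one, mul_one, sgn_one, one_mul] at this
  simpa using this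

theorem sgn_mul (x y : A) : sgn (x * y) = sgn x * sgn y := by
  refine gr_induction (p := fun x => sgn (x * y) = sgn x * sgn y) x
    (fun i v hv => ?_) (fun x y hx hy => by simp [add_mul, hx, hy])
  refine gr_induction (p := fun y => sgn (v * y) = sgn v * sgn y) y
    (fun j w hw => ?_) (fun x y hx hy => by simp [mul_add, hx, hy])
  rw [sgn_of_mem (DGAlgebra.mul_mem i j v hv w hw), sgn_of_mem hv, sgn_of_mem hw,
    Int.negOnePow_add]
  simp only [Units.smul_def, Units.val_mul, smul_mul_assoc, mul_smul_comm, smul_smul]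
  rw [mul_comm]

end DGA

/-! ### Categories of dg modules and dg comodules -/

/-- A left dg module over a dg algebra `A`. -/
structure DGMod (A : Type u) [Ring A] [Algebra ℚ A] [DGVect A] : Type (u + 1) where
  carrier : Type u
  [addCommGroup : AddCommGroup carrier]
  [moduleRat : Module ℚ carrier]
  [moduleAlg : Module A carrier]
  [tower : IsScalarTower ℚ A carrier]
  [dgVect : DGVect carrier]
  smul_mem : ∀ m n, ∀ a ∈ gr A m, ∀ x ∈ gr carrier n, a • x ∈ gr carrier (m + n)
  d_smul : ∀ (a : A) (x : carrier),
    dif carrier (a • x) = dif A a • x + sgn a • dif carrier x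

namespace DGMod

attribute [instance] addCommGroup moduleRat moduleAlg tower dgVect

variable {A : Type u} [Ring A] [Algebra ℚ A] [DGVect A]

instance : CoeSort (DGMod A) (Type u) := ⟨carrier⟩

/-- A morphism of dg modules. -/
@[ext] structure Hom (M N : DGMod A) extends DGHom M N where
  map_smul : ∀ (a : A) (x : M), toLin (a • x) = a • toLin x

instance : Category (DGMod A) where
  Hom := Hom
  id M := { toLin := LinearMap.id, map_mem := fun _ _ h => h, map_d := fun _ => rfl,
            map_smul := fun _ _ => rfl }
  comp f g :=
    { toLin := g.toLin ∘ₗ f.toLin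
      map_mem := fun n x h => g.map_mem n _ (f.map_mem n x h)
      map_d := fun x => by simp [f.map_d, g.map_d]
      map_smul := fun a x => by simp [f.map_smul, g.map_smul] }

/-- The action `A ⊗ M → M`. -/
def act (M : DGMod A) : A ⊗[ℚ] M →ₗ[ℚ] M :=
  TensorProduct.lift (Algebra.lsmul ℚ ℚ (M : Type u)).toLinearMap

@[simp] theorem act_tmul (M : DGMod A) (a : A) (x : M) : M.act (a ⊗ₜ x) = a • x := rfl

end DGMod

/-- A left dg comodule over a dg coalgebra `C` (coassociative and counital). -/
structure DGComod (C : Type u) [AddCommGroup C] [Module ℚ C] [Coalgebra ℚ C] [DGVect C] :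
    Type (u + 1) where
  carrier : Type u
  [addCommGroup : AddCommGroup carrier]
  [moduleRat : Module ℚ carrier]
  [dgVect : DGVect carrier]
  coact : carrier →ₗ[ℚ] C ⊗[ℚ] carrier
  coact_mem : ∀ n, ∀ x ∈ gr carrier n, coact x ∈ gr (C ⊗[ℚ] carrier) n
  coact_d : ∀ x, coact (dif carrier x) = dTens C carrier (coact x)
  coassoc : ∀ x, TensorProduct.assoc ℚ C C carrier
      ((Coalgebra.comul (R := ℚ) (A := C)).rTensor carrier (coact x)) =
    coact.lTensor C (coact x)
  counit : ∀ x, TensorProduct.lid ℚ carrier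
      ((Coalgebra.counit (R := ℚ) (A := C)).rTensor carrier (coact x)) = x

namespace DGComod

attribute [instance] addCommGroup moduleRat dgVect

variable {C : Type u} [AddCommGroup C] [Module ℚ C] [Coalgebra ℚ C] [DGVect C]

instance : CoeSort (DGComod C) (Type u) := ⟨carrier⟩

/-- A morphism of dg comodules. -/
@[ext] structure Hom (M N : DGComod C) extends DGHom M N where
  map_coact : ∀ x : M, N.coact (toLin x) = toLin.lTensor C (M.coact x)

instance : Category (DGComod C) where
  Hom := Hom
  id M := { toLin := LinearMap.id, map_mem := fun _ _ h => h, map_d := fun _ => rfl,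
            map_coact := fun _ => by simp }
  comp f g :=
    { toLin := g.toLin ∘ₗ f.toLin
      map_mem := fun n x h => g.map_mem n _ (f.map_mem n x h)
      map_d := fun x => by simp [f.map_d, g.map_d]
      map_coact := fun x => by
        simp [f.map_coact, g.map_coact, LinearMap.lTensor_comp] }

/-- A comodule is connective if it is concentrated in non-negative degrees. -/
def IsConnective (M : DGComod C) : Prop := ∀ n < 0, gr M n = ⊥

end DGComod

/-! ### Underlying chain complexes and quasi-isomorphisms -/

/-- The chain complex of homogeneous pieces associated with a family of subspaces `P n` of a
vector space and a square-zero operator taking `P n` to `P (n - 1)`. -/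
def complexOf {V : Type v} [AddCommGroup V] [Module ℚ V] (P : ℤ → Submodule ℚ V)
    (D : V →ₗ[ℚ] V) (hP : ∀ n, ∀ x ∈ P n, D x ∈ P (n - 1)) (hD : ∀ x, D (D x) = 0) :
    ChainComplex (ModuleCat.{v} ℚ) ℤ where
  X n := ModuleCat.of ℚ (P n)
  d i j := if h : j + 1 = i then
      ModuleCat.ofHom (D.restrict (p := P i) (q := P j)
        fun x hx => (show j = i - 1 by omega) ▸ hP i x hx)
    else 0
  shape i j h := dif_neg h
  d_comp_d' i j k hij hjk := by
    have hij' : j + 1 = i := hij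
    have hjk' : k + 1 = j := hjk
    rw [dif_pos hij', dif_pos hjk']
    exact ModuleCat.hom_ext (LinearMap.ext fun x => Subtype.ext (hD (x : V)))

/-- The map of complexes induced by a linear map compatible with the pieces and operators. -/
def complexMap {V : Type v} [AddCommGroup V] [Module ℚ V] {P : ℤ → Submodule ℚ V}
    {D : V →ₗ[ℚ] V} {hP : ∀ n, ∀ x ∈ P n, D x ∈ P (n - 1)} {hD : ∀ x, D (D x) = 0}
    {V' : Type v} [AddCommGroup V'] [Module ℚ V'] {P' : ℤ → Submodule ℚ V'}
    {D' : V' →ₗ[ℚ] V'} {hP' : ∀ n, ∀ x ∈ P' n, D' x ∈ P' (n - 1)} {hD' : ∀ x, D' (D' x) = 0}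
    (f : V →ₗ[ℚ] V') (hf : ∀ n, ∀ x ∈ P n, f x ∈ P' n) (hfD : ∀ x, f (D x) = D' (f x)) :
    complexOf P D hP hD ⟶ complexOf P' D' hP' hD' where
  f n := ModuleCat.ofHom (f.restrict (hf n))
  comm' i j hij := by
    have hij' : j + 1 = i := hij
    simp only [complexOf, dif_pos hij']
    exact ModuleCat.hom_ext (LinearMap.ext fun x => Subtype.ext (hfD (x : V)).symm)

/-- The chain complex `… → V_{n+1} → V_n → V_{n-1} → …` underlying a dg vector space. -/
def complex (V : Type u) [AddCommGroup V] [Module ℚ V] [DGVect V] :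
    ChainComplex (ModuleCat.{u} ℚ) ℤ :=
  complexOf (gr V) (dif V) DGVect.d_mem DGVect.d_d

/-- The map of chain complexes underlying a chain map. -/
def DGHom.complexMap {V : Type u} [AddCommGroup V] [Module ℚ V] [DGVect V]
    {W : Type u} [AddCommGroup W] [Module ℚ W] [DGVect W] (f : DGHom V W) :
    complex V ⟶ complex W :=
  DGKoszul.complexMap f.toLin f.map_mem f.map_d

/-- The chain complex underlying a dg module, as a functor. -/
def DGMod.underlying (A : Type u) [Ring A] [Algebra ℚ A] [DGVect A] :
    DGMod A ⥤ ChainComplex (ModuleCat.{u} ℚ) ℤ where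
  obj M := complex M
  map f := f.toDGHom.complexMap

/-- The chain complex underlying a dg comodule, as a functor. -/
def DGComod.underlying (C : Type u) [AddCommGroup C] [Module ℚ C] [Coalgebra ℚ C] [DGVect C] :
    DGComod C ⥤ ChainComplex (ModuleCat.{u} ℚ) ℤ where
  obj M := complex M
  map f := f.toDGHom.complexMap

set_option linter.unusedSectionVars false

/-! ### Twisting chains, twisted extensions and coextensions -/

/-- A twisting chain `τ : C ⇝ A`: a linear map of degree `-1` such that
`d(τ c) = -τ(dc) - (-1)^{|c₍₀₎|} τ(c₍₀₎) τ(c₍₁₎)`. -/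
structure TwistingChain (C : Type u) [AddCommGroup C] [Module ℚ C] [Coalgebra ℚ C] [DGVect C]
    (A : Type u) [Ring A] [Algebra ℚ A] [DGVect A] where
  toLin : C →ₗ[ℚ] A
  map_mem : ∀ n, ∀ c ∈ gr C n, toLin c ∈ gr A (n - 1)
  d_toLin : ∀ c : C, dif A (toLin c) = - toLin (dif C c) -
    LinearMap.mul' ℚ A (TensorProduct.map (toLin ∘ₗ sgn) toLin (Coalgebra.comul c))

section Twisting

variable {C : Type u} [AddCommGroup C] [Module ℚ C] [Coalgebra ℚ C] [DGVect C]
variable {A : Type u} [Ring A] [Algebra ℚ A] [DGVect A]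

theorem TwistingChain.sgn_toLin (τ : TwistingChain C A) (c : C) :
    sgn (τ.toLin c) = - τ.toLin (sgn c) := by
  rw [sgn_map_neg τ.toLin τ.map_mem, neg_neg]

/-- The map `a ↦ a • m`. -/
def smulBy {M : DGMod A} (m : M) : A →ₗ[ℚ] M := M.act ∘ₗ (TensorProduct.mk ℚ A M).flip m

@[simp] theorem smulBy_apply {M : DGMod A} (m : M) (a : A) : smulBy m a = a • m := rfl

/-- The twisting term `c ⊗ m ↦ (-1)^{|c₍₀₎|} c₍₀₎ ⊗ τ(c₍₁₎) · m`. -/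
def coextTwist (τ : TwistingChain C A) (M : DGMod A) : C ⊗[ℚ] M →ₗ[ℚ] C ⊗[ℚ] M :=
  TensorProduct.map sgn (M.act ∘ₗ τ.toLin.rTensor M) ∘ₗ
    (TensorProduct.assoc ℚ C C M).toLinearMap ∘ₗ (Coalgebra.comul (R := ℚ) (A := C)).rTensor M

/-- The differential of the twisted coextension,
`d(c ⊗ m) = dc ⊗ m + (-1)^{|c|} c ⊗ dm + (-1)^{|c₍₀₎|} c₍₀₎ ⊗ τ(c₍₁₎) · m`. -/
def coextD (τ : TwistingChain C A) (M : DGMod A) : C ⊗[ℚ] M →ₗ[ℚ] C ⊗[ℚ] M :=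
  dTens C M + coextTwist τ M

theorem coextTwist_tmul (τ : TwistingChain C A) (M : DGMod A) (c : C) (m : M) :
    coextTwist τ M (c ⊗ₜ m) =
      TensorProduct.map sgn (smulBy m ∘ₗ τ.toLin) (Coalgebra.comul c) := by
  simp only [coextTwist, LinearMap.comp_apply, LinearMap.rTensor_tmul, LinearEquiv.coe_coe]
  generalize (Coalgebra.comul (R := ℚ) c) = z
  induction z using TensorProduct.induction_on with
  | zero => simp
  | add x y hx hy => simp only [TensorProduct.add_tmul, map_add, hx, hy]
  | tmul a b => simp

theorem coextTwist_mem [DGCoalgebra C] (τ : TwistingChain C A) (M : DGMod A) (n : ℤ)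
    (z : C ⊗[ℚ] M) (hz : z ∈ gr (C ⊗[ℚ] M) n) : coextTwist τ M z ∈ gr (C ⊗[ℚ] M) (n - 1) := by
  refine tensor_degree (coextTwist τ M) (-1) (fun i j c hc m hm => ?_) n z hz
  rw [coextTwist_tmul]
  have := map_mem (sgn : C →ₗ[ℚ] C) (smulBy m ∘ₗ τ.toLin) 0 (j - 1)
    (fun n x hx => by simpa using sgn_mem hx)
    (fun n x hx => by
      have := M.smul_mem _ _ _ (τ.map_mem n x hx) _ hm
      rw [show n - 1 + j = n + (j - 1) by ring] at this
      exact this) i _ (DGCoalgebra.comul_mem i c hc)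
  rwa [show i + (0 + (j - 1)) = i + j + -1 by ring] at this

theorem coextD_mem [DGCoalgebra C] (τ : TwistingChain C A) (M : DGMod A) (n : ℤ)
    (z : C ⊗[ℚ] M) (hz : z ∈ gr (C ⊗[ℚ] M) n) : coextD τ M z ∈ gr (C ⊗[ℚ] M) (n - 1) :=
  Submodule.add_mem _ (dTens_mem n z hz) (coextTwist_mem τ M n z hz)

theorem sgn_comul [DGCoalgebra C] (c : C) :
    Coalgebra.comul (R := ℚ) (sgn c) = sgn (Coalgebra.comul (R := ℚ) c) :=
  sgn_map _ DGCoalgebra.comul_mem c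

theorem coextD_coextD [DGCoalgebra C] (τ : TwistingChain C A) (M : DGMod A) (z : C ⊗[ℚ] M) :
    coextD τ M (coextD τ M z) = 0 := by
  induction z using TensorProduct.induction_on with
  | zero => simp
  | add x y hx hy => simp only [map_add, hx, hy, add_zero]
  | tmul c m =>
    -- the quadratic part of the twisting term
    have hquad : ∀ z : C ⊗[ℚ] C,
        coextTwist τ M (TensorProduct.map sgn (smulBy m ∘ₗ τ.toLin) z) =
        TensorProduct.map LinearMap.id (smulBy m ∘ₗ LinearMap.mul' ℚ A ∘ₗ
          TensorProduct.map (τ.toLin ∘ₗ sgn) τ.toLin)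
          (TensorProduct.assoc ℚ C C C
            ((Coalgebra.comul (R := ℚ) (A := C)).rTensor C z)) := by
      intro z
      induction z using TensorProduct.induction_on with
      | zero => simp
      | add x y hx hy => simp only [map_add, hx, hy]
      | tmul a b =>
        simp only [TensorProduct.map_tmul, LinearMap.rTensor_tmul, coextTwist_tmul, sgn_comul]
        generalize (Coalgebra.comul (R := ℚ) a) = w
        induction w using TensorProduct.induction_on with
        | zero => simp
        | add x y hx hy => simp only [map_add, TensorProduct.add_tmul, hx, hy]
        | tmul p q => simp [mul_smul]
    have hlin : ∀ z : C ⊗[ℚ] C,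
        dTens C M (TensorProduct.map sgn (smulBy m ∘ₗ τ.toLin) z) +
        TensorProduct.map sgn (smulBy m ∘ₗ τ.toLin) (dTens C C z) +
        TensorProduct.map sgn (smulBy (dif M m) ∘ₗ τ.toLin) (sgn z) +
        TensorProduct.map LinearMap.id (smulBy m ∘ₗ LinearMap.mul' ℚ A ∘ₗ
          TensorProduct.map (τ.toLin ∘ₗ sgn) τ.toLin)
          ((Coalgebra.comul (R := ℚ) (A := C)).lTensor C z) = 0 := by
      intro z
      induction z using TensorProduct.induction_on with
      | zero => simp
      | add x y hx hy =>
        simp only [map_add]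
        have := congrArg₂ (· + ·) hx hy
        simp only [add_zero] at this
        rw [← this]; abel
      | tmul a b =>
        simp only [TensorProduct.map_tmul, dTens_tmul, map_add, sgn_tmul, sgn_sgn,
          LinearMap.comp_apply, smulBy_apply, LinearMap.lTensor_tmul, LinearMap.id_apply,
          M.d_smul, dif_sgn, τ.sgn_toLin, τ.d_toLin, TensorProduct.neg_tmul,
          TensorProduct.tmul_add, TensorProduct.tmul_neg, neg_smul, sub_smul,
          TensorProduct.tmul_sub]
        abel
    simp only [coextD, LinearMap.add_apply, map_add, dTens_dTens, zero_add]
    rw [coextTwist_tmul, hquad, Coalgebra.coassoc_apply, dTens_tmul, map_add, coextTwist_tmul,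
      coextTwist_tmul, DGCoalgebra.comul_d, sgn_comul]
    rw [← hlin (Coalgebra.comul (R := ℚ) c)]
    abel

/-- The coaction `m ⊗ v ↦ m₍₀₎ ⊗ (m₍₁₎ ⊗ v)` on `M ⊗ V` induced by a coaction `ρ` on `M`. -/
def leftCoact {M : Type u} [AddCommGroup M] [Module ℚ M] (ρ : M →ₗ[ℚ] C ⊗[ℚ] M)
    (V : Type u) [AddCommGroup V] [Module ℚ V] :
    M ⊗[ℚ] V →ₗ[ℚ] C ⊗[ℚ] (M ⊗[ℚ] V) :=
  (TensorProduct.assoc ℚ C M V).toLinearMap ∘ₗ ρ.rTensor V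

section LeftCoact

variable {M : Type u} [AddCommGroup M] [Module ℚ M] (ρ : M →ₗ[ℚ] C ⊗[ℚ] M)
variable {V : Type u} [AddCommGroup V] [Module ℚ V]

theorem leftCoact_tmul (m : M) (v : V) :
    leftCoact ρ V (m ⊗ₜ v) = ((TensorProduct.mk ℚ M V).flip v).lTensor C (ρ m) := by
  simp only [leftCoact, LinearMap.comp_apply, LinearMap.rTensor_tmul, LinearEquiv.coe_coe]
  generalize ρ m = z
  induction z using TensorProduct.induction_on with
  | zero => simp
  | add x y hx hy => simp only [TensorProduct.add_tmul, map_add, hx, hy]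
  | tmul a b => simp

theorem leftCoact_mem [GrVect M] [GrVect V]
    (hρ : ∀ n, ∀ x ∈ gr M n, ρ x ∈ gr (C ⊗[ℚ] M) n)
    (n : ℤ) (z : M ⊗[ℚ] V) (hz : z ∈ gr (M ⊗[ℚ] V) n) :
    leftCoact ρ V z ∈ gr (C ⊗[ℚ] (M ⊗[ℚ] V)) n := by
  have := tensor_degree (leftCoact ρ V) 0 (fun i j c hc v hv => by
    rw [leftCoact_tmul]
    have := map_mem (LinearMap.id : C →ₗ[ℚ] C) ((TensorProduct.mk ℚ M V).flip v) 0 j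
      (fun n x hx => by simpa using hx)
      (fun n x hx => tmul_mem rfl hx hv) i _ (hρ i c hc)
    rwa [show i + (0 + j) = i + j + 0 by ring] at this) n z hz
  simpa using this

theorem leftCoact_dTens [DGVect M] [DGVect V]
    (hρ : ∀ n, ∀ x ∈ gr M n, ρ x ∈ gr (C ⊗[ℚ] M) n)
    (hd : ∀ x, ρ (dif M x) = dTens C M (ρ x)) (z : M ⊗[ℚ] V) :
    leftCoact ρ V (dTens M V z) =
      TensorProduct.map (dif C) LinearMap.id (leftCoact ρ V z) +
        TensorProduct.map sgn (dTens M V) (leftCoact ρ V z) := by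
  induction z using TensorProduct.induction_on with
  | zero => simp
  | add x y hx hy => simp only [map_add, hx, hy]; abel
  | tmul c v =>
    simp only [dTens_tmul, map_add, leftCoact_tmul, hd, sgn_map ρ hρ]
    generalize ρ c = w
    induction w using TensorProduct.induction_on with
    | zero => simp
    | add x y hx hy =>
      simp only [map_add] at hx hy ⊢
      rw [add_add_add_comm, hx, hy]
      abel
    | tmul a b => simp [TensorProduct.tmul_add, add_assoc]

theorem leftCoact_coassoc
    (hρ : ∀ x, TensorProduct.assoc ℚ C C M
      ((Coalgebra.comul (R := ℚ) (A := C)).rTensor M (ρ x)) = ρ.lTensor C (ρ x))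
    (z : M ⊗[ℚ] V) :
    TensorProduct.assoc ℚ C C (M ⊗[ℚ] V)
      ((Coalgebra.comul (R := ℚ) (A := C)).rTensor (M ⊗[ℚ] V) (leftCoact ρ V z)) =
    (leftCoact ρ V).lTensor C (leftCoact ρ V z) := by
  induction z using TensorProduct.induction_on with
  | zero => simp
  | add x y hx hy => simp only [map_add, hx, hy]
  | tmul c v =>
    have h1 : ∀ w : C ⊗[ℚ] M, (leftCoact ρ V).lTensor C
        (((TensorProduct.mk ℚ M V).flip v).lTensor C w) =
        (((TensorProduct.mk ℚ M V).flip v).lTensor C).lTensor C (ρ.lTensor C w) := by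
      intro w
      induction w using TensorProduct.induction_on with
      | zero => simp
      | add x y hx hy => simp only [map_add, hx, hy]
      | tmul a b => simp [leftCoact_tmul]
    have h2 : ∀ w : C ⊗[ℚ] M, TensorProduct.assoc ℚ C C (M ⊗[ℚ] V)
        ((Coalgebra.comul (R := ℚ) (A := C)).rTensor (M ⊗[ℚ] V)
          (((TensorProduct.mk ℚ M V).flip v).lTensor C w)) =
        (((TensorProduct.mk ℚ M V).flip v).lTensor C).lTensor C
          (TensorProduct.assoc ℚ C C M ((Coalgebra.comul (R := ℚ) (A := C)).rTensor M w)) := by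
      intro w
      induction w using TensorProduct.induction_on with
      | zero => simp
      | add x y hx hy => simp only [map_add, hx, hy]
      | tmul a b =>
        simp only [LinearMap.lTensor_tmul, LinearMap.rTensor_tmul, LinearMap.flip_apply,
          TensorProduct.mk_apply]
        generalize (Coalgebra.comul (R := ℚ) a) = w
        induction w using TensorProduct.induction_on with
        | zero => simp
        | add x y hx hy => simp only [TensorProduct.add_tmul, map_add, hx, hy]
        | tmul a b => simp
    rw [leftCoact_tmul, h1, h2, hρ]

theorem leftCoact_counit
    (hρ : ∀ x, TensorProduct.lid ℚ M
      ((Coalgebra.counit (R := ℚ) (A := C)).rTensor M (ρ x)) = x) (z : M ⊗[ℚ] V) :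
    TensorProduct.lid ℚ (M ⊗[ℚ] V)
      ((Coalgebra.counit (R := ℚ) (A := C)).rTensor (M ⊗[ℚ] V) (leftCoact ρ V z)) = z := by
  induction z using TensorProduct.induction_on with
  | zero => simp
  | add x y hx hy => simp only [map_add, hx, hy]
  | tmul c v =>
    have h : ∀ w : C ⊗[ℚ] M, TensorProduct.lid ℚ (M ⊗[ℚ] V)
        ((Coalgebra.counit (R := ℚ) (A := C)).rTensor (M ⊗[ℚ] V)
          (((TensorProduct.mk ℚ M V).flip v).lTensor C w)) =
        (TensorProduct.lid ℚ M ((Coalgebra.counit (R := ℚ) (A := C)).rTensor M w)) ⊗ₜ[ℚ] v := by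
      intro w
      induction w using TensorProduct.induction_on with
      | zero => simp
      | add x y hx hy => simp only [map_add, hx, hy, TensorProduct.add_tmul]
      | tmul a b => simp [TensorProduct.smul_tmul']
    rw [leftCoact_tmul, h, hρ]

theorem leftCoact_map {M' : Type u} [AddCommGroup M'] [Module ℚ M'] (ρ' : M' →ₗ[ℚ] C ⊗[ℚ] M')
    {W : Type u} [AddCommGroup W] [Module ℚ W] (f : M →ₗ[ℚ] M')
    (hf : ∀ x, ρ' (f x) = f.lTensor C (ρ x)) (g : V →ₗ[ℚ] W) (z : M ⊗[ℚ] V) :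
    leftCoact ρ' W (TensorProduct.map f g z) =
      (TensorProduct.map f g).lTensor C (leftCoact ρ V z) := by
  induction z using TensorProduct.induction_on with
  | zero => simp
  | add x y hx hy => simp only [map_add, hx, hy]
  | tmul c m =>
    rw [TensorProduct.map_tmul, leftCoact_tmul, leftCoact_tmul, hf, ← LinearMap.lTensor_comp_apply,
      ← LinearMap.lTensor_comp_apply]
    rfl

end LeftCoact

/-- The coaction `c ⊗ v ↦ c₍₀₎ ⊗ (c₍₁₎ ⊗ v)` on `C ⊗ V`. -/
abbrev cofreeCoact (C : Type u) [AddCommGroup C] [Module ℚ C] [Coalgebra ℚ C]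
    (V : Type u) [AddCommGroup V] [Module ℚ V] :
    C ⊗[ℚ] V →ₗ[ℚ] C ⊗[ℚ] (C ⊗[ℚ] V) :=
  leftCoact (Coalgebra.comul (R := ℚ) (A := C)) V

theorem comul_coassoc (x : C) : TensorProduct.assoc ℚ C C C
      ((Coalgebra.comul (R := ℚ) (A := C)).rTensor C (Coalgebra.comul x)) =
    (Coalgebra.comul (R := ℚ) (A := C)).lTensor C (Coalgebra.comul x) :=
  Coalgebra.coassoc_apply x

theorem comul_counit (x : C) : TensorProduct.lid ℚ C
      ((Coalgebra.counit (R := ℚ) (A := C)).rTensor C (Coalgebra.comul x)) = x := by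
  rw [Coalgebra.rTensor_counit_comul]; simp

/-- The twisting term is a map of comodules. -/
theorem cofreeCoact_coextTwist [DGCoalgebra C] (τ : TwistingChain C A) (M : DGMod A)
    (z : C ⊗[ℚ] M) : cofreeCoact C M (coextTwist τ M z) =
      TensorProduct.map sgn (coextTwist τ M) (cofreeCoact C M z) := by
  induction z using TensorProduct.induction_on with
  | zero => simp
  | add x y hx hy => simp only [map_add, hx, hy]
  | tmul c m =>
    have h1 : ∀ w : C ⊗[ℚ] C,
        cofreeCoact C M (TensorProduct.map sgn (smulBy m ∘ₗ τ.toLin) w) =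
        TensorProduct.map sgn (TensorProduct.map sgn (smulBy m ∘ₗ τ.toLin))
          (TensorProduct.assoc ℚ C C C ((Coalgebra.comul (R := ℚ) (A := C)).rTensor C w)) := by
      intro w
      induction w using TensorProduct.induction_on with
      | zero => simp
      | add x y hx hy => simp only [map_add, hx, hy]
      | tmul a b =>
        simp only [TensorProduct.map_tmul, leftCoact_tmul, LinearMap.rTensor_tmul, sgn_comul]
        generalize (Coalgebra.comul (R := ℚ) a) = w
        induction w using TensorProduct.induction_on with
        | zero => simp
        | add x y hx hy => simp only [TensorProduct.add_tmul, map_add, hx, hy]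
        | tmul a b => simp
    have h2 : ∀ w : C ⊗[ℚ] C, TensorProduct.map sgn (coextTwist τ M)
        (((TensorProduct.mk ℚ C M).flip m).lTensor C w) =
        TensorProduct.map sgn (TensorProduct.map sgn (smulBy m ∘ₗ τ.toLin))
          ((Coalgebra.comul (R := ℚ) (A := C)).lTensor C w) := by
      intro w
      induction w using TensorProduct.induction_on with
      | zero => simp
      | add x y hx hy => simp only [map_add, hx, hy]
      | tmul a b => simp [coextTwist_tmul]
    rw [coextTwist_tmul, leftCoact_tmul, h1, h2, Coalgebra.coassoc_apply]

variable [DGCoalgebra C]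

/-- The `τ`-twisted coextension `τ_* M = C ⊗^τ M`, a left dg comodule. -/
def coextObj (τ : TwistingChain C A) (M : DGMod A) : DGComod C where
  carrier := C ⊗[ℚ] M
  dgVect :=
    { d := coextD τ M
      d_mem := coextD_mem τ M
      d_d := coextD_coextD τ M }
  coact := cofreeCoact C M
  coact_mem := leftCoact_mem _ DGCoalgebra.comul_mem
  coact_d z := by
    change cofreeCoact C M (dTens C M z + coextTwist τ M z) =
      TensorProduct.map (dif C) LinearMap.id (cofreeCoact C M z) +
        TensorProduct.map sgn (coextD τ M) (cofreeCoact C M z)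
    rw [map_add, leftCoact_dTens _ DGCoalgebra.comul_mem DGCoalgebra.comul_d, cofreeCoact_coextTwist, coextD, TensorProduct.map_add_right]
    simp only [LinearMap.add_apply]
    abel
  coassoc := leftCoact_coassoc _ comul_coassoc
  counit := leftCoact_counit _ comul_counit

/-- The cofree dg comodule `C ⊗ V` on a dg vector space `V`. -/
def cofree (C : Type u) [AddCommGroup C] [Module ℚ C] [Coalgebra ℚ C] [DGVect C]
    [DGCoalgebra C] (V : Type u) [AddCommGroup V] [Module ℚ V] [DGVect V] : DGComod C where
  carrier := C ⊗[ℚ] V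
  dgVect :=
    { d := dTens C V
      d_mem := dTens_mem
      d_d := dTens_dTens }
  coact := cofreeCoact C V
  coact_mem := leftCoact_mem _ DGCoalgebra.comul_mem
  coact_d := leftCoact_dTens _ DGCoalgebra.comul_mem DGCoalgebra.comul_d
  coassoc := leftCoact_coassoc _ comul_coassoc
  counit := leftCoact_counit _ comul_counit

theorem coext_map_d (τ : TwistingChain C A) {M N : DGMod A} (f : M ⟶ N) (z : C ⊗[ℚ] M) :
    f.toLin.lTensor C (coextD τ M z) = coextD τ N (f.toLin.lTensor C z) := by
  induction z using TensorProduct.induction_on with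
  | zero => simp
  | add x y hx hy => simp only [map_add, hx, hy]
  | tmul c m =>
    simp only [coextD, LinearMap.add_apply]
    rw [map_add, LinearMap.lTensor_tmul, coextTwist_tmul, coextTwist_tmul]
    congr 1
    · simp [f.map_d]
    · generalize (Coalgebra.comul (R := ℚ) c) = w
      induction w using TensorProduct.induction_on with
      | zero => simp
      | add x y hx hy => simp only [map_add, hx, hy]
      | tmul a b => simp [f.map_smul]

theorem cofreeCoact_map {V W : Type u} [AddCommGroup V] [Module ℚ V] [AddCommGroup W] [Module ℚ W]
    (f : V →ₗ[ℚ] W) (z : C ⊗[ℚ] V) :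
    cofreeCoact C W (f.lTensor C z) = (f.lTensor C).lTensor C (cofreeCoact C V z) :=
  leftCoact_map _ _ LinearMap.id (by simp) f z

/-- The `τ`-twisted coextension functor `τ_* : A-Mod ⥤ C-Comod`. -/
def coext (τ : TwistingChain C A) : DGMod A ⥤ DGComod C where
  obj M := coextObj τ M
  map {M N} f :=
    { toLin := f.toLin.lTensor C
      map_mem := fun n x hx => by
        have := map_mem (LinearMap.id : C →ₗ[ℚ] C) f.toLin 0 0 (by simp)
          (by simpa using f.map_mem) n x hx
        rw [show n + (0 + 0) = n by ring] at this
        exact this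
      map_d := coext_map_d τ f
      map_coact := cofreeCoact_map f.toLin }
  map_id M := DGComod.Hom.ext (LinearMap.lTensor_id C M)
  map_comp f g := DGComod.Hom.ext (LinearMap.lTensor_comp C g.toLin f.toLin)

end Twisting

section Extension

variable {C : Type u} [AddCommGroup C] [Module ℚ C] [Coalgebra ℚ C] [DGVect C]
variable {A : Type u} [Ring A] [Algebra ℚ A] [DGVect A]

/-- The twisting term `a ⊗ n ↦ (-1)^{|a|} a · τ(n₍₀₎) ⊗ n₍₁₎`. -/
def extTwist (τ : TwistingChain C A) (N : DGComod C) : A ⊗[ℚ] N →ₗ[ℚ] A ⊗[ℚ] N :=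
  (LinearMap.mul' ℚ A ∘ₗ TensorProduct.map sgn τ.toLin).rTensor N ∘ₗ
    (TensorProduct.assoc ℚ A C N).symm.toLinearMap ∘ₗ N.coact.lTensor A

/-- The differential of the twisted extension,
`d(a ⊗ n) = da ⊗ n + (-1)^{|a|} a ⊗ dn - (-1)^{|a|} a · τ(n₍₀₎) ⊗ n₍₁₎`. -/
def extD (τ : TwistingChain C A) (N : DGComod C) : A ⊗[ℚ] N →ₗ[ℚ] A ⊗[ℚ] N :=
  dTens A N - extTwist τ N

theorem extTwist_tmul (τ : TwistingChain C A) (N : DGComod C) (a : A) (x : N) :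
    extTwist τ N (a ⊗ₜ x) =
      (LinearMap.mulLeft ℚ (sgn a) ∘ₗ τ.toLin).rTensor N (N.coact x) := by
  simp only [extTwist, LinearMap.comp_apply, LinearMap.lTensor_tmul, LinearEquiv.coe_coe]
  generalize N.coact x = z
  induction z using TensorProduct.induction_on with
  | zero => simp
  | add x y hx hy => simp only [TensorProduct.tmul_add, map_add, hx, hy]
  | tmul a b => simp

variable [DGAlgebra A]

theorem extTwist_mem (τ : TwistingChain C A) (N : DGComod C) (n : ℤ)
    (z : A ⊗[ℚ] N) (hz : z ∈ gr (A ⊗[ℚ] N) n) : extTwist τ N z ∈ gr (A ⊗[ℚ] N) (n - 1) := by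
  refine tensor_degree (extTwist τ N) (-1) (fun i j a ha x hx => ?_) n z hz
  rw [extTwist_tmul]
  have := map_mem (LinearMap.mulLeft ℚ (sgn a) ∘ₗ τ.toLin) (LinearMap.id : N →ₗ[ℚ] N) (i - 1) 0
    (fun n x hx => by
      have := DGAlgebra.mul_mem _ _ _ (sgn_mem ha) _ (τ.map_mem n x hx)
      rw [show i + (n - 1) = n + (i - 1) by ring] at this
      exact this) (by simp) j _ (N.coact_mem j x hx)
  rwa [show j + (i - 1 + 0) = i + j + -1 by ring] at this

theorem extD_mem (τ : TwistingChain C A) (N : DGComod C) (n : ℤ)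
    (z : A ⊗[ℚ] N) (hz : z ∈ gr (A ⊗[ℚ] N) n) : extD τ N z ∈ gr (A ⊗[ℚ] N) (n - 1) :=
  Submodule.sub_mem _ (dTens_mem n z hz) (extTwist_mem τ N n z hz)

theorem sgn_coact (N : DGComod C) (x : N) : N.coact (sgn x) = sgn (N.coact x) :=
  sgn_map _ N.coact_mem x

theorem extD_extD (τ : TwistingChain C A) (N : DGComod C) (z : A ⊗[ℚ] N) :
    extD τ N (extD τ N z) = 0 := by
  induction z using TensorProduct.induction_on with
  | zero => simp
  | add x y hx hy => simp only [map_add, hx, hy, add_zero]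
  | tmul a x =>
    have hquad : ∀ z : C ⊗[ℚ] N,
        extTwist τ N ((LinearMap.mulLeft ℚ (sgn a) ∘ₗ τ.toLin).rTensor N z) =
        - (LinearMap.mulLeft ℚ a ∘ₗ LinearMap.mul' ℚ A ∘ₗ
          TensorProduct.map (τ.toLin ∘ₗ sgn) τ.toLin).rTensor N
          ((TensorProduct.assoc ℚ C C N).symm (N.coact.lTensor C z)) := by
      intro z
      induction z using TensorProduct.induction_on with
      | zero => simp
      | add x y hx hy => simp only [map_add, hx, hy, neg_add]
      | tmul c y =>
        simp only [LinearMap.rTensor_tmul, LinearMap.lTensor_tmul, extTwist_tmul,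
          LinearMap.comp_apply, LinearMap.mulLeft_apply, sgn_mul, sgn_sgn, τ.sgn_toLin]
        generalize N.coact y = w
        induction w using TensorProduct.induction_on with
        | zero => simp
        | add x y hx hy => simp only [map_add, TensorProduct.tmul_add, hx, hy, neg_add]
        | tmul p q => simp [mul_assoc, TensorProduct.neg_tmul]
    have hlin : ∀ z : C ⊗[ℚ] N,
        dTens A N ((LinearMap.mulLeft ℚ (sgn a) ∘ₗ τ.toLin).rTensor N z) +
        (LinearMap.mulLeft ℚ (sgn (dif A a)) ∘ₗ τ.toLin).rTensor N z +
        (LinearMap.mulLeft ℚ (sgn (sgn a)) ∘ₗ τ.toLin).rTensor N (dTens C N z) +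
        (LinearMap.mulLeft ℚ a ∘ₗ LinearMap.mul' ℚ A ∘ₗ
          TensorProduct.map (τ.toLin ∘ₗ sgn) τ.toLin).rTensor N
          ((Coalgebra.comul (R := ℚ) (A := C)).rTensor N z) = 0 := by
      intro z
      induction z using TensorProduct.induction_on with
      | zero => simp
      | add x y hx hy =>
        simp only [map_add]
        have := congrArg₂ (· + ·) hx hy
        simp only [add_zero] at this
        rw [← this]; abel
      | tmul c y =>
        simp only [LinearMap.rTensor_tmul, dTens_tmul, map_add, sgn_sgn, sgn_mul,
          LinearMap.comp_apply, LinearMap.mulLeft_apply, DGAlgebra.d_mul,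
          dif_sgn, τ.sgn_toLin, τ.d_toLin, TensorProduct.neg_tmul, mul_sub, mul_neg, neg_mul,
          TensorProduct.add_tmul, TensorProduct.sub_tmul]
        abel
    have hco : (TensorProduct.assoc ℚ C C N).symm (N.coact.lTensor C (N.coact x)) =
        (Coalgebra.comul (R := ℚ) (A := C)).rTensor N (N.coact x) := by
      rw [LinearEquiv.symm_apply_eq]; exact (N.coassoc x).symm
    simp only [extD, LinearMap.sub_apply, map_sub, dTens_dTens, zero_sub]
    rw [extTwist_tmul, hquad, hco, dTens_tmul, map_add, extTwist_tmul, extTwist_tmul, N.coact_d]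
    rw [← neg_eq_zero, ← hlin (N.coact x)]
    abel

theorem smul_eq_rTensor {N : Type u} [AddCommGroup N] [Module ℚ N] (a : A) (z : A ⊗[ℚ] N) :
    a • z = (LinearMap.mulLeft ℚ a).rTensor N z := by
  induction z using TensorProduct.induction_on with
  | zero => simp
  | add x y hx hy => simp only [smul_add, map_add, hx, hy]
  | tmul b x => simp [TensorProduct.smul_tmul']

theorem lTensor_smul {N N' : Type u} [AddCommGroup N] [Module ℚ N] [AddCommGroup N'] [Module ℚ N']
    (f : N →ₗ[ℚ] N') (a : A) (z : A ⊗[ℚ] N) : f.lTensor A (a • z) = a • f.lTensor A z := by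
  rw [smul_eq_rTensor, smul_eq_rTensor, ← LinearMap.comp_apply, ← LinearMap.comp_apply,
    LinearMap.lTensor_comp_rTensor, LinearMap.rTensor_comp_lTensor]

/-- The `τ`-twisted extension `τ^! N = A ⊗_τ N`, a left dg module. -/
def extObj (τ : TwistingChain C A) (N : DGComod C) : DGMod A where
  carrier := A ⊗[ℚ] N
  dgVect :=
    { d := extD τ N
      d_mem := extD_mem τ N
      d_d := extD_extD τ N }
  smul_mem m n a ha z hz := by
    have := tensor_degree ((LinearMap.mulLeft ℚ a).rTensor N) m (fun i j b hb x hx =>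
      tmul_mem (V := A) (by ring) (DGAlgebra.mul_mem m i a ha b hb) hx) n z hz
    rw [add_comm] at this
    rwa [smul_eq_rTensor]
  d_smul a z := by
    change extD τ N (a • z) = dif A a • z + sgn a • extD τ N z
    induction z using TensorProduct.induction_on with
    | zero => simp
    | add x y hx hy =>
      simp only [smul_add, map_add, hx, hy]
      abel
    | tmul b x =>
      have h : ∀ w : C ⊗[ℚ] N, (LinearMap.mulLeft ℚ (sgn (a * b)) ∘ₗ τ.toLin).rTensor N w =
          sgn a • (LinearMap.mulLeft ℚ (sgn b) ∘ₗ τ.toLin).rTensor N w := by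
        intro w
        induction w using TensorProduct.induction_on with
        | zero => simp
        | add x y hx hy => simp only [map_add, hx, hy, smul_add]
        | tmul c y => simp [TensorProduct.smul_tmul', sgn_mul]
      simp only [TensorProduct.smul_tmul', smul_eq_mul, extD, LinearMap.sub_apply, dTens_tmul,
        extTwist_tmul, h]
      simp only [TensorProduct.smul_tmul', smul_eq_mul, DGAlgebra.d_mul, sgn_mul, TensorProduct.add_tmul, smul_sub, smul_add]
      abel

theorem ext_map_d (τ : TwistingChain C A) {M N : DGComod C} (f : M ⟶ N) (z : A ⊗[ℚ] M) :
    f.toLin.lTensor A (extD τ M z) = extD τ N (f.toLin.lTensor A z) := by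
  induction z using TensorProduct.induction_on with
  | zero => simp
  | add x y hx hy => simp only [map_add, hx, hy]
  | tmul c m =>
    simp only [extD, LinearMap.sub_apply]
    rw [map_sub, LinearMap.lTensor_tmul, extTwist_tmul, extTwist_tmul, f.map_coact]
    congr 1
    · simp [f.map_d]
    · generalize M.coact m = w
      induction w using TensorProduct.induction_on with
      | zero => simp
      | add x y hx hy => simp only [map_add, hx, hy]
      | tmul a b => simp

/-- The `τ`-twisted extension functor `τ^! : C-Comod ⥤ A-Mod`. -/
def ext (τ : TwistingChain C A) : DGComod C ⥤ DGMod A where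
  obj N := extObj τ N
  map {M N} f :=
    { toLin := f.toLin.lTensor A
      map_mem := fun n x hx => by
        have := map_mem (LinearMap.id : A →ₗ[ℚ] A) f.toLin 0 0 (by simp)
          (by simpa using f.map_mem) n x hx
        rw [show n + (0 + 0) = n by ring] at this
        exact this
      map_d := ext_map_d τ f
      map_smul := fun a z => by
        change f.toLin.lTensor A (a • z) = a • f.toLin.lTensor A z
        exact lTensor_smul f.toLin a z }
  map_id M := DGMod.Hom.ext (LinearMap.lTensor_id A M)
  map_comp f g := DGMod.Hom.ext (LinearMap.lTensor_comp A g.toLin f.toLin)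

variable [DGCoalgebra C]

/-- The unit `N ⟶ τ_* τ^! N`, `n ↦ n₍₀₎ ⊗ (1 ⊗ n₍₁₎)`. -/
def unitHom (τ : TwistingChain C A) (N : DGComod C) : N ⟶ (coext τ).obj ((ext τ).obj N) where
  toLin := (TensorProduct.mk ℚ A N 1).lTensor C ∘ₗ N.coact
  map_mem n x hx := by
    have := map_mem (LinearMap.id : C →ₗ[ℚ] C) (TensorProduct.mk ℚ A N 1) 0 0 (by simp)
      (fun n x hx => tmul_mem (by ring) DGAlgebra.one_mem hx) n _ (N.coact_mem n x hx)
    rw [show n + (0 + 0) = n by ring] at this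
    exact this
  map_d x := by
    have hlin : ∀ z : C ⊗[ℚ] N,
        TensorProduct.map (dif C) LinearMap.id ((TensorProduct.mk ℚ A N 1).lTensor C z) +
          TensorProduct.map sgn (extD τ N) ((TensorProduct.mk ℚ A N 1).lTensor C z) =
        (TensorProduct.mk ℚ A N 1).lTensor C (dTens C N z) -
          TensorProduct.map sgn ((τ.toLin).rTensor N) (N.coact.lTensor C z) := by
      intro z
      induction z using TensorProduct.induction_on with
      | zero => simp
      | add x y hx hy =>
        simp only [map_add]
        rw [add_add_add_comm, hx, hy]
        abel
      | tmul c y =>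
        have h1 : extD τ N ((1 : A) ⊗ₜ[ℚ] y) =
            (1 : A) ⊗ₜ[ℚ] dif N y - (τ.toLin).rTensor N (N.coact y) := by
          rw [extD, LinearMap.sub_apply, extTwist_tmul, dTens_tmul, dif_one, sgn_one,
            TensorProduct.zero_tmul, zero_add]
          congr 3
          ext; simp
        simp [h1, TensorProduct.tmul_sub, add_sub_assoc]
    obtain ⟨T, hT⟩ : ∃ T : C ⊗[ℚ] (A ⊗[ℚ] N) →ₗ[ℚ] C ⊗[ℚ] (A ⊗[ℚ] N),
        T = coextTwist τ (extObj τ N) := ⟨_, rfl⟩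
    have htw : ∀ z : C ⊗[ℚ] N, T ((TensorProduct.mk ℚ A N 1).lTensor C z) =
        TensorProduct.map sgn ((τ.toLin).rTensor N)
          (TensorProduct.assoc ℚ C C N ((Coalgebra.comul (R := ℚ) (A := C)).rTensor N z)) := by
      intro z
      induction z using TensorProduct.induction_on with
      | zero => simp
      | add x y hx hy => simp only [map_add, hx, hy]
      | tmul c y =>
        obtain ⟨s, hs⟩ : ∃ s : A →ₗ[ℚ] A ⊗[ℚ] N,
            s = smulBy (M := extObj τ N) ((1 : A) ⊗ₜ[ℚ] y) := ⟨_, rfl⟩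
        have h2 : T (c ⊗ₜ[ℚ] ((1 : A) ⊗ₜ[ℚ] y)) =
            TensorProduct.map sgn (s ∘ₗ τ.toLin) (Coalgebra.comul c) := by
          rw [hT, hs]
          exact coextTwist_tmul τ (extObj τ N) c ((1 : A) ⊗ₜ[ℚ] y)
        have h3 : ∀ a : A, s a = a ⊗ₜ[ℚ] y := fun a => by
          rw [hs]
          change (a * 1) ⊗ₜ[ℚ] y = a ⊗ₜ[ℚ] y
          rw [mul_one]
        rw [LinearMap.lTensor_tmul, TensorProduct.mk_apply, h2, LinearMap.rTensor_tmul]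
        generalize (Coalgebra.comul (R := ℚ) c) = w
        induction w using TensorProduct.induction_on with
        | zero => simp
        | add x y hx hy => simp only [TensorProduct.add_tmul, map_add, hx, hy]
        | tmul a b => simp [h3]
    have key : (TensorProduct.mk ℚ A N 1).lTensor C (N.coact (dif N x)) =
      (TensorProduct.map (dif C) LinearMap.id
          ((TensorProduct.mk ℚ A N 1).lTensor C (N.coact x)) +
        TensorProduct.map sgn (extD τ N)
          ((TensorProduct.mk ℚ A N 1).lTensor C (N.coact x))) +
      T ((TensorProduct.mk ℚ A N 1).lTensor C (N.coact x)) := by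
      rw [hlin, htw, N.coassoc, N.coact_d]
      abel
    rw [hT] at key
    exact key
  map_coact x := by
    have h1 : ∀ z : C ⊗[ℚ] N,
        cofreeCoact C (A ⊗[ℚ] N) ((TensorProduct.mk ℚ A N 1).lTensor C z) =
        ((TensorProduct.mk ℚ A N 1).lTensor C).lTensor C
          (TensorProduct.assoc ℚ C C N ((Coalgebra.comul (R := ℚ) (A := C)).rTensor N z)) := by
      intro z
      induction z using TensorProduct.induction_on with
      | zero => simp
      | add x y hx hy => simp only [map_add, hx, hy]
      | tmul c y =>
        rw [LinearMap.lTensor_tmul, leftCoact_tmul, LinearMap.rTensor_tmul]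
        generalize (Coalgebra.comul (R := ℚ) c) = w
        induction w using TensorProduct.induction_on with
        | zero => simp
        | add x y hx hy => simp only [TensorProduct.add_tmul, map_add, hx, hy]
        | tmul a b => simp
    change cofreeCoact C (A ⊗[ℚ] N) ((TensorProduct.mk ℚ A N 1).lTensor C (N.coact x)) =
      ((TensorProduct.mk ℚ A N 1).lTensor C ∘ₗ N.coact).lTensor C (N.coact x)
    rw [h1, N.coassoc, ← LinearMap.lTensor_comp_apply]

end Extension

/-! ### Gradings and derivations on tensor algebras -/

section TensorAlg

open TensorAlgebra

variable {V : Type u} [AddCommGroup V] [Module ℚ V] [GrVect V]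

/-- The monomials `v₁ ⋯ vₖ` in homogeneous elements, with their degree `|v₁| + ⋯ + |vₖ|`. -/
inductive IsMonomial (V : Type u) [AddCommGroup V] [Module ℚ V] [GrVect V] :
    ℤ → TensorAlgebra ℚ V → Prop
  | one : IsMonomial V 0 1
  | mul (m n : ℤ) (v : V) (x : TensorAlgebra ℚ V) : v ∈ gr V m → IsMonomial V n x →
      IsMonomial V (m + n) (ι ℚ v * x)

/-- The degree `n` part of the tensor algebra on a graded vector space. -/
def tensorAlgPiece (V : Type u) [AddCommGroup V] [Module ℚ V] [GrVect V] (n : ℤ) :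
    Submodule ℚ (TensorAlgebra ℚ V) :=
  Submodule.span ℚ {x | IsMonomial V n x}

theorem tensorAlg_ι_mul_mem {m n : ℤ} {v : V} (hv : v ∈ gr V m) {x : TensorAlgebra ℚ V}
    (hx : x ∈ tensorAlgPiece V n) : ι ℚ v * x ∈ tensorAlgPiece V (m + n) := by
  refine Submodule.span_induction (p := fun x _ => ι ℚ v * x ∈ tensorAlgPiece V (m + n))
    (fun x hx => Submodule.subset_span (.mul m n v x hv hx)) (by simp)
    (fun x y _ _ hx hy => ?_) (fun a x _ hx => ?_) hx
  · rw [mul_add]; exact Submodule.add_mem _ hx hy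
  · rw [mul_smul_comm]; exact Submodule.smul_mem _ _ hx

theorem tensorAlg_one_mem : (1 : TensorAlgebra ℚ V) ∈ tensorAlgPiece V 0 :=
  Submodule.subset_span .one

theorem tensorAlg_mul_mem (m n : ℤ) (x : TensorAlgebra ℚ V) (hx : x ∈ tensorAlgPiece V m)
    (y : TensorAlgebra ℚ V) (hy : y ∈ tensorAlgPiece V n) : x * y ∈ tensorAlgPiece V (m + n) := by
  refine Submodule.span_induction (p := fun x _ => x * y ∈ tensorAlgPiece V (m + n))
    (fun x hm => ?_) (by simp)
    (fun x y _ _ hx hy => ?_) (fun a x _ hx => ?_) hx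
  · clear hx
    induction hm with
    | one => simpa using hy
    | mul m k v x hv _ ih =>
      rw [mul_assoc, add_assoc]
      exact tensorAlg_ι_mul_mem hv ih
  · rw [add_mul]; exact Submodule.add_mem _ hx hy
  · rw [smul_mul_assoc]; exact Submodule.smul_mem _ _ hx

theorem tensorAlg_iSup : iSup (tensorAlgPiece V) = ⊤ := by
  have hmul : ∀ (v : V) (x : TensorAlgebra ℚ V), x ∈ iSup (tensorAlgPiece V) →
      ι ℚ v * x ∈ iSup (tensorAlgPiece V) := by
    intro v x hx
    induction hx using Submodule.iSup_induction' with
    | mem n x hx =>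
      refine gr_induction (p := fun v => ι ℚ v * x ∈ iSup (tensorAlgPiece V)) v
        (fun m v hv => Submodule.mem_iSup_of_mem (m + n) (tensorAlg_ι_mul_mem hv hx))
        (fun v w hv hw => ?_)
      rw [map_add, add_mul]; exact Submodule.add_mem _ hv hw
    | zero => simp
    | add x y _ _ hx hy => rw [mul_add]; exact Submodule.add_mem _ hx hy
  rw [eq_top_iff]
  rintro x -
  suffices h : ∀ y ∈ iSup (tensorAlgPiece V), x * y ∈ iSup (tensorAlgPiece V) by
    simpa using h 1 (Submodule.mem_iSup_of_mem 0 tensorAlg_one_mem)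
  induction x using TensorAlgebra.induction with
  | algebraMap r =>
    intro y hy
    rw [← Algebra.smul_def]
    exact Submodule.smul_mem _ _ hy
  | ι v => exact hmul v
  | mul a b ha hb =>
    intro y hy
    rw [mul_assoc]
    exact ha _ (hb _ hy)
  | add a b ha hb =>
    intro y hy
    rw [add_mul]
    exact Submodule.add_mem _ (ha _ hy) (hb _ hy)

/-- The homogeneous components of elements of the tensor algebra. -/
def tensorAlgSplit (V : Type u) [AddCommGroup V] [Module ℚ V] [GrVect V] :
    TensorAlgebra ℚ V →ₐ[ℚ] AddMonoidAlgebra (TensorAlgebra ℚ V) ℤ :=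
  TensorAlgebra.lift ℚ
    ((Finsupp.lsum ℚ fun n : ℤ =>
      ({ toFun := fun v => AddMonoidAlgebra.single n (ι ℚ v)
         map_add' := fun v w => by rw [map_add, AddMonoidAlgebra.single_add]
         map_smul' := fun a v => by
          rw [map_smul, AddMonoidAlgebra.smul_single, RingHom.id_apply] } :
        V →ₗ[ℚ] AddMonoidAlgebra (TensorAlgebra ℚ V) ℤ)) ∘ₗ comps)

theorem tensorAlgSplit_of_mem (n : ℤ) (x : TensorAlgebra ℚ V) (hx : x ∈ tensorAlgPiece V n) :
    tensorAlgSplit V x = AddMonoidAlgebra.single n x := by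
  refine Submodule.span_induction
    (p := fun x _ => tensorAlgSplit V x = AddMonoidAlgebra.single n x)
    (fun x hm => ?_) (by simp) (fun x y _ _ hx hy => ?_) (fun a x _ hx => ?_) hx
  · clear hx
    induction hm with
    | one => rw [map_one, AddMonoidAlgebra.one_def]
    | mul m k v x hv _ ih =>
      rw [map_mul, ih, tensorAlgSplit, TensorAlgebra.lift_ι_apply, LinearMap.comp_apply,
        comps_of_mem hv, Finsupp.lsum_single, LinearMap.coe_mk, AddHom.coe_mk,
        AddMonoidAlgebra.single_mul_single]
  · rw [map_add, hx, hy, AddMonoidAlgebra.single_add]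
  · rw [map_smul, hx, AddMonoidAlgebra.smul_single]

instance : GrVect (TensorAlgebra ℚ V) where
  piece := tensorAlgPiece V
  isInternal := isInternal_of_split _
    { toFun := fun x => (tensorAlgSplit V x).coeff
      map_add' := fun x y => by rw [map_add]; rfl
      map_smul' := fun a x => by rw [map_smul]; rfl }
    (fun n x hx => by
      simp only [LinearMap.coe_mk, AddHom.coe_mk]
      rw [tensorAlgSplit_of_mem n x hx]; rfl)
    tensorAlg_iSup

theorem tensorAlg_ι_mem {n : ℤ} {v : V} (hv : v ∈ gr V n) :
    ι ℚ v ∈ gr (TensorAlgebra ℚ V) n := by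
  have := tensorAlg_ι_mul_mem hv (tensorAlg_one_mem (V := V))
  rwa [mul_one, add_zero] at this

theorem tensorAlg_sgn_mul (x y : TensorAlgebra ℚ V) : sgn (x * y) = sgn x * sgn y := by
  refine gr_induction (p := fun x => sgn (x * y) = sgn x * sgn y) x
    (fun i v hv => ?_) (fun x y hx hy => by simp [add_mul, hx, hy])
  refine gr_induction (p := fun y => sgn (v * y) = sgn v * sgn y) y
    (fun j w hw => ?_) (fun x y hx hy => by simp [mul_add, hx, hy])
  rw [sgn_of_mem (show v * w ∈ gr (TensorAlgebra ℚ V) (i + j) from tensorAlg_mul_mem i j v hv w hw),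
    sgn_of_mem hv, sgn_of_mem hw, Int.negOnePow_add]
  simp only [Units.smul_def, Units.val_mul, smul_mul_assoc, mul_smul_comm, smul_smul]
  rw [mul_comm]

theorem tensorAlg_sgn_algebraMap (r : ℚ) :
    sgn (algebraMap ℚ (TensorAlgebra ℚ V) r) = algebraMap ℚ (TensorAlgebra ℚ V) r := by
  have h : (1 : TensorAlgebra ℚ V) ∈ gr (TensorAlgebra ℚ V) 0 := tensorAlg_one_mem
  rw [Algebra.algebraMap_eq_smul_one, map_smul, sgn_of_mem h]
  simp

theorem tensorAlg_sgn_ι (v : V) : sgn (ι ℚ v) = ι ℚ (sgn v) :=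
  (sgn_map (ι ℚ) (fun _ _ h => tensorAlg_ι_mem h) v).symm

/-- The algebra map `x ↦ [[(-1)^{|x|} x, D x], [0, x]]`, where `D` is the derivation extending
`δ`. -/
def derivMatrix (δ : V →ₗ[ℚ] TensorAlgebra ℚ V) :
    TensorAlgebra ℚ V →ₐ[ℚ] Matrix (Fin 2) (Fin 2) (TensorAlgebra ℚ V) :=
  TensorAlgebra.lift ℚ
    { toFun := fun v => !![ι ℚ (sgn v), δ v; 0, ι ℚ v]
      map_add' := fun v w => by
        ext i j; fin_cases i <;> fin_cases j <;> simp
      map_smul' := fun a v => by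
        ext i j; fin_cases i <;> fin_cases j <;> simp }

/-- The unique linear map `D` with `D(xy) = D(x) y + (-1)^{|x|} x D(y)` and `D v = δ v`. -/
def derivExt (δ : V →ₗ[ℚ] TensorAlgebra ℚ V) : TensorAlgebra ℚ V →ₗ[ℚ] TensorAlgebra ℚ V where
  toFun x := derivMatrix δ x 0 1
  map_add' x y := by simp
  map_smul' a x := by simp

variable (δ : V →ₗ[ℚ] TensorAlgebra ℚ V)

theorem derivMatrix_ι (v : V) : derivMatrix δ (ι ℚ v) = !![ι ℚ (sgn v), δ v; 0, ι ℚ v] :=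
  TensorAlgebra.lift_ι_apply _ _

@[simp] theorem derivExt_ι (v : V) : derivExt δ (ι ℚ v) = δ v := by
  change derivMatrix δ (ι ℚ v) 0 1 = δ v
  rw [derivMatrix_ι]; rfl

@[simp] theorem derivExt_algebraMap (r : ℚ) : derivExt δ (algebraMap ℚ _ r) = 0 := by
  change derivMatrix δ (algebraMap ℚ _ r) 0 1 = 0
  rw [AlgHom.commutes, Matrix.algebraMap_matrix_apply]
  simp

theorem derivMatrix_entries (x : TensorAlgebra ℚ V) :
    derivMatrix δ x 0 0 = sgn x ∧ derivMatrix δ x 1 1 = x ∧ derivMatrix δ x 1 0 = 0 := by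
  induction x using TensorAlgebra.induction with
  | algebraMap r =>
    rw [AlgHom.commutes]
    simp [Matrix.algebraMap_matrix_apply, tensorAlg_sgn_algebraMap]
  | ι v => rw [derivMatrix_ι, tensorAlg_sgn_ι]; simp
  | mul a b ha hb =>
    rw [map_mul]
    simp [Matrix.mul_apply, Fin.sum_univ_two, ha, hb, tensorAlg_sgn_mul]
  | add a b ha hb => simp [ha, hb]

theorem derivExt_mul (x y : TensorAlgebra ℚ V) :
    derivExt δ (x * y) = derivExt δ x * y + sgn x * derivExt δ y := by
  change derivMatrix δ (x * y) 0 1 = derivMatrix δ x 0 1 * y + sgn x * derivMatrix δ y 0 1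
  rw [map_mul, Matrix.mul_apply, Fin.sum_univ_two, (derivMatrix_entries δ x).1,
    (derivMatrix_entries δ y).2.1, add_comm]

theorem derivExt_mem (hδ : ∀ n, ∀ v ∈ gr V n, δ v ∈ gr (TensorAlgebra ℚ V) (n - 1)) (n : ℤ)
    (x : TensorAlgebra ℚ V) (hx : x ∈ gr (TensorAlgebra ℚ V) n) :
    derivExt δ x ∈ gr (TensorAlgebra ℚ V) (n - 1) := by
  refine Submodule.span_induction
    (p := fun x _ => derivExt δ x ∈ gr (TensorAlgebra ℚ V) (n - 1))
    (fun x hm => ?_) (by simp) (fun x y _ _ hx hy => ?_) (fun a x _ hx => ?_) hx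
  · clear hx
    induction hm with
    | one =>
      have := derivExt_algebraMap δ 1
      rw [map_one] at this
      rw [this]; exact Submodule.zero_mem _
    | mul m k v x hv hx ih =>
      rw [derivExt_mul, derivExt_ι, tensorAlg_sgn_ι]
      refine Submodule.add_mem _ ?_ ?_
      · have := tensorAlg_mul_mem _ _ _ (hδ m v hv) _ (Submodule.subset_span hx)
        rwa [show m - 1 + k = m + k - 1 by ring] at this
      · have := tensorAlg_mul_mem _ _ _ (tensorAlg_ι_mem (sgn_mem hv)) _
          ih
        rwa [show m + (k - 1) = m + k - 1 by ring] at this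
  · rw [map_add]; exact Submodule.add_mem _ hx hy
  · rw [map_smul]; exact Submodule.smul_mem _ _ hx

theorem derivExt_derivExt (hδ : ∀ n, ∀ v ∈ gr V n, δ v ∈ gr (TensorAlgebra ℚ V) (n - 1))
    (h : ∀ v, derivExt δ (δ v) = 0) (x : TensorAlgebra ℚ V) :
    derivExt δ (derivExt δ x) = 0 := by
  induction x using TensorAlgebra.induction with
  | algebraMap r => simp
  | ι v => simp [h]
  | mul a b ha hb =>
    rw [derivExt_mul, map_add, derivExt_mul, derivExt_mul, ha, hb,
      sgn_map_neg _ (derivExt_mem δ hδ)]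
    simp
  | add a b ha hb => simp [ha, hb]

end TensorAlg

/-! ### The cobar construction -/

section Cobar

open TensorAlgebra

/-- The desuspension `C̄[1]` of the cokernel `C̄` of the coaugmentation `ℚ → C` of a `2`-reduced
dg coalgebra `C`; the image of the coaugmentation is `C₀`. -/
def CobarGen (C : Type u) [AddCommGroup C] [Module ℚ C] [DGVect C] : Type u := C ⧸ gr C 0

variable {C : Type u} [AddCommGroup C] [Module ℚ C] [DGVect C]

instance : AddCommGroup (CobarGen C) := inferInstanceAs (AddCommGroup (C ⧸ gr C 0))

instance : Module ℚ (CobarGen C) := inferInstanceAs (Module ℚ (C ⧸ gr C 0))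

/-- The desuspended projection `c ↦ s⁻¹ π(c)`. -/
def cobarProj (C : Type u) [AddCommGroup C] [Module ℚ C] [DGVect C] : C →ₗ[ℚ] CobarGen C :=
  (gr C 0).mkQ

theorem cobarProj_surjective : Function.Surjective (cobarProj C) := (gr C 0).mkQ_surjective

theorem cobarProj_of_mem {c : C} (hc : c ∈ gr C 0) : cobarProj C c = 0 :=
  (Submodule.Quotient.mk_eq_zero (gr C 0)).mpr hc

/-- A linear map vanishing on `C₀` factors through `C̄`. -/
def cobarLift {W : Type v} [AddCommGroup W] [Module ℚ W] (f : C →ₗ[ℚ] W)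
    (hf : ∀ c ∈ gr C 0, f c = 0) : CobarGen C →ₗ[ℚ] W :=
  (gr C 0).liftQ f hf

@[simp] theorem cobarLift_proj {W : Type v} [AddCommGroup W] [Module ℚ W] (f : C →ₗ[ℚ] W)
    (hf : ∀ c ∈ gr C 0, f c = 0) (c : C) : cobarLift f hf (cobarProj C c) = f c :=
  Submodule.liftQ_apply _ _ _

/-- `s⁻¹ π(c)` has degree `|c| - 1`. -/
instance : GrVect (CobarGen C) where
  piece n := (gr C (n + 1)).map (cobarProj C)
  isInternal := by
    refine isInternal_of_split _
      (cobarLift ((Finsupp.lmapDomain (CobarGen C) ℚ (fun n : ℤ => n - 1)) ∘ₗ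
        (Finsupp.mapRange.linearMap (cobarProj C)) ∘ₗ comps) (fun c hc => ?_)) ?_ ?_
    · simp [comps_of_mem hc, cobarProj_of_mem hc]
    · rintro n _ ⟨c, hc, rfl⟩
      rw [cobarLift_proj]
      simp only [LinearMap.comp_apply]
      rw [comps_of_mem hc]
      simp
    · have h : ⨆ n, gr C (n + 1) = iSup (gr C) := (Equiv.addRight (1 : ℤ)).iSup_comp
      rw [← Submodule.map_iSup, h, iSup_gr, Submodule.map_top, LinearMap.range_eq_top]
      exact cobarProj_surjective

theorem cobarProj_mem {n : ℤ} {c : C} (hc : c ∈ gr C n) :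
    cobarProj C c ∈ gr (CobarGen C) (n - 1) :=
  ⟨c, by simpa using hc, rfl⟩

/-- The graded algebra `T(C̄[1])` underlying the cobar construction `ΩC`. -/
abbrev Cobar (C : Type u) [AddCommGroup C] [Module ℚ C] [DGVect C] : Type u :=
  TensorAlgebra ℚ (CobarGen C)

/-- The map `c ↦ tc = s⁻¹ π(c)` from `C` to `ΩC`. -/
def univLin (C : Type u) [AddCommGroup C] [Module ℚ C] [DGVect C] : C →ₗ[ℚ] Cobar C :=
  ι ℚ ∘ₗ cobarProj C

theorem univLin_mem (n : ℤ) (c : C) (hc : c ∈ gr C n) : univLin C c ∈ gr (Cobar C) (n - 1) :=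
  tensorAlg_ι_mem (cobarProj_mem hc)

theorem univLin_zero (c : C) (hc : c ∈ gr C 0) : univLin C c = 0 := by
  rw [univLin, LinearMap.comp_apply, cobarProj_of_mem hc, map_zero]

/-- The map `a ⊗ b ↦ (-1)^{|a|} ta · tb`. -/
def cobarQuad (C : Type u) [AddCommGroup C] [Module ℚ C] [DGVect C] : C ⊗[ℚ] C →ₗ[ℚ] Cobar C :=
  LinearMap.mul' ℚ (Cobar C) ∘ₗ TensorProduct.map (univLin C ∘ₗ sgn) (univLin C)

@[simp] theorem cobarQuad_tmul (a b : C) :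
    cobarQuad C (a ⊗ₜ b) = univLin C (sgn a) * univLin C b := rfl

variable [Coalgebra ℚ C]

/-- `c ↦ d(tc) = -t(dc) - (-1)^{|c₍₀₎|} tc₍₀₎ · tc₍₁₎`. -/
def cobarDiffLin (C : Type u) [AddCommGroup C] [Module ℚ C] [DGVect C] [Coalgebra ℚ C] :
    C →ₗ[ℚ] Cobar C :=
  - (univLin C ∘ₗ dif C) - cobarQuad C ∘ₗ Coalgebra.comul

theorem cobarDiffLin_apply (c : C) : cobarDiffLin C c =
    - univLin C (dif C c) - cobarQuad C (Coalgebra.comul c) := rfl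

variable [DGCoalgebra C] [TwoReduced C]

theorem cobarDiffLin_zero (c : C) (hc : c ∈ gr C 0) : cobarDiffLin C c = 0 := by
  have h1 : dif C c = 0 := by
    have := DGVect.d_mem 0 c hc
    rw [show GrVect.piece (V := C) (0 - 1) = ⊥ from
      TwoReduced.gr_neg (C := C) (0 - 1) (by norm_num)] at this
    simpa using this
  have h2 : cobarQuad C (Coalgebra.comul c) = 0 := by
    refine Submodule.span_induction (p := fun z _ => cobarQuad C z = 0) ?_ (by simp)
      (fun x y _ _ hx hy => by simp [hx, hy]) (fun a x _ hx => by simp [hx])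
      (DGCoalgebra.comul_mem 0 c hc)
    rintro _ ⟨i, j, hij, a, ha, b, hb, rfl⟩
    rcases lt_trichotomy i 0 with hi | rfl | hi
    · rw [TwoReduced.gr_neg i hi, Submodule.mem_bot] at ha
      simp [ha]
    · rw [cobarQuad_tmul, univLin_zero _ (sgn_mem ha), zero_mul]
    · rw [TwoReduced.gr_neg j (by omega), Submodule.mem_bot] at hb
      simp [hb]
  rw [cobarDiffLin_apply, h1, h2]
  simp

/-- The differential of the cobar construction on generators. -/
def cobarDiffGen (C : Type u) [AddCommGroup C] [Module ℚ C] [DGVect C] [Coalgebra ℚ C]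
    [DGCoalgebra C] [TwoReduced C] : CobarGen C →ₗ[ℚ] Cobar C :=
  cobarLift (cobarDiffLin C) cobarDiffLin_zero

theorem cobarQuad_mem (n : ℤ) (z : C ⊗[ℚ] C) (hz : z ∈ gr (C ⊗[ℚ] C) n) :
    cobarQuad C z ∈ gr (Cobar C) (n - 2) := by
  refine tensor_degree (cobarQuad C) (-2) (fun i j a ha b hb => ?_) n z hz
  have := tensorAlg_mul_mem _ _ _ (univLin_mem i _ (sgn_mem ha)) _ (univLin_mem j b hb)
  rwa [show i - 1 + (j - 1) = i + j + -2 by ring] at this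

theorem cobarDiffGen_mem (n : ℤ) (v : CobarGen C) (hv : v ∈ gr (CobarGen C) n) :
    cobarDiffGen C v ∈ gr (Cobar C) (n - 1) := by
  obtain ⟨c, hc, rfl⟩ := hv
  rw [cobarDiffGen, cobarLift_proj, cobarDiffLin_apply]
  refine Submodule.sub_mem _ (Submodule.neg_mem _ ?_) ?_
  · have := univLin_mem _ _ (DGVect.d_mem (n + 1) c hc)
    rwa [show n + 1 - 1 - 1 = n - 1 by ring] at this
  · have := cobarQuad_mem _ _ (DGCoalgebra.comul_mem (n + 1) c hc)
    rwa [show n + 1 - 2 = n - 1 by ring] at this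

theorem derivExt_univLin (c : C) :
    derivExt (cobarDiffGen C) (univLin C c) = cobarDiffLin C c := by
  rw [univLin, LinearMap.comp_apply, derivExt_ι, cobarDiffGen, cobarLift_proj]

theorem sgn_univLin (c : C) : sgn (univLin C c) = - univLin C (sgn c) := by
  rw [sgn_map_neg (univLin C) univLin_mem, neg_neg]

theorem cobarDiffGen_sq (v : CobarGen C) :
    derivExt (cobarDiffGen C) (cobarDiffGen C v) = 0 := by
  obtain ⟨c, rfl⟩ := cobarProj_surjective v
  have hlin : ∀ z : C ⊗[ℚ] C,
      cobarQuad C (dTens C C z) - derivExt (cobarDiffGen C) (cobarQuad C z) =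
      (LinearMap.mul' ℚ (Cobar C) ∘ₗ TensorProduct.map (univLin C)
        (LinearMap.mul' ℚ (Cobar C) ∘ₗ TensorProduct.map (univLin C ∘ₗ sgn) (univLin C)))
        (TensorProduct.assoc ℚ C C C ((Coalgebra.comul (R := ℚ) (A := C)).rTensor C z)) -
      (LinearMap.mul' ℚ (Cobar C) ∘ₗ TensorProduct.map (univLin C)
        (LinearMap.mul' ℚ (Cobar C) ∘ₗ TensorProduct.map (univLin C ∘ₗ sgn) (univLin C)))
        ((Coalgebra.comul (R := ℚ) (A := C)).lTensor C z) := by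
    intro z
    induction z using TensorProduct.induction_on with
    | zero => simp
    | add x y hx hy =>
      simp only [map_add]
      rw [add_sub_add_comm, hx, hy]
      abel
    | tmul a b =>
      have h1 : (LinearMap.mul' ℚ (Cobar C) ∘ₗ TensorProduct.map (univLin C)
          (LinearMap.mul' ℚ (Cobar C) ∘ₗ TensorProduct.map (univLin C ∘ₗ sgn) (univLin C)))
          (TensorProduct.assoc ℚ C C C
            ((Coalgebra.comul (R := ℚ) (A := C)).rTensor C (a ⊗ₜ b))) =
          cobarQuad C (Coalgebra.comul (sgn a)) * univLin C b := by
        rw [LinearMap.rTensor_tmul, sgn_comul]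
        generalize (Coalgebra.comul (R := ℚ) a) = w
        induction w using TensorProduct.induction_on with
        | zero => simp
        | add x y hx hy => simp only [TensorProduct.add_tmul, map_add, hx, hy, add_mul]
        | tmul a b => simp [mul_assoc]
      have h2 : (LinearMap.mul' ℚ (Cobar C) ∘ₗ TensorProduct.map (univLin C)
          (LinearMap.mul' ℚ (Cobar C) ∘ₗ TensorProduct.map (univLin C ∘ₗ sgn) (univLin C)))
          ((Coalgebra.comul (R := ℚ) (A := C)).lTensor C (a ⊗ₜ b)) =
          univLin C a * cobarQuad C (Coalgebra.comul b) := rfl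
      rw [h1, h2, dTens_tmul, map_add, cobarQuad_tmul, cobarQuad_tmul, cobarQuad_tmul,
        derivExt_mul, derivExt_univLin, derivExt_univLin, sgn_univLin, sgn_sgn,
        cobarDiffLin_apply, cobarDiffLin_apply, dif_sgn]
      simp only [map_neg, sub_mul, mul_sub, neg_mul, mul_neg, neg_neg]
      abel
  have h := hlin (Coalgebra.comul c)
  rw [Coalgebra.coassoc_apply, sub_self, sub_eq_zero] at h
  rw [cobarDiffGen, cobarLift_proj, ← cobarDiffGen, cobarDiffLin_apply, map_sub, map_neg,
    derivExt_univLin, cobarDiffLin_apply, dif_dif, DGCoalgebra.comul_d, h]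
  simp

/-- The cobar construction `ΩC` with its differential, the derivation determined by
`d(tc) = -t(dc) - (-1)^{|c₍₀₎|} tc₍₀₎ · tc₍₁₎`. -/
instance : DGVect (Cobar C) where
  d := derivExt (cobarDiffGen C)
  d_mem := derivExt_mem _ cobarDiffGen_mem
  d_d := derivExt_derivExt _ cobarDiffGen_mem cobarDiffGen_sq

instance : DGAlgebra (Cobar C) where
  one_mem := tensorAlg_one_mem
  mul_mem := tensorAlg_mul_mem
  d_mul := derivExt_mul _

/-- The universal twisting chain `t : C ⇝ ΩC`. -/
def univ (C : Type u) [AddCommGroup C] [Module ℚ C] [DGVect C] [Coalgebra ℚ C]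
    [DGCoalgebra C] [TwoReduced C] : TwistingChain C (Cobar C) where
  toLin := univLin C
  map_mem := univLin_mem
  d_toLin := derivExt_univLin

end Cobar

/-! ### Subcomodules and cotensor products -/

section Cotensor

variable {C : Type u} [AddCommGroup C] [Module ℚ C] [Coalgebra ℚ C] [DGVect C]

/-- The tensor product `M ⊗ V` of a dg comodule and a dg vector space, with coaction
`m ⊗ v ↦ m₍₀₎ ⊗ (m₍₁₎ ⊗ v)`. -/
def tensorComod (M : DGComod C) (V : Type u) [AddCommGroup V] [Module ℚ V] [DGVect V] :
    DGComod C where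
  carrier := M ⊗[ℚ] V
  dgVect :=
    { d := dTens M V
      d_mem := dTens_mem
      d_d := dTens_dTens }
  coact := leftCoact M.coact V
  coact_mem := leftCoact_mem _ M.coact_mem
  coact_d := leftCoact_dTens _ M.coact_mem M.coact_d
  coassoc := leftCoact_coassoc _ M.coassoc
  counit := leftCoact_counit _ M.counit

/-- A degree-preserving injective map reflects degrees. -/
theorem mem_of_injective {V : Type u} [AddCommGroup V] [Module ℚ V] [GrVect V]
    {W : Type v} [AddCommGroup W] [Module ℚ W] [GrVect W] (f : V →ₗ[ℚ] W)
    (hf : ∀ n, ∀ x ∈ gr V n, f x ∈ gr W n) (hinj : Function.Injective f) (n : ℤ) (x : V)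
    (hx : f x ∈ gr W n) : x ∈ gr V n := by
  have h : x = comps x n := by
    apply hinj
    rw [← comps_map f hf, comps_of_mem hx, Finsupp.single_eq_same]
  rw [h]
  exact comps_apply_mem x n

section Sub

variable (X : DGComod C) (S : Submodule ℚ X)

theorem lTensor_subtype_injective : Function.Injective (S.subtype.lTensor C) :=
  Module.Flat.lTensor_preserves_injective_linearMap _ S.subtype_injective

/-- The coaction on a subspace `S` with `ρ(S) ⊆ C ⊗ S`. -/
def subCoact (hρ : ∀ x ∈ S, X.coact x ∈ LinearMap.range (S.subtype.lTensor C)) :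
    S →ₗ[ℚ] C ⊗[ℚ] S :=
  LinearMap.codRestrictOfInjective (X.coact ∘ₗ S.subtype) (S.subtype.lTensor C)
    (lTensor_subtype_injective X S) (fun x => hρ x x.2)

variable {S}

theorem lTensor_subCoact (hρ : ∀ x ∈ S, X.coact x ∈ LinearMap.range (S.subtype.lTensor C))
    (x : S) : S.subtype.lTensor C (subCoact X S hρ x) = X.coact x :=
  LinearMap.codRestrictOfInjective_comp_apply _ _ _ _ x

/-- A homogeneous subspace stable under the differential and the coaction is a dg comodule. -/
def subComod (hS : IsHomogeneous S) (hd : ∀ x ∈ S, dif X x ∈ S)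
    (hρ : ∀ x ∈ S, X.coact x ∈ LinearMap.range (S.subtype.lTensor C)) : DGComod C where
  carrier := S
  dgVect :=
    { piece := fun n => (gr X n).comap S.subtype
      isInternal := hS.isInternal
      d := (dif X).restrict hd
      d_mem := fun n x hx => DGVect.d_mem n (x : X) hx
      d_d := fun x => Subtype.ext (dif_dif (x : X)) }
  coact := subCoact X S hρ
  coact_mem n x hx := by
    let _ : GrVect S := ⟨fun n => (gr X n).comap S.subtype, hS.isInternal⟩
    refine mem_of_injective (S.subtype.lTensor C) (fun n z hz => ?_)
      (lTensor_subtype_injective X S) n _ ?_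
    · have := map_mem (LinearMap.id : C →ₗ[ℚ] C) S.subtype 0 0 (by simp)
        (fun n x hx => by rw [add_zero]; exact hx) n z hz
      rw [show n + (0 + 0) = n by ring] at this
      exact this
    · rw [lTensor_subCoact]
      exact X.coact_mem n x hx
  coact_d x := by
    let _ : DGVect S :=
      { piece := fun n => (gr X n).comap S.subtype
        isInternal := hS.isInternal
        d := (dif X).restrict hd
        d_mem := fun n x hx => DGVect.d_mem n (x : X) hx
        d_d := fun x => Subtype.ext (dif_dif (x : X)) }
    apply lTensor_subtype_injective X S
    rw [lTensor_subCoact]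
    let i : DGHom S X := ⟨S.subtype, fun _ _ h => h, fun _ => rfl⟩
    let j : DGHom C C := ⟨LinearMap.id, fun _ _ h => h, fun _ => rfl⟩
    have h := dTens_map j i (subCoact X S hρ x)
    refine Eq.trans ?_ h.symm
    have h2 : TensorProduct.map j.toLin i.toLin (subCoact X S hρ x) = X.coact x :=
      lTensor_subCoact X hρ x
    rw [h2]
    exact X.coact_d x
  coassoc x := by
    apply Module.Flat.lTensor_preserves_injective_linearMap (M := C) _
      (lTensor_subtype_injective X S)
    have h1 : ∀ z : C ⊗[ℚ] S, (S.subtype.lTensor C).lTensor C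
        (TensorProduct.assoc ℚ C C S ((Coalgebra.comul (R := ℚ) (A := C)).rTensor S z)) =
        TensorProduct.assoc ℚ C C X ((Coalgebra.comul (R := ℚ) (A := C)).rTensor X
          (S.subtype.lTensor C z)) := by
      intro z
      induction z using TensorProduct.induction_on with
      | zero => simp
      | add x y hx hy => simp only [map_add, hx, hy]
      | tmul c s =>
        simp only [LinearMap.rTensor_tmul, LinearMap.lTensor_tmul]
        generalize (Coalgebra.comul (R := ℚ) c) = w
        induction w using TensorProduct.induction_on with
        | zero => simp
        | add x y hx hy => simp only [TensorProduct.add_tmul, map_add, hx, hy]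
        | tmul a b => simp
    have h2 : ∀ z : C ⊗[ℚ] S, (S.subtype.lTensor C).lTensor C ((subCoact X S hρ).lTensor C z) =
        X.coact.lTensor C (S.subtype.lTensor C z) := by
      intro z
      rw [← LinearMap.lTensor_comp_apply, ← LinearMap.lTensor_comp_apply]
      congr 2
      ext s
      exact lTensor_subCoact X hρ s
    rw [h1, h2, lTensor_subCoact]
    exact X.coassoc x
  counit x := by
    apply S.subtype_injective
    have h1 : ∀ z : C ⊗[ℚ] S, S.subtype (TensorProduct.lid ℚ S
        ((Coalgebra.counit (R := ℚ) (A := C)).rTensor S z)) =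
        TensorProduct.lid ℚ X ((Coalgebra.counit (R := ℚ) (A := C)).rTensor X
          (S.subtype.lTensor C z)) := by
      intro z
      induction z using TensorProduct.induction_on with
      | zero => simp
      | add x y hx hy => simp only [map_add, hx, hy]
      | tmul c s => simp
    rw [h1, lTensor_subCoact]
    exact X.counit x

end Sub

/-- The right coaction `M → M ⊗ C` obtained from the left coaction by the Koszul symmetry. -/
def rightCoact (M : DGComod C) : M →ₗ[ℚ] M ⊗[ℚ] C := swap C M ∘ₗ M.coact

/-- The map `M ⊗ ρ_N : M ⊗ N → M ⊗ C ⊗ N`. -/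
def cotensorLeft (M N : DGComod C) : M ⊗[ℚ] N →ₗ[ℚ] M ⊗[ℚ] (C ⊗[ℚ] N) := N.coact.lTensor M

/-- The map `ρ_M ⊗ N : M ⊗ N → M ⊗ C ⊗ N`, using the right coaction of `M`. -/
def cotensorRight (M N : DGComod C) : M ⊗[ℚ] N →ₗ[ℚ] M ⊗[ℚ] (C ⊗[ℚ] N) :=
  (TensorProduct.assoc ℚ M C N).toLinearMap ∘ₗ (rightCoact M).rTensor N

/-- The subspace of `M ⊗ N` underlying the cotensor product `M □_C N`, the equaliser of
`M ⊗ ρ_N` and `ρ_M ⊗ N`. -/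
def cotensorSub (M N : DGComod C) : Submodule ℚ (M ⊗[ℚ] N) :=
  LinearMap.eqLocus (cotensorLeft M N) (cotensorRight M N)

theorem rightCoact_mem (M : DGComod C) (n : ℤ) (x : M) (hx : x ∈ gr M n) :
    rightCoact M x ∈ gr (M ⊗[ℚ] C) n :=
  swap_mem n _ (M.coact_mem n x hx)

theorem cotensorRight_tmul (M N : DGComod C) (m : M) (y : N) :
    cotensorRight M N (m ⊗ₜ y) = ((TensorProduct.mk ℚ C N).flip y).lTensor M (rightCoact M m) := by
  simp only [cotensorRight, LinearMap.comp_apply, LinearMap.rTensor_tmul, LinearEquiv.coe_coe]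
  generalize rightCoact M m = z
  induction z using TensorProduct.induction_on with
  | zero => simp
  | add x y hx hy => simp only [TensorProduct.add_tmul, map_add, hx, hy]
  | tmul a b => simp

theorem cotensorSub_isHomogeneous (M N : DGComod C) :
    IsHomogeneous (V := M ⊗[ℚ] N) (cotensorSub M N) := by
  refine eqLocus_isHomogeneous _ _ (fun n z hz => ?_) (fun n z hz => ?_)
  · have := map_mem (LinearMap.id : M →ₗ[ℚ] M) N.coact 0 0 (by simp)
      (fun n x hx => by simpa using N.coact_mem n x hx) n z hz
    rw [show n + (0 + 0) = n by ring] at this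
    exact this
  · have := tensor_degree (cotensorRight M N) 0 (fun i j m hm y hy => by
      rw [cotensorRight_tmul]
      have := map_mem (LinearMap.id : M →ₗ[ℚ] M) ((TensorProduct.mk ℚ C N).flip y) 0 j
        (fun n x hx => by simpa using hx)
        (fun n x hx => tmul_mem rfl hx hy) i _ (rightCoact_mem M i m hm)
      rwa [show i + (0 + j) = i + j + 0 by ring] at this) n z hz
    simpa using this

theorem cotensorSub_dTens (M N : DGComod C) (z : M ⊗[ℚ] N) (hz : z ∈ cotensorSub M N) :
    dTens M N z ∈ cotensorSub M N := by
  have h1 : ∀ z, cotensorLeft M N (dTens M N z) =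
      TensorProduct.map (dif M) LinearMap.id (cotensorLeft M N z) +
        TensorProduct.map sgn (dTens C N) (cotensorLeft M N z) := by
    intro z
    induction z using TensorProduct.induction_on with
    | zero => simp
    | add x y hx hy => simp only [map_add, hx, hy]; abel
    | tmul m y => simp [cotensorLeft, N.coact_d]
  have h2 : ∀ z, cotensorRight M N (dTens M N z) =
      TensorProduct.map (dif M) LinearMap.id (cotensorRight M N z) +
        TensorProduct.map sgn (dTens C N) (cotensorRight M N z) := by
    intro z
    induction z using TensorProduct.induction_on with
    | zero => simp
    | add x y hx hy => simp only [map_add, hx, hy]; abel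
    | tmul m y =>
      have hd : rightCoact M (dif M m) = dTens M C (rightCoact M m) := by
        rw [rightCoact, LinearMap.comp_apply, M.coact_d, dTens_swap]; rfl
      simp only [dTens_tmul, map_add, cotensorRight_tmul, hd,
        sgn_map (rightCoact M) (rightCoact_mem M)]
      generalize rightCoact M m = w
      induction w using TensorProduct.induction_on with
      | zero => simp
      | add x y hx hy =>
        simp only [map_add] at hx hy ⊢
        rw [add_add_add_comm, hx, hy]
        abel
      | tmul a b => simp [TensorProduct.tmul_add, add_assoc]
  change cotensorLeft M N z = cotensorRight M N z at hz
  change cotensorLeft M N (dTens M N z) = cotensorRight M N (dTens M N z)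
  rw [h1, h2, hz]

/-- The hexagon relation for the Koszul symmetry. -/
theorem swap_hexagon {X Y Z : Type u} [AddCommGroup X] [Module ℚ X] [GrVect X]
    [AddCommGroup Y] [Module ℚ Y] [GrVect Y] [AddCommGroup Z] [Module ℚ Z] [GrVect Z]
    (w : (X ⊗[ℚ] Y) ⊗[ℚ] Z) :
    TensorProduct.assoc ℚ Y Z X (swap X (Y ⊗[ℚ] Z) (TensorProduct.assoc ℚ X Y Z w)) =
      (swap X Z).lTensor Y (TensorProduct.assoc ℚ Y X Z ((swap X Y).rTensor Z w)) := by
  induction w using TensorProduct.induction_on with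
  | zero => simp
  | add x y hx hy => simp only [map_add, hx, hy]
  | tmul w c =>
    induction w using TensorProduct.induction_on with
    | zero => simp
    | add x y hx hy => simp only [TensorProduct.add_tmul, map_add, hx, hy]
    | tmul a b =>
      simp only [TensorProduct.assoc_tmul, swap_tmul, sgn_tmul, LinearMap.rTensor_tmul, map_add,
        map_sub, map_smul, TensorProduct.add_tmul, TensorProduct.sub_tmul,
        ← TensorProduct.smul_tmul', LinearMap.lTensor_tmul, TensorProduct.tmul_add,
        TensorProduct.tmul_sub, TensorProduct.tmul_smul, sgn_sgn]
      module

variable [GradedCocomm C]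

/-- The left and right coactions of a comodule over a cocommutative coalgebra commute. -/
theorem rightCoact_leftCoact (M : DGComod C) (m : M) :
    leftCoact M.coact C (rightCoact M m) = (rightCoact M).lTensor C (M.coact m) := by
  have h1 : M.coact.rTensor C (rightCoact M m) =
      swap C (C ⊗[ℚ] M) (M.coact.lTensor C (M.coact m)) :=
    (swap_map LinearMap.id M.coact (fun _ _ h => h) M.coact_mem (M.coact m)).symm
  have h2 : (swap C C).rTensor M
      ((Coalgebra.comul (R := ℚ) (A := C)).rTensor M (M.coact m)) =
      (Coalgebra.comul (R := ℚ) (A := C)).rTensor M (M.coact m) := by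
    rw [← LinearMap.rTensor_comp_apply]
    congr 2
    ext x
    exact GradedCocomm.swap_comul x
  rw [leftCoact, LinearMap.comp_apply, h1, ← M.coassoc, LinearEquiv.coe_coe, swap_hexagon, h2,
    M.coassoc, ← LinearMap.lTensor_comp_apply]
  rfl

theorem cotensorSub_coact (M N : DGComod C) (z : M ⊗[ℚ] N) (hz : z ∈ cotensorSub M N) :
    leftCoact M.coact N z ∈ LinearMap.range ((cotensorSub M N).subtype.lTensor C) := by
  have h1 : ∀ z, (cotensorLeft M N).lTensor C (leftCoact M.coact N z) =
      leftCoact M.coact (C ⊗[ℚ] N) (cotensorLeft M N z) := by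
    intro z
    induction z using TensorProduct.induction_on with
    | zero => simp
    | add x y hx hy => simp only [map_add, hx, hy]
    | tmul m y =>
      rw [cotensorLeft, LinearMap.lTensor_tmul, leftCoact_tmul, leftCoact_tmul,
        ← LinearMap.lTensor_comp_apply]
      rfl
  have h2 : ∀ z, (cotensorRight M N).lTensor C (leftCoact M.coact N z) =
      leftCoact M.coact (C ⊗[ℚ] N) (cotensorRight M N z) := by
    intro z
    induction z using TensorProduct.induction_on with
    | zero => simp
    | add x y hx hy => simp only [map_add, hx, hy]
    | tmul m y =>
      have h3 : ∀ w : M ⊗[ℚ] C, leftCoact M.coact (C ⊗[ℚ] N)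
          (((TensorProduct.mk ℚ C N).flip y).lTensor M w) =
          (((TensorProduct.mk ℚ C N).flip y).lTensor M).lTensor C (leftCoact M.coact C w) := by
        intro w
        exact leftCoact_map M.coact M.coact LinearMap.id (by simp) _ w
      rw [cotensorRight_tmul, h3, rightCoact_leftCoact, leftCoact_tmul,
        ← LinearMap.lTensor_comp_apply, ← LinearMap.lTensor_comp_apply]
      congr 2
      ext m'
      exact cotensorRight_tmul M N m' y
  have h := Module.Flat.eqLocus_lTensor_eq (S := ℚ) (M := C) (f := cotensorLeft M N)
    (g := cotensorRight M N)
  have hmem : leftCoact M.coact N z ∈ LinearMap.eqLocus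
      (TensorProduct.AlgebraTensorModule.lTensor ℚ C (cotensorLeft M N))
      (TensorProduct.AlgebraTensorModule.lTensor ℚ C (cotensorRight M N)) :=
    (h1 z).trans ((congrArg _ hz).trans (h2 z).symm)
  rw [h] at hmem
  exact hmem

/-- The cotensor product `M □_C N` over a cocommutative dg coalgebra, as a left dg comodule with
coaction `m ⊗ n ↦ m₍₀₎ ⊗ (m₍₁₎ ⊗ n)`. -/
def cotensor (M N : DGComod C) : DGComod C :=
  subComod (tensorComod M N) (S := cotensorSub M N) (cotensorSub_isHomogeneous M N)
    (cotensorSub_dTens M N) (cotensorSub_coact M N)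

/-- The inclusion `M □_C N ⊆ M ⊗ N`. -/
def cotensorIncl (M N : DGComod C) : cotensor M N →ₗ[ℚ] M ⊗[ℚ] N := (cotensorSub M N).subtype

theorem cotensorSub_map {M M' N N' : DGComod C} (f : M ⟶ M') (g : N ⟶ N') (z : M ⊗[ℚ] N)
    (hz : z ∈ cotensorSub M N) : TensorProduct.map f.toLin g.toLin z ∈ cotensorSub M' N' := by
  have h1 : ∀ z, cotensorLeft M' N' (TensorProduct.map f.toLin g.toLin z) =
      TensorProduct.map f.toLin (g.toLin.lTensor C) (cotensorLeft M N z) := by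
    intro z
    induction z using TensorProduct.induction_on with
    | zero => simp
    | add x y hx hy => simp only [map_add, hx, hy]
    | tmul m y => simp [cotensorLeft, g.map_coact]
  have h2 : ∀ z, cotensorRight M' N' (TensorProduct.map f.toLin g.toLin z) =
      TensorProduct.map f.toLin (g.toLin.lTensor C) (cotensorRight M N z) := by
    intro z
    induction z using TensorProduct.induction_on with
    | zero => simp
    | add x y hx hy => simp only [map_add, hx, hy]
    | tmul m y =>
      have hr : rightCoact M' (f.toLin m) = f.toLin.rTensor C (rightCoact M m) := by
        rw [rightCoact, LinearMap.comp_apply, f.map_coact]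
        exact swap_map LinearMap.id f.toLin (fun _ _ h => h) f.map_mem _
      rw [TensorProduct.map_tmul, cotensorRight_tmul, cotensorRight_tmul, hr]
      generalize rightCoact M m = w
      induction w using TensorProduct.induction_on with
      | zero => simp
      | add x y hx hy => simp only [map_add, hx, hy]
      | tmul a b => simp
  change cotensorLeft M N z = cotensorRight M N z at hz
  change cotensorLeft M' N' _ = cotensorRight M' N' _
  rw [h1, h2, hz]

/-- The map `f □ g : M □_C N ⟶ M' □_C N'`, the restriction of `f ⊗ g`. -/
def cotensorMap {M M' N N' : DGComod C} (f : M ⟶ M') (g : N ⟶ N') :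
    cotensor M N ⟶ cotensor M' N' where
  toLin := (TensorProduct.map f.toLin g.toLin).restrict (cotensorSub_map f g)
  map_mem n x hx := by
    have := map_mem f.toLin g.toLin 0 0 (by simpa using f.map_mem) (by simpa using g.map_mem) n
      (cotensorIncl M N x) hx
    rw [show n + (0 + 0) = n by ring] at this
    exact this
  map_d x := Subtype.ext (dTens_map f.toDGHom g.toDGHom (cotensorIncl M N x))
  map_coact x := by
    apply lTensor_subtype_injective (tensorComod M' N') (cotensorSub M' N')
    have h1 := lTensor_subCoact (tensorComod M' N') (cotensorSub_coact M' N')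
      (⟨TensorProduct.map f.toLin g.toLin (cotensorIncl M N x),
        cotensorSub_map f g _ x.2⟩ : cotensorSub M' N')
    refine h1.trans ?_
    have h2 := leftCoact_map M.coact M'.coact f.toLin f.map_coact g.toLin (cotensorIncl M N x)
    refine h2.trans ?_
    have h3 : leftCoact M.coact N (cotensorIncl M N x) =
        (cotensorIncl M N).lTensor C ((cotensor M N).coact x) :=
      (lTensor_subCoact (tensorComod M N) (cotensorSub_coact M N) x).symm
    rw [h3, ← LinearMap.lTensor_comp_apply]
    exact LinearMap.lTensor_comp_apply C (cotensorSub M' N').subtype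
      ((TensorProduct.map f.toLin g.toLin).restrict (cotensorSub_map f g)) _

/-- The cotensor product as a bifunctor `C-Comod × C-Comod ⥤ C-Comod`. -/
def cotensorFunctor (C : Type u) [AddCommGroup C] [Module ℚ C] [Coalgebra ℚ C] [DGVect C]
    [GradedCocomm C] : DGComod C × DGComod C ⥤ DGComod C where
  obj P := cotensor P.1 P.2
  map f := cotensorMap f.1 f.2
  map_id P := DGComod.Hom.ext (LinearMap.ext fun x => Subtype.ext
    (congrFun (congrArg DFunLike.coe (TensorProduct.map_id (R := ℚ) (M := P.1) (N := P.2)))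
      (cotensorIncl P.1 P.2 x)))
  map_comp f g := DGComod.Hom.ext (LinearMap.ext fun x => Subtype.ext
    (congrFun (congrArg DFunLike.coe
      (TensorProduct.map_comp g.1.toLin g.2.toLin f.1.toLin f.2.toLin)) (cotensorIncl _ _ x)))

end Cotensor

/-! ### The homotopy category of comodules up to `t`-equivalence -/

section Homotopy

variable (C : Type u) [AddCommGroup C] [Module ℚ C] [Coalgebra ℚ C] [DGVect C] [DGCoalgebra C]

/-- The coalgebra `C` as a left comodule over itself. -/
def regular : DGComod C where
  carrier := C
  coact := Coalgebra.comul
  coact_mem := DGCoalgebra.comul_mem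
  coact_d := DGCoalgebra.comul_d
  coassoc := comul_coassoc
  counit := comul_counit

variable [TwoReduced C]

/-- The functor `t^! : C-Comod ⥤ ΩC-Mod`. -/
abbrev tExt : DGComod C ⥤ DGMod (Cobar C) := ext (univ C)

/-- The functor `t_* : ΩC-Mod ⥤ C-Comod`. -/
abbrev tCoext : DGMod (Cobar C) ⥤ DGComod C := coext (univ C)

/-- The `t`-equivalences: morphisms `f` of comodules such that `t^! f` is a quasi-isomorphism. -/
def tEquiv : MorphismProperty (DGComod C) := fun _ _ f =>
  QuasiIso ((DGMod.underlying (Cobar C)).map ((tExt C).map f))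

/-- The homotopy category `Ho(C-Comod_(t))`: the localization of the category of (unbounded) dg
comodules at the `t`-equivalences. -/
abbrev HoComod : Type (u + 1) := (tEquiv C).Localization

/-- The localization functor `C-Comod ⥤ Ho(C-Comod_(t))`. -/
abbrev toHo : DGComod C ⥤ HoComod C := (tEquiv C).Q

variable [GradedCocomm C]

/-- The bifunctor `(M, N) ↦ t_* t^! M □_C t_* t^! N`. -/
def derivedCotensor : DGComod C × DGComod C ⥤ DGComod C :=
  ((tExt C ⋙ tCoext C).prod (tExt C ⋙ tCoext C)) ⋙ cotensorFunctor C

/-- The canonical map `M □_C N ⟶ t_* t^! M □_C t_* t^! N` induced by the units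
`M ⟶ t_* t^! M` and `N ⟶ t_* t^! N`. -/
def toDerivedCotensor (M N : DGComod C) : cotensor M N ⟶ (derivedCotensor C).obj (M, N) :=
  cotensorMap (unitHom (univ C) M) (unitHom (univ C) N)

variable {C}

open MonoidalCategory in
/-- Given a monoidal structure on the homotopy category whose tensor product is induced by the
derived cotensor product (via `μ`), the canonical map from the cotensor product `M □_C N` to the
tensor product of `M` and `N` in the homotopy category. -/
def laxMap [MonoidalCategory (HoComod C)]
    (μ : (toHo C).prod (toHo C) ⋙ tensor (HoComod C) ≅ derivedCotensor C ⋙ toHo C)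
    (M N : DGComod C) :
    (toHo C).obj (cotensor M N) ⟶ (toHo C).obj M ⊗ (toHo C).obj N :=
  (toHo C).map (toDerivedCotensor C M N) ≫ μ.inv.app (M, N)

end Homotopy

/-! ### Injective resolutions and the cotorsion functors -/

section Cotor

variable {C : Type u} [AddCommGroup C] [Module ℚ C] [Coalgebra ℚ C] [DGVect C]

/-- A cochain complex `X⁰ → X¹ → X² → ⋯` of dg comodules. -/
structure ComodComplex (C : Type u) [AddCommGroup C] [Module ℚ C] [Coalgebra ℚ C] [DGVect C] :
    Type (u + 1) where
  X : ℕ → DGComod C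
  δ : ∀ n, X n ⟶ X (n + 1)
  δ_δ : ∀ n (x : X n), (δ (n + 1)).toLin ((δ n).toLin x) = 0

/-- A morphism of cochain complexes of dg comodules. -/
structure ComodComplex.Hom (A B : ComodComplex C) where
  f : ∀ n, A.X n ⟶ B.X n
  comm : ∀ n (x : A.X n), (f (n + 1)).toLin ((A.δ n).toLin x) = (B.δ n).toLin ((f n).toLin x)

/-- The identity morphism. -/
def ComodComplex.Hom.id (A : ComodComplex C) : ComodComplex.Hom A A where
  f n := 𝟙 (A.X n)
  comm _ _ := rfl

/-- The zero comodule. -/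
def zeroComod (C : Type u) [AddCommGroup C] [Module ℚ C] [Coalgebra ℚ C] [DGVect C] :
    DGComod C where
  carrier := PUnit
  dgVect :=
    { piece := fun _ => ⊤
      isInternal := isInternal_of_split _ 0 (fun _ _ _ => Subsingleton.elim _ _)
        (Subsingleton.elim _ _)
      d := 0
      d_mem := fun _ _ _ => trivial
      d_d := fun _ => rfl }
  coact := 0
  coact_mem _ _ _ := Submodule.zero_mem _
  coact_d _ := by simp
  coassoc _ := by simp
  counit _ := Subsingleton.elim _ _

/-- The zero morphism between two comodules. -/
def zeroHom (M N : DGComod C) : M ⟶ N where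
  toLin := 0
  map_mem _ _ _ := Submodule.zero_mem _
  map_d _ := by simp
  map_coact _ := by simp

/-- A comodule as a complex concentrated in cohomological degree zero. -/
def ComodComplex.single (M : DGComod C) : ComodComplex C where
  X n := match n with
    | 0 => M
    | _ + 1 => zeroComod C
  δ _ := zeroHom _ _
  δ_δ _ _ := rfl

/-- A dg comodule `A` is (relatively) injective if the coaction `A → C ⊗ A` into the cofree
comodule admits a retraction in the category of dg comodules, i.e. if `A` is a direct summand of
a cofree dg comodule. -/
def IsInjective [DGCoalgebra C] (A : DGComod C) : Prop :=
  ∃ r : cofree C A ⟶ A, ∀ a : A, r.toLin (A.coact a) = a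

/-- An injective resolution `0 → M → A⁰ → A¹ → ⋯` of a comodule by connective injective
comodules. As usual in relative homological algebra, exactness means that the sequence of
underlying complexes of vector spaces is split exact (equivalently, applying `Hom(-, I)` gives
an exact sequence for every injective `I`). -/
structure InjRes [DGCoalgebra C] (M : DGComod C) where
  cx : ComodComplex C
  ι : M ⟶ cx.X 0
  ι_δ : ∀ x : M, (cx.δ 0).toLin (ι.toLin x) = 0
  connective : ∀ n, (cx.X n).IsConnective
  injective : ∀ n, IsInjective (cx.X n)
  split : ∃ (h₀ : DGHom (cx.X 0) M) (h : ∀ n, DGHom (cx.X (n + 1)) (cx.X n)),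
    (∀ x : M, h₀.toLin (ι.toLin x) = x) ∧
    (∀ x : cx.X 0, ι.toLin (h₀.toLin x) + (h 0).toLin ((cx.δ 0).toLin x) = x) ∧
    (∀ n, ∀ x : cx.X (n + 1),
      (cx.δ n).toLin ((h n).toLin x) + (h (n + 1)).toLin ((cx.δ (n + 1)).toLin x) = x)

/-- The augmentation of an injective resolution, as a morphism of complexes from `M`
concentrated in degree zero. -/
def InjRes.aug [DGCoalgebra C] {M : DGComod C} (R : InjRes M) :
    ComodComplex.Hom (ComodComplex.single M) R.cx where
  f n := match n with
    | 0 => R.ι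
    | _ + 1 => zeroHom _ _
  comm n x := match n with
    | 0 => (R.ι_δ x).symm
    | _ + 1 => (map_zero _).symm

variable [GradedCocomm C]

/-- The ambient space `∏_{i,j} Aⁱ □_C Bʲ` of the product total complex. -/
abbrev TotSpace (A B : ComodComplex C) : Type u := ∀ i j : ℕ, cotensor (A.X i) (B.X j)

/-- The component in `Aⁱ □_C Bʲ` of the differential of `A`. -/
def totHor (A B : ComodComplex C) : ∀ i j : ℕ, TotSpace A B →ₗ[ℚ] cotensor (A.X i) (B.X j)
  | 0, _ => 0
  | i + 1, j => (cotensorMap (A.δ i) (𝟙 (B.X j))).toLin ∘ₗ LinearMap.proj j ∘ₗ LinearMap.proj i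

/-- The component in `Aⁱ □_C Bʲ` of the differential of `B`. -/
def totVer (A B : ComodComplex C) : ∀ i j : ℕ, TotSpace A B →ₗ[ℚ] cotensor (A.X i) (B.X j)
  | _, 0 => 0
  | i, j + 1 => (cotensorMap (𝟙 (A.X i)) (B.δ j)).toLin ∘ₗ LinearMap.proj j ∘ₗ LinearMap.proj i

/-- The total differential, `(Dx)_{ij} = δ_A x_{i-1,j} + (-1)^i δ_B x_{i,j-1} +
(-1)^{i+j} d x_{ij}`. -/
def totD (A B : ComodComplex C) : TotSpace A B →ₗ[ℚ] TotSpace A B :=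
  LinearMap.pi fun i => LinearMap.pi fun j =>
    totHor A B i j + (-1 : ℚ) ^ i • totVer A B i j +
      (-1 : ℚ) ^ (i + j) • (dif (cotensor (A.X i) (B.X j)) ∘ₗ LinearMap.proj j ∘ₗ LinearMap.proj i)

/-- The part of total degree `k`: families of elements `x_{ij}` of `Aⁱ □_C Bʲ` of internal degree
`k + i + j` (cohomological degrees count negatively). -/
def totPiece (A B : ComodComplex C) (k : ℤ) : Submodule ℚ (TotSpace A B) where
  carrier := {x | ∀ i j : ℕ, x i j ∈ gr (cotensor (A.X i) (B.X j)) (k + i + j)}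
  add_mem' hx hy i j := Submodule.add_mem _ (hx i j) (hy i j)
  zero_mem' _ _ := Submodule.zero_mem _
  smul_mem' a _ hx i j := Submodule.smul_mem _ a (hx i j)

theorem totD_mem (A B : ComodComplex C) (k : ℤ) (x : TotSpace A B) (hx : x ∈ totPiece A B k) :
    totD A B x ∈ totPiece A B (k - 1) := by
  intro i j
  refine Submodule.add_mem _ (Submodule.add_mem _ ?_ (Submodule.smul_mem _ _ ?_))
    (Submodule.smul_mem _ _ ?_)
  · cases i with
    | zero => exact Submodule.zero_mem _
    | succ i =>
      have := (cotensorMap (A.δ i) (𝟙 (B.X j))).map_mem _ _ (hx i j)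
      rw [show k + i + j = k - 1 + (i + 1 : ℕ) + j by push_cast; ring] at this
      exact this
  · cases j with
    | zero => cases i <;> exact Submodule.zero_mem _
    | succ j =>
      have := (cotensorMap (𝟙 (A.X i)) (B.δ j)).map_mem _ _ (hx i j)
      rw [show k + i + j = k - 1 + i + (j + 1 : ℕ) by push_cast; ring] at this
      cases i <;> exact this
  · have := DGVect.d_mem _ _ (hx i j)
    rw [show k + i + j - 1 = k - 1 + i + j by ring] at this
    exact this

end Cotor

section Cotor

variable {C : Type u} [AddCommGroup C] [Module ℚ C] [Coalgebra ℚ C] [DGVect C] [GradedCocomm C]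

theorem cotensorMap_comp_zero {M M' M'' N N' N'' : DGComod C} (f : M ⟶ M') (f' : M' ⟶ M'')
    (g : N ⟶ N') (g' : N' ⟶ N'')
    (h : (∀ x, f'.toLin (f.toLin x) = 0) ∨ (∀ x, g'.toLin (g.toLin x) = 0))
    (z : cotensor M N) :
    (cotensorMap f' g').toLin ((cotensorMap f g).toLin z) = 0 := by
  apply Subtype.ext
  have key : ∀ w : M ⊗[ℚ] N,
      TensorProduct.map f'.toLin g'.toLin (TensorProduct.map f.toLin g.toLin w) = 0 := by
    intro w
    rw [← LinearMap.comp_apply, ← TensorProduct.map_comp]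
    rcases h with h | h
    · rw [show f'.toLin ∘ₗ f.toLin = 0 from LinearMap.ext h, TensorProduct.map_zero_left]; rfl
    · rw [show g'.toLin ∘ₗ g.toLin = 0 from LinearMap.ext h, TensorProduct.map_zero_right]; rfl
  exact key (cotensorIncl M N z)

theorem cotensorMap_interchange {M M' N N' : DGComod C} (f : M ⟶ M') (g : N ⟶ N')
    (z : cotensor M N) :
    (cotensorMap f (𝟙 N')).toLin ((cotensorMap (𝟙 M) g).toLin z) =
      (cotensorMap (𝟙 M') g).toLin ((cotensorMap f (𝟙 N)).toLin z) := by
  apply Subtype.ext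
  have key : ∀ w : M ⊗[ℚ] N,
      TensorProduct.map f.toLin LinearMap.id (TensorProduct.map LinearMap.id g.toLin w) =
        TensorProduct.map LinearMap.id g.toLin (TensorProduct.map f.toLin LinearMap.id w) := by
    intro w
    rw [← LinearMap.comp_apply, ← TensorProduct.map_comp, ← LinearMap.comp_apply,
      ← TensorProduct.map_comp]
    rfl
  exact key (cotensorIncl M N z)

theorem totD_apply (A B : ComodComplex C) (x : TotSpace A B) (i j : ℕ) :
    totD A B x i j = totHor A B i j x + (-1 : ℚ) ^ i • totVer A B i j x +
      (-1 : ℚ) ^ (i + j) • dif (cotensor (A.X i) (B.X j)) (x i j) := rfl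

@[simp] theorem totHor_zero (A B : ComodComplex C) (j : ℕ) (x : TotSpace A B) :
    totHor A B 0 j x = 0 := rfl

@[simp] theorem totVer_zero (A B : ComodComplex C) (i : ℕ) (x : TotSpace A B) :
    totVer A B i 0 x = 0 := by cases i <;> rfl

theorem totHor_succ (A B : ComodComplex C) (i j : ℕ) (x : TotSpace A B) :
    totHor A B (i + 1) j x = (cotensorMap (A.δ i) (𝟙 (B.X j))).toLin (x i j) := rfl

theorem totVer_succ (A B : ComodComplex C) (i j : ℕ) (x : TotSpace A B) :
    totVer A B i (j + 1) x = (cotensorMap (𝟙 (A.X i)) (B.δ j)).toLin (x i j) := by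
  cases i <;> rfl

theorem totHor_totHor (A B : ComodComplex C) (x : TotSpace A B) (i j : ℕ) :
    totHor A B i j (fun i j => totHor A B i j x) = 0 := by
  match i with
  | 0 => rfl
  | 1 => rw [totHor_succ, totHor_zero, map_zero]
  | i + 2 =>
    rw [totHor_succ, totHor_succ]
    exact cotensorMap_comp_zero _ _ _ _ (Or.inl (A.δ_δ i)) _

theorem totVer_totVer (A B : ComodComplex C) (x : TotSpace A B) (i j : ℕ) :
    totVer A B i j (fun i j => totVer A B i j x) = 0 := by
  match j with
  | 0 => rw [totVer_zero]
  | 1 => rw [totVer_succ, totVer_zero, map_zero]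
  | j + 2 =>
    rw [totVer_succ, totVer_succ]
    exact cotensorMap_comp_zero _ _ _ _ (Or.inr (B.δ_δ j)) _

theorem totD_totD (A B : ComodComplex C) (x : TotSpace A B) : totD A B (totD A B x) = 0 := by
  have hsq : ∀ n : ℕ, (-1 : ℚ) ^ n * (-1) ^ n = 1 := fun n => by
    rw [← mul_pow]; norm_num
  have hx : totD A B x = (fun i j => totHor A B i j x) +
      (fun i j => (-1 : ℚ) ^ i • totVer A B i j x) +
      (fun i j => (-1 : ℚ) ^ (i + j) • dif (cotensor (A.X i) (B.X j)) (x i j)) := rfl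
  have hH : ∀ i j, totHor A B i j (totD A B x) =
      (-1 : ℚ) • ((-1 : ℚ) ^ i • totVer A B i j (fun i j => totHor A B i j x)) +
      (-1 : ℚ) • ((-1 : ℚ) ^ (i + j) • dif (cotensor (A.X i) (B.X j)) (totHor A B i j x)) := by
    intro i j
    rw [hx, map_add, map_add, totHor_totHor, zero_add]
    congr 1
    · match i, j with
      | 0, 0 => simp
      | 0, j + 1 =>
        rw [totVer_succ]; simp
      | i + 1, 0 => rw [totHor_succ]; simp
      | i + 1, j + 1 =>
        rw [totHor_succ, totVer_succ, totVer_succ, totHor_succ, map_smul,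
          cotensorMap_interchange, smul_smul, pow_succ]
        congr 1; ring
    · match i with
      | 0 => simp
      | i + 1 =>
        rw [totHor_succ, totHor_succ, map_smul,
          (cotensorMap (A.δ i) (𝟙 (B.X j))).map_d, smul_smul]
        congr 1; ring
  have hV : ∀ i j, totVer A B i j (totD A B x) =
      totVer A B i j (fun i j => totHor A B i j x) +
      (-1 : ℚ) • ((-1 : ℚ) ^ (i + j) • dif (cotensor (A.X i) (B.X j)) (totVer A B i j x)) := by
    intro i j
    have h0 : totVer A B i j (fun i j => (-1 : ℚ) ^ i • totVer A B i j x) = 0 := by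
      have := totVer_totVer A B x i j
      match j with
      | 0 => rw [totVer_zero]
      | j + 1 =>
        rw [totVer_succ] at this ⊢
        rw [map_smul, this, smul_zero]
    rw [hx, map_add, map_add, h0, add_zero]
    congr 1
    match j with
    | 0 => simp
    | j + 1 =>
      rw [totVer_succ, totVer_succ, map_smul,
        (cotensorMap (𝟙 (A.X i)) (B.δ j)).map_d, smul_smul]
      congr 1; ring
  funext i j
  rw [totD_apply, hH, hV, totD_apply]
  simp only [map_add, map_smul, dif_dif, smul_zero, add_zero, smul_add]
  have h1 : ∀ y : cotensor (A.X i) (B.X j),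
      (-1 : ℚ) ^ (i + j) • (-1 : ℚ) ^ i • y = (-1 : ℚ) ^ i • (-1 : ℚ) ^ (i + j) • y :=
    fun y => smul_comm _ _ y
  rw [h1]
  simp only [neg_smul, one_smul, smul_neg]
  change _ = (0 : cotensor (A.X i) (B.X j))
  abel

/-- The product total complex `Tot^∏ (A □_C B)`, in homological grading. -/
def totComplex (A B : ComodComplex C) : ChainComplex (ModuleCat.{u} ℚ) ℤ :=
  complexOf (totPiece A B) (totD A B) (totD_mem A B) (totD_totD A B)

/-- The linear map `∏ φⁱ □ ψʲ`. -/
def totMapLin {A A' B B' : ComodComplex C} (φ : ComodComplex.Hom A A')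
    (ψ : ComodComplex.Hom B B') : TotSpace A B →ₗ[ℚ] TotSpace A' B' :=
  LinearMap.pi fun i => LinearMap.pi fun j =>
    (cotensorMap (φ.f i) (ψ.f j)).toLin ∘ₗ LinearMap.proj j ∘ₗ LinearMap.proj i

theorem cotensorMap_square {M N M₁ N₁ M₂ N₂ M₃ N₃ : DGComod C}
    (f : M ⟶ M₁) (f' : M₁ ⟶ M₃) (g : M ⟶ M₂) (g' : M₂ ⟶ M₃)
    (h : N ⟶ N₁) (h' : N₁ ⟶ N₃) (k : N ⟶ N₂) (k' : N₂ ⟶ N₃)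
    (hfg : ∀ x, f'.toLin (f.toLin x) = g'.toLin (g.toLin x))
    (hhk : ∀ x, h'.toLin (h.toLin x) = k'.toLin (k.toLin x)) (z : cotensor M N) :
    (cotensorMap f' h').toLin ((cotensorMap f h).toLin z) =
      (cotensorMap g' k').toLin ((cotensorMap g k).toLin z) := by
  apply Subtype.ext
  have key : ∀ w : M ⊗[ℚ] N,
      TensorProduct.map f'.toLin h'.toLin (TensorProduct.map f.toLin h.toLin w) =
        TensorProduct.map g'.toLin k'.toLin (TensorProduct.map g.toLin k.toLin w) := by
    intro w
    rw [← LinearMap.comp_apply, ← TensorProduct.map_comp, ← LinearMap.comp_apply,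
      ← TensorProduct.map_comp, show f'.toLin ∘ₗ f.toLin = g'.toLin ∘ₗ g.toLin from
        LinearMap.ext hfg, show h'.toLin ∘ₗ h.toLin = k'.toLin ∘ₗ k.toLin from LinearMap.ext hhk]
  exact key (cotensorIncl M N z)

theorem totMapLin_totD {A A' B B' : ComodComplex C} (φ : ComodComplex.Hom A A')
    (ψ : ComodComplex.Hom B B') (x : TotSpace A B) :
    totMapLin φ ψ (totD A B x) = totD A' B' (totMapLin φ ψ x) := by
  funext i j
  rw [totD_apply]
  change (cotensorMap (φ.f i) (ψ.f j)).toLin (totD A B x i j) = _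
  rw [totD_apply, map_add, map_add, map_smul, map_smul,
    (cotensorMap (φ.f i) (ψ.f j)).map_d]
  congr 1
  congr 1
  · match i with
    | 0 => simp
    | i + 1 =>
      rw [totHor_succ, totHor_succ]
      exact cotensorMap_square (A.δ i) (φ.f (i + 1)) (φ.f i) (A'.δ i) (𝟙 (B.X j)) (ψ.f j) (ψ.f j)
        (𝟙 (B'.X j)) (fun x => φ.comm i x) (fun _ => rfl) (x i j)
  · congr 1
    match j with
    | 0 => simp
    | j + 1 =>
      rw [totVer_succ, totVer_succ]
      exact cotensorMap_square (𝟙 (A.X i)) (φ.f i) (φ.f i) (𝟙 (A'.X i)) (B.δ j) (ψ.f (j + 1))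
        (ψ.f j) (B'.δ j) (fun _ => rfl) (fun x => ψ.comm j x) (x i j)

/-- The map `Tot^∏ (A □_C B) ⟶ Tot^∏ (A' □_C B')` induced by morphisms of complexes. -/
def totMap {A A' B B' : ComodComplex C} (φ : ComodComplex.Hom A A')
    (ψ : ComodComplex.Hom B B') : totComplex A B ⟶ totComplex A' B' :=
  complexMap (totMapLin φ ψ)
    (fun _ _ hx i j => (cotensorMap (φ.f i) (ψ.f j)).map_mem _ _ (hx i j))
    (totMapLin_totD φ ψ)

/-- The cotorsion groups `Cotor^C_k(M, N) = H_k(Tot^∏ (A_• □_C B_•))` computed by injective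
resolutions `M → A_•` and `N → B_•`. -/
def Cotor [DGCoalgebra C] {M N : DGComod C} (R : InjRes M) (S : InjRes N) (k : ℤ) :
    ModuleCat.{u} ℚ :=
  (totComplex R.cx S.cx).homology k

/-- The map of cotorsion groups induced by morphisms of resolutions. -/
def Cotor.map [DGCoalgebra C] {M M' N N' : DGComod C} {R : InjRes M} {R' : InjRes M'}
    {S : InjRes N} {S' : InjRes N'} (F : ComodComplex.Hom R.cx R'.cx)
    (G : ComodComplex.Hom S.cx S'.cx) (k : ℤ) : Cotor R S k ⟶ Cotor R' S' k :=
  HomologicalComplex.homologyMap (totMap F G) k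

/-- A morphism of resolutions lying over a morphism `f` of comodules. -/
def InjRes.LiesOver [DGCoalgebra C] {M M' : DGComod C} {R : InjRes M} {R' : InjRes M'}
    (F : ComodComplex.Hom R.cx R'.cx) (f : M ⟶ M') : Prop :=
  ∀ x : M, (F.f 0).toLin (R.ι.toLin x) = R'.ι.toLin (f.toLin x)

end Cotor

/-- The graded homology `H_k` of a dg comodule, as a functor. -/
def DGComod.homology (C : Type u) [AddCommGroup C] [Module ℚ C] [Coalgebra ℚ C] [DGVect C]
    (k : ℤ) : DGComod C ⥤ ModuleCat.{u} ℚ :=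
  DGComod.underlying C ⋙ HomologicalComplex.homologyFunctor _ _ k

end

end DGKoszul

open DGKoszul MonoidalCategory

set_option linter.unusedSectionVars false

namespace DGKoszul

noncomputable section

/-! ### An elementwise criterion for quasi-isomorphisms -/

/-- Cycles and homology classes of a short complex of modules, in terms of elements. -/
theorem moduleCatLeftHomologyData_elements (S : ShortComplex (ModuleCat.{v} ℚ)) :
    (∀ k, S.g (S.moduleCatLeftHomologyData.i k) = 0) ∧
    (∀ x, S.g x = 0 → ∃ k, S.moduleCatLeftHomologyData.i k = x) ∧
    Function.Surjective S.moduleCatLeftHomologyData.π ∧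
    (∀ k, S.moduleCatLeftHomologyData.π k = 0 ↔
      ∃ y, S.f y = S.moduleCatLeftHomologyData.i k) := by
  refine ⟨fun k => ?_, fun x hx => ⟨(⟨x, hx⟩ : LinearMap.ker S.g.hom), rfl⟩,
    Submodule.mkQ_surjective _, fun k => (Submodule.Quotient.mk_eq_zero _).trans ⟨?_, ?_⟩⟩
  · exact (k : LinearMap.ker S.g.hom).2
  · rintro ⟨y, hy⟩; exact ⟨y, congrArg Subtype.val hy⟩
  · rintro ⟨y, hy⟩; exact ⟨y, Subtype.ext hy⟩

/-- Quasi-isomorphisms of short complexes of modules in terms of elements. -/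
theorem shortComplex_quasiIso_iff {S₁ S₂ : ShortComplex (ModuleCat.{v} ℚ)} (φ : S₁ ⟶ S₂) :
    ShortComplex.QuasiIso φ ↔
      (∀ x : S₁.X₂, S₁.g x = 0 → ∀ y : S₂.X₁, S₂.f y = φ.τ₂ x → ∃ x', S₁.f x' = x) ∧
      (∀ y : S₂.X₂, S₂.g y = 0 → ∃ x, S₁.g x = 0 ∧ ∃ z, y = φ.τ₂ x + S₂.f z) := by
  obtain ⟨hg₁, hk₁, hs₁, hz₁⟩ := moduleCatLeftHomologyData_elements S₁
  obtain ⟨-, hk₂, hs₂, hz₂⟩ := moduleCatLeftHomologyData_elements S₂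
  let γ : ShortComplex.LeftHomologyMapData φ S₁.moduleCatLeftHomologyData
      S₂.moduleCatLeftHomologyData := default
  have hi : ∀ x, S₂.moduleCatLeftHomologyData.i (γ.φK x) =
      φ.τ₂ (S₁.moduleCatLeftHomologyData.i x) := fun x =>
    congrArg (fun h => h.hom x) γ.commi
  have hπ : ∀ x, γ.φH (S₁.moduleCatLeftHomologyData.π x) =
      S₂.moduleCatLeftHomologyData.π (γ.φK x) := fun x =>
    congrArg (fun h => h.hom x) γ.commπ.symm
  rw [γ.quasiIso_iff, ConcreteCategory.isIso_iff_bijective]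
  generalize S₁.moduleCatLeftHomologyData = h₁ at *
  generalize S₂.moduleCatLeftHomologyData = h₂ at *
  refine and_congr ⟨fun h x hx y hy => ?_, fun h => ?_⟩ ⟨fun h y hy => ?_, fun h => ?_⟩
  · obtain ⟨k, rfl⟩ := hk₁ x hx
    refine (hz₁ k).1 (h ?_)
    rw [hπ, map_zero, hz₂, hi]
    exact ⟨y, hy⟩
  · refine (injective_iff_map_eq_zero γ.φH.hom).2 fun a ha => ?_
    obtain ⟨k, rfl⟩ := hs₁ a
    obtain ⟨y, hy⟩ := (hz₂ _).1 ((hπ k).symm.trans ha)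
    rw [hi] at hy
    exact (hz₁ k).2 (h _ (hg₁ k) y hy)
  · obtain ⟨l, rfl⟩ := hk₂ y hy
    obtain ⟨a, ha⟩ := h (h₂.π l)
    obtain ⟨k, rfl⟩ := hs₁ a
    rw [hπ] at ha
    have : h₂.π (l - γ.φK k) = 0 := by rw [map_sub, ha, sub_self]
    obtain ⟨z, hz⟩ := (hz₂ _).1 this
    refine ⟨h₁.i k, hg₁ k, z, ?_⟩
    rw [hz, map_sub, hi, add_sub_cancel]
  · intro b
    obtain ⟨l, rfl⟩ := hs₂ b
    obtain ⟨x, hx, z, hz⟩ := h (h₂.i l) (by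
      rw [← ModuleCat.comp_apply, h₂.wi]; rfl)
    obtain ⟨k, rfl⟩ := hk₁ x hx
    refine ⟨h₁.π k, ?_⟩
    rw [hπ, ← sub_eq_zero, ← map_sub, hz₂]
    refine ⟨-z, ?_⟩
    rw [map_sub, hi, hz, map_neg]
    abel

section ComplexOf

variable {V : Type v} [AddCommGroup V] [Module ℚ V] (P : ℤ → Submodule ℚ V) (D : V →ₗ[ℚ] V)
  {V' : Type v} [AddCommGroup V'] [Module ℚ V'] (P' : ℤ → Submodule ℚ V') (D' : V' →ₗ[ℚ] V')

/-- Exactness of the mapping cone of `f`, in terms of homogeneous elements. -/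
def ConeExact (f : V →ₗ[ℚ] V') : Prop :=
  ∀ k, ∀ x ∈ P k, ∀ y ∈ P' (k + 1), D x = 0 → f x = D' y →
    ∃ x' ∈ P (k + 1), ∃ y' ∈ P' (k + 1 + 1), D x' = x ∧ y = f x' + D' y'

variable {P D P' D'}

/-- A map of complexes is a quasi-isomorphism if and only if its cone is exact. -/
theorem quasiIso_complexMap_iff {hP : ∀ n, ∀ x ∈ P n, D x ∈ P (n - 1)} {hD : ∀ x, D (D x) = 0}
    {hP' : ∀ n, ∀ x ∈ P' n, D' x ∈ P' (n - 1)} {hD' : ∀ x, D' (D' x) = 0}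
    (f : V →ₗ[ℚ] V') (hf : ∀ n, ∀ x ∈ P n, f x ∈ P' n) (hfD : ∀ x, f (D x) = D' (f x)) :
    QuasiIso (complexMap (hP := hP) (hD := hD) (hP' := hP') (hD' := hD') f hf hfD) ↔
      ConeExact P D P' D' f := by
  have hX : ∀ (k : ℤ) (x : V), x ∈ P (k + 1) → D x ∈ P k := fun k x hx => by
    have := hP _ _ hx; rwa [add_sub_cancel_right] at this
  have hX' : ∀ (k : ℤ) (x : V'), x ∈ P' (k + 1) → D' x ∈ P' k := fun k x hx => by
    have := hP' _ _ hx; rwa [add_sub_cancel_right] at this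
  have key : ∀ k : ℤ, QuasiIsoAt (complexMap (hP := hP) (hD := hD) (hP' := hP') (hD' := hD')
      f hf hfD) k ↔
      (∀ x ∈ P k, D x = 0 → ∀ y ∈ P' (k + 1), D' y = f x → ∃ x' ∈ P (k + 1), D x' = x) ∧
      (∀ y ∈ P' k, D' y = 0 → ∃ x ∈ P k, D x = 0 ∧ ∃ z ∈ P' (k + 1), y = f x + D' z) := by
    intro k
    rw [quasiIsoAt_iff' _ (k + 1) k (k - 1) (by simp) (by simp), shortComplex_quasiIso_iff]
    have d₁ : ∀ x : P k, ((complexOf P D hP hD).d k (k - 1) x : P (k - 1)).1 = D x := fun x => by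
      simp [complexOf]; rfl
    have d₂ : ∀ x : P (k + 1), ((complexOf P D hP hD).d (k + 1) k x : P k).1 = D x := fun x => by
      simp [complexOf]; rfl
    have d₁' : ∀ x : P' k, ((complexOf P' D' hP' hD').d k (k - 1) x : P' (k - 1)).1 = D' x :=
      fun x => by simp [complexOf]; rfl
    have d₂' : ∀ x : P' (k + 1), ((complexOf P' D' hP' hD').d (k + 1) k x : P' k).1 = D' x :=
      fun x => by simp [complexOf]; rfl
    refine and_congr ⟨fun h x hx hdx y hy hyx => ?_, fun h x hx y hy => ?_⟩
      ⟨fun h y hy hdy => ?_, fun h y hy => ?_⟩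
    · obtain ⟨x', hx'⟩ := h (⟨x, hx⟩ : P k) (Subtype.ext ((d₁ ⟨x, hx⟩).trans hdx))
        (⟨y, hy⟩ : P' (k + 1)) (Subtype.ext ((d₂' ⟨y, hy⟩).trans hyx))
      exact ⟨(x' : P (k + 1)).1, (x' : P (k + 1)).2, (d₂ x').symm.trans (congrArg Subtype.val hx')⟩
    · obtain ⟨x', h1, h2⟩ := h (x : P k).1 (x : P k).2
        ((d₁ x).symm.trans (congrArg Subtype.val hx)) (y : P' (k + 1)).1 (y : P' (k + 1)).2
        ((d₂' y).symm.trans (congrArg Subtype.val hy))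
      exact ⟨(⟨x', h1⟩ : P (k + 1)), Subtype.ext ((d₂ ⟨x', h1⟩).trans h2)⟩
    · obtain ⟨x, hx, z, hz⟩ := h (⟨y, hy⟩ : P' k) (Subtype.ext ((d₁' ⟨y, hy⟩).trans hdy))
      refine ⟨(x : P k).1, (x : P k).2, (d₁ x).symm.trans (congrArg Subtype.val hx),
        (z : P' (k + 1)).1, (z : P' (k + 1)).2, ?_⟩
      refine (congrArg Subtype.val hz).trans ?_
      exact congrArg (fun t => f (x : P k).1 + t) (d₂' z)
    · obtain ⟨x, hx, hdx, z, hz, hyz⟩ := h (y : P' k).1 (y : P' k).2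
        ((d₁' y).symm.trans (congrArg Subtype.val hy))
      refine ⟨(⟨x, hx⟩ : P k), Subtype.ext ((d₁ ⟨x, hx⟩).trans hdx), (⟨z, hz⟩ : P' (k + 1)),
        Subtype.ext ?_⟩
      exact hyz.trans (congrArg (fun t => f x + t) (d₂' ⟨z, hz⟩).symm)
  constructor
  · intro h k x hx y hy hdx hxy
    obtain ⟨x₁, hx₁, hdx₁⟩ := ((key k).1 (h.quasiIsoAt k)).1 x hx hdx y hy hxy.symm
    obtain ⟨x₂, hx₂, hdx₂, z, hz, hyz⟩ := ((key (k + 1)).1 (h.quasiIsoAt (k + 1))).2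
      (y - f x₁) (Submodule.sub_mem _ hy (hf _ _ hx₁)) (by
        rw [map_sub, ← hfD, hdx₁, hxy, sub_self])
    refine ⟨x₁ + x₂, Submodule.add_mem _ hx₁ hx₂, z, hz, by rw [map_add, hdx₁, hdx₂, add_zero], ?_⟩
    rw [map_add, add_assoc, ← hyz]; abel
  · intro h
    refine ⟨fun k => (key k).2 ⟨fun x hx hdx y hy hyx => ?_, fun y hy hdy => ?_⟩⟩
    · obtain ⟨x', hx', _, _, h1, _⟩ := h k x hx y hy hdx hyx.symm
      exact ⟨x', hx', h1⟩
    · obtain ⟨x', hx', y', hy', h1, h2⟩ := h (k - 1) 0 (Submodule.zero_mem _) y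
        (by rwa [sub_add_cancel]) (map_zero _) (by rw [hdy, map_zero])
      rw [sub_add_cancel] at hx' hy'
      exact ⟨x', hx', h1, y', hy', h2⟩

end ComplexOf

section DG

variable {V W : Type u} [AddCommGroup V] [Module ℚ V] [DGVect V]
  [AddCommGroup W] [Module ℚ W] [DGVect W]

theorem comps_dif (x : V) (n : ℤ) : comps (dif V x) n = dif V (comps x (n + 1)) := by
  refine gr_induction (p := fun x => comps (dif V x) n = dif V (comps x (n + 1))) x
    (fun m x hx => ?_) (fun x y hx hy => by simp [hx, hy])
  rw [comps_of_mem hx, comps_of_mem (DGVect.d_mem m x hx), Finsupp.single_apply,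
    Finsupp.single_apply]
  by_cases h : m = n + 1
  · rw [if_pos h, if_pos (by omega)]
  · rw [if_neg h, if_neg (by omega), map_zero]

/-- A chain map is a quasi-isomorphism if and only if its cone is exact, in terms of arbitrary
elements. -/
theorem quasiIso_iff_forall (f : DGHom V W) : QuasiIso f.complexMap ↔
    ∀ (x : V) (y : W), dif V x = 0 → f.toLin x = dif W y →
      ∃ x' y', dif V x' = x ∧ y = f.toLin x' + dif W y' := by
  refine (quasiIso_complexMap_iff f.toLin f.map_mem f.map_d).trans ⟨fun h x y hx hxy => ?_,
    fun h k x hx y hy hdx hxy => ?_⟩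
  · have h' : ∀ n : ℤ, ∃ x' : V, ∃ y' : W, dif V x' = comps x n ∧
        comps y (n + 1) = f.toLin x' + dif W y' := by
      intro n
      obtain ⟨x', _, y', _, h1, h2⟩ := h n (comps x n) (comps_apply_mem x n)
        (comps y (n + 1)) (comps_apply_mem y _) (by
          rw [← sub_add_cancel n 1, ← comps_dif, hx]; simp) (by
          rw [← comps_map f.toLin f.map_mem, hxy, comps_dif])
      exact ⟨x', y', h1, h2⟩
    choose a b ha hb using h'
    let S : Finset ℤ := (comps x).support ∪ (comps y).support.image (fun n => n - 1)
    have hSx : ∑ n ∈ S, comps x n = x := by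
      conv_rhs => rw [← sum_comps x]
      refine (Finset.sum_subset Finset.subset_union_left fun n _ hn => ?_).symm
      simpa using hn
    have hSy : ∑ n ∈ S, comps y (n + 1) = y := by
      conv_rhs => rw [← sum_comps y]
      have h1 : (comps y).sum (fun _ y => y) =
          ∑ n ∈ (comps y).support.image (fun n => n - 1), comps y (n + 1) := by
        rw [Finset.sum_image (fun a _ b _ h => by simpa using h)]
        simp [Finsupp.sum]
      rw [h1]
      refine (Finset.sum_subset Finset.subset_union_right fun n _ hn => ?_).symm
      by_contra h2
      exact hn (Finset.mem_image.2 ⟨n + 1, by simpa using h2, by ring⟩)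
    refine ⟨∑ n ∈ S, a n, ∑ n ∈ S, b n, ?_, ?_⟩
    · rw [map_sum, ← Finset.sum_congr rfl fun n _ => (ha n).symm, hSx]
    · rw [map_sum, map_sum, ← Finset.sum_add_distrib, ← Finset.sum_congr rfl fun n _ => hb n, hSy]
  · obtain ⟨x', y', h1, h2⟩ := h x y hdx hxy
    refine ⟨comps x' (k + 1), comps_apply_mem _ _, comps y' (k + 1 + 1), comps_apply_mem _ _, ?_, ?_⟩
    · rw [← comps_dif, h1, comps_of_mem hx, Finsupp.single_eq_same]
    · rw [← comps_dif, ← comps_map f.toLin f.map_mem, ← Finsupp.add_apply, ← map_add, ← h2,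
        comps_of_mem hy, Finsupp.single_eq_same]

end DG

/-! ### Quasi-isomorphisms and tensor products -/

/-- Exactness of the mapping cone of `f : (V, d) → (W, d')`, in terms of elements. -/
def QI {V : Type u} [AddCommGroup V] [Module ℚ V] {W : Type v} [AddCommGroup W] [Module ℚ W]
    (d : V →ₗ[ℚ] V) (d' : W →ₗ[ℚ] W) (f : V →ₗ[ℚ] W) : Prop :=
  ∀ (x : V) (y : W), d x = 0 → f x = d' y → ∃ x' y', d x' = x ∧ y = f x' + d' y'

theorem quasiIso_iff_QI {V W : Type u} [AddCommGroup V] [Module ℚ V] [DGVect V]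
    [AddCommGroup W] [Module ℚ W] [DGVect W] (f : DGHom V W) :
    QuasiIso f.complexMap ↔ QI (dif V) (dif W) f.toLin :=
  quasiIso_iff_forall f

/-- An exact differential on a vector space has a contraction. -/
theorem exists_contraction {V : Type u} [AddCommGroup V] [Module ℚ V] (D : V →ₗ[ℚ] V)
    (hD : ∀ x, D (D x) = 0) (hex : ∀ x, D x = 0 → ∃ y, D y = x) :
    ∃ s : V →ₗ[ℚ] V, ∀ x, D (s x) + s (D x) = x := by
  obtain ⟨t, ht⟩ := D.rangeRestrict.exists_rightInverse_of_surjective D.range_rangeRestrict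
  have ht' : ∀ y : LinearMap.range D, D (t y) = y := fun y =>
    congrArg Subtype.val (LinearMap.congr_fun ht y)
  have hmem : ∀ x, x - t (D.rangeRestrict x) ∈ LinearMap.range D := fun x => by
    obtain ⟨y, hy⟩ := hex (x - t (D.rangeRestrict x)) (by rw [map_sub, ht', sub_eq_zero]; rfl)
    exact ⟨y, hy⟩
  refine ⟨t ∘ₗ (LinearMap.id - t ∘ₗ D.rangeRestrict).codRestrict (LinearMap.range D) hmem,
    fun x => ?_⟩
  have h1 : D.rangeRestrict (D x) = 0 := Subtype.ext (hD x)
  have h2 : (LinearMap.id - t ∘ₗ D.rangeRestrict).codRestrict (LinearMap.range D) hmem (D x) =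
      D.rangeRestrict x := Subtype.ext (by simp [h1])
  rw [LinearMap.comp_apply, LinearMap.comp_apply, ht', h2]
  simp

/-- A differential which is contractible up to a locally nilpotent error is exact. -/
theorem exact_of_contraction_mod {V : Type u} [AddCommGroup V] [Module ℚ V] (D h : V →ₗ[ℚ] V)
    (hD : ∀ x, D (D x) = 0) (G : ℕ → Submodule ℚ V) (hG : ∀ x ∈ G 0, x = 0)
    (hT : ∀ n, ∀ x ∈ G (n + 1), x - D (h x) - h (D x) ∈ G n) (n : ℕ) :
    ∀ x ∈ G n, D x = 0 → ∃ y, D y = x := by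
  induction n with
  | zero => exact fun x hx _ => ⟨0, by rw [hG x hx, map_zero]⟩
  | succ n ih =>
    intro x hx hDx
    have h1 := hT n x hx
    rw [hDx, map_zero, sub_zero] at h1
    obtain ⟨y, hy⟩ := ih _ h1 (by rw [map_sub, hDx, hD, sub_zero])
    exact ⟨y + h x, by rw [map_add, hy, sub_add_cancel]⟩

section TensorFil

variable {U : Type u} [AddCommGroup U] [Module ℚ U]

/-- The subspace `S ⊗ V` of `U ⊗ V`. -/
def tensorSub (S : Submodule ℚ U) (V : Type v) [AddCommGroup V] [Module ℚ V] :
    Submodule ℚ (U ⊗[ℚ] V) :=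
  Submodule.span ℚ {z | ∃ c ∈ S, ∃ x : V, z = c ⊗ₜ[ℚ] x}

variable {V : Type v} [AddCommGroup V] [Module ℚ V] {W : Type w} [AddCommGroup W] [Module ℚ W]

theorem tmul_mem_tensorSub {S : Submodule ℚ U} {c : U} (hc : c ∈ S) (x : V) :
    c ⊗ₜ[ℚ] x ∈ tensorSub S V :=
  Submodule.subset_span ⟨c, hc, x, rfl⟩

theorem mem_of_tensorSub {S : Submodule ℚ U} (φ : U ⊗[ℚ] V →ₗ[ℚ] W) (G : Submodule ℚ W)
    (h : ∀ c ∈ S, ∀ x, φ (c ⊗ₜ x) ∈ G) (z : U ⊗[ℚ] V) (hz : z ∈ tensorSub S V) : φ z ∈ G := by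
  have : tensorSub S V ≤ G.comap φ := Submodule.span_le.2 (by
    rintro _ ⟨c, hc, x, rfl⟩; exact h c hc x)
  exact this hz

theorem map_mem_tensorSub {S S' : Submodule ℚ U} (g : U →ₗ[ℚ] U) (hg : ∀ c ∈ S, g c ∈ S')
    (k : V →ₗ[ℚ] W) (z : U ⊗[ℚ] V) (hz : z ∈ tensorSub S V) :
    TensorProduct.map g k z ∈ tensorSub S' W :=
  mem_of_tensorSub _ _ (fun c hc _ => tmul_mem_tensorSub (hg c hc) _) z hz

theorem tensorSub_mono {S S' : Submodule ℚ U} (h : S ≤ S') : tensorSub S V ≤ tensorSub S' V :=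
  Submodule.span_mono (by rintro _ ⟨c, hc, x, rfl⟩; exact ⟨c, h hc, x, rfl⟩)

end TensorFil

/-- Tensoring with a filtered graded vector space `U` preserves quasi-isomorphisms, where the
tensor products may carry twisted differentials `d ⊗ 1 + (±1) ⊗ d + τ` with `τ` lowering the
filtration. -/
theorem QI.twistedTensor {U : Type u} [AddCommGroup U] [Module ℚ U] [DGVect U]
    {V W : Type u} [AddCommGroup V] [Module ℚ V] [DGVect V]
    [AddCommGroup W] [Module ℚ W] [DGVect W] (f : DGHom V W) (hf : QI (dif V) (dif W) f.toLin)
    (G : ℕ → Submodule ℚ U) (hG0 : ∀ x ∈ G 0, x = 0) (hGmono : Monotone G)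
    (hGtop : ∀ x, ∃ n, x ∈ G n) (hGs : ∀ n, ∀ x ∈ G n, sgn x ∈ G n)
    (τ : U ⊗[ℚ] V →ₗ[ℚ] U ⊗[ℚ] V) (τ' : U ⊗[ℚ] W →ₗ[ℚ] U ⊗[ℚ] W)
    (hτ : ∀ n, ∀ z ∈ tensorSub (G (n + 1)) V, τ z ∈ tensorSub (G n) V)
    (hτ' : ∀ n, ∀ z ∈ tensorSub (G (n + 1)) W, τ' z ∈ tensorSub (G n) W)
    (hD : ∀ z, (dTens U V + τ) ((dTens U V + τ) z) = 0)
    (hD' : ∀ z, (dTens U W + τ') ((dTens U W + τ') z) = 0)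
    (hfτ : ∀ z, f.toLin.lTensor U (τ z) = τ' (f.toLin.lTensor U z)) :
    QI (dTens U V + τ) (dTens U W + τ') (f.toLin.lTensor U) := by
  let cD : V × W →ₗ[ℚ] V × W := LinearMap.prod (dif V ∘ₗ LinearMap.fst ℚ V W)
    (f.toLin ∘ₗ LinearMap.fst ℚ V W - dif W ∘ₗ LinearMap.snd ℚ V W)
  obtain ⟨s, hs⟩ := exists_contraction cD (fun x => by simp [cD, f.map_d]) (by
    rintro ⟨x, y⟩ h
    obtain ⟨h1, h2⟩ := Prod.ext_iff.1 h
    obtain ⟨x', y', h3, h4⟩ := hf x y h1 (sub_eq_zero.1 h2)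
    exact ⟨(x', -y'), by simp [cD, h3, h4]⟩)
  obtain ⟨a, ha⟩ : ∃ a : V →ₗ[ℚ] V, a = LinearMap.fst ℚ V W ∘ₗ s ∘ₗ LinearMap.inl ℚ V W := ⟨_, rfl⟩
  obtain ⟨b, hb⟩ : ∃ b : W →ₗ[ℚ] V, b = LinearMap.fst ℚ V W ∘ₗ s ∘ₗ LinearMap.inr ℚ V W := ⟨_, rfl⟩
  obtain ⟨c, hc⟩ : ∃ c : V →ₗ[ℚ] W, c = LinearMap.snd ℚ V W ∘ₗ s ∘ₗ LinearMap.inl ℚ V W := ⟨_, rfl⟩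
  obtain ⟨e, he⟩ : ∃ e : W →ₗ[ℚ] W, e = LinearMap.snd ℚ V W ∘ₗ s ∘ₗ LinearMap.inr ℚ V W := ⟨_, rfl⟩
  have hs0 : ∀ x y, s (x, y) = (a x + b y, c x + e y) := fun x y => by
    have : (x, y) = (x, 0) + ((0, y) : V × W) := by simp
    rw [this, map_add, ha, hb, hc, he]
    rfl
  have e1 : ∀ x, dif V (a x) + a (dif V x) + b (f.toLin x) = x := fun x => by
    have := congrArg Prod.fst (hs (x, 0))
    simpa [cD, hs0, add_assoc] using this
  have e2 : ∀ y, dif V (b y) = b (dif W y) := fun y => by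
    have := congrArg Prod.fst (hs (0, y))
    simpa [cD, hs0, add_neg_eq_zero] using this
  have e3 : ∀ x, f.toLin (a x) - dif W (c x) + (c (dif V x) + e (f.toLin x)) = 0 := fun x => by
    have := congrArg Prod.snd (hs (x, 0))
    simpa [cD, hs0] using this
  have e4 : ∀ y, f.toLin (b y) - dif W (e y) - e (dif W y) = y := fun y => by
    have := congrArg Prod.snd (hs (0, y))
    simpa [cD, hs0, sub_eq_add_neg] using this
  clear_value cD
  clear ha hb hc he hs0 hs s cD
  let F := f.toLin.lTensor U
  have hF : ∀ z, F ((dTens U V + τ) z) = (dTens U W + τ') (F z) := fun z => by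
    rw [LinearMap.add_apply, map_add, LinearMap.add_apply]
    refine congrArg₂ (· + ·) ?_ (hfτ z)
    exact dTens_map (⟨LinearMap.id, fun _ _ h => h, fun _ => rfl⟩ : DGHom U U) f z
  let Δ : (U ⊗[ℚ] V) × (U ⊗[ℚ] W) →ₗ[ℚ] (U ⊗[ℚ] V) × (U ⊗[ℚ] W) :=
    LinearMap.prod ((dTens U V + τ) ∘ₗ LinearMap.fst ℚ _ _)
      (F ∘ₗ LinearMap.fst ℚ _ _ - (dTens U W + τ') ∘ₗ LinearMap.snd ℚ _ _)
  let A := TensorProduct.map (sgn : U →ₗ[ℚ] U) a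
  let B := TensorProduct.map (LinearMap.id : U →ₗ[ℚ] U) b
  let Cc := TensorProduct.map (LinearMap.id : U →ₗ[ℚ] U) c
  let E := TensorProduct.map (sgn : U →ₗ[ℚ] U) e
  let h : (U ⊗[ℚ] V) × (U ⊗[ℚ] W) →ₗ[ℚ] (U ⊗[ℚ] V) × (U ⊗[ℚ] W) :=
    LinearMap.prod (A ∘ₗ LinearMap.fst ℚ _ _ + B ∘ₗ LinearMap.snd ℚ _ _)
      (Cc ∘ₗ LinearMap.fst ℚ _ _ + E ∘ₗ LinearMap.snd ℚ _ _)
  have k1 : ∀ z, dTens U V (A z) + A (dTens U V z) + B (F z) = z := fun z => by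
    induction z using TensorProduct.induction_on with
    | zero => simp
    | add x y hx hy => conv_rhs => rw [← hx, ← hy]
                       simp only [map_add]; abel
    | tmul u x =>
      conv_rhs => rw [← e1 x]
      simp [A, B, F, dif_sgn, TensorProduct.neg_tmul, TensorProduct.tmul_add]; abel
  have k2 : ∀ z, dTens U V (B z) = B (dTens U W z) := fun z => by
    induction z using TensorProduct.induction_on with
    | zero => simp
    | add x y hx hy => simp only [map_add, hx, hy]
    | tmul u x => simp [B, e2]
  have k3 : ∀ z, F (A z) - dTens U W (Cc z) + (Cc (dTens U V z) + E (F z)) = 0 := fun z => by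
    induction z using TensorProduct.induction_on with
    | zero => simp
    | add x y hx hy =>
      have := congrArg₂ (· + ·) hx hy
      simp only [add_zero] at this
      rw [← this]
      simp only [map_add]; abel
    | tmul u x =>
      have := congrArg (fun t => sgn u ⊗ₜ[ℚ] t) (e3 x)
      simp only [TensorProduct.tmul_add, TensorProduct.tmul_sub, TensorProduct.tmul_zero] at this
      rw [← this]
      simp [A, Cc, F, E]; abel
  have k4 : ∀ z, F (B z) - dTens U W (E z) - E (dTens U W z) = z := fun z => by
    induction z using TensorProduct.induction_on with
    | zero => simp
    | add x y hx hy => conv_rhs => rw [← hx, ← hy]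
                       simp only [map_add]; abel
    | tmul u x =>
      conv_rhs => rw [← e4 x]
      simp [B, E, F, dif_sgn, TensorProduct.neg_tmul, TensorProduct.tmul_sub]; abel
  have hmemA : ∀ n, ∀ z ∈ tensorSub (G n) V, A z ∈ tensorSub (G n) V :=
    fun n => map_mem_tensorSub _ (hGs n) _
  have hmemB : ∀ n, ∀ z ∈ tensorSub (G n) W, B z ∈ tensorSub (G n) V :=
    fun n => map_mem_tensorSub _ (fun _ h => h) _
  have hmemC : ∀ n, ∀ z ∈ tensorSub (G n) V, Cc z ∈ tensorSub (G n) W :=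
    fun n => map_mem_tensorSub _ (fun _ h => h) _
  have hmemE : ∀ n, ∀ z ∈ tensorSub (G n) W, E z ∈ tensorSub (G n) W :=
    fun n => map_mem_tensorSub _ (hGs n) _
  have htop : ∀ {X : Type u} [AddCommGroup X] [Module ℚ X] (z : U ⊗[ℚ] X),
      ∃ n, z ∈ tensorSub (G n) X := by
    intro X _ _ z
    induction z using TensorProduct.induction_on with
    | zero => exact ⟨0, Submodule.zero_mem _⟩
    | tmul u x => exact (hGtop u).imp fun n hn => tmul_mem_tensorSub hn x
    | add x y hx hy =>
      obtain ⟨n, hn⟩ := hx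
      obtain ⟨m, hm⟩ := hy
      exact ⟨max n m, Submodule.add_mem _
        (tensorSub_mono (hGmono (le_max_left n m)) hn)
        (tensorSub_mono (hGmono (le_max_right n m)) hm)⟩
  have hzero : ∀ {X : Type u} [AddCommGroup X] [Module ℚ X] (z : U ⊗[ℚ] X),
      z ∈ tensorSub (G 0) X → z = 0 := by
    intro X _ _ z hz
    have := mem_of_tensorSub LinearMap.id ⊥ (fun c hc x => by rw [hG0 c hc]; simp) z hz
    simpa using this
  have main := exact_of_contraction_mod Δ h (fun p => by
      refine Prod.ext (hD _) ?_
      change F ((dTens U V + τ) p.1) - (dTens U W + τ') (F p.1 - (dTens U W + τ') p.2) = 0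
      rw [map_sub, hD', hF]; simp)
    (fun n => (tensorSub (G n) V).prod (tensorSub (G n) W))
    (fun p hp => Prod.ext (hzero _ hp.1) (hzero _ hp.2))
    (fun n p hp => by
      obtain ⟨z, y⟩ := p
      obtain ⟨hz, hy⟩ : z ∈ tensorSub (G (n + 1)) V ∧ y ∈ tensorSub (G (n + 1)) W := hp
      constructor
      · have : z - (dTens U V + τ) (A z + B y) - (A ((dTens U V + τ) z) +
            B (F z - (dTens U W + τ') y)) = B (τ' y) - τ (A z) - τ (B y) - A (τ z) := by
          simp only [LinearMap.add_apply, map_add, map_sub, k2]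
          rw [← sub_eq_zero]
          refine Eq.trans ?_ (sub_eq_zero.2 (k1 z).symm)
          abel
        change z - (dTens U V + τ) (A z + B y) - (A ((dTens U V + τ) z) +
            B (F z - (dTens U W + τ') y)) ∈ _
        rw [this]
        exact Submodule.sub_mem _ (Submodule.sub_mem _ (Submodule.sub_mem _
          (hmemB _ _ (hτ' _ _ hy)) (hτ _ _ (hmemA _ _ hz))) (hτ _ _ (hmemB _ _ hy)))
          (hmemA _ _ (hτ _ _ hz))
      · have : y - (F (A z + B y) - (dTens U W + τ') (Cc z + E y)) - (Cc ((dTens U V + τ) z) +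
            E (F z - (dTens U W + τ') y)) = τ' (Cc z) + τ' (E y) - Cc (τ z) + E (τ' y) := by
          simp only [LinearMap.add_apply, map_add, map_sub]
          rw [← sub_eq_zero]
          refine Eq.trans ?_ (sub_eq_zero.2 ((sub_eq_zero.2 (k4 y).symm).trans (k3 z).symm))
          abel
        change y - (F (A z + B y) - (dTens U W + τ') (Cc z + E y)) - (Cc ((dTens U V + τ) z) +
            E (F z - (dTens U W + τ') y)) ∈ _
        rw [this]
        exact Submodule.add_mem _ (Submodule.sub_mem _ (Submodule.add_mem _
          (hτ' _ _ (hmemC _ _ hz)) (hτ' _ _ (hmemE _ _ hy))) (hmemC _ _ (hτ _ _ hz)))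
          (hmemE _ _ (hτ' _ _ hy)))
  intro x y hx hxy
  obtain ⟨n, hn⟩ := htop x
  obtain ⟨m, hm⟩ := htop y
  obtain ⟨⟨x', y'⟩, hp⟩ := main (max n m) (x, y)
    ⟨tensorSub_mono (hGmono (le_max_left n m)) hn, tensorSub_mono (hGmono (le_max_right n m)) hm⟩
    (Prod.ext hx (sub_eq_zero.2 hxy))
  obtain ⟨h1, h2⟩ := Prod.ext_iff.1 hp
  refine ⟨x', -y', h1, ?_⟩
  rw [map_neg, ← sub_eq_add_neg]
  exact h2.symm

/-! ### The adjunction between twisted extensions and coextensions -/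

section Counit

variable {C : Type u} [AddCommGroup C] [Module ℚ C] [Coalgebra ℚ C] [DGVect C] [DGCoalgebra C]
variable {A : Type u} [Ring A] [Algebra ℚ A] [DGVect A] [DGAlgebra A]

theorem counit_sgn (c : C) : Coalgebra.counit (R := ℚ) (sgn c) = Coalgebra.counit (R := ℚ) c := by
  refine gr_induction (p := fun c => Coalgebra.counit (R := ℚ) (sgn c) =
    Coalgebra.counit (R := ℚ) c) c (fun n x hx => ?_) (fun x y hx hy => by simp [hx, hy])
  rw [sgn_of_mem hx]
  by_cases h : n = 0
  · subst h; simp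
  · rw [Units.smul_def, map_zsmul, DGCoalgebra.counit_of_ne n h x hx, smul_zero]

/-- The map `ε ⊗ X : C ⊗ X → X`. -/
def counitMap (C : Type u) [AddCommGroup C] [Module ℚ C] [Coalgebra ℚ C]
    (X : Type u) [AddCommGroup X] [Module ℚ X] : C ⊗[ℚ] X →ₗ[ℚ] X :=
  (TensorProduct.lid ℚ X).toLinearMap ∘ₗ (Coalgebra.counit (R := ℚ) (A := C)).rTensor X

@[simp] theorem counitMap_tmul {X : Type u} [AddCommGroup X] [Module ℚ X] (c : C) (x : X) :
    counitMap C X (c ⊗ₜ x) = Coalgebra.counit (R := ℚ) c • x := rfl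

theorem counitMap_mem {X : Type u} [AddCommGroup X] [Module ℚ X] [GrVect X] (n : ℤ)
    (z : C ⊗[ℚ] X) (hz : z ∈ gr (C ⊗[ℚ] X) n) : counitMap C X z ∈ gr X n := by
  have := tensor_degree (counitMap C X) 0 (fun i j c hc x hx => by
    rw [counitMap_tmul]
    by_cases h : i = 0
    · subst h; simpa using Submodule.smul_mem _ _ hx
    · rw [DGCoalgebra.counit_of_ne i h c hc, zero_smul]; exact Submodule.zero_mem _) n z hz
  simpa using this

theorem counitMap_lTensor {X Y : Type u} [AddCommGroup X] [Module ℚ X] [AddCommGroup Y]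
    [Module ℚ Y] (f : X →ₗ[ℚ] Y) (z : C ⊗[ℚ] X) :
    counitMap C Y (f.lTensor C z) = f (counitMap C X z) := by
  induction z using TensorProduct.induction_on with
  | zero => simp
  | add x y hx hy => simp only [map_add, hx, hy]
  | tmul c x => simp

theorem counitMap_dTens {X : Type u} [AddCommGroup X] [Module ℚ X] [DGVect X] (z : C ⊗[ℚ] X) :
    counitMap C X (dTens C X z) = dif X (counitMap C X z) := by
  induction z using TensorProduct.induction_on with
  | zero => simp
  | add x y hx hy => simp only [map_add, hx, hy]
  | tmul c x => simp [DGCoalgebra.counit_d, counit_sgn]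

theorem counitMap_coact (N : DGComod C) (x : N) : counitMap C N (N.coact x) = x := N.counit x

theorem lTensor_counitMap_cofreeCoact {X : Type u} [AddCommGroup X] [Module ℚ X]
    (z : C ⊗[ℚ] X) : (counitMap C X).lTensor C (cofreeCoact C X z) = z := by
  induction z using TensorProduct.induction_on with
  | zero => simp
  | add x y hx hy => simp only [map_add, hx, hy]
  | tmul c x =>
    have h : ∀ w : C ⊗[ℚ] C, (counitMap C X).lTensor C
        (((TensorProduct.mk ℚ C X).flip x).lTensor C w) =
        TensorProduct.map LinearMap.id (LinearMap.toSpanSingleton ℚ X x)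
          ((Coalgebra.counit (R := ℚ) (A := C)).lTensor C w) := by
      intro w
      induction w using TensorProduct.induction_on with
      | zero => simp
      | add x y hx hy => simp only [map_add, hx, hy]
      | tmul a b => simp
    rw [leftCoact_tmul, h, Coalgebra.lTensor_counit_comul]
    simp

theorem counitMap_coextTwist (τ : TwistingChain C A) (X : DGMod A) (c : C) (x : X) :
    counitMap C X (coextTwist τ X (c ⊗ₜ x)) = τ.toLin c • x := by
  have h : ∀ w : C ⊗[ℚ] C, counitMap C X (TensorProduct.map sgn (smulBy x ∘ₗ τ.toLin) w) =
      smulBy x (τ.toLin (counitMap C C w)) := by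
    intro w
    induction w using TensorProduct.induction_on with
    | zero => simp
    | add x y hx hy => simp only [map_add, hx, hy]
    | tmul a b =>
      simp only [TensorProduct.map_tmul, counitMap_tmul, counit_sgn, LinearMap.comp_apply, map_smul]
  rw [coextTwist_tmul, h]
  have : counitMap C C (Coalgebra.comul c) = c := comul_counit c
  rw [this, smulBy_apply]

/-- The map `a ⊗ (c ⊗ x) ↦ a ⊗ ε(c) x`. -/
def extCounit (A : Type u) [Ring A] [Algebra ℚ A] (C : Type u) [AddCommGroup C] [Module ℚ C]
    [Coalgebra ℚ C] (X : Type u) [AddCommGroup X] [Module ℚ X] :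
    A ⊗[ℚ] (C ⊗[ℚ] X) →ₗ[ℚ] A ⊗[ℚ] X := (counitMap C X).lTensor A

/-- The map `a ⊗ (c ⊗ x) ↦ (-1)^{|a|} (a ⊗ τc · x - a · τc ⊗ x)`. -/
def extTheta (τ : TwistingChain C A) (X : DGMod A) : A ⊗[ℚ] (C ⊗[ℚ] X) →ₗ[ℚ] A ⊗[ℚ] X :=
  TensorProduct.map sgn (X.act ∘ₗ τ.toLin.rTensor X) -
    (LinearMap.mul' ℚ A ∘ₗ TensorProduct.map sgn τ.toLin).rTensor X ∘ₗ
      (TensorProduct.assoc ℚ A C X).symm.toLinearMap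

theorem extTheta_tmul (τ : TwistingChain C A) (X : DGMod A) (a : A) (c : C) (x : X) :
    extTheta τ X (a ⊗ₜ (c ⊗ₜ x)) =
      sgn a ⊗ₜ (τ.toLin c • x) - (sgn a * τ.toLin c) ⊗ₜ x := rfl

theorem extCounit_extD (τ : TwistingChain C A) (X : DGMod A) (z : A ⊗[ℚ] (C ⊗[ℚ] X)) :
    extCounit A C X (extD τ (coextObj τ X) z) =
      dTens A X (extCounit A C X z) + extTheta τ X z := by
  obtain ⟨D, hD⟩ : ∃ D : A ⊗[ℚ] (C ⊗[ℚ] X) →ₗ[ℚ] A ⊗[ℚ] (C ⊗[ℚ] X),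
      D = extD τ (coextObj τ X) := ⟨_, rfl⟩
  suffices key : ∀ z : A ⊗[ℚ] (C ⊗[ℚ] X), extCounit A C X (D z) =
      dTens A X (extCounit A C X z) + extTheta τ X z by
    subst hD
    exact key z
  intro z
  induction z using TensorProduct.induction_on with
  | zero => simp
  | add x y hx hy => simp only [map_add, hx, hy]; abel
  | tmul a z =>
    induction z using TensorProduct.induction_on with
    | zero => simp
    | add x y hx hy => simp only [TensorProduct.tmul_add, map_add, hx, hy]; abel
    | tmul c x =>
      have h1 : D (a ⊗ₜ[ℚ] (c ⊗ₜ[ℚ] x)) =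
          dif A a ⊗ₜ (c ⊗ₜ x) + sgn a ⊗ₜ (dTens C X (c ⊗ₜ x) + coextTwist τ X (c ⊗ₜ x)) -
          (LinearMap.mulLeft ℚ (sgn a) ∘ₗ τ.toLin).rTensor (C ⊗[ℚ] X)
            (cofreeCoact C X (c ⊗ₜ x)) := by
        rw [hD]
        refine (congrArg (fun t => dTens A (coextObj τ X) (a ⊗ₜ[ℚ] (c ⊗ₜ[ℚ] x)) - t)
          (extTwist_tmul τ (coextObj τ X) a (c ⊗ₜ[ℚ] x))).trans ?_
        rfl
      have h2 : extCounit A C X ((LinearMap.mulLeft ℚ (sgn a) ∘ₗ τ.toLin).rTensor (C ⊗[ℚ] X)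
            (cofreeCoact C X (c ⊗ₜ x))) = (sgn a * τ.toLin c) ⊗ₜ x := by
        rw [extCounit, ← LinearMap.comp_apply, LinearMap.lTensor_comp_rTensor,
          ← LinearMap.rTensor_comp_lTensor, LinearMap.comp_apply, lTensor_counitMap_cofreeCoact]
        rfl
      rw [h1, map_sub, h2, extTheta_tmul]
      simp only [extCounit, map_add, LinearMap.lTensor_tmul, dTens_tmul, counitMap_coextTwist,
        TensorProduct.tmul_add, counitMap_tmul, counit_sgn, DGCoalgebra.counit_d, zero_smul,
        TensorProduct.tmul_zero, zero_add, map_smul]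
      abel

/-- The counit `τ^! τ_* X ⟶ X`, `a ⊗ (c ⊗ x) ↦ ε(c) a · x`. -/
def counitHom (τ : TwistingChain C A) (X : DGMod A) : (ext τ).obj ((coext τ).obj X) ⟶ X where
  toLin := X.act ∘ₗ extCounit A C X
  map_mem n z hz := by
    have h1 := map_mem (LinearMap.id : A →ₗ[ℚ] A) (counitMap C X) 0 0 (by simp)
      (fun n z hz => by simpa using counitMap_mem n z hz) n z hz
    have h2 := tensor_degree X.act 0 (fun i j a ha x hx => by
      simpa using X.smul_mem i j a ha x hx) _ _ h1
    rw [show n + (0 + 0) + 0 = n by ring] at h2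
    exact h2
  map_d z := by
    have h1 : ∀ w, X.act (dTens A X w) = dif X (X.act w) := by
      intro w
      induction w using TensorProduct.induction_on with
      | zero => simp
      | add x y hx hy => simp only [map_add, hx, hy]
      | tmul a x => simp [X.d_smul]
    have h2 : ∀ w, X.act (extTheta τ X w) = 0 := by
      intro w
      induction w using TensorProduct.induction_on with
      | zero => simp
      | add x y hx hy => simp only [map_add, hx, hy, add_zero]
      | tmul a w =>
        induction w using TensorProduct.induction_on with
        | zero => simp
        | add x y hx hy => simp only [TensorProduct.tmul_add, map_add, hx, hy, add_zero]
        | tmul c x => simp [extTheta_tmul, mul_smul]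
    have key : ∀ w : A ⊗[ℚ] (C ⊗[ℚ] X), X.act (dTens A X (extCounit A C X w) + extTheta τ X w) =
        dif X (X.act (extCounit A C X w)) := fun w => by rw [map_add, h2, add_zero, h1]
    exact (congrArg X.act (extCounit_extD τ X z)).trans (key z)
  map_smul a z := by
    have h1 : ∀ w : A ⊗[ℚ] X, X.act (a • w) = a • X.act w := by
      intro w
      induction w using TensorProduct.induction_on with
      | zero => simp
      | add x y hx hy => simp only [map_add, smul_add, hx, hy]
      | tmul b x => simp [TensorProduct.smul_tmul', mul_smul]
    exact (congrArg X.act (lTensor_smul (counitMap C X) a z)).trans (h1 _)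

theorem counitHom_tmul (τ : TwistingChain C A) (X : DGMod A) (a : A) (w : C ⊗[ℚ] X) :
    (counitHom τ X).toLin (a ⊗ₜ[ℚ] w) = a • counitMap C X w := rfl

theorem counitHom_naturality (τ : TwistingChain C A) {X Y : DGMod A} (f : X ⟶ Y) :
    (ext τ).map ((coext τ).map f) ≫ counitHom τ Y = counitHom τ X ≫ f := by
  have key : ∀ (a : A) (w : C ⊗[ℚ] X),
      a • counitMap C Y (f.toLin.lTensor C w) = f.toLin (a • counitMap C X w) := fun a w => by
    rw [counitMap_lTensor, f.map_smul]
  exact DGMod.Hom.ext (TensorProduct.ext' key)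

theorem unitHom_naturality (τ : TwistingChain C A) {M N : DGComod C} (f : M ⟶ N) :
    f ≫ unitHom τ N = unitHom τ M ≫ (coext τ).map ((ext τ).map f) := by
  refine DGComod.Hom.ext (LinearMap.ext fun x => ?_)
  change (TensorProduct.mk ℚ A N 1).lTensor C (N.coact (f.toLin x)) =
    (f.toLin.lTensor A).lTensor C ((TensorProduct.mk ℚ A M 1).lTensor C (M.coact x))
  rw [f.map_coact, ← LinearMap.lTensor_comp_apply, ← LinearMap.lTensor_comp_apply]
  rfl

theorem ext_unitHom_counitHom (τ : TwistingChain C A) (N : DGComod C) :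
    (ext τ).map (unitHom τ N) ≫ counitHom τ ((ext τ).obj N) = 𝟙 _ := by
  refine DGMod.Hom.ext (TensorProduct.ext' fun a x => ?_)
  have h : counitMap C (A ⊗[ℚ] N) ((TensorProduct.mk ℚ A N 1).lTensor C (N.coact x)) =
      1 ⊗ₜ[ℚ] x := by
    rw [counitMap_lTensor, counitMap_coact]; rfl
  change a • counitMap C (A ⊗[ℚ] N) ((TensorProduct.mk ℚ A N 1).lTensor C (N.coact x)) = a ⊗ₜ[ℚ] x
  rw [h, TensorProduct.smul_tmul', smul_eq_mul, mul_one]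

theorem unitHom_coext_counitHom (τ : TwistingChain C A) (X : DGMod A) :
    unitHom τ ((coext τ).obj X) ≫ (coext τ).map (counitHom τ X) = 𝟙 _ := by
  refine DGComod.Hom.ext (LinearMap.ext fun z => ?_)
  change ((counitHom τ X).toLin).lTensor C ((TensorProduct.mk ℚ A (C ⊗[ℚ] X) 1).lTensor C
    (cofreeCoact C X z)) = z
  have h : (counitHom τ X).toLin ∘ₗ TensorProduct.mk ℚ A (C ⊗[ℚ] X) 1 = counitMap C X :=
    LinearMap.ext fun w => by
      change (counitHom τ X).toLin (1 ⊗ₜ[ℚ] w) = _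
      rw [counitHom_tmul, one_smul]
  exact ((LinearMap.lTensor_comp_apply C _ _ _).symm.trans
    (congrArg (fun k : C ⊗[ℚ] X →ₗ[ℚ] X => k.lTensor C (cofreeCoact C X z)) h)).trans
    (lTensor_counitMap_cofreeCoact z)

end Counit

/-! ### Modules over tensor algebras -/

section FreeResolution

theorem algebra_smul_eq_rTensor {A : Type u} [Ring A] [Algebra ℚ A] {N : Type v} [AddCommGroup N]
    [Module ℚ N] (a : A) (z : A ⊗[ℚ] N) : a • z = (LinearMap.mulLeft ℚ a).rTensor N z := by
  induction z using TensorProduct.induction_on with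
  | zero => simp
  | add x y hx hy => simp only [smul_add, map_add, hx, hy]
  | tmul b x => simp [TensorProduct.smul_tmul']

variable {V : Type u} [AddCommGroup V] [Module ℚ V]
variable (X : Type u) [AddCommGroup X] [Module ℚ X] [Module (TensorAlgebra ℚ V) X]
  [IsScalarTower ℚ (TensorAlgebra ℚ V) X]

/-- The map `a ⊗ (v ⊗ x) ↦ a v ⊗ x - a ⊗ v x`. -/
def freeTheta : TensorAlgebra ℚ V ⊗[ℚ] (V ⊗[ℚ] X) →ₗ[ℚ] TensorAlgebra ℚ V ⊗[ℚ] X :=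
  (LinearMap.mul' ℚ (TensorAlgebra ℚ V) ∘ₗ
      (TensorAlgebra.ι ℚ).lTensor (TensorAlgebra ℚ V)).rTensor X ∘ₗ
      (TensorProduct.assoc ℚ (TensorAlgebra ℚ V) V X).symm.toLinearMap -
  (TensorProduct.lift ((Algebra.lsmul ℚ ℚ X).toLinearMap ∘ₗ TensorAlgebra.ι ℚ)).lTensor _

@[simp] theorem freeTheta_tmul (a : TensorAlgebra ℚ V) (v : V) (x : X) :
    freeTheta X (a ⊗ₜ (v ⊗ₜ x)) =
      (a * TensorAlgebra.ι ℚ v) ⊗ₜ x - a ⊗ₜ (TensorAlgebra.ι ℚ v • x) := rfl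

/-- The action `v (w, x) = (v w + 1 ⊗ v ⊗ x, v x)` of the tensor algebra on
`(T V ⊗ V ⊗ X) × X`. -/
def freeAct : TensorAlgebra ℚ V →ₐ[ℚ]
    Module.End ℚ ((TensorAlgebra ℚ V ⊗[ℚ] (V ⊗[ℚ] X)) × X) :=
  TensorAlgebra.lift ℚ
    { toFun := fun v => LinearMap.prod
        ((LinearMap.mulLeft ℚ (TensorAlgebra.ι ℚ v)).rTensor (V ⊗[ℚ] X) ∘ₗ LinearMap.fst ℚ _ _ +
          (TensorProduct.mk ℚ (TensorAlgebra ℚ V) (V ⊗[ℚ] X) 1 ∘ₗ TensorProduct.mk ℚ V X v) ∘ₗ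
            LinearMap.snd ℚ _ _)
        (Algebra.lsmul ℚ ℚ X (TensorAlgebra.ι ℚ v) ∘ₗ LinearMap.snd ℚ _ _)
      map_add' := fun v w => by
        refine LinearMap.ext fun p => Prod.ext ?_ ?_
        · have : LinearMap.mulLeft ℚ (TensorAlgebra.ι ℚ v + TensorAlgebra.ι ℚ w) =
            LinearMap.mulLeft ℚ (TensorAlgebra.ι ℚ v) + LinearMap.mulLeft ℚ (TensorAlgebra.ι ℚ w) :=
            LinearMap.ext fun x => by simp [add_mul]
          simp [this, LinearMap.rTensor_add, TensorProduct.tmul_add]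
          abel
        · simp
      map_smul' := fun r v => by
        refine LinearMap.ext fun p => Prod.ext ?_ ?_
        · have : LinearMap.mulLeft ℚ (r • TensorAlgebra.ι ℚ v) =
            r • LinearMap.mulLeft ℚ (TensorAlgebra.ι ℚ v) :=
            LinearMap.ext fun x => by simp
          simp [this, LinearMap.rTensor_smul, TensorProduct.smul_tmul']
          exact (TensorProduct.smul_tmul r 1 (v ⊗ₜ[ℚ] p.2)).symm
        · simp }

variable {X}

theorem freeAct_apply (a : TensorAlgebra ℚ V) :
    ∀ p, freeAct X a p = (a • p.1 + (freeAct X a (0, p.2)).1, a • p.2) := by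
  induction a using TensorAlgebra.induction with
  | algebraMap r =>
    intro p
    simp [Algebra.algebraMap_eq_smul_one, Prod.ext_iff]
  | ι v =>
    intro p
    simp [freeAct, algebra_smul_eq_rTensor]
  | mul a b ha hb =>
    intro p
    have h2 := ha (freeAct X b (0, p.2))
    rw [map_mul, Module.End.mul_apply, Module.End.mul_apply, hb p, ha, h2, hb (0, p.2)]
    simp [mul_smul, add_assoc]
  | add a b ha hb =>
    intro p
    rw [map_add, LinearMap.add_apply, LinearMap.add_apply, ha p, hb p]
    simp only [Prod.mk_add_mk, Prod.fst_add, add_smul]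
    congr 1
    abel

variable (X)

/-- The left inverse `v₁ ⋯ vₙ ⊗ x ↦ ∑ᵢ v₁ ⋯ vᵢ₋₁ ⊗ vᵢ ⊗ vᵢ₊₁ ⋯ vₙ x` of `freeTheta`. -/
def freeHtpy : TensorAlgebra ℚ V ⊗[ℚ] X →ₗ[ℚ] TensorAlgebra ℚ V ⊗[ℚ] (V ⊗[ℚ] X) :=
  TensorProduct.lift
    { toFun := fun a => LinearMap.fst ℚ _ _ ∘ₗ freeAct X a ∘ₗ LinearMap.inr ℚ _ _
      map_add' := fun a b => by ext; simp
      map_smul' := fun r a => by ext; simp }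

theorem freeHtpy_tmul (a : TensorAlgebra ℚ V) (x : X) :
    freeHtpy X (a ⊗ₜ x) = (freeAct X a (0, x)).1 := rfl

theorem freeHtpy_mul_tmul (a b : TensorAlgebra ℚ V) (x : X) :
    freeHtpy X ((a * b) ⊗ₜ x) = a • freeHtpy X (b ⊗ₜ x) + freeHtpy X (a ⊗ₜ (b • x)) := by
  rw [freeHtpy_tmul, map_mul, Module.End.mul_apply, freeAct_apply a, freeAct_apply b]
  simp [freeHtpy_tmul]

theorem freeHtpy_ι_tmul (v : V) (x : X) :
    freeHtpy X (TensorAlgebra.ι ℚ v ⊗ₜ x) = 1 ⊗ₜ (v ⊗ₜ x) := by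
  simp [freeHtpy_tmul, freeAct]

theorem freeHtpy_freeTheta (z : TensorAlgebra ℚ V ⊗[ℚ] (V ⊗[ℚ] X)) :
    freeHtpy X (freeTheta X z) = z := by
  induction z using TensorProduct.induction_on with
  | zero => simp
  | add x y hx hy => simp only [map_add, hx, hy]
  | tmul a z =>
    induction z using TensorProduct.induction_on with
    | zero => simp
    | add x y hx hy => simp only [TensorProduct.tmul_add, map_add, hx, hy]
    | tmul v x =>
      rw [freeTheta_tmul, map_sub, freeHtpy_mul_tmul, freeHtpy_ι_tmul]
      simp [TensorProduct.smul_tmul']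

theorem freeTheta_smul (a : TensorAlgebra ℚ V) (z : TensorAlgebra ℚ V ⊗[ℚ] (V ⊗[ℚ] X)) :
    freeTheta X (a • z) = a • freeTheta X z := by
  induction z using TensorProduct.induction_on with
  | zero => simp
  | add x y hx hy => simp only [smul_add, map_add, hx, hy]
  | tmul b z =>
    induction z using TensorProduct.induction_on with
    | zero => simp
    | add x y hx hy => simp only [TensorProduct.tmul_add, smul_add, map_add, hx, hy]
    | tmul v x => simp [TensorProduct.smul_tmul', smul_sub, mul_assoc]

theorem freeTheta_freeHtpy_tmul (a : TensorAlgebra ℚ V) :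
    ∀ x : X, freeTheta X (freeHtpy X (a ⊗ₜ x)) = a ⊗ₜ x - 1 ⊗ₜ (a • x) := by
  induction a using TensorAlgebra.induction with
  | algebraMap r =>
    intro x
    simp [freeHtpy_tmul, Algebra.algebraMap_eq_smul_one, TensorProduct.smul_tmul]
  | ι v =>
    intro x
    rw [freeHtpy_ι_tmul, freeTheta_tmul, one_mul]
  | mul a b ha hb =>
    intro x
    rw [freeHtpy_mul_tmul, map_add, freeTheta_smul, ha, hb]
    simp [TensorProduct.smul_tmul', smul_sub, mul_smul]
  | add a b ha hb =>
    intro x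
    simp only [TensorProduct.add_tmul, map_add, ha, hb, add_smul, TensorProduct.tmul_add]
    abel

end FreeResolution

section CounitQuasiIso

variable {C : Type u} [AddCommGroup C] [Module ℚ C] [Coalgebra ℚ C] [DGVect C] [DGCoalgebra C]
  [TwoReduced C]

theorem exists_counit_eq_one (C : Type u) [AddCommGroup C] [Module ℚ C] [Coalgebra ℚ C]
    [DGVect C] [TwoReduced C] : ∃ u ∈ gr C 0, Coalgebra.counit (R := ℚ) u = 1 := by
  obtain ⟨u, hu⟩ := (TwoReduced.counit_bijective (C := C)).2 1
  exact ⟨u, u.2, hu⟩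

theorem eq_counit_smul {u : C} (hu : u ∈ gr C 0) (hu1 : Coalgebra.counit (R := ℚ) u = 1) {c : C}
    (hc : c ∈ gr C 0) : c = Coalgebra.counit (R := ℚ) c • u := by
  have := (TwoReduced.counit_bijective (C := C)).1
    (a₁ := ⟨c, hc⟩) (a₂ := ⟨Coalgebra.counit (R := ℚ) c • u, Submodule.smul_mem _ _ hu⟩)
    (by simp [hu1])
  exact congrArg Subtype.val this

/-- The counit `t^! t_* X ⟶ X` is a quasi-isomorphism. -/
theorem counitHom_quasiIso (X : DGMod (Cobar C)) :
    QuasiIso (counitHom (univ C) X).toDGHom.complexMap := by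
  rw [quasiIso_iff_QI]
  obtain ⟨u, hu, hu1⟩ := exists_counit_eq_one C
  obtain ⟨D, hD⟩ : ∃ D : Cobar C ⊗[ℚ] (C ⊗[ℚ] X) →ₗ[ℚ] Cobar C ⊗[ℚ] (C ⊗[ℚ] X),
      D = extD (univ C) (coextObj (univ C) X) := ⟨_, rfl⟩
  have hDD : ∀ z, D (D z) = 0 := by rw [hD]; exact extD_extD (univ C) (coextObj (univ C) X)
  have hp : ∀ z, extCounit (Cobar C) C X (D z) =
      dTens (Cobar C) X (extCounit (Cobar C) C X z) + extTheta (univ C) X z := by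
    rw [hD]; exact extCounit_extD (univ C) X
  have hε : ∀ z, X.act (extCounit (Cobar C) C X (D z)) =
      dif X (X.act (extCounit (Cobar C) C X z)) := by
    rw [hD]; exact (counitHom (univ C) X).map_d
  let p := extCounit (Cobar C) C X
  let r : CobarGen C →ₗ[ℚ] C := cobarLift
    (LinearMap.id - (Coalgebra.counit (R := ℚ) (A := C)).smulRight u) (fun c hc => by
      simpa [sub_eq_zero] using eq_counit_smul hu hu1 hc)
  have hr : ∀ c, r (cobarProj C c) = c - Coalgebra.counit (R := ℚ) c • u := fun c => by simp [r]
  have hqr : ∀ v, cobarProj C (r v) = v := fun v => by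
    obtain ⟨c, rfl⟩ := cobarProj_surjective v
    rw [hr, map_sub, map_smul, cobarProj_of_mem hu, smul_zero, sub_zero]
  have hεr : ∀ v, Coalgebra.counit (R := ℚ) (r v) = 0 := fun v => by
    obtain ⟨c, rfl⟩ := cobarProj_surjective v
    rw [hr, map_sub, map_smul, hu1]; simp
  let s : Cobar C ⊗[ℚ] (CobarGen C ⊗[ℚ] X) →ₗ[ℚ] Cobar C ⊗[ℚ] (C ⊗[ℚ] X) :=
    - TensorProduct.map sgn (r.rTensor X)
  have hs1 : ∀ z, p (s z) = 0 := by
    intro z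
    induction z using TensorProduct.induction_on with
    | zero => simp
    | add x y hx hy => simp only [map_add, hx, hy, add_zero]
    | tmul a z =>
      induction z using TensorProduct.induction_on with
      | zero => simp
      | add x y hx hy => simp only [TensorProduct.tmul_add, map_add, hx, hy, add_zero]
      | tmul v x => simp [p, s, extCounit, hεr]
  have hs2 : ∀ z, extTheta (univ C) X (s z) = freeTheta X z := by
    intro z
    induction z using TensorProduct.induction_on with
    | zero => simp
    | add x y hx hy => simp only [map_add, hx, hy]
    | tmul a z =>
      induction z using TensorProduct.induction_on with
      | zero => simp
      | add x y hx hy => simp only [TensorProduct.tmul_add, map_add, hx, hy]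
      | tmul v x =>
        have hv : (univ C).toLin (r v) = TensorAlgebra.ι ℚ v := by
          change TensorAlgebra.ι ℚ (cobarProj C (r v)) = _
          rw [hqr]
        simp [s, extTheta_tmul, hv]
  have hθ : ∀ z, extTheta (univ C) X z =
      - freeTheta X (TensorProduct.map sgn ((cobarProj C).rTensor X) z) := by
    intro z
    induction z using TensorProduct.induction_on with
    | zero => simp
    | add x y hx hy => simp only [map_add, hx, hy, neg_add]
    | tmul a z =>
      induction z using TensorProduct.induction_on with
      | zero => simp
      | add x y hx hy => simp only [TensorProduct.tmul_add, map_add, hx, hy, neg_add]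
      | tmul v x => simp [extTheta_tmul, univ, univLin]
  have hrec : ∀ z, z = TensorProduct.map sgn (r.rTensor X)
      (TensorProduct.map sgn ((cobarProj C).rTensor X) z) +
      (TensorProduct.mk ℚ C X u).lTensor _ (p z) := by
    intro z
    induction z using TensorProduct.induction_on with
    | zero => simp
    | add x y hx hy => 
      simp only [map_add]
      rw [add_add_add_comm, ← hx, ← hy]
    | tmul a z =>
      induction z using TensorProduct.induction_on with
      | zero => simp
      | add x y hx hy =>
        simp only [TensorProduct.tmul_add, map_add]
        rw [add_add_add_comm, ← hx, ← hy]
      | tmul v x =>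
        simp [p, extCounit, hr, TensorProduct.sub_tmul, TensorProduct.tmul_sub,
          TensorProduct.smul_tmul]
  have hF : ∀ w : Cobar C ⊗[ℚ] X, freeTheta X (freeHtpy X w) = w - 1 ⊗ₜ X.act w := by
    intro w
    induction w using TensorProduct.induction_on with
    | zero => simp
    | add x y hx hy => simp only [map_add, hx, hy, TensorProduct.tmul_add]; abel
    | tmul a x => exact freeTheta_freeHtpy_tmul X a x
  have key : ∀ (z : Cobar C ⊗[ℚ] (C ⊗[ℚ] X)) (y : X), D z = 0 → X.act (p z) = dif X y →
      ∃ z', D z' = z ∧ y = X.act (p z') := by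
    intro z y hz hy
    have hσ : X.act (p (1 ⊗ₜ (u ⊗ₜ y))) = y := by simp [p, extCounit, hu1]
    let z₁ := z - D (1 ⊗ₜ (u ⊗ₜ y))
    have h1 : X.act (p z₁) = 0 := by
      have := hε (1 ⊗ₜ (u ⊗ₜ y))
      rw [hσ] at this
      simp only [z₁, map_sub, hy]
      rw [this, sub_self]
    have h2 : D z₁ = 0 := by simp only [z₁, map_sub, hDD, hz, sub_self]
    let w := s (freeHtpy X (p z₁))
    have h3 : p (z₁ - D w) = 0 := by
      have h : p (D w) = p z₁ := by
        refine (hp w).trans ?_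
        have : p w = 0 := hs1 _
        change dTens (Cobar C) X (p w) + _ = _
        rw [this, map_zero, zero_add, hs2, hF, h1, TensorProduct.tmul_zero, sub_zero]
      rw [map_sub, h, sub_self]
    have h4 : TensorProduct.map sgn ((cobarProj C).rTensor X) (z₁ - D w) = 0 := by
      have h : D (z₁ - D w) = 0 := by rw [map_sub, h2, hDD, sub_zero]
      have h' := hp (z₁ - D w)
      rw [h, map_zero, hθ] at h'
      change 0 = dTens (Cobar C) X (p (z₁ - D w)) + _ at h'
      rw [h3, map_zero, zero_add, eq_comm, neg_eq_zero] at h'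
      rw [← freeHtpy_freeTheta X (TensorProduct.map sgn ((cobarProj C).rTensor X) (z₁ - D w)), h',
        map_zero]
    have h5 := hrec (z₁ - D w)
    rw [h3, h4, map_zero, map_zero, add_zero] at h5
    refine ⟨w + 1 ⊗ₜ (u ⊗ₜ y), ?_, ?_⟩
    · rw [map_add, ← sub_eq_zero.1 h5]; simp [z₁]
    · rw [map_add, map_add, hσ, hs1, map_zero, zero_add]
  intro z y hz hy
  obtain ⟨z', h1, h2⟩ := key z y (by rw [hD]; exact hz) hy
  refine ⟨z', 0, by rw [hD] at h1; exact h1, ?_⟩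
  rw [map_zero, add_zero]
  exact h2

/-- The twisting term of `τ_* X` lowers the degree in `C` if `τ` vanishes on `C₀`. -/
theorem coextTwist_mem_tensorSub {A : Type u} [Ring A] [Algebra ℚ A] [DGVect A]
    (τ : TwistingChain C A) (hτ : ∀ c ∈ gr C 0, τ.toLin c = 0) (X : DGMod A) (n : ℕ)
    (z : C ⊗[ℚ] X)
    (hz : z ∈ tensorSub (⨆ i < ((n + 1 : ℕ) : ℤ), gr C i) X) :
    coextTwist τ X z ∈ tensorSub (⨆ i < (n : ℤ), gr C i) X := by
  refine mem_of_tensorSub _ _ (fun c hc x => ?_) z hz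
  rw [coextTwist_tmul]
  have hle : (⨆ i < ((n + 1 : ℕ) : ℤ), gr C i) ≤ (tensorSub (⨆ i < (n : ℤ), gr C i) X).comap
      (TensorProduct.map sgn (smulBy x ∘ₗ τ.toLin) ∘ₗ Coalgebra.comul) := by
    refine iSup₂_le fun i hi c hc => ?_
    refine Submodule.span_induction (p := fun z _ => TensorProduct.map sgn
      (smulBy x ∘ₗ τ.toLin) z ∈ tensorSub (⨆ i < (n : ℤ), gr C i) X) ?_ (by simp)
      (fun x y _ _ hx hy => by rw [map_add]; exact Submodule.add_mem _ hx hy)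
      (fun a x _ hx => by rw [map_smul]; exact Submodule.smul_mem _ _ hx)
      (DGCoalgebra.comul_mem i c hc)
    rintro _ ⟨k, l, hkl, a, ha, b, hb, rfl⟩
    rw [TensorProduct.map_tmul]
    have hz : sgn a ⊗ₜ[ℚ] (0 : X) ∈ tensorSub (⨆ i < (n : ℤ), gr C i) X := by
      rw [TensorProduct.tmul_zero]; exact Submodule.zero_mem _
    rcases lt_trichotomy l 0 with hl | rfl | hl
    · rw [TwoReduced.gr_neg l hl, Submodule.mem_bot] at hb
      rw [hb, map_zero]; exact hz
    · rw [LinearMap.comp_apply, hτ b hb, map_zero]; exact hz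
    · have hk : k < (n : ℤ) := by push_cast at hi; omega
      have h : gr C k ≤ ⨆ i < (n : ℤ), gr C i :=
        le_iSup₂_of_le (f := fun i (_ : i < (n : ℤ)) => gr C i) k hk le_rfl
      exact tmul_mem_tensorSub (h (sgn_mem ha)) _
  exact hle hc

theorem coextTwist_univ_mem (X : DGMod (Cobar C)) (n : ℕ) (z : C ⊗[ℚ] X)
    (hz : z ∈ tensorSub (⨆ i < ((n + 1 : ℕ) : ℤ), gr C i) X) :
    coextTwist (univ C) X z ∈ tensorSub (⨆ i < (n : ℤ), gr C i) X :=
  coextTwist_mem_tensorSub (univ C) univLin_zero X n z hz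

theorem exists_mem_iSup_gr_lt (x : C) : ∃ n : ℕ, x ∈ ⨆ i < (n : ℤ), gr C i := by
  have hmono : Monotone fun n : ℕ => ⨆ i < (n : ℤ), gr C i := fun m n h =>
    iSup₂_le fun i hi => le_iSup₂_of_le i (hi.trans_le (by exact_mod_cast h)) le_rfl
  refine gr_induction (p := fun x => ∃ n : ℕ, x ∈ ⨆ i < (n : ℤ), gr C i) x (fun n x hx => ?_) ?_
  · exact ⟨n.toNat + 1, Submodule.mem_iSup_of_mem n (Submodule.mem_iSup_of_mem (by omega) hx)⟩
  · rintro x y ⟨m, hx⟩ ⟨n, hy⟩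
    exact ⟨max m n, Submodule.add_mem _ (hmono (le_max_left m n) hx)
      (hmono (le_max_right m n) hy)⟩

/-- Twisted coextensions preserve quasi-isomorphisms. -/
theorem tCoext_map_quasiIso {X Y : DGMod (Cobar C)} (f : X ⟶ Y)
    (hf : QuasiIso f.toDGHom.complexMap) :
    QuasiIso ((tCoext C).map f).toDGHom.complexMap := by
  rw [quasiIso_iff_QI] at hf ⊢
  refine QI.twistedTensor f.toDGHom hf (fun n => ⨆ i < (n : ℤ), gr C i) (fun x hx => ?_)
    (fun m n h => iSup₂_le fun i hi => le_iSup₂_of_le i (hi.trans_le (by exact_mod_cast h)) le_rfl)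
    exists_mem_iSup_gr_lt (fun n x hx => ?_) (coextTwist (univ C) X) (coextTwist (univ C) Y)
    (coextTwist_univ_mem X) (coextTwist_univ_mem Y) (coextD_coextD (univ C) X)
    (coextD_coextD (univ C) Y) (fun z => ?_)
  · have : (⨆ i < ((0 : ℕ) : ℤ), gr C i) ≤ ⊥ := iSup₂_le fun i hi =>
      (TwoReduced.gr_neg (C := C) i (by simpa using hi)).le
    simpa using this hx
  · have : (⨆ i < (n : ℤ), gr C i) ≤ (⨆ i < (n : ℤ), gr C i).comap sgn :=
      iSup₂_le fun i hi x hx => Submodule.mem_iSup_of_mem i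
        (Submodule.mem_iSup_of_mem hi (sgn_mem hx))
    exact this hx
  · have h := coext_map_d (univ C) f z
    simp only [coextD, LinearMap.add_apply, map_add] at h
    have h' := dTens_map (⟨LinearMap.id, fun _ _ h => h, fun _ => rfl⟩ : DGHom C C) f.toDGHom z
    change f.toLin.lTensor C (dTens C X z) = dTens C Y (f.toLin.lTensor C z) at h'
    rw [h'] at h
    exact add_left_cancel h

end CounitQuasiIso

section TensorQuasiIso

variable {V : Type u} [AddCommGroup V] [Module ℚ V] {W : Type u} [AddCommGroup W] [Module ℚ W]

@[simp] theorem swap_swap [GrVect V] [GrVect W] (z : V ⊗[ℚ] W) : swap W V (swap V W z) = z := by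
  induction z using TensorProduct.induction_on with
  | zero => simp
  | add x y hx hy => simp only [map_add, hx, hy]
  | tmul v w =>
    simp only [swap_tmul, map_smul, map_add, map_sub, sgn_sgn]
    module

variable [DGVect V] [DGVect W] (U : Type u) [AddCommGroup U] [Module ℚ U] [DGVect U]

theorem QI.lTensor (f : DGHom V W) (hf : QI (dif V) (dif W) f.toLin) :
    QI (dTens U V) (dTens U W) (f.toLin.lTensor U) := by
  have h := QI.twistedTensor (U := U) f hf (fun n => if n = 0 then ⊥ else ⊤)
    (fun x hx => by simpa using hx) (fun m n h => by
      by_cases hm : m = 0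
      · simp [hm]
      · simp [hm, show n ≠ 0 by omega])
    (fun x => ⟨1, by simp⟩) (fun n x hx => by
      by_cases hn : n = 0
      · simp only [hn, if_true, Submodule.mem_bot] at hx
        simp [hx]
      · simp [hn]) 0 0
    (fun n z hz => Submodule.zero_mem _) (fun n z hz => Submodule.zero_mem _)
    (fun z => by simp [dTens_dTens]) (fun z => by simp [dTens_dTens]) (fun z => by simp)
  rwa [add_zero, add_zero] at h

theorem QI.rTensor (f : DGHom V W) (hf : QI (dif V) (dif W) f.toLin) :
    QI (dTens V U) (dTens W U) (f.toLin.rTensor U) := by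
  have hs : ∀ z, swap W U (f.toLin.rTensor U z) = f.toLin.lTensor U (swap V U z) :=
    swap_map f.toLin LinearMap.id f.map_mem (fun _ _ h => h)
  intro x y hx hxy
  obtain ⟨x', y', h1, h2⟩ := QI.lTensor U f hf (swap V U x) (swap W U y)
    (by rw [← dTens_swap, hx, map_zero]) (by rw [← hs, hxy, dTens_swap])
  refine ⟨swap U V x', swap U W y', by rw [← dTens_swap, h1, swap_swap], ?_⟩
  have h3 : swap U W (f.toLin.lTensor U x') = f.toLin.rTensor U (swap U V x') :=
    swap_map LinearMap.id f.toLin (fun _ _ h => h) f.map_mem x'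
  rw [← dTens_swap, ← h3, ← map_add, ← h2, swap_swap]

end TensorQuasiIso

/-! ### The tensor product of modules over the cobar construction -/

section CobarMod

variable {C : Type u} [AddCommGroup C] [Module ℚ C] [Coalgebra ℚ C] [DGVect C] [DGCoalgebra C]
  [TwoReduced C]

open TensorAlgebra

theorem dif_univLin (c : C) : dif (Cobar C) (univLin C c) =
    - univLin C (dif C c) - cobarQuad C (Coalgebra.comul c) :=
  derivExt_univLin c

/-- The `ΩC`-module determined by the action of the generators. -/
def cobarMod (X : Type u) [AddCommGroup X] [Module ℚ X] [DGVect X]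
    (θ : CobarGen C →ₗ[ℚ] Module.End ℚ X)
    (hmem : ∀ m n, ∀ v ∈ gr (CobarGen C) m, ∀ x ∈ gr X n, θ v x ∈ gr X (m + n))
    (hd : ∀ (c : C) (x : X), dif X (θ (cobarProj C c) x) =
      - θ (cobarProj C (dif C c)) x -
      LinearMap.mul' ℚ (Module.End ℚ X) (TensorProduct.map (θ ∘ₗ cobarProj C ∘ₗ sgn)
        (θ ∘ₗ cobarProj C) (Coalgebra.comul c)) x - θ (cobarProj C (sgn c)) (dif X x)) :
    DGMod (Cobar C) where
  carrier := X
  moduleAlg := Module.compHom X (TensorAlgebra.lift ℚ θ).toRingHom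
  tower :=
    letI : Module (Cobar C) X := Module.compHom X (TensorAlgebra.lift ℚ θ).toRingHom
    ⟨fun r a x => by
      change TensorAlgebra.lift ℚ θ (r • a) x = r • TensorAlgebra.lift ℚ θ a x
      rw [map_smul]; rfl⟩
  smul_mem m n a ha x hx := by
    change TensorAlgebra.lift ℚ θ a x ∈ gr X (m + n)
    refine Submodule.span_induction
      (p := fun a _ => TensorAlgebra.lift ℚ θ a x ∈ gr X (m + n))
      (fun a hm => ?_) (by simp) (fun a b _ _ ha hb => ?_) (fun r a _ ha => ?_) ha
    · clear ha
      induction hm with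
      | one => simpa using hx
      | mul m k v a hv _ ih =>
        rw [map_mul, TensorAlgebra.lift_ι_apply, Module.End.mul_apply, add_assoc]
        exact hmem m _ v hv _ ih
    · rw [map_add]; exact Submodule.add_mem _ ha hb
    · rw [map_smul]; exact Submodule.smul_mem _ _ ha
  d_smul a x := by
    change dif X (TensorAlgebra.lift ℚ θ a x) = TensorAlgebra.lift ℚ θ (derivExt (cobarDiffGen C) a) x +
      TensorAlgebra.lift ℚ θ (sgn a) (dif X x)
    revert x
    induction a using TensorAlgebra.induction with
    | algebraMap r =>
      intro x
      rw [tensorAlg_sgn_algebraMap, derivExt_algebraMap, map_zero, AlgHom.commutes]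
      simp
    | ι v =>
      intro x
      obtain ⟨c, rfl⟩ := cobarProj_surjective v
      have h1 : ∀ w : C ⊗[ℚ] C, TensorAlgebra.lift ℚ θ (cobarQuad C w) =
          LinearMap.mul' ℚ (Module.End ℚ X) (TensorProduct.map (θ ∘ₗ cobarProj C ∘ₗ sgn)
            (θ ∘ₗ cobarProj C) w) := by
        intro w
        induction w using TensorProduct.induction_on with
        | zero => simp
        | add x y hx hy => simp only [map_add, hx, hy]
        | tmul a b =>
          rw [cobarQuad_tmul, map_mul, univLin, LinearMap.comp_apply, LinearMap.comp_apply,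
            TensorAlgebra.lift_ι_apply, TensorAlgebra.lift_ι_apply]
          rfl
      have h2 : sgn (cobarProj C c) = - cobarProj C (sgn c) := by
        rw [sgn_map_neg (cobarProj C) (fun n x hx => cobarProj_mem hx), neg_neg]
      have h3 := derivExt_univLin c
      rw [cobarDiffLin_apply] at h3
      rw [TensorAlgebra.lift_ι_apply, hd, tensorAlg_sgn_ι, TensorAlgebra.lift_ι_apply, h2]
      change _ = TensorAlgebra.lift ℚ θ (derivExt (cobarDiffGen C) (univLin C c)) x + _
      rw [h3, map_sub, map_neg, h1, univLin, LinearMap.comp_apply, TensorAlgebra.lift_ι_apply,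
        map_neg]
      simp only [LinearMap.sub_apply, LinearMap.neg_apply]
      abel
    | mul a b ha hb =>
      intro x
      rw [derivExt_mul, tensorAlg_sgn_mul]
      simp only [map_mul, map_add, Module.End.mul_apply, LinearMap.add_apply, ha, hb]
      abel
    | add a b ha hb =>
      intro x
      simp only [map_add, LinearMap.add_apply, ha, hb]
      abel

theorem cobarMod_smul (X : Type u) [AddCommGroup X] [Module ℚ X] [DGVect X]
    (θ : CobarGen C →ₗ[ℚ] Module.End ℚ X)
    (hmem : ∀ m n, ∀ v ∈ gr (CobarGen C) m, ∀ x ∈ gr X n, θ v x ∈ gr X (m + n)) (hd)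
    (v : CobarGen C) (x : cobarMod X θ hmem hd) :
    (ι ℚ v : Cobar C) • x = θ v x := by
  change TensorAlgebra.lift ℚ θ (ι ℚ v) x = θ v x
  rw [TensorAlgebra.lift_ι_apply]

/-- A chain map between `ΩC`-modules is linear if it commutes with the generators. -/
def cobarHom {X Y : DGMod (Cobar C)} (f : DGHom X Y)
    (h : ∀ (v : CobarGen C) (x : X), f.toLin ((ι ℚ v : Cobar C) • x) =
      (ι ℚ v : Cobar C) • f.toLin x) : X ⟶ Y where
  toDGHom := f
  map_smul a := by
    induction a using TensorAlgebra.induction with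
    | algebraMap r => intro x; simp [algebraMap_smul]
    | ι v => exact h v
    | mul a b ha hb => intro x; rw [mul_smul, ha, hb, mul_smul]
    | add a b ha hb => intro x; rw [add_smul, map_add, ha, hb, add_smul]

theorem DGMod.sgn_smul {A : Type u} [Ring A] [Algebra ℚ A] [DGVect A] (X : DGMod A) (a : A)
    (x : X) : sgn (a • x) = sgn a • sgn x := by
  refine gr_induction (p := fun a => sgn (a • x) = sgn a • sgn x) a
    (fun i v hv => ?_) (fun a b hx hy => by simp [add_smul, hx, hy])
  refine gr_induction (p := fun x => sgn (v • x) = sgn v • sgn x) x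
    (fun j w hw => ?_) (fun x y hx hy => by simp [smul_add, hx, hy])
  rw [sgn_of_mem (X.smul_mem i j v hv w hw), sgn_of_mem hv, sgn_of_mem hw,
    Int.negOnePow_add]
  rcases Int.even_or_odd i with hi | hi <;> rcases Int.even_or_odd j with hj | hj <;>
    simp [hi, hj, Int.negOnePow_even, Int.negOnePow_odd]

/-- The action of a generator. -/
def genAct (X : DGMod (Cobar C)) : CobarGen C →ₗ[ℚ] Module.End ℚ X :=
  (Algebra.lsmul ℚ ℚ (X : Type u)).toLinearMap ∘ₗ ι ℚ

theorem genAct_apply (X : DGMod (Cobar C)) (v : CobarGen C) (x : X) :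
    genAct X v x = (ι ℚ v : Cobar C) • x := rfl

theorem genAct_mem (X : DGMod (Cobar C)) (m n : ℤ) (v : CobarGen C) (hv : v ∈ gr (CobarGen C) m)
    (x : X) (hx : x ∈ gr X n) : genAct X v x ∈ gr X (m + n) :=
  X.smul_mem m n _ (tensorAlg_ι_mem hv) x hx

theorem sgn_genAct (X : DGMod (Cobar C)) (v : CobarGen C) (x : X) :
    sgn (genAct X v x) = genAct X (sgn v) (sgn x) := by
  rw [genAct_apply, X.sgn_smul, tensorAlg_sgn_ι]; rfl

theorem dif_genAct (X : DGMod (Cobar C)) (c : C) (x : X) :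
    dif X (genAct X (cobarProj C c) x) = - genAct X (cobarProj C (dif C c)) x -
      LinearMap.mul' ℚ (Module.End ℚ X) (TensorProduct.map (genAct X ∘ₗ cobarProj C ∘ₗ sgn)
        (genAct X ∘ₗ cobarProj C) (Coalgebra.comul c)) x -
      genAct X (cobarProj C (sgn c)) (dif X x) := by
  have h1 : ∀ w : C ⊗[ℚ] C, cobarQuad C w • x =
      LinearMap.mul' ℚ (Module.End ℚ X) (TensorProduct.map (genAct X ∘ₗ cobarProj C ∘ₗ sgn)
        (genAct X ∘ₗ cobarProj C) w) x := by
    intro w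
    induction w using TensorProduct.induction_on with
    | zero => simp
    | add x y hx hy => simp only [map_add, add_smul, hx, hy, LinearMap.add_apply]
    | tmul a b => rw [cobarQuad_tmul, mul_smul]; rfl
  have h2 : ∀ c : C, genAct X (cobarProj C c) x = univLin C c • x := fun c => rfl
  rw [h2, X.d_smul, dif_univLin, sgn_univLin, sub_smul, h1, neg_smul, neg_smul, ← sub_eq_add_neg]
  rfl

end CobarMod

section TensorMod

variable {C : Type u} [AddCommGroup C] [Module ℚ C] [Coalgebra ℚ C] [DGVect C] [DGCoalgebra C]
  [TwoReduced C]

/-- The action `x ⊗ y ↦ v x ⊗ y + (-1)^{|v| |x|} x ⊗ v y` of a generator `v` on `X ⊗ Y`. -/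
def tensorAct (X Y : DGMod (Cobar C)) : CobarGen C →ₗ[ℚ] Module.End ℚ (X ⊗[ℚ] Y) :=
  LinearMap.rTensorHom (R := ℚ) (Y : Type u) ∘ₗ genAct X +
    (2⁻¹ : ℚ) • (TensorProduct.mapBilinear (RingHom.id ℚ) (X : Type u) (Y : Type u) (X : Type u)
        (Y : Type u) (LinearMap.id + sgn) ∘ₗ genAct Y +
      TensorProduct.mapBilinear (RingHom.id ℚ) (X : Type u) (Y : Type u) (X : Type u) (Y : Type u)
        (LinearMap.id - sgn) ∘ₗ genAct Y ∘ₗ sgn)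

theorem tensorAct_tmul (X Y : DGMod (Cobar C)) (v : CobarGen C) (x : X) (y : Y) :
    tensorAct X Y v (x ⊗ₜ y) = genAct X v x ⊗ₜ y + (2⁻¹ : ℚ) • ((x + sgn x) ⊗ₜ genAct Y v y +
      (x - sgn x) ⊗ₜ genAct Y (sgn v) y) := rfl

theorem tensorAct_tmul_even (X Y : DGMod (Cobar C)) (v : CobarGen C) {x : X} (hx : sgn x = x)
    (y : Y) : tensorAct X Y v (x ⊗ₜ y) = genAct X v x ⊗ₜ y + x ⊗ₜ genAct Y v y := by
  rw [tensorAct_tmul, hx, TensorProduct.add_tmul, sub_self, TensorProduct.zero_tmul]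
  module

theorem tensorAct_tmul_odd (X Y : DGMod (Cobar C)) (v : CobarGen C) {x : X} (hx : sgn x = -x)
    (y : Y) : tensorAct X Y v (x ⊗ₜ y) = genAct X v x ⊗ₜ y + x ⊗ₜ genAct Y (sgn v) y := by
  rw [tensorAct_tmul, hx, add_neg_cancel, sub_neg_eq_add, TensorProduct.add_tmul,
    TensorProduct.zero_tmul]
  module

theorem parity_induction {V : Type u} [AddCommGroup V] [Module ℚ V] [GrVect V] {p : V → Prop}
    (x : V) (even : ∀ x, sgn x = x → p x) (odd : ∀ x, sgn x = -x → p x)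
    (add : ∀ x y, p x → p y → p (x + y)) : p x := by
  refine gr_induction x (fun n x hx => ?_) add
  rcases Int.even_or_odd n with hn | hn
  · exact even x (by rw [sgn_of_mem hx, Int.negOnePow_even _ hn, one_smul])
  · exact odd x (by rw [sgn_of_mem hx, Int.negOnePow_odd _ hn, Units.neg_smul, one_smul])

theorem tensorAct_mem (X Y : DGMod (Cobar C)) (m n : ℤ) (v : CobarGen C)
    (hv : v ∈ gr (CobarGen C) m) (z : X ⊗[ℚ] Y) (hz : z ∈ gr (X ⊗[ℚ] Y) n) :
    tensorAct X Y v z ∈ gr (X ⊗[ℚ] Y) (m + n) := by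
  rw [add_comm]
  refine tensor_degree (tensorAct X Y v) m (fun i j x hx y hy => ?_) n z hz
  rw [tensorAct_tmul]
  refine Submodule.add_mem _ (tmul_mem (by ring) (genAct_mem X m i v hv x hx) hy)
    (Submodule.smul_mem _ _ (Submodule.add_mem _ ?_ ?_))
  · exact tmul_mem (by ring) (Submodule.add_mem _ hx (sgn_mem hx)) (genAct_mem Y m j v hv y hy)
  · exact tmul_mem (by ring) (Submodule.sub_mem _ hx (sgn_mem hx))
      (genAct_mem Y m j _ (sgn_mem hv) y hy)

theorem sgn_cobarProj (c : C) : sgn (cobarProj C c) = - cobarProj C (sgn c) := by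
  rw [sgn_map_neg (cobarProj C) (fun n x hx => cobarProj_mem hx), neg_neg]

/-- The cross terms of the action of a product of two generators. -/
def tensorCross (X Y : DGMod (Cobar C)) (x : X) (y : Y) : C ⊗[ℚ] C →ₗ[ℚ] X ⊗[ℚ] Y :=
  TensorProduct.map ((genAct X).flip x ∘ₗ cobarProj C ∘ₗ sgn)
    ((genAct Y).flip y ∘ₗ cobarProj C)

theorem tensorAct_quad_even [GradedCocomm C] (X Y : DGMod (Cobar C)) (c : C) {x : X}
    (hx : sgn x = x) (y : Y) :
    LinearMap.mul' ℚ (Module.End ℚ (X ⊗[ℚ] Y)) (TensorProduct.map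
      (tensorAct X Y ∘ₗ cobarProj C ∘ₗ sgn) (tensorAct X Y ∘ₗ cobarProj C)
        (Coalgebra.comul c)) (x ⊗ₜ y) =
      LinearMap.mul' ℚ (Module.End ℚ X) (TensorProduct.map (genAct X ∘ₗ cobarProj C ∘ₗ sgn)
        (genAct X ∘ₗ cobarProj C) (Coalgebra.comul c)) x ⊗ₜ y +
      x ⊗ₜ LinearMap.mul' ℚ (Module.End ℚ Y) (TensorProduct.map (genAct Y ∘ₗ cobarProj C ∘ₗ sgn)
        (genAct Y ∘ₗ cobarProj C) (Coalgebra.comul c)) y := by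
  have h : ∀ w : C ⊗[ℚ] C, LinearMap.mul' ℚ (Module.End ℚ (X ⊗[ℚ] Y)) (TensorProduct.map
      (tensorAct X Y ∘ₗ cobarProj C ∘ₗ sgn) (tensorAct X Y ∘ₗ cobarProj C)
        w) (x ⊗ₜ y) =
      LinearMap.mul' ℚ (Module.End ℚ X) (TensorProduct.map (genAct X ∘ₗ cobarProj C ∘ₗ sgn)
        (genAct X ∘ₗ cobarProj C) w) x ⊗ₜ y +
      x ⊗ₜ LinearMap.mul' ℚ (Module.End ℚ Y) (TensorProduct.map (genAct Y ∘ₗ cobarProj C ∘ₗ sgn)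
        (genAct Y ∘ₗ cobarProj C) w) y +
      (tensorCross X Y x y w - tensorCross X Y x y (swap C C w)) := by
    intro w
    induction w using TensorProduct.induction_on with
    | zero => simp
    | add a b ha hb =>
      simp only [map_add, LinearMap.add_apply, TensorProduct.add_tmul, TensorProduct.tmul_add,
        ha, hb]
      abel
    | tmul a b =>
      refine parity_induction (p := fun b => LinearMap.mul' ℚ (Module.End ℚ (X ⊗[ℚ] Y)) (TensorProduct.map
      (tensorAct X Y ∘ₗ cobarProj C ∘ₗ sgn) (tensorAct X Y ∘ₗ cobarProj C)
        (a ⊗ₜ b)) (x ⊗ₜ y) =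
      LinearMap.mul' ℚ (Module.End ℚ X) (TensorProduct.map (genAct X ∘ₗ cobarProj C ∘ₗ sgn)
        (genAct X ∘ₗ cobarProj C) (a ⊗ₜ b)) x ⊗ₜ y +
      x ⊗ₜ LinearMap.mul' ℚ (Module.End ℚ Y) (TensorProduct.map (genAct Y ∘ₗ cobarProj C ∘ₗ sgn)
        (genAct Y ∘ₗ cobarProj C) (a ⊗ₜ b)) y +
      (tensorCross X Y x y (a ⊗ₜ b) - tensorCross X Y x y (swap C C (a ⊗ₜ b)))) b
        (fun b hb => ?_) (fun b hb => ?_) (fun b b' hb hb' => ?_)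
      · have hp : sgn (genAct X (cobarProj C b) x) = - genAct X (cobarProj C b) x := by
          rw [sgn_genAct, sgn_cobarProj, hb, hx]; simp
        simp only [TensorProduct.map_tmul, LinearMap.mul'_apply, LinearMap.comp_apply,
          Module.End.mul_apply, tensorAct_tmul_even X Y _ hx, map_add,
          tensorAct_tmul_odd X Y _ hp, tensorCross, swap_tmul, hb, map_smul, map_sub,
          LinearMap.flip_apply, sgn_cobarProj, sgn_sgn, map_neg, LinearMap.neg_apply,
          TensorProduct.tmul_neg]
        module
      · have hp : sgn (genAct X (cobarProj C b) x) = genAct X (cobarProj C b) x := by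
          rw [sgn_genAct, sgn_cobarProj, hb, hx]; simp
        simp only [TensorProduct.map_tmul, LinearMap.mul'_apply, LinearMap.comp_apply,
          Module.End.mul_apply, tensorAct_tmul_even X Y _ hx, map_add,
          tensorAct_tmul_even X Y _ hp, tensorCross, swap_tmul, hb, map_smul, map_sub,
          LinearMap.flip_apply, map_neg, TensorProduct.neg_tmul]
        module
      · simp only [TensorProduct.tmul_add, map_add, LinearMap.add_apply, TensorProduct.add_tmul,
          hb, hb']
        abel
  rw [h, GradedCocomm.swap_comul, sub_self, add_zero]

theorem tensorAct_quad_odd [GradedCocomm C] (X Y : DGMod (Cobar C)) (c : C) {x : X}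
    (hx : sgn x = -x) (y : Y) :
    LinearMap.mul' ℚ (Module.End ℚ (X ⊗[ℚ] Y)) (TensorProduct.map
      (tensorAct X Y ∘ₗ cobarProj C ∘ₗ sgn) (tensorAct X Y ∘ₗ cobarProj C)
        (Coalgebra.comul c)) (x ⊗ₜ y) =
      LinearMap.mul' ℚ (Module.End ℚ X) (TensorProduct.map (genAct X ∘ₗ cobarProj C ∘ₗ sgn)
        (genAct X ∘ₗ cobarProj C) (Coalgebra.comul c)) x ⊗ₜ y +
      x ⊗ₜ LinearMap.mul' ℚ (Module.End ℚ Y) (TensorProduct.map (genAct Y ∘ₗ cobarProj C ∘ₗ sgn)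
        (genAct Y ∘ₗ cobarProj C) (Coalgebra.comul (sgn c))) y := by
  have h : ∀ w : C ⊗[ℚ] C, LinearMap.mul' ℚ (Module.End ℚ (X ⊗[ℚ] Y)) (TensorProduct.map
      (tensorAct X Y ∘ₗ cobarProj C ∘ₗ sgn) (tensorAct X Y ∘ₗ cobarProj C)
        w) (x ⊗ₜ y) =
      LinearMap.mul' ℚ (Module.End ℚ X) (TensorProduct.map (genAct X ∘ₗ cobarProj C ∘ₗ sgn)
        (genAct X ∘ₗ cobarProj C) w) x ⊗ₜ y +
      x ⊗ₜ LinearMap.mul' ℚ (Module.End ℚ Y) (TensorProduct.map (genAct Y ∘ₗ cobarProj C ∘ₗ sgn)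
        (genAct Y ∘ₗ cobarProj C) (sgn w)) y +
      (tensorCross X Y x y (sgn.lTensor C (swap C C w)) - tensorCross X Y x y (sgn.lTensor C w)) := by
    intro w
    induction w using TensorProduct.induction_on with
    | zero => simp
    | add a b ha hb =>
      simp only [map_add, LinearMap.add_apply, TensorProduct.add_tmul, TensorProduct.tmul_add,
        ha, hb]
      abel
    | tmul a b =>
      refine parity_induction (p := fun b => LinearMap.mul' ℚ (Module.End ℚ (X ⊗[ℚ] Y)) (TensorProduct.map
      (tensorAct X Y ∘ₗ cobarProj C ∘ₗ sgn) (tensorAct X Y ∘ₗ cobarProj C)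
        (a ⊗ₜ b)) (x ⊗ₜ y) =
      LinearMap.mul' ℚ (Module.End ℚ X) (TensorProduct.map (genAct X ∘ₗ cobarProj C ∘ₗ sgn)
        (genAct X ∘ₗ cobarProj C) (a ⊗ₜ b)) x ⊗ₜ y +
      x ⊗ₜ LinearMap.mul' ℚ (Module.End ℚ Y) (TensorProduct.map (genAct Y ∘ₗ cobarProj C ∘ₗ sgn)
        (genAct Y ∘ₗ cobarProj C) (sgn (a ⊗ₜ b))) y +
      (tensorCross X Y x y (sgn.lTensor C (swap C C (a ⊗ₜ b))) -
        tensorCross X Y x y (sgn.lTensor C (a ⊗ₜ b)))) b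
        (fun b hb => ?_) (fun b hb => ?_) (fun b b' hb hb' => ?_)
      · have hp : sgn (genAct X (cobarProj C b) x) = genAct X (cobarProj C b) x := by
          rw [sgn_genAct, sgn_cobarProj, hb, hx]; simp
        simp only [TensorProduct.map_tmul, LinearMap.mul'_apply, LinearMap.comp_apply,
          Module.End.mul_apply, tensorAct_tmul_odd X Y _ hx, map_add, sgn_tmul,
          tensorAct_tmul_even X Y _ hp, tensorCross, swap_tmul, hb, map_smul, map_sub,
          LinearMap.flip_apply, sgn_cobarProj, sgn_sgn, map_neg, LinearMap.neg_apply,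
          TensorProduct.tmul_neg, LinearMap.lTensor_tmul]
        module
      · have hp : sgn (genAct X (cobarProj C b) x) = - genAct X (cobarProj C b) x := by
          rw [sgn_genAct, sgn_cobarProj, hb, hx]; simp
        simp only [TensorProduct.map_tmul, LinearMap.mul'_apply, LinearMap.comp_apply,
          Module.End.mul_apply, tensorAct_tmul_odd X Y _ hx, map_add, sgn_tmul,
          tensorAct_tmul_odd X Y _ hp, tensorCross, swap_tmul, hb, map_smul, map_sub,
          LinearMap.flip_apply, sgn_cobarProj, sgn_sgn, map_neg, LinearMap.neg_apply,
          TensorProduct.tmul_neg, TensorProduct.neg_tmul, LinearMap.lTensor_tmul]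
        module
      · simp only [TensorProduct.tmul_add, map_add, LinearMap.add_apply, TensorProduct.add_tmul,
          hb, hb']
        abel
  rw [h, GradedCocomm.swap_comul, sgn_comul, sub_self, add_zero]


theorem dTens_tensorAct [GradedCocomm C] (X Y : DGMod (Cobar C)) (c : C) (z : X ⊗[ℚ] Y) :
    dTens X Y (tensorAct X Y (cobarProj C c) z) =
      - tensorAct X Y (cobarProj C (dif C c)) z -
      LinearMap.mul' ℚ (Module.End ℚ (X ⊗[ℚ] Y)) (TensorProduct.map
        (tensorAct X Y ∘ₗ cobarProj C ∘ₗ sgn) (tensorAct X Y ∘ₗ cobarProj C)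
        (Coalgebra.comul c)) z - tensorAct X Y (cobarProj C (sgn c)) (dTens X Y z) := by
  induction z using TensorProduct.induction_on with
  | zero => simp
  | add x y hx hy => simp only [map_add, hx, hy]; abel
  | tmul x y =>
    refine parity_induction (p := fun x => dTens X Y (tensorAct X Y (cobarProj C c) (x ⊗ₜ y)) =
      - tensorAct X Y (cobarProj C (dif C c)) (x ⊗ₜ y) -
      LinearMap.mul' ℚ (Module.End ℚ (X ⊗[ℚ] Y)) (TensorProduct.map
        (tensorAct X Y ∘ₗ cobarProj C ∘ₗ sgn) (tensorAct X Y ∘ₗ cobarProj C)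
        (Coalgebra.comul c)) (x ⊗ₜ y) -
      tensorAct X Y (cobarProj C (sgn c)) (dTens X Y (x ⊗ₜ y))) x
        (fun x hx => ?_) (fun x hx => ?_) (fun x x' hx hx' => ?_)
    · have hd : sgn (dif X x) = - dif X x := by
        have := dif_sgn x
        rw [hx] at this
        exact neg_eq_iff_eq_neg.1 this.symm
      rw [tensorAct_quad_even X Y c hx]
      simp only [tensorAct_tmul_even X Y _ hx, dTens_tmul, map_add, hx,
        tensorAct_tmul_odd X Y _ hd, dif_genAct, sgn_genAct, sgn_cobarProj, sgn_sgn,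
        map_neg, LinearMap.neg_apply, TensorProduct.tmul_neg, TensorProduct.neg_tmul,
        TensorProduct.sub_tmul, TensorProduct.tmul_sub]
      abel
    · have hd : sgn (dif X x) = dif X x := by
        have := dif_sgn x
        rw [hx, map_neg, neg_inj] at this
        exact this.symm
      rw [tensorAct_quad_odd X Y c hx]
      simp only [tensorAct_tmul_odd X Y _ hx, dTens_tmul, map_add, hx,
        tensorAct_tmul_even X Y _ hd, dif_genAct, sgn_genAct, sgn_cobarProj, sgn_sgn,
        map_neg, LinearMap.neg_apply, TensorProduct.tmul_neg, TensorProduct.neg_tmul,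
        TensorProduct.sub_tmul, TensorProduct.tmul_sub, dif_sgn]
      abel
    · simp only [TensorProduct.add_tmul, map_add, hx, hx']
      abel

/-- The tensor product of modules over the cobar construction of a cocommutative coalgebra. -/
def tensorMod [GradedCocomm C] (X Y : DGMod (Cobar C)) : DGMod (Cobar C) :=
  letI : DGVect (X ⊗[ℚ] Y) := { d := dTens X Y, d_mem := dTens_mem, d_d := dTens_dTens }
  cobarMod (X ⊗[ℚ] Y) (tensorAct X Y) (tensorAct_mem X Y) (dTens_tensorAct X Y)

theorem tensorMod_smul [GradedCocomm C] (X Y : DGMod (Cobar C)) (v : CobarGen C)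
    (z : tensorMod X Y) : (TensorAlgebra.ι ℚ v : Cobar C) • z = tensorAct X Y v z :=
  letI : DGVect (X ⊗[ℚ] Y) := { d := dTens X Y, d_mem := dTens_mem, d_d := dTens_dTens }
  cobarMod_smul (X ⊗[ℚ] Y) (tensorAct X Y) (tensorAct_mem X Y) (dTens_tensorAct X Y) v z

end TensorMod

section Iso

/-- A bijective morphism of dg modules is an isomorphism. -/
theorem DGMod.isIso_of_bijective {A : Type u} [Ring A] [Algebra ℚ A] [DGVect A] {X Y : DGMod A}
    (f : X ⟶ Y) (hf : Function.Bijective f.toLin) : IsIso f := by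
  let e := LinearEquiv.ofBijective f.toLin hf
  have he' : ∀ x, f.toLin (e.symm x) = x := e.apply_symm_apply
  let g : Y ⟶ X :=
    { toLin := e.symm
      map_mem := fun n y hy => mem_of_injective f.toLin f.map_mem hf.1 n _ (by
        change f.toLin (e.symm y) ∈ _
        rwa [he'])
      map_d := fun y => hf.1 (by
        rw [f.map_d]
        change f.toLin (e.symm _) = dif Y (f.toLin (e.symm y))
        rw [he', he'])
      map_smul := fun a y => hf.1 (by
        rw [f.map_smul]
        change f.toLin (e.symm _) = a • (f.toLin (e.symm y))
        rw [he', he']) }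
  exact ⟨g, DGMod.Hom.ext (LinearMap.ext e.symm_apply_apply), DGMod.Hom.ext (LinearMap.ext he')⟩

/-- A bijective morphism of dg comodules is an isomorphism. -/
theorem DGComod.isIso_of_bijective {C : Type u} [AddCommGroup C] [Module ℚ C] [Coalgebra ℚ C]
    [DGVect C] {X Y : DGComod C} (f : X ⟶ Y) (hf : Function.Bijective f.toLin) : IsIso f := by
  let e := LinearEquiv.ofBijective f.toLin hf
  have he' : ∀ x, f.toLin (e.symm x) = x := e.apply_symm_apply
  have hge : (e.symm : Y →ₗ[ℚ] X) ∘ₗ f.toLin = LinearMap.id := LinearMap.ext e.symm_apply_apply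
  let g : Y ⟶ X :=
    { toLin := e.symm
      map_mem := fun n y hy => mem_of_injective f.toLin f.map_mem hf.1 n _ (by
        change f.toLin (e.symm y) ∈ _
        rwa [he'])
      map_d := fun y => hf.1 (by
        rw [f.map_d]
        change f.toLin (e.symm _) = dif Y (f.toLin (e.symm y))
        rw [he', he'])
      map_coact := fun y => by
        obtain ⟨x, rfl⟩ := hf.2 y
        have h1 : (e.symm : Y →ₗ[ℚ] X) (f.toLin x) = x := LinearMap.congr_fun hge x
        rw [h1, f.map_coact, ← LinearMap.lTensor_comp_apply, hge, LinearMap.lTensor_id]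
        rfl }
  exact ⟨g, DGComod.Hom.ext hge, DGComod.Hom.ext (LinearMap.ext he')⟩

end Iso

section Monoidal

variable {C : Type u} [AddCommGroup C] [Module ℚ C] [Coalgebra ℚ C] [DGVect C] [DGCoalgebra C]
  [TwoReduced C] [GradedCocomm C]

/-- The tensor product of morphisms. -/
def tensorModMap {X X' Y Y' : DGMod (Cobar C)} (f : X ⟶ X') (g : Y ⟶ Y') :
    tensorMod X Y ⟶ tensorMod X' Y' :=
  cobarHom (X := tensorMod X Y) (Y := tensorMod X' Y')
    { toLin := TensorProduct.map f.toLin g.toLin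
      map_mem := fun n x hx => by
        have := map_mem f.toLin g.toLin 0 0 (by simpa using f.map_mem) (by simpa using g.map_mem)
          n x hx
        rw [show n + (0 + 0) = n by ring] at this
        exact this
      map_d := dTens_map f.toDGHom g.toDGHom }
    (fun v z => by
      have hf : ∀ v x, f.toLin (genAct X v x) = genAct X' v (f.toLin x) := fun v => f.map_smul _
      have hg : ∀ v x, g.toLin (genAct Y v x) = genAct Y' v (g.toLin x) := fun v => g.map_smul _
      have key : ∀ z : X ⊗[ℚ] Y, TensorProduct.map f.toLin g.toLin (tensorAct X Y v z) =
          tensorAct X' Y' v (TensorProduct.map f.toLin g.toLin z) := by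
        intro z
        induction z using TensorProduct.induction_on with
        | zero => simp
        | add x y hx hy => simp only [map_add, hx, hy]
        | tmul x y =>
          simp only [tensorAct_tmul, map_add, map_smul, TensorProduct.map_tmul, hf, hg, map_sub,
            sgn_map f.toLin f.map_mem]
      rw [tensorMod_smul, tensorMod_smul]
      exact key z)

/-- The unit module `ℚ`. -/
def unitMod (C : Type u) [AddCommGroup C] [Module ℚ C] [Coalgebra ℚ C] [DGVect C]
    [DGCoalgebra C] [TwoReduced C] : DGMod (Cobar C) :=
  letI : DGVect (ULift.{u} ℚ) :=
    { piece := fun n => if n = 0 then ⊤ else ⊥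
      isInternal := isInternal_of_split _ (Finsupp.lsingle 0) (fun n x hx => by
          by_cases hn : n = 0
          · subst hn; rfl
          · simp only [hn, if_false, Submodule.mem_bot] at hx
            simp [hx])
        (eq_top_iff.2 (le_iSup_of_le 0 (by simp)))
      d := 0
      d_mem := fun _ _ _ => Submodule.zero_mem _
      d_d := fun _ => rfl }
  cobarMod (ULift.{u} ℚ) 0 (fun _ _ _ _ _ _ => Submodule.zero_mem _) (fun c x => by
    have h : TensorProduct.map ((0 : CobarGen C →ₗ[ℚ] Module.End ℚ (ULift.{u} ℚ)) ∘ₗ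
        cobarProj C ∘ₗ sgn) ((0 : CobarGen C →ₗ[ℚ] Module.End ℚ (ULift.{u} ℚ)) ∘ₗ
        cobarProj C) = 0 := by
      rw [LinearMap.zero_comp, TensorProduct.map_zero_left]
    rw [h]
    simp)

theorem unitMod_smul (v : CobarGen C) (r : unitMod C) :
    (TensorAlgebra.ι ℚ v : Cobar C) • r = 0 := by
  change (TensorAlgebra.lift ℚ (0 : CobarGen C →ₗ[ℚ] Module.End ℚ (ULift.{u} ℚ))
    (TensorAlgebra.ι ℚ v)) r = 0
  rw [TensorAlgebra.lift_ι_apply]; rfl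

theorem unitMod_mem_zero (r : unitMod C) : r ∈ gr (unitMod C) 0 := by
  have h : gr (unitMod C) 0 = ⊤ := if_pos rfl
  rw [h]
  exact Submodule.mem_top

/-- The identification of the unit module with `ℚ`. -/
def unitLin (C : Type u) [AddCommGroup C] [Module ℚ C] [Coalgebra ℚ C] [DGVect C]
    [DGCoalgebra C] [TwoReduced C] : unitMod C ≃ₗ[ℚ] ℚ :=
  ULift.moduleEquiv (R := ℚ) (M := ℚ)

/-- The map `ℚ ⊗ X → X`. -/
def unitorLin (X : DGMod (Cobar C)) : unitMod C ⊗[ℚ] X ≃ₗ[ℚ] X :=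
  ((unitLin C).rTensor X).trans (TensorProduct.lid ℚ X)

@[simp] theorem unitorLin_tmul (X : DGMod (Cobar C)) (r : unitMod C) (x : X) :
    unitorLin X (r ⊗ₜ x) = unitLin C r • x := rfl

theorem unitMod_of_ne {n : ℤ} (hn : n ≠ 0) {r : unitMod C} (hr : r ∈ gr (unitMod C) n) :
    r = 0 := by
  have h : gr (unitMod C) n = ⊥ := if_neg hn
  rw [h] at hr
  simpa using hr

theorem unitMod_sgn (r : unitMod C) : sgn r = r := by
  rw [sgn_of_mem (unitMod_mem_zero r)]; simp

/-- The isomorphism `ℚ ⊗ X → X`. -/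
def leftUnitorHom (X : DGMod (Cobar C)) : tensorMod (unitMod C) X ⟶ X :=
  cobarHom (X := tensorMod (unitMod C) X)
    { toLin := (unitorLin X).toLinearMap
      map_mem := fun n z hz => by
        have := tensor_degree (unitorLin X).toLinearMap 0 (fun i j r hr x hx => by
          by_cases hi : i = 0
          · subst hi
            rw [zero_add, add_zero]
            exact Submodule.smul_mem _ _ hx
          · rw [unitMod_of_ne hi hr, TensorProduct.zero_tmul, map_zero]
            exact Submodule.zero_mem _) n z hz
        rw [add_zero] at this
        exact this
      map_d := fun z => by
        have key : ∀ z : unitMod C ⊗[ℚ] X, unitorLin X (dTens (unitMod C) X z) =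
          dif X (unitorLin X z) := by
          intro z
          induction z using TensorProduct.induction_on with
          | zero => simp only [map_zero]
          | add x y hx hy => simp only [map_add, hx, hy]
          | tmul r x =>
            have h : dif (unitMod C) r = 0 := rfl
            rw [dTens_tmul, h, TensorProduct.zero_tmul, zero_add, unitMod_sgn, unitorLin_tmul,
              unitorLin_tmul, map_smul]
        exact key z }
    (fun v z => by
      have key : ∀ z : unitMod C ⊗[ℚ] X, unitorLin X (tensorAct (unitMod C) X v z) =
          genAct X v (unitorLin X z) := by
        intro z
        induction z using TensorProduct.induction_on with
        | zero => simp only [map_zero]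
        | add x y hx hy => simp only [map_add, hx, hy]
        | tmul r x =>
          have h : genAct (unitMod C) v r = 0 := unitMod_smul v r
          rw [tensorAct_tmul_even _ _ _ (unitMod_sgn r), h, TensorProduct.zero_tmul, zero_add,
            unitorLin_tmul, unitorLin_tmul, map_smul]
      rw [tensorMod_smul]
      exact key z)

/-- The Koszul symmetry of dg modules. -/
def braidHom (X Y : DGMod (Cobar C)) : tensorMod X Y ⟶ tensorMod Y X :=
  cobarHom (X := tensorMod X Y) (Y := tensorMod Y X)
    { toLin := swap X Y
      map_mem := swap_mem
      map_d := dTens_swap }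
    (fun v z => by
      have key : ∀ z : X ⊗[ℚ] Y, swap X Y (tensorAct X Y v z) =
          tensorAct Y X v (swap X Y z) := by
        intro z
        induction z using TensorProduct.induction_on with
        | zero => simp
        | add x y hx hy => simp only [map_add, hx, hy]
        | tmul x y =>
          refine gr_induction (p := fun v => swap X Y (tensorAct X Y v (x ⊗ₜ y)) =
            tensorAct Y X v (swap X Y (x ⊗ₜ y))) v (fun n v hv => ?_) (fun v w hv hw => by
              simp only [map_add, LinearMap.add_apply, hv, hw])
          have hv : sgn v = v ∨ sgn v = -v := by
            rcases Int.even_or_odd n with hn | hn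
            · left; rw [sgn_of_mem hv, Int.negOnePow_even _ hn, one_smul]
            · right; rw [sgn_of_mem hv, Int.negOnePow_odd _ hn, Units.neg_smul, one_smul]
          refine parity_induction (p := fun x => swap X Y (tensorAct X Y v (x ⊗ₜ y)) =
            tensorAct Y X v (swap X Y (x ⊗ₜ y))) x (fun x hx => ?_) (fun x hx => ?_)
            (fun x x' hx hx' => by simp only [TensorProduct.add_tmul, map_add, hx, hx'])
          all_goals
            refine parity_induction (p := fun y => swap X Y (tensorAct X Y v (x ⊗ₜ y)) =
              tensorAct Y X v (swap X Y (x ⊗ₜ y))) y (fun y hy => ?_) (fun y hy => ?_)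
              (fun y y' hy hy' => by simp only [TensorProduct.tmul_add, map_add, hy, hy'])
          all_goals
            rcases hv with hv | hv <;>
            · simp only [tensorAct_tmul, swap_tmul, sgn_genAct, hx, hy, hv, map_add, map_sub,
                map_smul, map_neg, LinearMap.neg_apply, TensorProduct.add_tmul,
                TensorProduct.sub_tmul, TensorProduct.tmul_neg, TensorProduct.neg_tmul, neg_neg]
              module
      rw [tensorMod_smul, tensorMod_smul]
      exact key z)

theorem assoc_mem {V W Z : Type u} [AddCommGroup V] [Module ℚ V] [GrVect V]
    [AddCommGroup W] [Module ℚ W] [GrVect W] [AddCommGroup Z] [Module ℚ Z] [GrVect Z]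
    (n : ℤ) (z : (V ⊗[ℚ] W) ⊗[ℚ] Z) (hz : z ∈ gr ((V ⊗[ℚ] W) ⊗[ℚ] Z) n) :
    TensorProduct.assoc ℚ V W Z z ∈ gr (V ⊗[ℚ] (W ⊗[ℚ] Z)) n := by
  have := tensor_degree (TensorProduct.assoc ℚ V W Z).toLinearMap 0 (fun i j w hw z hz => by
    have := tensor_degree ((TensorProduct.assoc ℚ V W Z).toLinearMap ∘ₗ
      (TensorProduct.mk ℚ (V ⊗[ℚ] W) Z).flip z) j (fun k l v hv w hw =>
        tmul_mem (by ring) hv (tmul_mem rfl hw hz)) i w hw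
    rw [add_zero]
    exact this) n z hz
  rwa [add_zero] at this

theorem assoc_dTens (X Y Z : DGMod (Cobar C)) (D : (X ⊗[ℚ] Y) ⊗[ℚ] Z →ₗ[ℚ] (X ⊗[ℚ] Y) ⊗[ℚ] Z)
    (D' : X ⊗[ℚ] (Y ⊗[ℚ] Z) →ₗ[ℚ] X ⊗[ℚ] (Y ⊗[ℚ] Z)) (hD : D = dTens (tensorMod X Y) Z)
    (hD' : D' = dTens X (tensorMod Y Z)) (z : (X ⊗[ℚ] Y) ⊗[ℚ] Z) :
    TensorProduct.assoc ℚ X Y Z (D z) = D' (TensorProduct.assoc ℚ X Y Z z) := by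
  have h1 : ∀ x y z, D ((x ⊗ₜ y) ⊗ₜ z) = (dif X x ⊗ₜ y) ⊗ₜ z + (sgn x ⊗ₜ dif Y y) ⊗ₜ z +
      (sgn x ⊗ₜ sgn y) ⊗ₜ dif Z z := fun x y z => by
    rw [hD, ← sgn_tmul, ← TensorProduct.add_tmul]; rfl
  have h2 : ∀ x y z, D' (x ⊗ₜ (y ⊗ₜ z)) = dif X x ⊗ₜ (y ⊗ₜ z) + sgn x ⊗ₜ (dif Y y ⊗ₜ z) +
      sgn x ⊗ₜ (sgn y ⊗ₜ dif Z z) := fun x y z => by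
    rw [hD', add_assoc, ← TensorProduct.tmul_add]; rfl
  clear hD hD'
  have key : TensorProduct.assoc ℚ X Y Z ∘ₗ D =
      D' ∘ₗ (TensorProduct.assoc ℚ X Y Z).toLinearMap := by
    refine TensorProduct.ext_threefold fun x y z => ?_
    simp only [LinearMap.comp_apply, LinearEquiv.coe_coe, TensorProduct.assoc_tmul, h1, h2, map_add]
  exact LinearMap.congr_fun key z

theorem assoc_tensorAct (X Y Z : DGMod (Cobar C)) (v : CobarGen C)
    (D : (X ⊗[ℚ] Y) ⊗[ℚ] Z →ₗ[ℚ] (X ⊗[ℚ] Y) ⊗[ℚ] Z)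
    (D' : X ⊗[ℚ] (Y ⊗[ℚ] Z) →ₗ[ℚ] X ⊗[ℚ] (Y ⊗[ℚ] Z)) (hD : D = tensorAct (tensorMod X Y) Z v)
    (hD' : D' = tensorAct X (tensorMod Y Z) v) (z : (X ⊗[ℚ] Y) ⊗[ℚ] Z) :
    TensorProduct.assoc ℚ X Y Z (D z) = D' (TensorProduct.assoc ℚ X Y Z z) := by
  have hg : ∀ X Y : DGMod (Cobar C), ∃ a : CobarGen C → X ⊗[ℚ] Y →ₗ[ℚ] X ⊗[ℚ] Y,
      (a = fun v => genAct (tensorMod X Y) v) ∧ ∀ v z, a v z = tensorAct X Y v z := fun X Y =>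
    ⟨_, rfl, tensorMod_smul X Y⟩
  obtain ⟨a, ha, ha'⟩ := hg X Y
  obtain ⟨b, hb, hb'⟩ := hg Y Z
  have h1 : ∀ x y z, D ((x ⊗ₜ y) ⊗ₜ z) = a v (x ⊗ₜ y) ⊗ₜ z +
      (2⁻¹ : ℚ) • ((x ⊗ₜ y + sgn x ⊗ₜ sgn y) ⊗ₜ genAct Z v z +
        (x ⊗ₜ y - sgn x ⊗ₜ sgn y) ⊗ₜ genAct Z (sgn v) z) := fun x y z => by
    rw [hD, ← sgn_tmul, ha]; rfl
  have h2 : ∀ x y z, D' (x ⊗ₜ (y ⊗ₜ z)) = genAct X v x ⊗ₜ (y ⊗ₜ z) +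
      (2⁻¹ : ℚ) • ((x + sgn x) ⊗ₜ b v (y ⊗ₜ z) +
        (x - sgn x) ⊗ₜ b (sgn v) (y ⊗ₜ z)) := fun x y z => by
    rw [hD', hb]; rfl
  clear hD hD' ha hb
  have key : TensorProduct.assoc ℚ X Y Z ∘ₗ D =
      D' ∘ₗ (TensorProduct.assoc ℚ X Y Z).toLinearMap := by
    refine TensorProduct.ext_threefold fun x y z => ?_
    simp only [LinearMap.comp_apply, LinearEquiv.coe_coe, TensorProduct.assoc_tmul, h1, h2, ha', hb',
      tensorAct_tmul, map_add, map_sub, map_smul, sgn_sgn, TensorProduct.add_tmul,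
      TensorProduct.tmul_add, TensorProduct.sub_tmul, TensorProduct.tmul_sub,
      ← TensorProduct.smul_tmul', TensorProduct.tmul_smul]
    module
  exact LinearMap.congr_fun key z

/-- The associator of dg modules. -/
def assocHom (X Y Z : DGMod (Cobar C)) :
    tensorMod (tensorMod X Y) Z ⟶ tensorMod X (tensorMod Y Z) :=
  cobarHom (X := tensorMod (tensorMod X Y) Z) (Y := tensorMod X (tensorMod Y Z))
    { toLin := (TensorProduct.assoc ℚ X Y Z).toLinearMap
      map_mem := assoc_mem
      map_d := assoc_dTens X Y Z _ _ rfl rfl }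
    (fun v z => by
      rw [tensorMod_smul, tensorMod_smul]
      exact assoc_tensorAct X Y Z v _ _ rfl rfl z)

instance (X : DGMod (Cobar C)) : IsIso (leftUnitorHom X) :=
  DGMod.isIso_of_bijective _ (unitorLin X).bijective

instance (X Y Z : DGMod (Cobar C)) : IsIso (assocHom X Y Z) :=
  DGMod.isIso_of_bijective _ (TensorProduct.assoc ℚ X Y Z).bijective

/-- The Koszul symmetry as an isomorphism. -/
def braidIso (X Y : DGMod (Cobar C)) : tensorMod X Y ≅ tensorMod Y X where
  hom := braidHom X Y
  inv := braidHom Y X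
  hom_inv_id := DGMod.Hom.ext (LinearMap.ext (swap_swap (V := X) (W := Y)))
  inv_hom_id := DGMod.Hom.ext (LinearMap.ext (swap_swap (V := Y) (W := X)))

instance : MonoidalCategoryStruct (DGMod (Cobar C)) where
  tensorObj := tensorMod
  whiskerLeft X _ _ f := tensorModMap (𝟙 X) f
  whiskerRight f Y := tensorModMap f (𝟙 Y)
  tensorHom := tensorModMap
  tensorUnit := unitMod C
  associator X Y Z := asIso (assocHom X Y Z)
  leftUnitor X := asIso (leftUnitorHom X)
  rightUnitor X := braidIso X (unitMod C) ≪≫ asIso (leftUnitorHom X)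

theorem braidHom_naturality {X X' Y Y' : DGMod (Cobar C)} (f : X ⟶ X') (g : Y ⟶ Y') :
    tensorModMap f g ≫ braidHom X' Y' = braidHom X Y ≫ tensorModMap g f :=
  DGMod.Hom.ext (LinearMap.ext (swap_map f.toLin g.toLin f.map_mem g.map_mem))

theorem leftUnitorHom_naturality {X Y : DGMod (Cobar C)} (f : X ⟶ Y) :
    tensorModMap (𝟙 (unitMod C)) f ≫ leftUnitorHom Y = leftUnitorHom X ≫ f := by
  refine DGMod.Hom.ext (TensorProduct.ext' fun r x => ?_)
  exact (map_smul f.toLin (unitLin C r) x).symm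

theorem swap_unit_tmul (X : DGMod (Cobar C)) (x : X) (r : unitMod C) :
    swap X (unitMod C) (x ⊗ₜ r) = r ⊗ₜ x := by
  rw [swap_tmul, unitMod_sgn]
  module

instance : MonoidalCategory (DGMod (Cobar C)) := MonoidalCategory.ofTensorHom
  (id_tensorHom_id := fun X Y => DGMod.Hom.ext TensorProduct.map_id)
  (tensorHom_comp_tensorHom := fun f₁ f₂ g₁ g₂ => DGMod.Hom.ext
    (TensorProduct.map_comp g₁.toLin g₂.toLin f₁.toLin f₂.toLin).symm)
  (associator_naturality := fun f₁ f₂ f₃ => DGMod.Hom.ext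
    (TensorProduct.ext_threefold fun _ _ _ => rfl))
  (leftUnitor_naturality := leftUnitorHom_naturality)
  (rightUnitor_naturality := fun {X Y} f => by
    change tensorModMap f (𝟙 (unitMod C)) ≫ braidHom Y (unitMod C) ≫ leftUnitorHom Y =
      (braidHom X (unitMod C) ≫ leftUnitorHom X) ≫ f
    rw [← Category.assoc, braidHom_naturality, Category.assoc, Category.assoc,
      leftUnitorHom_naturality])
  (pentagon := fun W X Y Z => DGMod.Hom.ext (TensorProduct.ext_fourfold fun _ _ _ _ => rfl))
  (triangle := fun X Y => by
    refine DGMod.Hom.ext (TensorProduct.ext_threefold fun x r y => ?_)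
    change x ⊗ₜ[ℚ] (unitLin C r • y) = unitorLin X (swap X (unitMod C) (x ⊗ₜ r)) ⊗ₜ[ℚ] y
    rw [swap_unit_tmul, unitorLin_tmul, TensorProduct.smul_tmul])

instance : BraidedCategory (DGMod (Cobar C)) where
  braiding := braidIso
  braiding_naturality_right X _ _ f := braidHom_naturality (𝟙 X) f
  braiding_naturality_left f Z := braidHom_naturality f (𝟙 Z)
  hexagon_forward X Y Z := by
    refine DGMod.Hom.ext (LinearMap.ext fun w => ?_)
    exact swap_hexagon (X := X) (Y := Y) (Z := Z) w
  hexagon_reverse X Y Z := by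
    have h : (α_ Z X Y).hom ≫ (braidIso Z (X ⊗ Y)).hom ≫ (α_ X Y Z).hom =
        ((braidIso Z X).hom ▷ Y) ≫ (α_ X Z Y).hom ≫ (X ◁ (braidIso Z Y).hom) :=
      DGMod.Hom.ext (LinearMap.ext fun w => swap_hexagon (X := Z) (Y := X) (Z := Y) w)
    have h1 : ∀ X Y : DGMod (Cobar C), (braidIso X Y).hom ≫ (braidIso Y X).hom = 𝟙 (X ⊗ Y) :=
      fun X Y => (braidIso X Y).hom_inv_id
    rw [← cancel_mono ((α_ Z X Y).hom ≫ (braidIso Z (X ⊗ Y)).hom ≫ (α_ X Y Z).hom)]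
    conv_rhs => rw [h]
    have h2 := h1 (X ⊗ Y) Z
    simp only [Category.assoc, Iso.inv_hom_id_assoc, reassoc_of% h2,
      ← comp_whiskerRight_assoc, h1, id_whiskerRight, Category.id_comp, ← whiskerLeft_comp,
      whiskerLeft_id]
    exact (congrArg (fun k => (α_ X Y Z).inv ≫ k) (Category.id_comp _)).trans (Iso.inv_hom_id _)

instance : SymmetricCategory (DGMod (Cobar C)) where
  symmetry X Y := (braidIso X Y).hom_inv_id

end Monoidal

/-! ### Morphisms into twisted coextensions -/

section CoextLift

variable {C : Type u} [AddCommGroup C] [Module ℚ C] [Coalgebra ℚ C] [DGVect C] [DGCoalgebra C]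
variable {A : Type u} [Ring A] [Algebra ℚ A] [DGVect A] [DGAlgebra A]

theorem counitMap_coextD (τ : TwistingChain C A) (X : DGMod A) (z : C ⊗[ℚ] X) :
    counitMap C X (coextD τ X z) = dif X (counitMap C X z) + X.act (τ.toLin.rTensor X z) := by
  induction z using TensorProduct.induction_on with
  | zero => simp
  | add x y hx hy => simp only [map_add, hx, hy]; abel
  | tmul c x =>
    rw [coextD, LinearMap.add_apply, map_add, counitMap_dTens, counitMap_coextTwist]
    rfl

/-- The comodule map `n ↦ n₍₀₎ ⊗ φ(n₍₁₎)` determined by a twisted chain map `φ`. -/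
def coextLift (τ : TwistingChain C A) (N : DGComod C) (X : DGMod A) (φ : N →ₗ[ℚ] X)
    (hmem : ∀ n, ∀ x ∈ gr N n, φ x ∈ gr X n)
    (hd : ∀ x, φ (dif N x) = dif X (φ x) + X.act (TensorProduct.map τ.toLin φ (N.coact x))) :
    N ⟶ (coext τ).obj X where
  toLin := φ.lTensor C ∘ₗ N.coact
  map_mem n x hx := by
    have := map_mem (LinearMap.id : C →ₗ[ℚ] C) φ 0 0 (by simp) (by simpa using hmem) n _
      (N.coact_mem n x hx)
    rw [show n + (0 + 0) = n by ring] at this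
    exact this
  map_d x := by
    have h1 : ∀ z : C ⊗[ℚ] N, coextTwist τ X (φ.lTensor C z) =
        TensorProduct.map sgn (X.act ∘ₗ TensorProduct.map τ.toLin φ)
          (TensorProduct.assoc ℚ C C N ((Coalgebra.comul (R := ℚ) (A := C)).rTensor N z)) := by
      intro z
      induction z using TensorProduct.induction_on with
      | zero => simp
      | add x y hx hy => simp only [map_add, hx, hy]
      | tmul c y =>
        rw [LinearMap.lTensor_tmul, coextTwist_tmul, LinearMap.rTensor_tmul]
        generalize (Coalgebra.comul (R := ℚ) c) = w
        induction w using TensorProduct.induction_on with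
        | zero => simp
        | add x y hx hy => simp only [TensorProduct.add_tmul, map_add, hx, hy]
        | tmul a b => simp
    have h2 : ∀ z : C ⊗[ℚ] N, φ.lTensor C (dTens C N z) = dTens C X (φ.lTensor C z) +
        TensorProduct.map sgn (X.act ∘ₗ TensorProduct.map τ.toLin φ) (N.coact.lTensor C z) := by
      intro z
      induction z using TensorProduct.induction_on with
      | zero => simp
      | add x y hx hy => simp only [map_add, hx, hy]; abel
      | tmul c y =>
        simp only [dTens_tmul, map_add, LinearMap.lTensor_tmul, hd, TensorProduct.tmul_add,
          TensorProduct.map_tmul, LinearMap.comp_apply, add_assoc]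
    have key : φ.lTensor C (N.coact (dif N x)) = dTens C X (φ.lTensor C (N.coact x)) +
        coextTwist τ X (φ.lTensor C (N.coact x)) := by
      rw [N.coact_d, h2, h1, N.coassoc]
    exact key
  map_coact x := by
    have h1 : ∀ z : C ⊗[ℚ] N, cofreeCoact C X (φ.lTensor C z) =
        (φ.lTensor C).lTensor C
          (TensorProduct.assoc ℚ C C N ((Coalgebra.comul (R := ℚ) (A := C)).rTensor N z)) := by
      intro z
      induction z using TensorProduct.induction_on with
      | zero => simp
      | add x y hx hy => simp only [map_add, hx, hy]
      | tmul c y =>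
        rw [LinearMap.lTensor_tmul, leftCoact_tmul, LinearMap.rTensor_tmul]
        generalize (Coalgebra.comul (R := ℚ) c) = w
        induction w using TensorProduct.induction_on with
        | zero => simp
        | add x y hx hy => simp only [TensorProduct.add_tmul, map_add, hx, hy]
        | tmul a b => simp
    change cofreeCoact C X (φ.lTensor C (N.coact x)) = (φ.lTensor C ∘ₗ N.coact).lTensor C (N.coact x)
    rw [h1, N.coassoc, ← LinearMap.lTensor_comp_apply]

theorem counitMap_coextLift (τ : TwistingChain C A) (N : DGComod C) (X : DGMod A)
    (φ : N →ₗ[ℚ] X) (hmem hd) (x : N) :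
    counitMap C X ((coextLift τ N X φ hmem hd).toLin x) = φ x :=
  (counitMap_lTensor φ (N.coact x)).trans (congrArg φ (N.counit x))

theorem toLin_eq_of_counitMap {N : DGComod C} {V : Type u} [AddCommGroup V] [Module ℚ V]
    (f : N →ₗ[ℚ] C ⊗[ℚ] V) (hf : ∀ x, cofreeCoact C V (f x) = f.lTensor C (N.coact x)) (x : N) :
    f x = (counitMap C V ∘ₗ f).lTensor C (N.coact x) := by
  rw [LinearMap.lTensor_comp_apply, ← hf, lTensor_counitMap_cofreeCoact]

theorem coext_hom_ext (τ : TwistingChain C A) {N : DGComod C} {X : DGMod A}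
    (f g : N ⟶ (coext τ).obj X)
    (h : ∀ x, counitMap C X (f.toLin x) = counitMap C X (g.toLin x)) : f = g := by
  refine DGComod.Hom.ext (LinearMap.ext fun x => ?_)
  have h' : counitMap C X ∘ₗ f.toLin = counitMap C X ∘ₗ g.toLin := LinearMap.ext h
  exact (toLin_eq_of_counitMap (V := X) f.toLin f.map_coact x).trans
    ((congrArg (fun k : N →ₗ[ℚ] X => k.lTensor C (N.coact x)) h').trans
      (toLin_eq_of_counitMap (V := X) g.toLin g.map_coact x).symm)

end CoextLift

/-! ### Cotensor products with cofree comodules -/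

section CotensorCofree

variable {C : Type u} [AddCommGroup C] [Module ℚ C] [Coalgebra ℚ C] [DGVect C]

theorem swap_assoc_swap {M : Type u} [AddCommGroup M] [Module ℚ M] [GrVect M]
    (z : (C ⊗[ℚ] C) ⊗[ℚ] M) :
    TensorProduct.assoc ℚ M C C (swap C (M ⊗[ℚ] C) ((swap C M).lTensor C
      (TensorProduct.assoc ℚ C C M z))) = swap (C ⊗[ℚ] C) M ((swap C C).rTensor M z) := by
  induction z using TensorProduct.induction_on with
  | zero => simp
  | add x y hx hy => simp only [map_add, hx, hy]
  | tmul z m =>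
    induction z using TensorProduct.induction_on with
    | zero => simp
    | add x y hx hy => simp only [TensorProduct.add_tmul, map_add, hx, hy]
    | tmul a b =>
      simp only [TensorProduct.assoc_tmul, swap_tmul, sgn_tmul, LinearMap.rTensor_tmul, map_add,
        map_sub, map_smul, TensorProduct.add_tmul, TensorProduct.sub_tmul,
        ← TensorProduct.smul_tmul', LinearMap.lTensor_tmul, TensorProduct.tmul_add,
        TensorProduct.tmul_sub, TensorProduct.tmul_smul, sgn_sgn]
      module

/-- The right coaction is coassociative. -/
theorem rightCoact_coassoc [GradedCocomm C] [DGCoalgebra C] (M : DGComod C) (m : M) :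
    TensorProduct.assoc ℚ M C C ((rightCoact M).rTensor C (rightCoact M m)) =
      (Coalgebra.comul (R := ℚ) (A := C)).lTensor M (rightCoact M m) := by
  have h1 : (rightCoact M).rTensor C (rightCoact M m) =
      swap C (M ⊗[ℚ] C) ((rightCoact M).lTensor C (M.coact m)) :=
    (swap_map LinearMap.id (rightCoact M) (fun _ _ h => h) (rightCoact_mem M) (M.coact m)).symm
  have h2 : (Coalgebra.comul (R := ℚ) (A := C)).lTensor M (rightCoact M m) =
      swap (C ⊗[ℚ] C) M ((Coalgebra.comul (R := ℚ) (A := C)).rTensor M (M.coact m)) :=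
    (swap_map Coalgebra.comul LinearMap.id DGCoalgebra.comul_mem (fun _ _ h => h)
      (M.coact m)).symm
  have h3 : (swap C C).rTensor M
      ((Coalgebra.comul (R := ℚ) (A := C)).rTensor M (M.coact m)) =
      (Coalgebra.comul (R := ℚ) (A := C)).rTensor M (M.coact m) := by
    rw [← LinearMap.rTensor_comp_apply]
    congr 2
    ext x
    exact GradedCocomm.swap_comul x
  rw [h1, h2, ← h3, ← swap_assoc_swap, M.coassoc, ← LinearMap.lTensor_comp_apply]
  rfl

theorem rightCoact_counit [DGCoalgebra C] (M : DGComod C) (m : M) :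
    TensorProduct.rid ℚ M ((Coalgebra.counit (R := ℚ) (A := C)).lTensor M (rightCoact M m)) =
      m := by
  have h : ∀ z : C ⊗[ℚ] M, TensorProduct.rid ℚ M
      ((Coalgebra.counit (R := ℚ) (A := C)).lTensor M (swap C M z)) = counitMap C M z := by
    intro z
    induction z using TensorProduct.induction_on with
    | zero => simp
    | add x y hx hy => simp only [map_add, hx, hy]
    | tmul c m =>
      simp only [swap_tmul, map_smul, map_sub, map_add, LinearMap.lTensor_tmul, counit_sgn,
        TensorProduct.rid_tmul, counitMap_tmul]
      module
  exact (h _).trans (M.counit m)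

variable {V : Type u} [AddCommGroup V] [Module ℚ V]

/-- The map `m ⊗ v ↦ m₍₀₎ ⊗ (m₍₁₎ ⊗ v)` using the right coaction of `M`. -/
def cotensorCofreeInv (M : DGComod C) (V : Type u) [AddCommGroup V] [Module ℚ V] :
    M ⊗[ℚ] V →ₗ[ℚ] M ⊗[ℚ] (C ⊗[ℚ] V) :=
  (TensorProduct.assoc ℚ M C V).toLinearMap ∘ₗ (rightCoact M).rTensor V

theorem cotensorCofreeInv_tmul (M : DGComod C) (m : M) (y : V) :
    cotensorCofreeInv M V (m ⊗ₜ y) =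
      ((TensorProduct.mk ℚ C V).flip y).lTensor M (rightCoact M m) := by
  simp only [cotensorCofreeInv, LinearMap.comp_apply, LinearMap.rTensor_tmul, LinearEquiv.coe_coe]
  generalize rightCoact M m = z
  induction z using TensorProduct.induction_on with
  | zero => simp
  | add x y hx hy => simp only [TensorProduct.add_tmul, map_add, hx, hy]
  | tmul a b => simp

variable [DGCoalgebra C]

theorem lTensor_counitMap_cotensorCofreeInv (M : DGComod C) (z : M ⊗[ℚ] V) :
    (counitMap C V).lTensor M (cotensorCofreeInv M V z) = z := by
  induction z using TensorProduct.induction_on with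
  | zero => simp
  | add x y hx hy => simp only [map_add, hx, hy]
  | tmul m v =>
    have h : ∀ w : M ⊗[ℚ] C, (counitMap C V).lTensor M
        (((TensorProduct.mk ℚ C V).flip v).lTensor M w) =
        TensorProduct.rid ℚ M ((Coalgebra.counit (R := ℚ) (A := C)).lTensor M w) ⊗ₜ v := by
      intro w
      induction w using TensorProduct.induction_on with
      | zero => simp
      | add x y hx hy => simp only [map_add, TensorProduct.add_tmul, hx, hy]
      | tmul a b => simp [TensorProduct.smul_tmul]
    rw [cotensorCofreeInv_tmul, h, rightCoact_counit]

variable {N : DGComod C} (e : N ≃ₗ[ℚ] C ⊗[ℚ] V)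

theorem cotensorCofreeInv_of_mem
    (he : ∀ x, cofreeCoact C V (e x) = e.toLinearMap.lTensor C (N.coact x))
    (M : DGComod C) (z : M ⊗[ℚ] N) (hz : z ∈ cotensorSub M N) :
    cotensorCofreeInv M V ((counitMap C V ∘ₗ e.toLinearMap).lTensor M z) =
      e.toLinearMap.lTensor M z := by
  have h1 : ∀ z : M ⊗[ℚ] N, cotensorCofreeInv M V ((counitMap C V ∘ₗ e.toLinearMap).lTensor M z) =
      ((counitMap C V ∘ₗ e.toLinearMap).lTensor C).lTensor M (cotensorRight M N z) := by
    intro z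
    induction z using TensorProduct.induction_on with
    | zero => simp
    | add x y hx hy => simp only [map_add, hx, hy]
    | tmul m x =>
      rw [LinearMap.lTensor_tmul, cotensorCofreeInv_tmul, cotensorRight_tmul,
        ← LinearMap.lTensor_comp_apply]
      rfl
  have h2 : (counitMap C V ∘ₗ e.toLinearMap).lTensor C ∘ₗ N.coact = e.toLinearMap :=
    LinearMap.ext fun x => (toLin_eq_of_counitMap e.toLinearMap he x).symm
  have hz' : cotensorLeft M N z = cotensorRight M N z := hz
  rw [h1, ← hz', cotensorLeft, ← LinearMap.lTensor_comp_apply, h2]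

theorem cotensorCofreeInv_mem [GradedCocomm C]
    (he : ∀ x, cofreeCoact C V (e x) = e.toLinearMap.lTensor C (N.coact x))
    (M : DGComod C) (z : M ⊗[ℚ] V) :
    e.symm.toLinearMap.lTensor M (cotensorCofreeInv M V z) ∈ cotensorSub M N := by
  have he' : ∀ w, N.coact (e.symm w) = e.symm.toLinearMap.lTensor C (cofreeCoact C V w) := by
    intro w
    have := he (e.symm w)
    rw [e.apply_symm_apply] at this
    rw [this, ← LinearMap.lTensor_comp_apply]
    simp
  change cotensorLeft M N _ = cotensorRight M N _
  induction z using TensorProduct.induction_on with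
  | zero => simp
  | add x y hx hy => simp only [map_add, hx, hy]
  | tmul m v =>
    have h1 : ∀ w : M ⊗[ℚ] C, cotensorLeft M N (e.symm.toLinearMap.lTensor M
        (((TensorProduct.mk ℚ C V).flip v).lTensor M w)) =
        ((e.symm.toLinearMap ∘ₗ (TensorProduct.mk ℚ C V).flip v).lTensor C).lTensor M
          ((Coalgebra.comul (R := ℚ) (A := C)).lTensor M w) := by
      intro w
      induction w using TensorProduct.induction_on with
      | zero => simp
      | add x y hx hy => simp only [map_add, hx, hy]
      | tmul m c =>
        simp only [cotensorLeft, LinearMap.lTensor_tmul, LinearMap.flip_apply,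
          TensorProduct.mk_apply, LinearEquiv.coe_coe, he', leftCoact_tmul,
          ← LinearMap.lTensor_comp_apply]
    have h2 : ∀ w : M ⊗[ℚ] C, cotensorRight M N (e.symm.toLinearMap.lTensor M
        (((TensorProduct.mk ℚ C V).flip v).lTensor M w)) =
        ((e.symm.toLinearMap ∘ₗ (TensorProduct.mk ℚ C V).flip v).lTensor C).lTensor M
          (TensorProduct.assoc ℚ M C C ((rightCoact M).rTensor C w)) := by
      intro w
      induction w using TensorProduct.induction_on with
      | zero => simp
      | add x y hx hy => simp only [map_add, hx, hy]
      | tmul m c =>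
        simp only [LinearMap.lTensor_tmul, LinearMap.flip_apply,
          TensorProduct.mk_apply, LinearEquiv.coe_coe, cotensorRight_tmul, LinearMap.rTensor_tmul]
        generalize rightCoact M m = w
        induction w using TensorProduct.induction_on with
        | zero => simp
        | add x y hx hy => simp only [TensorProduct.add_tmul, map_add, hx, hy]
        | tmul a b => simp
    rw [cotensorCofreeInv_tmul, h1, h2, rightCoact_coassoc]

/-- The map `M □ (C ⊗ V) → M ⊗ V` is bijective. -/
theorem cotensor_cofree_bijective [GradedCocomm C]
    (he : ∀ x, cofreeCoact C V (e x) = e.toLinearMap.lTensor C (N.coact x))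
    (M : DGComod C) :
    Function.Bijective ((counitMap C V ∘ₗ e.toLinearMap).lTensor M ∘ₗ cotensorIncl M N) := by
  constructor
  · rw [← LinearMap.ker_eq_bot, LinearMap.ker_eq_bot']
    intro z hz
    have h := cotensorCofreeInv_of_mem e he M (cotensorIncl M N z) z.2
    rw [LinearMap.comp_apply] at hz
    rw [hz, map_zero] at h
    refine Subtype.ext ((e.lTensor M).injective ?_)
    exact h.symm.trans (map_zero (e.lTensor M)).symm
  · intro z
    refine ⟨⟨_, cotensorCofreeInv_mem e he M z⟩, ?_⟩
    change (counitMap C V ∘ₗ e.toLinearMap).lTensor M (e.symm.toLinearMap.lTensor M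
      (cotensorCofreeInv M V z)) = z
    rw [← LinearMap.lTensor_comp_apply, LinearMap.comp_assoc, LinearEquiv.comp_symm,
      LinearMap.comp_id, lTensor_counitMap_cotensorCofreeInv]

end CotensorCofree

/-! ### Cotensor products of twisted coextensions -/

section Kappa

variable {C : Type u} [AddCommGroup C] [Module ℚ C] [Coalgebra ℚ C] [DGVect C] [DGCoalgebra C]
  [TwoReduced C] [GradedCocomm C]

theorem lTensor_cotensorIncl_coact (M N : DGComod C) (z : cotensor M N) :
    (cotensorIncl M N).lTensor C ((cotensor M N).coact z) =
      leftCoact M.coact N (cotensorIncl M N z) :=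
  lTensor_subCoact (tensorComod M N) (cotensorSub_coact M N) z

theorem cotensorIncl_map {M M' N N' : DGComod C} (f : M ⟶ M') (g : N ⟶ N') (z : cotensor M N) :
    cotensorIncl M' N' ((cotensorMap f g).toLin z) =
      TensorProduct.map f.toLin g.toLin (cotensorIncl M N z) := rfl

variable (X Y : DGMod (Cobar C))

/-- The action of the cogenerators, `c ⊗ x ↦ t(c) x`. -/
def cogenAct (X : DGMod (Cobar C)) : C ⊗[ℚ] X →ₗ[ℚ] X := X.act ∘ₗ (univLin C).rTensor X

theorem cogenAct_tmul (c : C) (x : X) : cogenAct X (c ⊗ₜ x) = genAct X (cobarProj C c) x := rfl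

theorem cogenAct_counitMap_cofreeCoact (z : C ⊗[ℚ] X) :
    cogenAct X ((counitMap C X).lTensor C (cofreeCoact C X z)) = cogenAct X z := by
  rw [lTensor_counitMap_cofreeCoact]

/-- The sign-twisted action on the second factor. -/
def crossAct : (C ⊗[ℚ] X) ⊗[ℚ] Y →ₗ[ℚ] X ⊗[ℚ] Y :=
  TensorProduct.map sgn (cogenAct Y) ∘ₗ (TensorProduct.assoc ℚ X C Y).toLinearMap ∘ₗ
    (swap C X).rTensor Y

theorem tensorAct_cogen (c : C) (x : X) (y : Y) :
    tensorAct X Y (cobarProj C c) (x ⊗ₜ y) =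
      cogenAct X (c ⊗ₜ x) ⊗ₜ y + crossAct X Y ((c ⊗ₜ x) ⊗ₜ y) := by
  rw [tensorAct_tmul, sgn_cobarProj]
  simp only [crossAct, LinearMap.comp_apply, LinearMap.rTensor_tmul, swap_tmul,
    TensorProduct.add_tmul, TensorProduct.sub_tmul, ← TensorProduct.smul_tmul', map_add, map_sub,
    map_smul, LinearEquiv.coe_coe, TensorProduct.assoc_tmul, TensorProduct.map_tmul, sgn_sgn,
    cogenAct_tmul, map_neg, LinearMap.neg_apply, TensorProduct.tmul_neg]
  module

theorem map_comp_eq {P Q R S T V : Type*} [AddCommGroup P] [Module ℚ P] [AddCommGroup Q]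
    [Module ℚ Q] [AddCommGroup R] [Module ℚ R] [AddCommGroup S] [Module ℚ S] [AddCommGroup T]
    [Module ℚ T] [AddCommGroup V] [Module ℚ V] (t : P →ₗ[ℚ] Q) (i : R →ₗ[ℚ] S) (q : S →ₗ[ℚ] T)
    (a : Q ⊗[ℚ] T →ₗ[ℚ] V) (u : P ⊗[ℚ] R) :
    a (TensorProduct.map t (q ∘ₗ i) u) =
      (a ∘ₗ t.rTensor T) (q.lTensor P (i.lTensor P u)) := by
  induction u using TensorProduct.induction_on with
  | zero => simp
  | add x y hx hy => simp only [map_add, hx, hy]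
  | tmul p r => rfl

theorem crossAct_of_mem (z : (C ⊗[ℚ] X) ⊗[ℚ] (C ⊗[ℚ] Y))
    (hz : z ∈ cotensorSub ((tCoext C).obj X) ((tCoext C).obj Y)) :
    TensorProduct.map (sgn ∘ₗ counitMap C X) (cogenAct Y) z =
      crossAct X Y ((counitMap C Y).lTensor (C ⊗[ℚ] X) z) := by
  set Ψ : (C ⊗[ℚ] X) ⊗[ℚ] (C ⊗[ℚ] (C ⊗[ℚ] Y)) →ₗ[ℚ] X ⊗[ℚ] Y :=
    TensorProduct.map (sgn ∘ₗ counitMap C X) (cogenAct Y ∘ₗ (counitMap C Y).lTensor C) with hΨ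
  obtain ⟨l, hl⟩ : ∃ l : (C ⊗[ℚ] X) ⊗[ℚ] (C ⊗[ℚ] Y) →ₗ[ℚ] (C ⊗[ℚ] X) ⊗[ℚ] (C ⊗[ℚ] (C ⊗[ℚ] Y)),
    l = cotensorLeft ((tCoext C).obj X) ((tCoext C).obj Y) := ⟨_, rfl⟩
  obtain ⟨r, hr⟩ : ∃ r : (C ⊗[ℚ] X) ⊗[ℚ] (C ⊗[ℚ] Y) →ₗ[ℚ] (C ⊗[ℚ] X) ⊗[ℚ] (C ⊗[ℚ] (C ⊗[ℚ] Y)),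
    r = cotensorRight ((tCoext C).obj X) ((tCoext C).obj Y) := ⟨_, rfl⟩
  have hlr : l z = r z := by rw [hl, hr]; exact hz
  have h1 : ∀ z, Ψ (l z) = TensorProduct.map (sgn ∘ₗ counitMap C X) (cogenAct Y) z := by
    intro z
    induction z using TensorProduct.induction_on with
    | zero => simp
    | add x y hx hy => simp only [map_add, hx, hy]
    | tmul m n =>
      have : l (m ⊗ₜ n) = m ⊗ₜ cofreeCoact C Y n := by rw [hl]; rfl
      rw [this, hΨ, TensorProduct.map_tmul, TensorProduct.map_tmul,
        LinearMap.comp_apply (cogenAct Y), cogenAct_counitMap_cofreeCoact]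
  have h2 : ∀ z, Ψ (r z) = crossAct X Y ((counitMap C Y).lTensor (C ⊗[ℚ] X) z) := by
    intro z
    induction z using TensorProduct.induction_on with
    | zero => simp
    | add x y hx hy => simp only [map_add, hx, hy]
    | tmul m n =>
      have h3 : r (m ⊗ₜ n) = ((TensorProduct.mk ℚ C (C ⊗[ℚ] Y)).flip n).lTensor (C ⊗[ℚ] X)
          (swap C (C ⊗[ℚ] X) (cofreeCoact C X m)) := by
        rw [hr]; exact cotensorRight_tmul ((tCoext C).obj X) ((tCoext C).obj Y) m n
      have h4 : swap C X m = (counitMap C X).rTensor C (swap C (C ⊗[ℚ] X) (cofreeCoact C X m)) := 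
        (congrArg (swap C X) (lTensor_counitMap_cofreeCoact m).symm).trans
        (swap_map (LinearMap.id : C →ₗ[ℚ] C) (counitMap C X) (fun _ _ h => h) counitMap_mem _)
      rw [h3, LinearMap.lTensor_tmul, crossAct, LinearMap.comp_apply, LinearMap.comp_apply,
        LinearMap.rTensor_tmul, h4]
      generalize swap C (C ⊗[ℚ] X) (cofreeCoact C X m) = w
      induction w using TensorProduct.induction_on with
      | zero => simp
      | add x y hx hy => simp only [map_add, TensorProduct.add_tmul, hx, hy]
      | tmul m' c =>
        simp [hΨ, cogenAct, univLin]
  rw [← h1, hlr, h2]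

/-- The projection `t_*X □ t_*Y → X ⊗ Y`. -/
def kappaLin : cotensor ((tCoext C).obj X) ((tCoext C).obj Y) →ₗ[ℚ] X ⊗[ℚ] Y :=
  TensorProduct.map (counitMap C X) (counitMap C Y) ∘ₗ
    cotensorIncl ((tCoext C).obj X) ((tCoext C).obj Y)

theorem kappaLin_mem (n : ℤ) (z : cotensor ((tCoext C).obj X) ((tCoext C).obj Y))
    (hz : z ∈ gr (cotensor ((tCoext C).obj X) ((tCoext C).obj Y)) n) :
    kappaLin X Y z ∈ gr (X ⊗[ℚ] Y) n := by
  have := map_mem (V := C ⊗[ℚ] X) (W := C ⊗[ℚ] Y) (counitMap C X) (counitMap C Y) 0 0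
    (by simpa using counitMap_mem) (by simpa using counitMap_mem) n
    (cotensorIncl ((tCoext C).obj X) ((tCoext C).obj Y) z) hz
  rwa [show n + (0 + 0) = n by ring] at this

theorem kappaLin_dif (z : cotensor ((tCoext C).obj X) ((tCoext C).obj Y)) :
    kappaLin X Y (dif _ z) = dif (tensorMod X Y) (kappaLin X Y z) +
      (tensorMod X Y).act (TensorProduct.map (univ C).toLin (kappaLin X Y)
        ((cotensor ((tCoext C).obj X) ((tCoext C).obj Y)).coact z)) := by
  obtain ⟨D, hD⟩ : ∃ D : (C ⊗[ℚ] X) ⊗[ℚ] (C ⊗[ℚ] Y) →ₗ[ℚ] (C ⊗[ℚ] X) ⊗[ℚ] (C ⊗[ℚ] Y),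
    D = dTens ((tCoext C).obj X) ((tCoext C).obj Y) := ⟨_, rfl⟩
  have hD' : ∀ m n, D (m ⊗ₜ n) = coextD (univ C) X m ⊗ₜ n + sgn m ⊗ₜ coextD (univ C) Y n := by
    intro m n; rw [hD]; rfl
  have h1 : ∀ w, TensorProduct.map (counitMap C X) (counitMap C Y) (D w) =
      dTens X Y (TensorProduct.map (counitMap C X) (counitMap C Y) w) +
      (TensorProduct.map (cogenAct X) (counitMap C Y) w +
        TensorProduct.map (sgn ∘ₗ counitMap C X) (cogenAct Y) w) := by
    intro w
    induction w using TensorProduct.induction_on with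
    | zero => simp
    | add x y hx hy => simp only [map_add, hx, hy]; abel
    | tmul m n =>
      simp only [hD', map_add, TensorProduct.map_tmul, counitMap_coextD, dTens_tmul,
        sgn_map (counitMap C X) counitMap_mem, TensorProduct.add_tmul, TensorProduct.tmul_add,
        LinearMap.comp_apply, cogenAct]
      change _ = _ + (_ + sgn (counitMap C X m) ⊗ₜ[ℚ] Y.act ((univ C).toLin.rTensor Y n))
      change _ + _ ⊗ₜ[ℚ] counitMap C Y n + _ = _ + (X.act ((univ C).toLin.rTensor X m) ⊗ₜ[ℚ] _ + _)
      abel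
  obtain ⟨B, hB⟩ : ∃ B : C ⊗[ℚ] (X ⊗[ℚ] Y) →ₗ[ℚ] X ⊗[ℚ] Y,
    B = (tensorMod X Y).act ∘ₗ (univ C).toLin.rTensor (X ⊗[ℚ] Y) := ⟨_, rfl⟩
  have hB' : ∀ c v, B (c ⊗ₜ v) = tensorAct X Y (cobarProj C c) v := fun c v => by
    rw [hB]; exact tensorMod_smul X Y (cobarProj C c) v
  have h2 : ∀ w, B ((TensorProduct.map (counitMap C X) (counitMap C Y)).lTensor C
      (leftCoact (cofreeCoact C X) (C ⊗[ℚ] Y) w)) =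
      TensorProduct.map (cogenAct X) (counitMap C Y) w +
        crossAct X Y ((counitMap C Y).lTensor (C ⊗[ℚ] X) w) := by
    intro w
    induction w using TensorProduct.induction_on with
    | zero => simp
    | add x y hx hy => simp only [map_add, hx, hy]; abel
    | tmul m n =>
      have h3 : ∀ w : C ⊗[ℚ] (C ⊗[ℚ] X), B ((TensorProduct.map (counitMap C X)
          (counitMap C Y)).lTensor C (((TensorProduct.mk ℚ (C ⊗[ℚ] X) (C ⊗[ℚ] Y)).flip n).lTensor C
            w)) = cogenAct X ((counitMap C X).lTensor C w) ⊗ₜ counitMap C Y n +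
            crossAct X Y ((counitMap C X).lTensor C w ⊗ₜ counitMap C Y n) := by
        intro w
        induction w using TensorProduct.induction_on with
        | zero => simp
        | add x y hx hy =>
          simp only [map_add, TensorProduct.add_tmul, hx, hy]; abel
        | tmul c m' => simp only [LinearMap.lTensor_tmul, LinearMap.flip_apply,
            TensorProduct.mk_apply, TensorProduct.map_tmul, hB', tensorAct_cogen]
      rw [leftCoact_tmul, h3, lTensor_counitMap_cofreeCoact]
      rfl
  have h3 : (tensorMod X Y).act (TensorProduct.map (univ C).toLin (kappaLin X Y)
      ((cotensor ((tCoext C).obj X) ((tCoext C).obj Y)).coact z)) =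
      B ((TensorProduct.map (counitMap C X) (counitMap C Y)).lTensor C
      (leftCoact (cofreeCoact C X) (C ⊗[ℚ] Y) (cotensorIncl _ _ z))) := by
    have h4 : ∀ u : C ⊗[ℚ] cotensor ((tCoext C).obj X) ((tCoext C).obj Y),
        (tensorMod X Y).act (TensorProduct.map (univ C).toLin (kappaLin X Y) u) =
        B ((TensorProduct.map (counitMap C X) (counitMap C Y)).lTensor C
          ((cotensorIncl ((tCoext C).obj X) ((tCoext C).obj Y)).lTensor C u)) := by
      intro u
      rw [hB]
      exact map_comp_eq (univ C).toLin (cotensorIncl ((tCoext C).obj X) ((tCoext C).obj Y))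
        (TensorProduct.map (counitMap C X) (counitMap C Y)) (tensorMod X Y).act u
    rw [h4, lTensor_cotensorIncl_coact]
    rfl
  rw [h3]
  refine Eq.trans ?_ (congrArg (dTens X Y (kappaLin X Y z) + ·) (h2 _).symm)
  rw [← crossAct_of_mem X Y (cotensorIncl _ _ z) z.2]
  refine Eq.trans ?_ (h1 (cotensorIncl _ _ z))
  rw [hD]
  rfl

/-- The comparison map `t_*X □ t_*Y ⟶ t_*(X ⊗ Y)`. -/
def kappa : cotensor ((tCoext C).obj X) ((tCoext C).obj Y) ⟶ (tCoext C).obj (X ⊗ Y) :=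
  coextLift (univ C) _ (tensorMod X Y) (kappaLin X Y) (kappaLin_mem X Y) (kappaLin_dif X Y)

theorem counitMap_kappa (z : cotensor ((tCoext C).obj X) ((tCoext C).obj Y)) :
    counitMap C (X ⊗[ℚ] Y) ((kappa X Y).toLin z) = kappaLin X Y z :=
  counitMap_coextLift _ _ (tensorMod X Y) _ _ _ z

theorem kappa_apply (z : cotensor ((tCoext C).obj X) ((tCoext C).obj Y)) :
    (kappa X Y).toLin z = TensorProduct.assoc ℚ C X Y ((counitMap C Y).lTensor (C ⊗[ℚ] X)
      (cotensorIncl _ _ z)) := by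
  have h1 : (kappa X Y).toLin z = (TensorProduct.map (counitMap C X) (counitMap C Y)).lTensor C
      (leftCoact (cofreeCoact C X) (C ⊗[ℚ] Y) (cotensorIncl _ _ z)) := by
    have h2 : ∀ u : C ⊗[ℚ] cotensor ((tCoext C).obj X) ((tCoext C).obj Y),
        (kappaLin X Y).lTensor C u = (TensorProduct.map (counitMap C X) (counitMap C Y)).lTensor C
          ((cotensorIncl ((tCoext C).obj X) ((tCoext C).obj Y)).lTensor C u) :=
      fun u => LinearMap.lTensor_comp_apply C _ _ u
    refine (h2 _).trans ?_
    rw [lTensor_cotensorIncl_coact]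
    rfl
  have h3 : ∀ w : (C ⊗[ℚ] X) ⊗[ℚ] (C ⊗[ℚ] Y),
      (TensorProduct.map (counitMap C X) (counitMap C Y)).lTensor C
        (leftCoact (cofreeCoact C X) (C ⊗[ℚ] Y) w) =
      TensorProduct.assoc ℚ C X Y ((counitMap C Y).lTensor (C ⊗[ℚ] X) w) := by
    intro w
    induction w using TensorProduct.induction_on with
    | zero => simp
    | add x y hx hy => simp only [map_add, hx, hy]
    | tmul m n =>
      have h4 : ∀ w : C ⊗[ℚ] (C ⊗[ℚ] X), (TensorProduct.map (counitMap C X)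
          (counitMap C Y)).lTensor C (((TensorProduct.mk ℚ (C ⊗[ℚ] X) (C ⊗[ℚ] Y)).flip n).lTensor C
            w) = TensorProduct.assoc ℚ C X Y ((counitMap C X).lTensor C w ⊗ₜ counitMap C Y n) := by
        intro w
        induction w using TensorProduct.induction_on with
        | zero => simp
        | add x y hx hy => simp only [map_add, TensorProduct.add_tmul, hx, hy]
        | tmul c m' => simp
      rw [leftCoact_tmul, h4, lTensor_counitMap_cofreeCoact]
      rfl
  rw [h1]
  exact h3 _

theorem kappa_bijective : Function.Bijective (kappa X Y).toLin := by
  have h := cotensor_cofree_bijective (N := (tCoext C).obj Y) (V := Y)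
    (LinearEquiv.refl ℚ (C ⊗[ℚ] Y)) (fun x => (LinearMap.lTensor_id_apply _ _ _).symm)
    ((tCoext C).obj X)
  have h2 := (TensorProduct.assoc ℚ C X Y).bijective.comp h
  have h3 : ⇑(kappa X Y).toLin = TensorProduct.assoc ℚ C X Y ∘ _ := funext (kappa_apply X Y)
  rw [h3]
  exact h2

instance : IsIso (kappa X Y) := DGComod.isIso_of_bijective _ (kappa_bijective X Y)

theorem kappa_naturality {X X' Y Y' : DGMod (Cobar C)} (f : X ⟶ X') (g : Y ⟶ Y') :
    cotensorMap ((tCoext C).map f) ((tCoext C).map g) ≫ kappa X' Y' =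
      kappa X Y ≫ (tCoext C).map (f ⊗ₘ g) := by
  refine coext_hom_ext (univ C) (X := X' ⊗ Y') _ _ fun z => ?_
  have h1 : ∀ w : (C ⊗[ℚ] X) ⊗[ℚ] (C ⊗[ℚ] Y), TensorProduct.map (counitMap C X') (counitMap C Y')
      (TensorProduct.map (f.toLin.lTensor C) (g.toLin.lTensor C) w) =
      TensorProduct.map f.toLin g.toLin (TensorProduct.map (counitMap C X) (counitMap C Y) w) := by
    intro w
    induction w using TensorProduct.induction_on with
    | zero => simp
    | add x y hx hy => simp only [map_add, hx, hy]
    | tmul m n => simp [counitMap_lTensor]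
  refine (counitMap_kappa X' Y' _).trans ((h1 (cotensorIncl _ _ z)).trans ?_)
  refine Eq.trans ?_ (counitMap_lTensor (X := X ⊗[ℚ] Y) (Y := X' ⊗[ℚ] Y')
    (TensorProduct.map f.toLin g.toLin) ((kappa X Y).toLin z)).symm
  exact congrArg (TensorProduct.map f.toLin g.toLin) (counitMap_kappa X Y z).symm

theorem kappa_assoc {Z : DGComod C} (X Y W : DGMod (Cobar C))
    (a : Z ⟶ cotensor (cotensor ((tCoext C).obj X) ((tCoext C).obj Y)) ((tCoext C).obj W))
    (b : Z ⟶ cotensor ((tCoext C).obj X) (cotensor ((tCoext C).obj Y) ((tCoext C).obj W)))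
    (hab : ∀ x : Z, TensorProduct.assoc ℚ _ _ _
        ((cotensorIncl ((tCoext C).obj X) ((tCoext C).obj Y)).rTensor _
          (cotensorIncl _ ((tCoext C).obj W) (a.toLin x))) =
      (cotensorIncl ((tCoext C).obj Y) ((tCoext C).obj W)).lTensor _
        (cotensorIncl ((tCoext C).obj X) _ (b.toLin x))) :
    a ≫ cotensorMap (kappa X Y) (𝟙 _) ≫ kappa (X ⊗ Y) W ≫ (tCoext C).map (α_ X Y W).hom =
      b ≫ cotensorMap (𝟙 _) (kappa Y W) ≫ kappa X (Y ⊗ W) := by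
  refine coext_hom_ext (univ C) (X := X ⊗ (Y ⊗ W)) _ _ fun z => ?_
  let p := counitMap C X
  let q := counitMap C Y
  let r := counitMap C W
  obtain ⟨i, hi⟩ : ∃ i : cotensor ((tCoext C).obj X) ((tCoext C).obj Y) →ₗ[ℚ]
    (C ⊗[ℚ] X) ⊗[ℚ] (C ⊗[ℚ] Y), i = cotensorIncl _ _ := ⟨_, rfl⟩
  obtain ⟨j, hj⟩ : ∃ j : cotensor ((tCoext C).obj Y) ((tCoext C).obj W) →ₗ[ℚ]
    (C ⊗[ℚ] Y) ⊗[ℚ] (C ⊗[ℚ] W), j = cotensorIncl _ _ := ⟨_, rfl⟩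
  obtain ⟨k, hk, hk'⟩ : ∃ k : cotensor ((tCoext C).obj X) ((tCoext C).obj Y) →ₗ[ℚ]
      C ⊗[ℚ] (X ⊗[ℚ] Y), k = (kappa X Y).toLin ∧
        ∀ m, counitMap C (X ⊗[ℚ] Y) (k m) = TensorProduct.map p q (i m) :=
    ⟨_, rfl, fun m => by rw [hi]; exact counitMap_kappa X Y m⟩
  obtain ⟨l, hl, hl'⟩ : ∃ l : cotensor ((tCoext C).obj Y) ((tCoext C).obj W) →ₗ[ℚ]
      C ⊗[ℚ] (Y ⊗[ℚ] W), l = (kappa Y W).toLin ∧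
        ∀ m, counitMap C (Y ⊗[ℚ] W) (l m) = TensorProduct.map q r (j m) :=
    ⟨_, rfl, fun m => by rw [hj]; exact counitMap_kappa Y W m⟩
  have h1 : ∀ w : cotensor ((tCoext C).obj X) ((tCoext C).obj Y) ⊗[ℚ] (C ⊗[ℚ] W),
      TensorProduct.assoc ℚ X Y W (TensorProduct.map (counitMap C (X ⊗[ℚ] Y)) r
        (TensorProduct.map k LinearMap.id w)) =
      TensorProduct.map p (TensorProduct.map q r)
        (TensorProduct.assoc ℚ (C ⊗[ℚ] X) (C ⊗[ℚ] Y) (C ⊗[ℚ] W) (i.rTensor (C ⊗[ℚ] W) w)) := by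
    intro w
    induction w using TensorProduct.induction_on with
    | zero => simp
    | add x y hx hy => simp only [map_add, hx, hy]
    | tmul m n =>
      rw [TensorProduct.map_tmul, TensorProduct.map_tmul, LinearMap.rTensor_tmul, hk']
      generalize i m = t
      induction t using TensorProduct.induction_on with
      | zero => simp
      | add x y hx hy => simp only [map_add, TensorProduct.add_tmul, hx, hy]
      | tmul x y => rfl
  have h2 : ∀ w : (C ⊗[ℚ] X) ⊗[ℚ] cotensor ((tCoext C).obj Y) ((tCoext C).obj W),
      TensorProduct.map p (counitMap C (Y ⊗[ℚ] W))
        (TensorProduct.map LinearMap.id l w) =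
      TensorProduct.map p (TensorProduct.map q r) (j.lTensor (C ⊗[ℚ] X) w) := by
    intro w
    induction w using TensorProduct.induction_on with
    | zero => simp
    | add x y hx hy => simp only [map_add, hx, hy]
    | tmul m n =>
      rw [TensorProduct.map_tmul, TensorProduct.map_tmul, LinearMap.lTensor_tmul,
        TensorProduct.map_tmul, hl']
      rfl
  refine (counitMap_lTensor (X := (X ⊗[ℚ] Y) ⊗[ℚ] W) (Y := X ⊗[ℚ] (Y ⊗[ℚ] W))
    (TensorProduct.assoc ℚ X Y W).toLinearMap ((kappa (X ⊗ Y) W).toLin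
      ((cotensorMap (kappa X Y) (𝟙 _)).toLin (a.toLin z)))).trans ?_
  refine (congrArg (TensorProduct.assoc ℚ X Y W) (counitMap_kappa (X ⊗ Y) W _)).trans ?_
  have h1' := h1 (cotensorIncl _ _ (a.toLin z))
  have h2' := h2 (cotensorIncl _ _ (b.toLin z))
  rw [hk, hi] at h1'
  rw [hl, hj] at h2'
  refine h1'.trans (Eq.trans ?_ (counitMap_kappa X (Y ⊗ W) _).symm)
  refine Eq.trans ?_ h2'.symm
  exact congrArg (TensorProduct.map p (TensorProduct.map q r)) (hab z)

theorem kappa_symm {Z : DGComod C} (X Y : DGMod (Cobar C))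
    (a : Z ⟶ cotensor ((tCoext C).obj X) ((tCoext C).obj Y))
    (b : Z ⟶ cotensor ((tCoext C).obj Y) ((tCoext C).obj X))
    (hab : ∀ x : Z, swap _ _ (cotensorIncl _ _ (a.toLin x)) = cotensorIncl _ _ (b.toLin x)) :
    a ≫ kappa X Y ≫ (tCoext C).map (β_ X Y).hom = b ≫ kappa Y X := by
  refine coext_hom_ext (univ C) (X := Y ⊗ X) _ _ fun z => ?_
  refine (counitMap_lTensor (X := X ⊗[ℚ] Y) (Y := Y ⊗[ℚ] X)
    (swap X Y) ((kappa X Y).toLin (a.toLin z))).trans ?_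
  refine (congrArg (swap X Y) (counitMap_kappa X Y _)).trans (Eq.trans ?_
    (counitMap_kappa Y X _).symm)
  refine (swap_map (V := C ⊗[ℚ] X) (W := C ⊗[ℚ] Y) (counitMap C X) (counitMap C Y) counitMap_mem
    counitMap_mem (cotensorIncl _ _ (a.toLin z))).trans ?_
  exact congrArg (TensorProduct.map (counitMap C Y) (counitMap C X)) (hab z)

/-- The isomorphism `C ≅ t_*ℚ`. -/
def regularHom (C : Type u) [AddCommGroup C] [Module ℚ C] [Coalgebra ℚ C] [DGVect C]
    [DGCoalgebra C] [TwoReduced C] [GradedCocomm C] : regular C ⟶ (tCoext C).obj (𝟙_ (DGMod (Cobar C))) :=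
  coextLift (univ C) (regular C) (unitMod C)
    (show C →ₗ[ℚ] unitMod C from
      (unitLin C).symm.toLinearMap ∘ₗ Coalgebra.counit (R := ℚ) (A := C))
    (fun n x hx => by
      by_cases h : n = 0
      · subst h; exact unitMod_mem_zero _
      · have : Coalgebra.counit (R := ℚ) (A := C) x = 0 := DGCoalgebra.counit_of_ne (C := C) n h x hx
        change (unitLin C).symm (Coalgebra.counit (R := ℚ) (A := C) x) ∈ gr (unitMod C) n
        rw [this, map_zero]
        exact Submodule.zero_mem _)
    (fun x => by
      have h1 : Coalgebra.counit (R := ℚ) (A := C) (dif C x) = 0 :=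
        DGCoalgebra.counit_d (C := C) x
      have h2 : ∀ w : C ⊗[ℚ] C, (unitMod C).act (TensorProduct.map (univ C).toLin
          ((unitLin C).symm.toLinearMap ∘ₗ Coalgebra.counit (R := ℚ) (A := C)) w) = 0 := by
        intro w
        induction w using TensorProduct.induction_on with
        | zero => simp
        | add x y hx hy => rw [map_add, map_add, hx, hy, add_zero]
        | tmul a b => exact unitMod_smul _ _
      refine (congrArg (unitLin C).symm h1).trans ((map_zero _).trans ?_)
      exact ((congrArg (dif (unitMod C) _ + ·) (h2 _)).trans (add_zero _)).symm)

theorem counitMap_regularHom (c : C) :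
    counitMap C (unitMod C) ((regularHom C).toLin c) =
      (unitLin C).symm (Coalgebra.counit (R := ℚ) c) :=
  counitMap_coextLift _ (regular C) (unitMod C) _ _ _ c

instance : IsIso (regularHom C) := by
  refine DGComod.isIso_of_bijective _ ?_
  have h1 : ∀ c : C, (regularHom C).toLin c = c ⊗ₜ (unitLin C).symm 1 := by
    intro c
    refine (LinearMap.lTensor_comp_apply C (unitLin C).symm.toLinearMap
      (Coalgebra.counit (R := ℚ) (A := C)) (Coalgebra.comul (R := ℚ) c)).trans ?_
    rw [Coalgebra.lTensor_counit_comul]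
    rfl
  have h2 : Function.Bijective (fun c : C => c ⊗ₜ[ℚ] (unitLin C).symm 1) :=
    ((TensorProduct.rid ℚ C).symm.trans
      (LinearEquiv.lTensor C (unitLin C).symm)).bijective
  rw [show ⇑(regularHom C).toLin = _ from funext h1]
  exact h2

theorem kappa_unit {Z : DGComod C} (Y : DGMod (Cobar C))
    (a : Z ⟶ cotensor (regular C) ((tCoext C).obj Y)) (b : Z ⟶ (tCoext C).obj Y)
    (hab : ∀ x : Z, TensorProduct.lid ℚ _ ((Coalgebra.counit (R := ℚ) (A := C)).rTensor _
            (cotensorIncl (regular C) _ (a.toLin x))) = b.toLin x) :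
    a ≫ cotensorMap (regularHom C) (𝟙 _) ≫ kappa (𝟙_ _) Y ≫ (tCoext C).map (λ_ Y).hom = b := by
  refine coext_hom_ext (univ C) (X := Y) _ _ fun z => ?_
  refine (counitMap_lTensor (X := unitMod C ⊗[ℚ] Y) (Y := Y)
    (unitorLin Y).toLinearMap ((kappa (𝟙_ _) Y).toLin
      ((cotensorMap (regularHom C) (𝟙 _)).toLin (a.toLin z)))).trans ?_
  refine (congrArg (unitorLin Y) (counitMap_kappa (𝟙_ _) Y _)).trans ?_
  obtain ⟨k, hk, hk'⟩ : ∃ k : C →ₗ[ℚ] C ⊗[ℚ] unitMod C, k = (regularHom C).toLin ∧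
      ∀ c, counitMap C (unitMod C) (k c) = (unitLin C).symm (Coalgebra.counit (R := ℚ) c) :=
    ⟨_, rfl, counitMap_regularHom⟩
  have h1 : ∀ w : C ⊗[ℚ] (C ⊗[ℚ] Y), unitorLin Y (TensorProduct.map (counitMap C (unitMod C))
      (counitMap C Y) (TensorProduct.map k LinearMap.id w)) =
      counitMap C Y (counitMap C (C ⊗[ℚ] Y) w) := by
    intro w
    induction w using TensorProduct.induction_on with
    | zero => simp
    | add x y hx hy => simp only [map_add, hx, hy]
    | tmul m n =>
      rw [TensorProduct.map_tmul, TensorProduct.map_tmul, counitMap_tmul, map_smul, hk',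
        unitorLin_tmul, LinearEquiv.apply_symm_apply, LinearMap.id_apply]
  have h1' := h1 (cotensorIncl _ _ (a.toLin z))
  rw [hk] at h1'
  refine h1'.trans ?_
  exact congrArg (counitMap C Y) (hab z)

end Kappa

/-! ### Quasi-isomorphisms of modules and `t`-equivalences -/

section TEquiv

variable (C : Type u) [AddCommGroup C] [Module ℚ C] [Coalgebra ℚ C] [DGVect C] [DGCoalgebra C]
  [TwoReduced C]

/-- The quasi-isomorphisms of dg modules over the cobar construction. -/
def modQuasiIso : MorphismProperty (DGMod (Cobar C)) :=
  (HomologicalComplex.quasiIso _ _).inverseImage (DGMod.underlying (Cobar C))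

instance : (modQuasiIso C).IsMultiplicative :=
  inferInstanceAs ((HomologicalComplex.quasiIso _ _).inverseImage _).IsMultiplicative

instance : (modQuasiIso C).HasTwoOutOfThreeProperty :=
  inferInstanceAs ((HomologicalComplex.quasiIso _ _).inverseImage _).HasTwoOutOfThreeProperty

instance : (tEquiv C).HasTwoOutOfThreeProperty :=
  inferInstanceAs ((modQuasiIso C).inverseImage (tExt C)).HasTwoOutOfThreeProperty

variable {C}

theorem modQuasiIso_counitHom (X : DGMod (Cobar C)) : modQuasiIso C (counitHom (univ C) X) :=
  counitHom_quasiIso X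

theorem tEquiv_unitHom (N : DGComod C) : tEquiv C (unitHom (univ C) N) := by
  change modQuasiIso C ((tExt C).map (unitHom (univ C) N))
  refine (modQuasiIso C).of_postcomp _ _ (modQuasiIso_counitHom ((tExt C).obj N)) ?_
  rw [ext_unitHom_counitHom]
  exact (modQuasiIso C).id_mem _

theorem tEquiv_tCoext_map {X Y : DGMod (Cobar C)} (f : X ⟶ Y) (hf : modQuasiIso C f) :
    tEquiv C ((tCoext C).map f) := by
  change modQuasiIso C ((tExt C).map ((tCoext C).map f))
  refine (modQuasiIso C).of_postcomp _ _ (modQuasiIso_counitHom Y) ?_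
  rw [counitHom_naturality]
  exact (modQuasiIso C).comp_mem _ _ (modQuasiIso_counitHom X) hf

/-- The unit `1 ⟶ t_* t^!` as a natural transformation. -/
def unitNat (C : Type u) [AddCommGroup C] [Module ℚ C] [Coalgebra ℚ C] [DGVect C] [DGCoalgebra C]
    [TwoReduced C] : 𝟭 (DGComod C) ⟶ tExt C ⋙ tCoext C where
  app N := unitHom (univ C) N
  naturality _ _ f := unitHom_naturality (univ C) f

/-- The counit `t^! t_* ⟶ 1` as a natural transformation. -/
def counitNat (C : Type u) [AddCommGroup C] [Module ℚ C] [Coalgebra ℚ C] [DGVect C]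
    [DGCoalgebra C] [TwoReduced C] : tCoext C ⋙ tExt C ⟶ 𝟭 (DGMod (Cobar C)) where
  app X := counitHom (univ C) X
  naturality _ _ f := counitHom_naturality (univ C) f

instance (N : DGComod C) : IsIso ((toHo C).map (unitHom (univ C) N)) :=
  Localization.inverts (toHo C) (tEquiv C) _ (tEquiv_unitHom N)

/-- The localization functor on modules over the cobar construction. -/
abbrev coextHo (C : Type u) [AddCommGroup C] [Module ℚ C] [Coalgebra ℚ C] [DGVect C]
    [DGCoalgebra C] [TwoReduced C] : DGMod (Cobar C) ⥤ HoComod C := tCoext C ⋙ toHo C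

theorem coextHo_inverts : (modQuasiIso C).IsInvertedBy (coextHo C) := fun _ _ f hf =>
  Localization.inverts (toHo C) (tEquiv C) _ (tEquiv_tCoext_map f hf)

instance : (coextHo C).IsLocalization (modQuasiIso C) where
  inverts := coextHo_inverts
  isEquivalence := by
    have hE : (tEquiv C).IsInvertedBy (tExt C ⋙ (modQuasiIso C).Q) := fun _ _ f hf =>
      Localization.inverts (modQuasiIso C).Q (modQuasiIso C) _ hf
    have : IsIso (Functor.whiskerRight (unitNat C) (toHo C)) := by
      rw [NatTrans.isIso_iff_isIso_app]
      intro N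
      exact inferInstanceAs (IsIso ((toHo C).map (unitHom (univ C) N)))
    have : IsIso (Functor.whiskerRight (counitNat C) (modQuasiIso C).Q) := by
      rw [NatTrans.isIso_iff_isIso_app]
      intro X
      exact Localization.inverts (modQuasiIso C).Q (modQuasiIso C) _ (modQuasiIso_counitHom X)
    refine Localization.isEquivalence (modQuasiIso C).Q (modQuasiIso C) (toHo C) (tEquiv C)
      (coextHo C) (Localization.Construction.lift (coextHo C) coextHo_inverts)
      (tExt C ⋙ (modQuasiIso C).Q) (Localization.lift _ hE (toHo C)) ?_ ?_
    · exact Functor.associator _ _ _ ≪≫ Functor.isoWhiskerLeft _ (Localization.fac _ hE (toHo C)) ≪≫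
        (Functor.associator _ _ _).symm ≪≫
          asIso (Functor.whiskerRight (counitNat C) (modQuasiIso C).Q) ≪≫ Functor.leftUnitor _
    · exact Functor.associator _ _ _ ≪≫ Functor.isoWhiskerLeft _
        (Localization.Lifting.iso (modQuasiIso C).Q (modQuasiIso C) _ _) ≪≫
        (Functor.associator _ _ _).symm ≪≫
          (asIso (Functor.whiskerRight (unitNat C) (toHo C))).symm ≪≫ Functor.leftUnitor _

variable [GradedCocomm C]

instance : (modQuasiIso C).IsMonoidal where
  whiskerLeft X {Y₁ Y₂} g hg := by
    change QuasiIso (X ◁ g).toDGHom.complexMap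
    rw [quasiIso_iff_QI]
    exact QI.lTensor X g.toDGHom ((quasiIso_iff_QI g.toDGHom).1 hg)
  whiskerRight {X₁ X₂} f hf Y := by
    change QuasiIso (f ▷ Y).toDGHom.complexMap
    rw [quasiIso_iff_QI]
    exact QI.rTensor Y f.toDGHom ((quasiIso_iff_QI f.toDGHom).1 hf)

theorem tEquiv_cotensorMap {X X' Y Y' : DGMod (Cobar C)} (f : X ⟶ X') (g : Y ⟶ Y')
    (hf : modQuasiIso C f) (hg : modQuasiIso C g) :
    tEquiv C (cotensorMap ((tCoext C).map f) ((tCoext C).map g)) := by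
  have h : ∀ X Y : DGMod (Cobar C), tEquiv C (kappa X Y) := fun X Y =>
    inferInstanceAs (QuasiIso ((DGMod.underlying (Cobar C)).map ((tExt C).map (kappa X Y))))
  refine (tEquiv C).of_postcomp _ (kappa X' Y') (h _ _) ?_
  rw [kappa_naturality]
  exact (tEquiv C).comp_mem _ _ (h _ _)
    (tEquiv_tCoext_map _ ((modQuasiIso C).tensorHom_mem f g hf hg))

/-- The derived cotensor product preserves `t`-equivalences. -/
theorem tEquiv_derivedCotensor_map {M M' N N' : DGComod C} (f : M ⟶ M') (g : N ⟶ N')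
    (hf : tEquiv C f) (hg : tEquiv C g) :
    tEquiv C ((derivedCotensor C).map (X := (M, N)) (Y := (M', N')) (Prod.mkHom f g)) :=
  tEquiv_cotensorMap ((tExt C).map f) ((tExt C).map g) hf hg

end TEquiv

/-! ### The symmetric monoidal structure -/

section Monoidal

variable {C : Type u} [AddCommGroup C] [Module ℚ C] [Coalgebra ℚ C] [DGVect C] [DGCoalgebra C]
  [TwoReduced C] [GradedCocomm C]

theorem cotensorMap_comp {M M' M'' N N' N'' : DGComod C} (f : M ⟶ M') (f' : M' ⟶ M'')
    (g : N ⟶ N') (g' : N' ⟶ N'') :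
    cotensorMap f g ≫ cotensorMap f' g' = cotensorMap (f ≫ f') (g ≫ g') :=
  ((cotensorFunctor C).map_comp (X := (M, N)) (Y := (M', N')) (Z := (M'', N''))
    (Prod.mkHom f g) (Prod.mkHom f' g')).symm

/-- The comparison `Q(t_*X □ t_*Y) ≅ Q(t_*(X ⊗ Y))`. -/
def kappaIso (X Y : DGMod (Cobar C)) :
    (toHo C).obj (cotensor ((tCoext C).obj X) ((tCoext C).obj Y)) ≅ (coextHo C).obj (X ⊗ Y) :=
  (toHo C).mapIso (asIso (kappa X Y))

theorem kappaIso_naturality {X X' Y Y' : DGMod (Cobar C)} (f : X ⟶ X') (g : Y ⟶ Y') :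
    (toHo C).map (cotensorMap ((tCoext C).map f) ((tCoext C).map g)) ≫ (kappaIso X' Y').hom =
      (kappaIso X Y).hom ≫ (coextHo C).map (f ⊗ₘ g) := by
  change (toHo C).map _ ≫ (toHo C).map (kappa X' Y') = (toHo C).map (kappa X Y) ≫ (toHo C).map _
  rw [← Functor.map_comp, ← Functor.map_comp, kappa_naturality]

variable [MonoidalCategory (HoComod C)] [SymmetricCategory (HoComod C)] [(coextHo C).Braided]

open Functor.LaxMonoidal Functor.OplaxMonoidal

/-- The isomorphism `Q(t_*X □ t_*Y) ≅ Q(t_*X) ⊗ Q(t_*Y)`. -/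
def kappaTensor (X Y : DGMod (Cobar C)) :
    (toHo C).obj (cotensor ((tCoext C).obj X) ((tCoext C).obj Y)) ≅
      (coextHo C).obj X ⊗ (coextHo C).obj Y :=
  kappaIso X Y ≪≫ (Functor.Monoidal.μIso (coextHo C) X Y).symm

theorem kappaTensor_hom (X Y : DGMod (Cobar C)) :
    (kappaTensor X Y).hom = (toHo C).map (kappa X Y) ≫ δ (coextHo C) X Y := rfl

theorem kappaTensor_naturality {X X' Y Y' : DGMod (Cobar C)} (f : X ⟶ X') (g : Y ⟶ Y') :
    (toHo C).map (cotensorMap ((tCoext C).map f) ((tCoext C).map g)) ≫ (kappaTensor X' Y').hom =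
      (kappaTensor X Y).hom ≫ ((coextHo C).map f ⊗ₘ (coextHo C).map g) := by
  rw [kappaTensor_hom, kappaTensor_hom, Category.assoc, δ_natural, ← Category.assoc,
    ← Category.assoc]
  congr 1
  exact kappaIso_naturality f g

/-- The isomorphism `QM ⊗ QN ≅ Q(t_*t^!M □ t_*t^!N)`. -/
def tensorDerivedIso : (toHo C).prod (toHo C) ⋙ tensor (HoComod C) ≅ derivedCotensor C ⋙ toHo C :=
  NatIso.ofComponents (fun P => (asIso ((toHo C).map (unitHom (univ C) P.1)) ⊗ᵢ
      asIso ((toHo C).map (unitHom (univ C) P.2))) ≪≫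
      (kappaTensor ((tExt C).obj P.1) ((tExt C).obj P.2)).symm) (by
    rintro ⟨M, N⟩ ⟨M', N'⟩ f
    have h := kappaTensor_naturality ((tExt C).map f.1) ((tExt C).map f.2)
    have h1 := congrArg (toHo C).map (unitHom_naturality (univ C) f.1)
    have h2 := congrArg (toHo C).map (unitHom_naturality (univ C) f.2)
    rw [Functor.map_comp, Functor.map_comp] at h1 h2
    change ((toHo C).map f.1 ⊗ₘ (toHo C).map f.2) ≫
      (((toHo C).map (unitHom (univ C) M') ⊗ₘ (toHo C).map (unitHom (univ C) N')) ≫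
        (kappaTensor ((tExt C).obj M') ((tExt C).obj N')).inv) =
      (((toHo C).map (unitHom (univ C) M) ⊗ₘ (toHo C).map (unitHom (univ C) N)) ≫
        (kappaTensor ((tExt C).obj M) ((tExt C).obj N)).inv) ≫
        (toHo C).map (cotensorMap ((tCoext C).map ((tExt C).map f.1))
          ((tCoext C).map ((tExt C).map f.2)))
    rw [← Category.assoc, Iso.comp_inv_eq, Category.assoc, Category.assoc, h,
      Iso.inv_hom_id_assoc]
    erw [MonoidalCategory.tensorHom_comp_tensorHom, MonoidalCategory.tensorHom_comp_tensorHom]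
    rw [h1, h2]
    rfl)

/-- The canonical map `Q(M □ N) ⟶ QM ⊗ QN`. -/
def cotensorToTensor (M N : DGComod C) :
    (toHo C).obj (cotensor M N) ⟶ (toHo C).obj M ⊗ (toHo C).obj N :=
  (toHo C).map (cotensorMap (unitHom (univ C) M) (unitHom (univ C) N)) ≫
    (kappaTensor ((tExt C).obj M) ((tExt C).obj N)).hom ≫
      (inv ((toHo C).map (unitHom (univ C) M)) ⊗ₘ inv ((toHo C).map (unitHom (univ C) N)))

theorem cotensorToTensor_unit (M N : DGComod C) :
    cotensorToTensor M N ≫ ((toHo C).map (unitHom (univ C) M) ⊗ₘ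
        (toHo C).map (unitHom (univ C) N)) =
      (toHo C).map (cotensorMap (unitHom (univ C) M) (unitHom (univ C) N)) ≫
        (kappaTensor ((tExt C).obj M) ((tExt C).obj N)).hom := by
  have h : (inv ((toHo C).map (unitHom (univ C) M)) ⊗ₘ inv ((toHo C).map (unitHom (univ C) N))) ≫
    ((toHo C).map (unitHom (univ C) M) ⊗ₘ (toHo C).map (unitHom (univ C) N)) = 𝟙 _ := by
    rw [MonoidalCategory.tensorHom_comp_tensorHom, IsIso.inv_hom_id, IsIso.inv_hom_id,
      id_tensorHom_id]
  rw [cotensorToTensor, Category.assoc, Category.assoc, h]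
  exact congrArg _ (Category.comp_id _)

theorem cotensorToTensor_naturality {M M' N N' : DGComod C} (f : M ⟶ M') (g : N ⟶ N') :
    (toHo C).map (cotensorMap f g) ≫ cotensorToTensor M' N' =
      cotensorToTensor M N ≫ ((toHo C).map f ⊗ₘ (toHo C).map g) := by
  rw [← cancel_mono ((toHo C).map (unitHom (univ C) M') ⊗ₘ (toHo C).map (unitHom (univ C) N')),
    Category.assoc, Category.assoc, cotensorToTensor_unit,
    MonoidalCategory.tensorHom_comp_tensorHom, ← Functor.map_comp, ← Functor.map_comp,
    unitHom_naturality, unitHom_naturality, Functor.map_comp, Functor.map_comp,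
    ← MonoidalCategory.tensorHom_comp_tensorHom, ← Category.assoc, ← Category.assoc,
    cotensorToTensor_unit, ← Functor.map_comp, cotensorMap_comp, unitHom_naturality,
    unitHom_naturality, ← cotensorMap_comp, Functor.map_comp, Category.assoc, Category.assoc]
  congr 1
  exact kappaTensor_naturality ((tExt C).map f) ((tExt C).map g)

/-- On twisted coextensions the canonical map is the comparison `kappaTensor`. -/
theorem cotensorToTensor_tCoext (X Y : DGMod (Cobar C)) :
    cotensorToTensor ((tCoext C).obj X) ((tCoext C).obj Y) = (kappaTensor X Y).hom := by
  have h : ∀ X : DGMod (Cobar C), IsIso ((toHo C).map ((tCoext C).map (counitHom (univ C) X))) :=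
    fun X => coextHo_inverts _ (modQuasiIso_counitHom X)
  have h1 : ∀ X : DGMod (Cobar C), unitHom (univ C) ((tCoext C).obj X) ≫
      (tCoext C).map (counitHom (univ C) X) = 𝟙 _ := unitHom_coext_counitHom (univ C)
  have h2 : ∀ X : DGMod (Cobar C), (toHo C).map (unitHom (univ C) ((tCoext C).obj X)) ≫
      (toHo C).map ((tCoext C).map (counitHom (univ C) X)) = 𝟙 _ := fun X => by
    rw [← Functor.map_comp, h1, CategoryTheory.Functor.map_id]
  have h3 := cotensorToTensor_unit ((tCoext C).obj X) ((tCoext C).obj Y) =≫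
    ((toHo C).map ((tCoext C).map (counitHom (univ C) X)) ⊗ₘ
      (toHo C).map ((tCoext C).map (counitHom (univ C) Y)))
  rw [Category.assoc, MonoidalCategory.tensorHom_comp_tensorHom, h2, h2, id_tensorHom_id,
    Category.comp_id, Category.assoc] at h3
  rw [h3]
  refine (congrArg _ (kappaTensor_naturality (counitHom (univ C) X)
    (counitHom (univ C) Y)).symm).trans ?_
  rw [← Category.assoc, ← Functor.map_comp, cotensorMap_comp, h1, h1]
  have h4 : cotensorMap (𝟙 ((tCoext C).obj X)) (𝟙 ((tCoext C).obj Y)) = 𝟙 _ :=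
    (cotensorFunctor C).map_id (((tCoext C).obj X), ((tCoext C).obj Y))
  rw [h4, CategoryTheory.Functor.map_id, Category.id_comp]

end Monoidal

section Coherence

variable {C : Type u} [AddCommGroup C] [Module ℚ C] [Coalgebra ℚ C] [DGVect C] [DGCoalgebra C]
  [TwoReduced C] [GradedCocomm C]
variable [MonoidalCategory (HoComod C)] [SymmetricCategory (HoComod C)] [(coextHo C).Braided]

open Functor.LaxMonoidal Functor.OplaxMonoidal

theorem cotensorToTensor_assoc_tCoext (X Y W : DGMod (Cobar C)) {Z : DGComod C}
    (a : Z ⟶ cotensor (cotensor ((tCoext C).obj X) ((tCoext C).obj Y)) ((tCoext C).obj W))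
    (b : Z ⟶ cotensor ((tCoext C).obj X) (cotensor ((tCoext C).obj Y) ((tCoext C).obj W)))
    (hab : ∀ x : Z, TensorProduct.assoc ℚ _ _ _
        ((cotensorIncl ((tCoext C).obj X) ((tCoext C).obj Y)).rTensor _
          (cotensorIncl _ ((tCoext C).obj W) (a.toLin x))) =
      (cotensorIncl ((tCoext C).obj Y) ((tCoext C).obj W)).lTensor _
        (cotensorIncl ((tCoext C).obj X) _ (b.toLin x))) :
    (toHo C).map a ≫ cotensorToTensor _ _ ≫
        (cotensorToTensor ((tCoext C).obj X) ((tCoext C).obj Y) ▷ (toHo C).obj ((tCoext C).obj W)) ≫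
        (α_ ((toHo C).obj ((tCoext C).obj X)) ((toHo C).obj ((tCoext C).obj Y))
          ((toHo C).obj ((tCoext C).obj W))).hom =
      (toHo C).map b ≫ cotensorToTensor _ _ ≫
        ((toHo C).obj ((tCoext C).obj X) ◁
          cotensorToTensor ((tCoext C).obj Y) ((tCoext C).obj W)) := by
  have h1 := cotensorToTensor_naturality (kappa X Y) (𝟙 ((tCoext C).obj W))
  have h2 := cotensorToTensor_naturality (𝟙 ((tCoext C).obj X)) (kappa Y W)
  have h3 := congrArg (toHo C).map (kappa_assoc X Y W a b hab)
  have h4 := Functor.OplaxMonoidal.associativity (F := coextHo C) X Y W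
  rw [CategoryTheory.Functor.map_id, tensorHom_id] at h1
  rw [CategoryTheory.Functor.map_id, id_tensorHom] at h2
  simp only [Functor.map_comp] at h3
  have h5 : cotensorToTensor ((tCoext C).obj (X ⊗ Y)) ((tCoext C).obj W) =
    (toHo C).map (kappa (X ⊗ Y) W) ≫ δ (coextHo C) (X ⊗ Y) W := cotensorToTensor_tCoext _ _
  have h6 : cotensorToTensor ((tCoext C).obj X) ((tCoext C).obj (Y ⊗ W)) =
    (toHo C).map (kappa X (Y ⊗ W)) ≫ δ (coextHo C) X (Y ⊗ W) := cotensorToTensor_tCoext _ _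
  have h7 : ∀ X Y, cotensorToTensor ((tCoext C).obj X) ((tCoext C).obj Y) =
    (toHo C).map (kappa X Y) ≫ δ (coextHo C) X Y := cotensorToTensor_tCoext
  rw [h5] at h1
  rw [h6] at h2
  rw [h7 X Y, h7 Y W, comp_whiskerRight, MonoidalCategory.whiskerLeft_comp]
  calc _ = (toHo C).map a ≫ (cotensorToTensor _ _ ≫ ((toHo C).map (kappa X Y) ▷
          (toHo C).obj ((tCoext C).obj W))) ≫ (δ (coextHo C) X Y ▷ (coextHo C).obj W ≫
            (α_ ((coextHo C).obj X) ((coextHo C).obj Y) ((coextHo C).obj W)).hom) := by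
        simp only [Category.assoc]; rfl
    _ = ((toHo C).map a ≫ (toHo C).map (cotensorMap (kappa X Y) (𝟙 _)) ≫
          (toHo C).map (kappa (X ⊗ Y) W)) ≫ (δ (coextHo C) (X ⊗ Y) W ≫
          δ (coextHo C) X Y ▷ (coextHo C).obj W ≫
            (α_ ((coextHo C).obj X) ((coextHo C).obj Y) ((coextHo C).obj W)).hom) := by
        rw [← h1]; simp only [Category.assoc]
    _ = ((toHo C).map a ≫ (toHo C).map (cotensorMap (kappa X Y) (𝟙 _)) ≫
          (toHo C).map (kappa (X ⊗ Y) W) ≫ (toHo C).map ((tCoext C).map (α_ X Y W).hom)) ≫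
          (δ (coextHo C) X (Y ⊗ W) ≫ (coextHo C).obj X ◁ δ (coextHo C) Y W) := by
        rw [h4]; simp only [Category.assoc]; rfl
    _ = (toHo C).map b ≫ (toHo C).map (cotensorMap (𝟙 _) (kappa Y W)) ≫
          ((toHo C).map (kappa X (Y ⊗ W)) ≫ δ (coextHo C) X (Y ⊗ W)) ≫
            (coextHo C).obj X ◁ δ (coextHo C) Y W := by
        rw [h3]; simp only [Category.assoc]
    _ = _ := by
        have h8 := h2 =≫ ((coextHo C).obj X ◁ δ (coextHo C) Y W)
        rw [Category.assoc] at h8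
        rw [h8]; simp only [Category.assoc]; rfl

theorem cotensorToTensor_assoc (M N P X : DGComod C) (a : X ⟶ cotensor (cotensor M N) P)
    (b : X ⟶ cotensor M (cotensor N P))
    (hab : ∀ x : X, TensorProduct.assoc ℚ M N P
        ((cotensorIncl M N).rTensor P (cotensorIncl (cotensor M N) P (a.toLin x))) =
      (cotensorIncl N P).lTensor M (cotensorIncl M (cotensor N P) (b.toLin x))) :
    (toHo C).map a ≫ cotensorToTensor (cotensor M N) P ≫
        (cotensorToTensor M N ▷ (toHo C).obj P) ≫
        (α_ ((toHo C).obj M) ((toHo C).obj N) ((toHo C).obj P)).hom =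
      (toHo C).map b ≫ cotensorToTensor M (cotensor N P) ≫
        ((toHo C).obj M ◁ cotensorToTensor N P) := by
  let η := fun M : DGComod C => unitHom (univ C) M
  have h := cotensorToTensor_assoc_tCoext ((tExt C).obj M) ((tExt C).obj N) ((tExt C).obj P)
    (a ≫ cotensorMap (cotensorMap (η M) (η N)) (η P))
    (b ≫ cotensorMap (η M) (cotensorMap (η N) (η P))) (fun x => by
      have h1 : ∀ w : cotensor M N ⊗[ℚ] P, TensorProduct.assoc ℚ _ _ _
          ((cotensorIncl _ _).rTensor _ (TensorProduct.map (cotensorMap (η M) (η N)).toLin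
            (η P).toLin w)) =
          TensorProduct.map (η M).toLin (TensorProduct.map (η N).toLin (η P).toLin)
            (TensorProduct.assoc ℚ M N P ((cotensorIncl M N).rTensor P w)) := by
        intro w
        induction w using TensorProduct.induction_on with
        | zero => simp
        | add x y hx hy => simp only [map_add, hx, hy]
        | tmul m n =>
          rw [TensorProduct.map_tmul, LinearMap.rTensor_tmul, LinearMap.rTensor_tmul,
            cotensorIncl_map]
          generalize cotensorIncl M N m = t
          induction t using TensorProduct.induction_on with
          | zero => simp
          | add x y hx hy => simp only [map_add, TensorProduct.add_tmul, hx, hy]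
          | tmul x y => rfl
      have h2 : ∀ w : M ⊗[ℚ] cotensor N P,
          ((cotensorIncl _ _).lTensor _ (TensorProduct.map (η M).toLin
            (cotensorMap (η N) (η P)).toLin w)) =
          TensorProduct.map (η M).toLin (TensorProduct.map (η N).toLin (η P).toLin)
            ((cotensorIncl N P).lTensor M w) := by
        intro w
        induction w using TensorProduct.induction_on with
        | zero => simp
        | add x y hx hy => simp only [map_add, hx, hy]
        | tmul m n =>
          rw [TensorProduct.map_tmul, LinearMap.lTensor_tmul, LinearMap.lTensor_tmul,
            cotensorIncl_map, TensorProduct.map_tmul]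
      refine (h1 (cotensorIncl _ _ (a.toLin x))).trans (Eq.trans ?_
        (h2 (cotensorIncl _ _ (b.toLin x))).symm)
      rw [hab])
  have n1 := cotensorToTensor_naturality (η M) (η N)
  have n2 := cotensorToTensor_naturality (η N) (η P)
  have n3 := cotensorToTensor_naturality (cotensorMap (η M) (η N)) (η P)
  have n4 := cotensorToTensor_naturality (η M) (cotensorMap (η N) (η P))
  have i : ∀ M, IsIso ((toHo C).map (η M)) := fun M =>
    inferInstanceAs (IsIso ((toHo C).map (unitHom (univ C) M)))
  rw [← cancel_mono ((toHo C).map (η M) ⊗ₘ ((toHo C).map (η N) ⊗ₘ (toHo C).map (η P)))]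
  simp only [Functor.map_comp, Category.assoc] at h
  rw [reassoc_of% n3, reassoc_of% n4] at h
  simp only [Category.assoc, ← associator_naturality]
  refine Eq.trans ?_ (h.trans ?_)
  · rw [← tensorHom_id, ← tensorHom_id, MonoidalCategory.tensorHom_comp_tensorHom_assoc,
      MonoidalCategory.tensorHom_comp_tensorHom_assoc, n1, Category.id_comp, Category.comp_id]
  · rw [← id_tensorHom, ← id_tensorHom, MonoidalCategory.tensorHom_comp_tensorHom,
      MonoidalCategory.tensorHom_comp_tensorHom, n2, Category.id_comp, Category.comp_id]

theorem cotensorToTensor_symm (M N X : DGComod C) (a : X ⟶ cotensor M N) (b : X ⟶ cotensor N M)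
    (hab : ∀ x : X, swap M N (cotensorIncl M N (a.toLin x)) = cotensorIncl N M (b.toLin x)) :
    (toHo C).map a ≫ cotensorToTensor M N ≫ (β_ ((toHo C).obj M) ((toHo C).obj N)).hom =
      (toHo C).map b ≫ cotensorToTensor N M := by
  have h := kappa_symm ((tExt C).obj M) ((tExt C).obj N)
    (a ≫ cotensorMap (unitHom (univ C) M) (unitHom (univ C) N))
    (b ≫ cotensorMap (unitHom (univ C) N) (unitHom (univ C) M)) (fun x => by
      refine (swap_map (unitHom (univ C) M).toLin (unitHom (univ C) N).toLin
        (unitHom (univ C) M).map_mem (unitHom (univ C) N).map_mem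
          (cotensorIncl _ _ (a.toLin x))).trans ?_
      rw [hab]; rfl)
  have h' := congrArg (toHo C).map h
  simp only [Functor.map_comp, Category.assoc] at h'
  rw [← cancel_mono ((toHo C).map (unitHom (univ C) N) ⊗ₘ (toHo C).map (unitHom (univ C) M)),
    Category.assoc, Category.assoc, Category.assoc, ← BraidedCategory.braiding_naturality,
    cotensorToTensor_unit, ← Category.assoc (cotensorToTensor M N), cotensorToTensor_unit]
  have h2 := Functor.map_braiding (coextHo C) ((tExt C).obj M) ((tExt C).obj N)
  have h3 : δ (coextHo C) ((tExt C).obj M) ((tExt C).obj N) ≫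
      (β_ ((coextHo C).obj ((tExt C).obj M)) ((coextHo C).obj ((tExt C).obj N))).hom =
      (coextHo C).map (β_ ((tExt C).obj M) ((tExt C).obj N)).hom ≫
        δ (coextHo C) ((tExt C).obj N) ((tExt C).obj M) := by
    rw [h2]; simp
  rw [kappaTensor_hom, kappaTensor_hom]
  calc _ = ((toHo C).map a ≫ (toHo C).map (cotensorMap (unitHom (univ C) M) (unitHom (univ C) N)) ≫
          (toHo C).map (kappa _ _)) ≫ (δ (coextHo C) ((tExt C).obj M) ((tExt C).obj N) ≫ (β_ _ _).hom) := by
        simp only [Category.assoc]; rfl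
    _ = _ := by
        rw [h3]
        simp only [Category.assoc]
        have h9 := h' =≫ δ (coextHo C) ((tExt C).obj N) ((tExt C).obj M)
        simp only [Category.assoc] at h9
        exact h9

theorem cotensorToTensor_leftUnit (M X : DGComod C) (a : X ⟶ cotensor (regular C) M) (b : X ⟶ M)
    (hab : ∀ x : X, TensorProduct.lid ℚ M ((Coalgebra.counit (R := ℚ) (A := C)).rTensor M
            (cotensorIncl (regular C) M (a.toLin x))) = b.toLin x) :
    (toHo C).map a ≫ cotensorToTensor (regular C) M ≫
      (((toHo C).map (regularHom C) ≫ Functor.OplaxMonoidal.η (coextHo C)) ▷ (toHo C).obj M) ≫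
            (λ_ ((toHo C).obj M)).hom = (toHo C).map b := by
  have h := congrArg (toHo C).map (kappa_unit ((tExt C).obj M)
    (a ≫ cotensorMap (𝟙 _) (unitHom (univ C) M)) (b ≫ unitHom (univ C) M) (fun x => by
      have h1 : ∀ w : C ⊗[ℚ] M, TensorProduct.lid ℚ _ ((Coalgebra.counit (R := ℚ) (A := C)).rTensor _
          (TensorProduct.map LinearMap.id (unitHom (univ C) M).toLin w)) =
          (unitHom (univ C) M).toLin (TensorProduct.lid ℚ M
            ((Coalgebra.counit (R := ℚ) (A := C)).rTensor M w)) := by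
        intro w
        induction w using TensorProduct.induction_on with
        | zero => simp
        | add x y hx hy => simp only [map_add, hx, hy]
        | tmul m n => simp
      refine (h1 (cotensorIncl (regular C) M (a.toLin x))).trans ?_
      rw [hab]; rfl))
  have n1 := cotensorToTensor_naturality (𝟙 (regular C)) (unitHom (univ C) M)
  have n2 := cotensorToTensor_naturality (regularHom C) (𝟙 ((tCoext C).obj ((tExt C).obj M)))
  rw [CategoryTheory.Functor.map_id, id_tensorHom] at n1
  rw [CategoryTheory.Functor.map_id, tensorHom_id] at n2
  have h7 : cotensorToTensor ((tCoext C).obj (𝟙_ _)) ((tCoext C).obj ((tExt C).obj M)) =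
    (toHo C).map (kappa (𝟙_ _) ((tExt C).obj M)) ≫ δ (coextHo C) (𝟙_ _) ((tExt C).obj M) :=
    cotensorToTensor_tCoext _ _
  have h8 := Functor.OplaxMonoidal.left_unitality_hom (F := coextHo C) ((tExt C).obj M)
  rw [h7] at n2
  simp only [Functor.map_comp, Category.assoc] at h
  rw [← cancel_mono ((toHo C).map (unitHom (univ C) M))]
  simp only [Category.assoc, ← leftUnitor_naturality, comp_whiskerRight]
  rw [← whisker_exchange_assoc, ← whisker_exchange_assoc, ← reassoc_of% n1, ← reassoc_of% n2]
  rw [← h]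
  congr 3
  exact congrArg ((toHo C).map (kappa (𝟙_ (DGMod (Cobar C))) ((tExt C).obj M)) ≫ ·) h8

end Coherence

section Main

variable (C : Type u) [AddCommGroup C] [Module ℚ C] [Coalgebra ℚ C] [DGVect C] [DGCoalgebra C]
  [TwoReduced C] [GradedCocomm C]

/-- The compatibility of a symmetric monoidal structure on the homotopy category with the cotensor
product. -/
def IsCotensorStructure [MonoidalCategory (HoComod C)] [SymmetricCategory (HoComod C)]
    (μ : (toHo C).prod (toHo C) ⋙ tensor (HoComod C) ≅ derivedCotensor C ⋙ toHo C)
    (e : 𝟙_ (HoComod C) ≅ (toHo C).obj (regular C)) : Prop :=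
  (∀ (M N P X : DGComod C) (a : X ⟶ cotensor (cotensor M N) P)
    (b : X ⟶ cotensor M (cotensor N P)),
    (∀ x : X, TensorProduct.assoc ℚ M N P
        ((cotensorIncl M N).rTensor P (cotensorIncl (cotensor M N) P (a.toLin x))) =
      (cotensorIncl N P).lTensor M (cotensorIncl M (cotensor N P) (b.toLin x))) →
    (toHo C).map a ≫ laxMap μ (cotensor M N) P ≫ (laxMap μ M N ▷ (toHo C).obj P) ≫
        (α_ ((toHo C).obj M) ((toHo C).obj N) ((toHo C).obj P)).hom =
      (toHo C).map b ≫ laxMap μ M (cotensor N P) ≫ ((toHo C).obj M ◁ laxMap μ N P)) ∧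
  (∀ (M X : DGComod C) (a : X ⟶ cotensor (regular C) M) (b : X ⟶ M),
    (∀ x : X, TensorProduct.lid ℚ M ((Coalgebra.counit (R := ℚ) (A := C)).rTensor M
        (cotensorIncl (regular C) M (a.toLin x))) = b.toLin x) →
    (toHo C).map a ≫ laxMap μ (regular C) M ≫ (e.inv ▷ (toHo C).obj M) ≫
        (λ_ ((toHo C).obj M)).hom = (toHo C).map b) ∧
  (∀ (M N X : DGComod C) (a : X ⟶ cotensor M N) (b : X ⟶ cotensor N M),
    (∀ x : X, swap M N (cotensorIncl M N (a.toLin x)) = cotensorIncl N M (b.toLin x)) →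
    (toHo C).map a ≫ laxMap μ M N ≫ (β_ ((toHo C).obj M) ((toHo C).obj N)).hom =
      (toHo C).map b ≫ laxMap μ N M)

theorem isCotensorStructure_of_braided [MonoidalCategory (HoComod C)]
    [SymmetricCategory (HoComod C)] [(coextHo C).Braided] :
    IsCotensorStructure C tensorDerivedIso
      (Functor.Monoidal.εIso (coextHo C) ≪≫ ((toHo C).mapIso (asIso (regularHom C))).symm) :=
  ⟨fun M N P X a b hab => cotensorToTensor_assoc M N P X a b hab,
    fun M X a b hab => cotensorToTensor_leftUnit M X a b hab,
    fun M N X a b hab => cotensorToTensor_symm M N X a b hab⟩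

theorem exists_isCotensorStructure : ∃ (_ : MonoidalCategory (HoComod C))
    (_ : SymmetricCategory (HoComod C))
    (μ : (toHo C).prod (toHo C) ⋙ tensor (HoComod C) ≅ derivedCotensor C ⋙ toHo C)
    (e : 𝟙_ (HoComod C) ≅ (toHo C).obj (regular C)), IsCotensorStructure C μ e := by
  let ε := Iso.refl ((coextHo C).obj (𝟙_ (DGMod (Cobar C))))
  let m : MonoidalCategory (HoComod C) :=
    (inferInstance : MonoidalCategory (LocalizedMonoidal (coextHo C) (modQuasiIso C) ε))
  let s : SymmetricCategory (HoComod C) :=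
    (inferInstance : SymmetricCategory (LocalizedMonoidal (coextHo C) (modQuasiIso C) ε))
  let b : (coextHo C).Braided := (inferInstance :
    (Localization.Monoidal.toMonoidalCategory (coextHo C) (modQuasiIso C) ε).Braided)
  exact ⟨_, _, _, _, isCotensorStructure_of_braided C⟩

end Main

/-! ### Exactness of towers and of perturbed rows -/

section Tower

variable {E : ℕ → Type u} [∀ i, AddCommGroup (E i)] [∀ i, Module ℚ (E i)]

/-- The product of a sequence of exact complexes stays exact after adding to the differential maps
from each complex to the next. -/
theorem tower_exact (P : ∀ i, ℤ → Submodule ℚ (E i)) (D : ∀ i, E i →ₗ[ℚ] E i)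
    (a : ∀ i, E i →ₗ[ℚ] E (i + 1)) (haP : ∀ i k, ∀ x ∈ P i (k + 1), a i x ∈ P (i + 1) k)
    (haa : ∀ i x, a (i + 1) (a i x) = 0) (haD : ∀ i x, a i (D i x) = - D (i + 1) (a i x))
    (hex : ∀ i k, ∀ x ∈ P i k, D i x = 0 → ∃ y ∈ P i (k + 1), D i y = x)
    (k : ℤ) (x : ∀ i, E i) (hx : ∀ i, x i ∈ P i k) (h0 : D 0 (x 0) = 0)
    (hs : ∀ i, D (i + 1) (x (i + 1)) + a i (x i) = 0) :
    ∃ y : ∀ i, E i, (∀ i, y i ∈ P i (k + 1)) ∧ D 0 (y 0) = x 0 ∧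
      ∀ i, D (i + 1) (y (i + 1)) + a i (y i) = x (i + 1) := by
  let S : ℕ → Type u := fun i =>
    {y : E i // y ∈ P i (k + 1) ∧ D (i + 1) (x (i + 1) - a i y) = 0}
  have step : ∀ i (y : S i), ∃ y' : S (i + 1), D (i + 1) y'.1 = x (i + 1) - a i y.1 := by
    rintro i ⟨y, hy, hy'⟩
    obtain ⟨y', h1, h2⟩ := hex (i + 1) k _ (Submodule.sub_mem _ (hx _) (haP i k y hy)) hy'
    refine ⟨⟨y', h1, ?_⟩, h2⟩
    have h3 := haD (i + 1) y'
    rw [h2, map_sub, haa, sub_zero] at h3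
    rw [map_sub, eq_neg_of_add_eq_zero_left (hs (i + 1)), h3]
    simp
  obtain ⟨y0, h1, h2⟩ := hex 0 k _ (hx 0) h0
  have hy0 : D 1 (x 1 - a 0 y0) = 0 := by
    have h3 := haD 0 y0
    rw [h2] at h3
    rw [map_sub, eq_neg_of_add_eq_zero_left (hs 0), h3]
    simp
  choose f hf using step
  let y : ∀ i, S i := fun i => Nat.rec ⟨y0, h1, hy0⟩ (fun i s => f i s) i
  refine ⟨fun i => (y i).1, fun i => (y i).2.1, h2, fun i => ?_⟩
  have := hf i (y i)
  change D (i + 1) (f i (y i)).1 + _ = _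
  rw [this]
  simp

end Tower

section Row

variable {R : ℕ → Type u} [∀ i, AddCommGroup (R i)] [∀ i, Module ℚ (R i)]

/-- The differential `x ↦ (b x_{j-1} + (-1)^j d x_j)_j` on the product of a row. -/
def rowD (d : ∀ j, R j →ₗ[ℚ] R j) (b : ∀ j, R j →ₗ[ℚ] R (j + 1)) :
    (∀ j, R j) →ₗ[ℚ] (∀ j, R j) :=
  LinearMap.pi fun j => match j with
    | 0 => d 0 ∘ₗ LinearMap.proj 0
    | j + 1 => b j ∘ₗ LinearMap.proj j + (-1 : ℚ) ^ (j + 1) • (d (j + 1) ∘ₗ LinearMap.proj (j + 1))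

variable (d : ∀ j, R j →ₗ[ℚ] R j) (b : ∀ j, R j →ₗ[ℚ] R (j + 1))

@[simp] theorem rowD_zero (x : ∀ j, R j) : rowD d b x 0 = d 0 (x 0) := rfl

@[simp] theorem rowD_succ (x : ∀ j, R j) (j : ℕ) :
    rowD d b x (j + 1) = b j (x j) + (-1 : ℚ) ^ (j + 1) • d (j + 1) (x (j + 1)) := rfl

variable {d b}

theorem rowD_rowD (hdd : ∀ j x, d j (d j x) = 0) (hbb : ∀ j x, b (j + 1) (b j x) = 0)
    (hbd : ∀ j x, b j (d j x) = d (j + 1) (b j x)) (x : ∀ j, R j) :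
    rowD d b (rowD d b x) = 0 := by
  funext j
  match j with
  | 0 => simp [hdd]
  | 1 => simp [hdd, hbd]
  | j + 2 =>
    simp only [rowD_succ, map_add, map_smul, hdd, hbb, hbd, pow_succ]
    simp

/-- A row with a contraction `h` of `b` that commutes with `d` up to a locally nilpotent error is
exact. -/
theorem row_exact (P F : ∀ j, ℤ → Submodule ℚ (R j)) (h : ∀ j, R (j + 1) →ₗ[ℚ] R j)
    (hPd : ∀ j k, ∀ x ∈ P j (k + 1), d j x ∈ P j k)
    (hPb : ∀ j k, ∀ x ∈ P j k, b j x ∈ P (j + 1) k)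
    (hPh : ∀ j k, ∀ x ∈ P (j + 1) k, h j x ∈ P j k)
    (hPF : ∀ j k, P j k ≤ F j k) (hF : ∀ j n, n < 0 → F j n = ⊥)
    (hdd : ∀ j x, d j (d j x) = 0) (hbb : ∀ j x, b (j + 1) (b j x) = 0)
    (hbd : ∀ j x, b j (d j x) = d (j + 1) (b j x))
    (h0 : ∀ x, h 0 (b 0 x) = x) (hs : ∀ j x, b j (h j x) + h (j + 1) (b (j + 1) x) = x)
    (hT : ∀ j n, ∀ x ∈ F (j + 1) n, d j (h j x) - h j (d (j + 1) x) ∈ F j (n - 2))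
    (k : ℤ) (x : ∀ j, R j) (hx : ∀ j, x j ∈ P j (k + j)) (hx0 : rowD d b x = 0) :
    ∃ y : ∀ j, R j, (∀ j, y j ∈ P j (k + 1 + j)) ∧ rowD d b y = x := by
  set T : ∀ j, R (j + 1) →ₗ[ℚ] R j := fun j =>
    (-1 : ℚ) ^ j • (d j ∘ₗ h j - h j ∘ₗ d (j + 1)) with hTdef
  have hT' : ∀ j n, ∀ x ∈ F (j + 1) n, T j x ∈ F j (n - 2) := fun j n x hx =>
    Submodule.smul_mem _ _ (hT j n x hx)
  have hTP : ∀ j k, ∀ x ∈ P (j + 1) (k + 1), T j x ∈ P j k := fun j k x hx =>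
    Submodule.smul_mem _ _ (Submodule.sub_mem _ (hPd j k _ (hPh j _ x hx))
      (hPh j k _ (hPd (j + 1) k x hx)))
  have solve : ∃ w : ∀ j, R j, (∀ j, w j ∈ P j (k + j)) ∧ ∀ j, w j + T j (w (j + 1)) = x j := by
    let Y : ℕ → ∀ j, R j := fun m => Nat.rec 0 (fun _ Y j => x j - T j (Y (j + 1))) m
    have hY0 : Y 0 = 0 := rfl
    have hYs : ∀ m j, Y (m + 1) j = x j - T j (Y m (j + 1)) := fun m j => rfl
    have hYP : ∀ m j, Y m j ∈ P j (k + j) := by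
      intro m
      induction m with
      | zero => intro j; exact Submodule.zero_mem _
      | succ m ih =>
        intro j
        rw [hYs]
        refine Submodule.sub_mem _ (hx j) (hTP j _ _ ?_)
        have := ih (j + 1)
        rwa [show k + ((j + 1 : ℕ) : ℤ) = k + j + 1 by push_cast; ring] at this
    have hYF : ∀ m j : ℕ, Y (m + 1) j - Y m j ∈ F j (k + j - m) := by
      intro m
      induction m with
      | zero =>
        intro j
        rw [hYs, hY0]
        have := hPF _ _ (hx j)
        simpa using this
      | succ m ih =>
        intro j
        have h1 : Y (m + 1 + 1) j - Y (m + 1) j = - T j (Y (m + 1) (j + 1) - Y m (j + 1)) := by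
          rw [map_sub]
          change x j - T j (Y (m + 1) (j + 1)) - (x j - T j (Y m (j + 1))) = _
          abel
        rw [h1]
        refine Submodule.neg_mem _ ?_
        have h2 := hT' j _ _ (ih (j + 1))
        rwa [show k + ((j + 1 : ℕ) : ℤ) - m - 2 = k + j - ((m + 1 : ℕ) : ℤ) by
          push_cast; ring] at h2
    have hst : ∀ j m : ℕ, k + j < m → Y (m + 1) j = Y m j := by
      intro j m hm
      have := hYF m j
      rw [hF j _ (by linarith), Submodule.mem_bot, sub_eq_zero] at this
      exact this
    have hst' : ∀ j m m' : ℕ, (k + j < m) → m ≤ m' → Y m' j = Y m j := by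
      intro j m m' hm hmm
      induction hmm with
      | refl => rfl
      | step hle ih =>
        rw [hst j _ (lt_of_lt_of_le hm (by exact_mod_cast hle)), ih]
    let N : ℕ → ℕ := fun j => (k + j).toNat + 1
    have hN : ∀ j, k + j < N j := fun j => by
      have := Int.self_le_toNat (k + j)
      simp only [N]; push_cast; linarith
    refine ⟨fun j => Y (N j) j, fun j => hYP (N j) j, fun j => ?_⟩
    have h1 : N j ≤ N (j + 1) + 1 := by simp only [N]; push_cast; omega
    change Y (N j) j + T j (Y (N (j + 1)) (j + 1)) = x j
    rw [← hst' j (N j) (N (j + 1) + 1) (hN j) h1, hYs (N (j + 1)) j]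
    exact sub_add_cancel _ _
  have unique : ∀ w : ∀ j, R j, (∀ j, w j ∈ P j (k - 1 + j)) →
      (∀ j, w j + T j (w (j + 1)) = 0) → w = 0 := by
    intro w hw hw0
    have hm : ∀ (m : ℕ) j, w j ∈ F j (k - 1 + j - m) := by
      intro m
      induction m with
      | zero => intro j; simpa using hPF _ _ (hw j)
      | succ m ih =>
        intro j
        rw [eq_neg_of_add_eq_zero_left (hw0 j)]
        refine Submodule.neg_mem _ ?_
        have h2 := hT' j _ _ (ih (j + 1))
        rwa [show k - 1 + ((j + 1 : ℕ) : ℤ) - m - 2 = k - 1 + j - ((m + 1 : ℕ) : ℤ) by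
          push_cast; ring] at h2
    funext j
    have := hm ((k - 1 + j).toNat + 1) j
    rw [hF j _ (by have := Int.self_le_toNat (k - 1 + j); push_cast; linarith)] at this
    exact (Submodule.mem_bot _).1 this
  have htp : ∀ (w : ∀ j, R j) j, w j + T j (w (j + 1)) =
      rowD d b (fun j => h j (w (j + 1))) j + h j (rowD d b w (j + 1)) := by
    intro w j
    match j with
    | 0 => simp [hTdef, h0]; abel
    | j + 1 =>
      have := hs j (w (j + 1))
      simp only [rowD_succ, hTdef, map_add, map_smul, LinearMap.smul_apply, LinearMap.sub_apply,
        LinearMap.comp_apply, pow_succ]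
      conv_lhs => rw [← this]
      module
  obtain ⟨w, hw, hwx⟩ := solve
  have hv : rowD d b w = 0 := by
    refine unique _ (fun j => ?_) (fun j => ?_)
    · match j with
      | 0 =>
        refine hPd 0 _ _ ?_
        have := hw 0
        rwa [show k + ((0 : ℕ) : ℤ) = k - 1 + ((0 : ℕ) : ℤ) + 1 by ring] at this
      | j + 1 =>
        refine Submodule.add_mem _ ?_ (Submodule.smul_mem _ _ (hPd _ _ _ ?_))
        · have := hPb _ _ _ (hw j)
          rwa [show k + (j : ℤ) = k - 1 + ((j + 1 : ℕ) : ℤ) by push_cast; ring] at this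
        · have := hw (j + 1)
          rwa [show k + ((j + 1 : ℕ) : ℤ) = k - 1 + ((j + 1 : ℕ) : ℤ) + 1 by ring] at this
    · rw [htp, rowD_rowD hdd hbb hbd]
      have h1 : (fun j => w j + T j (w (j + 1))) = x := funext hwx
      have h2 : (fun j => w j + T j (w (j + 1))) =
          rowD d b (fun j => h j (w (j + 1))) + fun j => h j (rowD d b w (j + 1)) :=
        funext (htp w)
      have h3 := congrArg (rowD d b) (h1.symm.trans h2)
      rw [hx0, map_add, rowD_rowD hdd hbb hbd, zero_add] at h3
      have h4 := congrFun h3 j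
      simp only [Pi.zero_apply, map_zero, add_zero] at h4 ⊢
      exact h4.symm
  refine ⟨fun j => h j (w (j + 1)), fun j => ?_, ?_⟩
  · have := hPh _ _ _ (hw (j + 1))
    rwa [show k + ((j + 1 : ℕ) : ℤ) = k + 1 + j by push_cast; ring] at this
  · funext j
    have := htp w j
    rw [hwx, hv] at this
    simpa using this.symm

end Row

/-! ### Acyclicity of total complexes -/

section TotAcyclic

variable {C : Type u} [AddCommGroup C] [Module ℚ C] [Coalgebra ℚ C] [DGVect C] [GradedCocomm C]

/-- Exactness of the product total complex of `E □ K`, with the differential of `K` scaled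
by `ε`. -/
def ColExact (E : ComodComplex C) (K : DGComod C) : Prop :=
  ∀ (ε : ℚ) (k : ℤ) (x : ∀ i, cotensor (E.X i) K), (∀ i : ℕ, x i ∈ gr (cotensor (E.X i) K) (k + i)) →
    rowD (fun i => ε • dif (cotensor (E.X i) K)) (fun i => (cotensorMap (E.δ i) (𝟙 K)).toLin) x = 0 →
    ∃ y : ∀ i, cotensor (E.X i) K, (∀ i : ℕ, y i ∈ gr (cotensor (E.X i) K) (k + 1 + i)) ∧
      rowD (fun i => ε • dif (cotensor (E.X i) K)) (fun i => (cotensorMap (E.δ i) (𝟙 K)).toLin) y = x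

/-- Exactness of the product total complex `Tot^∏ (E □ B)`. -/
def TotExact (E B : ComodComplex C) : Prop :=
  ∀ (k : ℤ), ∀ x ∈ totPiece E B k, totD E B x = 0 → ∃ y ∈ totPiece E B (k + 1), totD E B y = x

theorem totExact_of_colExact (E B : ComodComplex C) (h : ∀ j, ColExact E (B.X j)) :
    TotExact E B := by
  intro k x hx hx0
  let D : ∀ j, (∀ i, cotensor (E.X i) (B.X j)) →ₗ[ℚ] (∀ i, cotensor (E.X i) (B.X j)) := fun j =>
    rowD (fun i => ((-1 : ℚ) ^ j) • dif (cotensor (E.X i) (B.X j)))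
      (fun i => (cotensorMap (E.δ i) (𝟙 (B.X j))).toLin)
  let a : ∀ j, (∀ i, cotensor (E.X i) (B.X j)) →ₗ[ℚ] (∀ i, cotensor (E.X i) (B.X (j + 1))) :=
    fun j => LinearMap.pi fun i =>
      (-1 : ℚ) ^ i • ((cotensorMap (𝟙 (E.X i)) (B.δ j)).toLin ∘ₗ LinearMap.proj i)
  have ha : ∀ j y i, a j y i = (-1 : ℚ) ^ i • (cotensorMap (𝟙 (E.X i)) (B.δ j)).toLin (y i) :=
    fun _ _ _ => rfl
  have hD0 : ∀ j y, D j y 0 = ((-1 : ℚ) ^ j) • dif (cotensor (E.X 0) (B.X j)) (y 0) :=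
    fun _ _ => rfl
  have hDs : ∀ j y i, D j y (i + 1) = (cotensorMap (E.δ i) (𝟙 (B.X j))).toLin (y i) +
      (-1 : ℚ) ^ (i + 1) • ((-1 : ℚ) ^ j • dif (cotensor (E.X (i + 1)) (B.X j)) (y (i + 1))) :=
    fun _ _ _ => rfl
  have ht0 : ∀ (y : TotSpace E B) (i : ℕ), totD E B y i 0 = D 0 (fun i => y i 0) i := by
    intro y i
    cases i with
    | zero => rw [totD_apply, hD0, totHor_zero, totVer_zero]; simp
    | succ i =>
      rw [totD_apply, hDs, totHor_succ, totVer_zero, smul_smul, ← pow_add, smul_zero, add_zero]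
  have hts : ∀ (y : TotSpace E B) (i j : ℕ), totD E B y i (j + 1) =
      D (j + 1) (fun i => y i (j + 1)) i + a j (fun i => y i j) i := by
    intro y i j
    cases i with
    | zero => rw [totD_apply, hD0, totHor_zero, totVer_succ, ha]; simp [add_comm]
    | succ i =>
      rw [totD_apply, hDs, totHor_succ, totVer_succ, smul_smul, ← pow_add, ha, add_right_comm]
  let P : ∀ j : ℕ, ℤ → Submodule ℚ (∀ i, cotensor (E.X i) (B.X j)) := fun j k =>
    { carrier := {y | ∀ i : ℕ, y i ∈ gr (cotensor (E.X i) (B.X j)) (k + j + i)}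
      add_mem' := fun hx hy i => Submodule.add_mem _ (hx i) (hy i)
      zero_mem' := fun i => Submodule.zero_mem _
      smul_mem' := fun r _ hx i => Submodule.smul_mem _ r (hx i) }
  refine (tower_exact P D a ?_ ?_ ?_ ?_ k (fun j i => x i j) ?_ ?_ ?_).elim ?_
  · intro j k y hy i
    refine Submodule.smul_mem _ _ ((cotensorMap (𝟙 (E.X i)) (B.δ j)).map_mem _ _ ?_)
    have := hy i
    rwa [show k + 1 + (j : ℤ) + i = k + ((j + 1 : ℕ) : ℤ) + i by push_cast; ring] at this
  · intro j y
    funext i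
    rw [ha, ha, map_smul, cotensorMap_comp_zero _ _ _ _ (Or.inr (B.δ_δ j)), smul_zero, smul_zero]
    rfl
  · intro j y
    funext i
    change _ = - D (j + 1) (a j y) i
    cases i with
    | zero =>
      rw [ha, hD0, hD0, ha, map_smul, map_smul, DGHom.map_d, smul_comm]
      simp [pow_succ]
    | succ i =>
      rw [ha, hDs, hDs, ha, ha, map_add, map_smul, map_smul, DGHom.map_d, map_smul, map_smul,
        cotensorMap_interchange]
      simp only [pow_succ]
      module
  · intro j k y hy hy0
    exact h j _ (k + j) y hy hy0 |>.imp fun z hz => ⟨fun i => by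
      have := hz.1 i
      rwa [add_right_comm k (j : ℤ) 1] at this, hz.2⟩
  · intro j i
    have := hx i j
    rwa [add_right_comm] at this
  · funext i
    have := congrFun (congrFun hx0 i) 0
    rw [ht0] at this
    exact this
  · intro j
    funext i
    have := congrFun (congrFun hx0 i) (j + 1)
    rw [hts] at this
    exact this
  · rintro y ⟨hy, hy0, hys⟩
    refine ⟨fun i j => y j i, fun i j => ?_, ?_⟩
    · have := hy j i
      rwa [add_right_comm] at this
    · funext i j
      cases j with
      | zero => rw [ht0]; exact congrFun hy0 i
      | succ j => rw [hts]; exact congrFun (hys j) i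

theorem colExact_zeroComod (E : ComodComplex C) : ColExact E (zeroComod C) := by
  have h : ∀ i, Subsingleton (cotensor (E.X i) (zeroComod C)) := fun i =>
    ⟨fun x y => by
      apply Subtype.ext
      have : Subsingleton (E.X i ⊗[ℚ] (zeroComod C)) :=
        (inferInstance : Subsingleton (E.X i ⊗[ℚ] PUnit.{u + 1}))
      exact Subsingleton.elim (α := E.X i ⊗[ℚ] (zeroComod C)) _ _⟩
  intro ε k x _ _
  exact ⟨0, fun i => Submodule.zero_mem _, funext fun i => Subsingleton.elim _ _⟩

/-- The complex `E¹ → E² → ⋯`. -/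
def ComodComplex.shift (E : ComodComplex C) : ComodComplex C where
  X n := E.X (n + 1)
  δ n := E.δ (n + 1)
  δ_δ n := E.δ_δ (n + 1)

/-- The map from `E⁰` to the complex `E¹ → E² → ⋯`. -/
def ComodComplex.augHom (E : ComodComplex C) :
    ComodComplex.Hom (ComodComplex.single (E.X 0)) E.shift where
  f n := match n with
    | 0 => E.δ 0
    | _ + 1 => zeroHom _ _
  comm n x := match n with
    | 0 => (E.δ_δ 0 x).symm
    | _ + 1 => (map_zero _).symm

variable (E B : ComodComplex C)

instance subsingleton_cotensor_zeroComod (M : DGComod C) :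
    Subsingleton (cotensor (zeroComod C) M) :=
  ⟨fun x y => by
    apply Subtype.ext
    have : Subsingleton ((zeroComod C) ⊗[ℚ] M) := (inferInstance : Subsingleton (PUnit.{u + 1} ⊗[ℚ] M))
    exact Subsingleton.elim (α := (zeroComod C) ⊗[ℚ] M) _ _⟩

/-- The element of `Tot^∏ (E □ B)` with components `x` in `E⁰ □ B` and `± y` elsewhere. -/
def totGlue (x : TotSpace (ComodComplex.single (E.X 0)) B) (y : TotSpace E.shift B) :
    TotSpace E B := fun i => match i with
  | 0 => x 0
  | i + 1 => fun j => (-1 : ℚ) ^ i • (show cotensor (E.X (i + 1)) (B.X j) from y i j)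

theorem totGlue_zero (x : TotSpace (ComodComplex.single (E.X 0)) B) (y : TotSpace E.shift B)
    (j : ℕ) : totGlue E B x y 0 j = x 0 j := rfl

theorem totGlue_succ (x : TotSpace (ComodComplex.single (E.X 0)) B) (y : TotSpace E.shift B)
    (i j : ℕ) : totGlue E B x y (i + 1) j =
      (-1 : ℚ) ^ i • (show cotensor (E.X (i + 1)) (B.X j) from y i j) := rfl

theorem totD_totGlue (x : TotSpace (ComodComplex.single (E.X 0)) B) (y : TotSpace E.shift B) :
    totD E B (totGlue E B x y) = totGlue E B (totD _ _ x)
      (totMapLin E.augHom (ComodComplex.Hom.id B) x - totD _ _ y) := by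
  have hver : ∀ i j, totVer E B (i + 1) j (totGlue E B x y) =
      (-1 : ℚ) ^ i • (show cotensor (E.X (i + 1)) (B.X j) from totVer E.shift B i j y) := by
    intro i j
    cases j with
    | zero => rw [totVer_zero, totVer_zero]; exact (smul_zero _).symm
    | succ j =>
      rw [totVer_succ, totVer_succ, totGlue_succ, map_smul]; rfl
  have hver0 : ∀ j, totVer E B 0 j (totGlue E B x y) =
      (show cotensor (E.X 0) (B.X j) from totVer (ComodComplex.single (E.X 0)) B 0 j x) := by
    intro j
    cases j with
    | zero => rfl
    | succ j => rfl
  funext i j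
  match i with
  | 0 =>
    rw [totD_apply, totGlue_zero, totGlue_zero, totD_apply, hver0, totHor_zero, totHor_zero]
    rfl
  | 1 =>
    rw [totD_apply, totGlue_succ, totGlue_succ, hver, totHor_succ, totGlue_zero]
    change _ = (-1 : ℚ) ^ 0 • (((cotensorMap (E.δ 0) (𝟙 (B.X j))).toLin (x 0 j)) -
      (show cotensor (E.X 1) (B.X j) from totD E.shift B y 0 j))
    rw [totD_apply, totHor_zero]
    have key : ∀ (p q r : cotensor (E.X 1) (B.X j)), p + (-1 : ℚ) ^ (0 + 1) • (-1 : ℚ) ^ 0 • q +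
        (-1 : ℚ) ^ (0 + 1 + j) • dif (cotensor (E.X 1) (B.X j)) ((-1 : ℚ) ^ 0 • r) =
        (-1 : ℚ) ^ 0 • (p - (0 + (-1 : ℚ) ^ 0 • q + (-1 : ℚ) ^ (0 + j) •
          dif (cotensor (E.X 1) (B.X j)) r)) := by
      intro p q r
      simp only [map_smul, pow_add, pow_zero, pow_one]
      module
    exact key _ _ _
  | i + 2 =>
    rw [totD_apply, totGlue_succ, totGlue_succ, hver, totHor_succ, totGlue_succ]
    change _ = (-1 : ℚ) ^ (i + 1) • (((cotensorMap (zeroHom (zeroComod C) (E.X (i + 2)))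
      (𝟙 (B.X j))).toLin (x (i + 1) j)) -
      (show cotensor (E.X (i + 2)) (B.X j) from totD E.shift B y (i + 1) j))
    have h0 : (show cotensor (zeroComod C) (B.X j) from x (i + 1) j) = 0 := Subsingleton.elim _ _
    have h1 : (cotensorMap (zeroHom (zeroComod C) (E.X (i + 2))) (𝟙 (B.X j))).toLin
        (show cotensor (zeroComod C) (B.X j) from x (i + 1) j) = 0 := by rw [h0, map_zero]
    refine Eq.trans ?_ (congrArg (fun z => (-1 : ℚ) ^ (i + 1) • (z -
      (show cotensor (E.X (i + 2)) (B.X j) from totD E.shift B y (i + 1) j))) h1.symm)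
    rw [totD_apply, totHor_succ]
    have key : ∀ (p : cotensor (E.X (i + 1)) (B.X j)) (q r : cotensor (E.X (i + 2)) (B.X j)),
        (cotensorMap (E.δ (i + 1)) (𝟙 (B.X j))).toLin ((-1 : ℚ) ^ i • p) +
        (-1 : ℚ) ^ (i + 1 + 1) • (-1 : ℚ) ^ (i + 1) • q +
        (-1 : ℚ) ^ (i + 1 + 1 + j) • dif (cotensor (E.X (i + 2)) (B.X j)) ((-1 : ℚ) ^ (i + 1) • r) =
        (-1 : ℚ) ^ (i + 1) • (0 - ((cotensorMap (E.δ (i + 1)) (𝟙 (B.X j))).toLin p +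
          (-1 : ℚ) ^ (i + 1) • q + (-1 : ℚ) ^ (i + 1 + j) •
          dif (cotensor (E.X (i + 2)) (B.X j)) r)) := by
      intro p q r
      simp only [map_smul, pow_add, pow_one]
      module
    exact key _ _ _

/-- If `Tot^∏ (E □ B)` is exact, then `E⁰ □ B → (E¹ → E² → ⋯) □ B` is a quasi-isomorphism on
total complexes. -/
theorem coneExact_augHom (h : TotExact E B) :
    ConeExact (totPiece _ B) (totD _ B) (totPiece _ B) (totD _ B)
      (totMapLin E.augHom (ComodComplex.Hom.id B)) := by
  intro k x hx y hy hx0 hxy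
  have hglue : ∀ (k : ℤ) (x : TotSpace (ComodComplex.single (E.X 0)) B) (y : TotSpace E.shift B),
      totGlue E B x y = 0 → x = 0 ∧ y = 0 := by
    intro k x y hz
    constructor
    · funext i j
      cases i with
      | zero => exact congrFun (congrFun hz 0) j
      | succ i => exact (subsingleton_cotensor_zeroComod (B.X j)).elim (x (i + 1) j) 0
    · funext i j
      have := congrFun (congrFun hz (i + 1)) j
      rw [totGlue_succ] at this
      exact (smul_eq_zero.1 this).resolve_left (pow_ne_zero _ (by norm_num))
  obtain ⟨w, hw, hwz⟩ := h k (totGlue E B x y) (fun i j => by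
    cases i with
    | zero => exact hx 0 j
    | succ i =>
      refine Submodule.smul_mem _ _ ?_
      have := hy i j
      rwa [show k + 1 + (i : ℤ) + j = k + ((i + 1 : ℕ) : ℤ) + j by push_cast; ring] at this) (by
    rw [totD_totGlue, hx0, hxy, sub_self]
    funext i j
    cases i with
    | zero => rfl
    | succ i => exact smul_zero (A := cotensor (E.X (i + 1)) (B.X j)) _)
  let x' : TotSpace (ComodComplex.single (E.X 0)) B := fun i => match i with
    | 0 => w 0
    | _ + 1 => 0
  let y' : TotSpace E.shift B := fun i j => (-1 : ℚ) ^ i • w (i + 1) j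
  have hw' : w = totGlue E B x' y' := by
    funext i j
    cases i with
    | zero => rfl
    | succ i =>
      change w (i + 1) j = (-1 : ℚ) ^ i • ((-1 : ℚ) ^ i • w (i + 1) j)
      rw [smul_smul, ← mul_pow]; simp
  have hsub : ∀ (x₁ x₂ : TotSpace (ComodComplex.single (E.X 0)) B) (y₁ y₂ : TotSpace E.shift B),
      totGlue E B x₁ y₁ - totGlue E B x₂ y₂ = totGlue E B (x₁ - x₂) (y₁ - y₂) := by
    intro x₁ x₂ y₁ y₂
    funext i j
    cases i with
    | zero => rfl
    | succ i => exact (smul_sub _ _ _).symm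
  rw [hw', totD_totGlue] at hwz
  obtain ⟨h1, h2⟩ := hglue k _ _ ((hsub _ _ _ _).symm.trans (sub_eq_zero.2 hwz))
  refine ⟨x', fun i j => ?_, -y', Submodule.neg_mem _ fun i j => ?_, sub_eq_zero.1 h1, ?_⟩
  · cases i with
    | zero => exact hw 0 j
    | succ i => exact Submodule.zero_mem _
  · refine Submodule.smul_mem _ _ ?_
    have := hw (i + 1) j
    rwa [show k + 1 + ((i + 1 : ℕ) : ℤ) + j = k + 1 + 1 + (i : ℤ) + j by push_cast; ring] at this
  · rw [map_neg, ← sub_eq_add_neg]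
    exact (sub_eq_zero.1 h2).symm

end TotAcyclic

/-! ### Symmetry of cotensor products and of total complexes -/

section CotensorSwap

variable {C : Type u} [AddCommGroup C] [Module ℚ C] [Coalgebra ℚ C] [DGVect C]

theorem swap_tmul_of_mem_rat {V W : Type u} [AddCommGroup V] [Module ℚ V] [GrVect V]
    [AddCommGroup W] [Module ℚ W] [GrVect W] {i j : ℤ} {v : V} (hv : v ∈ gr V i) {w : W}
    (hw : w ∈ gr W j) :
    swap V W (v ⊗ₜ w) = (((i * j).negOnePow : ℤ) : ℚ) • (w ⊗ₜ[ℚ] v) := by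
  rw [swap_tmul_of_mem hv hw, Units.smul_def, Int.cast_smul_eq_zsmul]

theorem swap_rTensor_assoc_swap {M N : Type u} [AddCommGroup M] [Module ℚ M] [GrVect M]
    [AddCommGroup N] [Module ℚ N] [GrVect N] (w : (C ⊗[ℚ] M) ⊗[ℚ] N) :
    TensorProduct.assoc ℚ N C M ((swap C N).rTensor M (swap M (C ⊗[ℚ] N)
      (TensorProduct.assoc ℚ M C N ((swap C M).rTensor N w)))) = swap (C ⊗[ℚ] M) N w := by
  obtain ⟨L, hL⟩ : ∃ L : (C ⊗[ℚ] M) ⊗[ℚ] N →ₗ[ℚ] N ⊗[ℚ] (C ⊗[ℚ] M), L =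
      (TensorProduct.assoc ℚ N C M).toLinearMap ∘ₗ (swap C N).rTensor M ∘ₗ
        swap M (C ⊗[ℚ] N) ∘ₗ (TensorProduct.assoc ℚ M C N).toLinearMap ∘ₗ (swap C M).rTensor N :=
    ⟨_, rfl⟩
  have h0 : ∀ i, ∀ c ∈ gr C i, ∀ j, ∀ m ∈ gr M j, ∀ k, ∀ n ∈ gr N k,
      L ((c ⊗ₜ m) ⊗ₜ n) = swap (C ⊗[ℚ] M) N ((c ⊗ₜ m) ⊗ₜ n) := by
    intro i c hc j m hm k n hn
    rw [hL]
    simp only [LinearMap.comp_apply, LinearMap.rTensor_tmul, LinearEquiv.coe_coe]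
    rw [swap_tmul_of_mem_rat hc hm, swap_tmul_of_mem_rat (tmul_mem rfl hc hm) hn]
    simp only [← TensorProduct.smul_tmul', map_smul, TensorProduct.assoc_tmul]
    rw [swap_tmul_of_mem_rat hm (tmul_mem rfl hc hn)]
    simp only [map_smul, LinearMap.rTensor_tmul]
    rw [swap_tmul_of_mem_rat hc hn]
    simp only [← TensorProduct.smul_tmul', map_smul, TensorProduct.assoc_tmul, smul_smul]
    congr 1
    rw [← Int.cast_mul, ← Int.cast_mul, ← Units.val_mul, ← Units.val_mul, ← Int.negOnePow_add,
      ← Int.negOnePow_add]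
    congr 2
    rw [Int.negOnePow_eq_iff]
    exact ⟨i * j, by ring⟩
  have h : L = swap (C ⊗[ℚ] M) N := by
    refine TensorProduct.ext_threefold fun c m n => ?_
    refine gr_induction (p := fun c => L ((c ⊗ₜ m) ⊗ₜ n) = swap (C ⊗[ℚ] M) N ((c ⊗ₜ m) ⊗ₜ n)) c
      (fun i c hc => ?_) (fun x y hx hy => by
        simp only [TensorProduct.add_tmul, map_add, hx, hy])
    refine gr_induction (p := fun m => L ((c ⊗ₜ m) ⊗ₜ n) = swap (C ⊗[ℚ] M) N ((c ⊗ₜ m) ⊗ₜ n)) m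
      (fun j m hm => ?_) (fun x y hx hy => by
        simp only [TensorProduct.tmul_add, TensorProduct.add_tmul, map_add, hx, hy])
    refine gr_induction (p := fun n => L ((c ⊗ₜ m) ⊗ₜ n) = swap (C ⊗[ℚ] M) N ((c ⊗ₜ m) ⊗ₜ n)) n
      (fun k n hn => h0 i c hc j m hm k n hn) (fun x y hx hy => by
        simp only [TensorProduct.tmul_add, map_add, hx, hy])
  rw [← h, hL]
  rfl

variable [GradedCocomm C]

theorem cotensorSub_swap (M N : DGComod C) (z : M ⊗[ℚ] N) (hz : z ∈ cotensorSub M N) :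
    swap M N z ∈ cotensorSub N M := by
  have h1 : TensorProduct.assoc ℚ N C M ((swap C N).rTensor M (swap M (C ⊗[ℚ] N)
      (cotensorLeft M N z))) = cotensorRight N M (swap M N z) := by
    have := swap_map LinearMap.id N.coact (fun _ _ h => h) N.coact_mem z
    refine (congrArg (fun w => TensorProduct.assoc ℚ N C M ((swap C N).rTensor M w)) this).trans ?_
    change TensorProduct.assoc ℚ N C M ((swap C N).rTensor M (N.coact.rTensor M (swap M N z))) = _
    rw [← LinearMap.rTensor_comp_apply]
    rfl
  have h2 : TensorProduct.assoc ℚ N C M ((swap C N).rTensor M (swap M (C ⊗[ℚ] N)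
      (cotensorRight M N z))) = cotensorLeft N M (swap M N z) := by
    have := swap_map M.coact LinearMap.id M.coact_mem (fun _ _ h => h) z
    refine Eq.trans ?_ ((swap_rTensor_assoc_swap (M.coact.rTensor N z)).trans this)
    rw [← LinearMap.rTensor_comp_apply]
    rfl
  have hz' : cotensorLeft M N z = cotensorRight M N z := hz
  rw [← hz', h1] at h2
  exact h2.symm

/-- The Koszul symmetry of cotensor products. -/
def cotensorSwap (M N : DGComod C) : cotensor M N →ₗ[ℚ] cotensor N M :=
  (swap M N).restrict (cotensorSub_swap M N)

@[simp] theorem cotensorSwap_swap (M N : DGComod C) (z : cotensor M N) :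
    cotensorSwap N M (cotensorSwap M N z) = z :=
  Subtype.ext (swap_swap (cotensorIncl M N z))

theorem cotensorSwap_mem (M N : DGComod C) (n : ℤ) (z : cotensor M N)
    (hz : z ∈ gr (cotensor M N) n) : cotensorSwap M N z ∈ gr (cotensor N M) n :=
  swap_mem n (cotensorIncl M N z) hz

theorem cotensorSwap_dif (M N : DGComod C) (z : cotensor M N) :
    cotensorSwap M N (dif (cotensor M N) z) = dif (cotensor N M) (cotensorSwap M N z) :=
  Subtype.ext (dTens_swap (cotensorIncl M N z))

theorem cotensorSwap_map {M M' N N' : DGComod C} (f : M ⟶ M') (g : N ⟶ N') (z : cotensor M N) :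
    cotensorSwap M' N' ((cotensorMap f g).toLin z) =
      (cotensorMap g f).toLin (cotensorSwap M N z) :=
  Subtype.ext (swap_map f.toLin g.toLin f.map_mem g.map_mem (cotensorIncl M N z))

/-- The symmetry of total complexes. -/
def totSwap (A B : ComodComplex C) : TotSpace A B →ₗ[ℚ] TotSpace B A :=
  LinearMap.pi fun j => LinearMap.pi fun i =>
    (-1 : ℚ) ^ (i * j) • (cotensorSwap (A.X i) (B.X j) ∘ₗ LinearMap.proj j ∘ₗ LinearMap.proj i)

theorem totSwap_apply (A B : ComodComplex C) (x : TotSpace A B) (i j : ℕ) :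
    totSwap A B x j i = (-1 : ℚ) ^ (i * j) • cotensorSwap (A.X i) (B.X j) (x i j) := rfl

theorem totSwap_totSwap (A B : ComodComplex C) (x : TotSpace A B) :
    totSwap B A (totSwap A B x) = x := by
  funext i j
  rw [totSwap_apply, totSwap_apply, map_smul, cotensorSwap_swap, smul_smul, mul_comm j i, ← mul_pow]
  simp

theorem totSwap_mem (A B : ComodComplex C) (k : ℤ) (x : TotSpace A B) (hx : x ∈ totPiece A B k) :
    totSwap A B x ∈ totPiece B A k := fun j i => by
  have := cotensorSwap_mem _ _ _ _ (hx i j)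
  rw [add_right_comm] at this
  exact Submodule.smul_mem _ _ this

theorem totSwap_totMapLin {A A' B B' : ComodComplex C} (φ : ComodComplex.Hom A A')
    (ψ : ComodComplex.Hom B B') (x : TotSpace A B) :
    totSwap A' B' (totMapLin φ ψ x) = totMapLin ψ φ (totSwap A B x) := by
  funext j i
  rw [totSwap_apply]
  change _ = (cotensorMap (ψ.f j) (φ.f i)).toLin (totSwap A B x j i)
  rw [totSwap_apply, map_smul, ← cotensorSwap_map]
  rfl

theorem totSwap_totD (A B : ComodComplex C) (x : TotSpace A B) :
    totSwap A B (totD A B x) = totD B A (totSwap A B x) := by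
  funext j i
  have h1 : (-1 : ℚ) ^ (i * j) • cotensorSwap (A.X i) (B.X j) (totHor A B i j x) =
      (-1 : ℚ) ^ j • totVer B A j i (totSwap A B x) := by
    cases i with
    | zero => rw [totHor_zero, totVer_zero, map_zero, smul_zero, smul_zero]
    | succ i =>
      rw [totHor_succ, totVer_succ, totSwap_apply, map_smul, cotensorSwap_map, smul_smul, ← pow_add]
      congr 2; ring
  have h2 : (-1 : ℚ) ^ (i * j) • (-1 : ℚ) ^ i • cotensorSwap (A.X i) (B.X j) (totVer A B i j x) =
      totHor B A j i (totSwap A B x) := by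
    cases j with
    | zero => rw [totHor_zero, totVer_zero, map_zero, smul_zero, smul_zero]
    | succ j =>
      rw [totHor_succ, totVer_succ, totSwap_apply, map_smul, cotensorSwap_map, smul_smul, ← pow_add,
        show i * (j + 1) + i = i * j + 2 * i by ring, pow_add, pow_mul]
      simp
  rw [totSwap_apply, totD_apply, totD_apply, map_add, map_add, map_smul, map_smul, smul_add,
    smul_add, h1, h2, totSwap_apply, cotensorSwap_dif, map_smul, add_comm j i,
    smul_comm ((-1 : ℚ) ^ (i + j)), add_comm (totHor B A j i _)]

theorem coneExact_totMapLin_swap {A A' B B' : ComodComplex C} (φ : ComodComplex.Hom A A')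
    (ψ : ComodComplex.Hom B B')
    (h : ConeExact (totPiece A B) (totD A B) (totPiece A' B') (totD A' B') (totMapLin φ ψ)) :
    ConeExact (totPiece B A) (totD B A) (totPiece B' A') (totD B' A') (totMapLin ψ φ) := by
  intro k x hx y hy hx0 hxy
  obtain ⟨x', hx', y', hy', h1, h2⟩ := h k (totSwap B A x) (totSwap_mem _ _ _ _ hx)
    (totSwap B' A' y) (totSwap_mem _ _ _ _ hy) (by rw [← totSwap_totD, hx0, map_zero])
    (by rw [← totSwap_totMapLin, hxy, totSwap_totD])
  refine ⟨totSwap A B x', totSwap_mem _ _ _ _ hx', totSwap A' B' y', totSwap_mem _ _ _ _ hy', ?_, ?_⟩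
  · rw [← totSwap_totD, h1, totSwap_totSwap]
  · rw [← totSwap_totMapLin, ← totSwap_totD, ← map_add, ← h2, totSwap_totSwap]

end CotensorSwap

/-! ### Cotensor products with injective comodules -/

section InjectiveColumns

variable {C : Type u} [AddCommGroup C] [Module ℚ C] [Coalgebra ℚ C] [DGVect C]

theorem rightCoact_dif (M : DGComod C) (m : M) :
    rightCoact M (dif M m) = dTens M C (rightCoact M m) := by
  rw [rightCoact, LinearMap.comp_apply, M.coact_d, dTens_swap]
  rfl

theorem cotensorCofreeInv_dTens (M : DGComod C) (V : Type u) [AddCommGroup V] [Module ℚ V]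
    [DGVect V] (z : M ⊗[ℚ] V) : cotensorCofreeInv M V (dTens M V z) =
      (TensorProduct.map (dif M) LinearMap.id + TensorProduct.map sgn (dTens C V) :
        M ⊗[ℚ] (C ⊗[ℚ] V) →ₗ[ℚ] M ⊗[ℚ] (C ⊗[ℚ] V)) (cotensorCofreeInv M V z) := by
  induction z using TensorProduct.induction_on with
  | zero => simp
  | add x y hx hy => simp only [map_add, hx, hy]
  | tmul m v =>
    have hs : rightCoact M (sgn m) = sgn (rightCoact M m) := sgn_map _ (rightCoact_mem M) m
    rw [dTens_tmul, map_add, cotensorCofreeInv_tmul, cotensorCofreeInv_tmul,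
      cotensorCofreeInv_tmul, rightCoact_dif, hs]
    generalize rightCoact M m = w
    induction w using TensorProduct.induction_on with
    | zero => simp
    | add x y hx hy =>
      simp only [map_add, ← hx, ← hy]
      abel
    | tmul a c =>
      simp only [dTens_tmul, map_add, LinearMap.lTensor_tmul, LinearMap.flip_apply,
        TensorProduct.mk_apply, LinearMap.add_apply, TensorProduct.map_tmul, LinearMap.id_apply,
        sgn_tmul, TensorProduct.tmul_add, add_assoc]

theorem cotensorCofreeInv_gr (M : DGComod C) (V : Type u) [AddCommGroup V] [Module ℚ V]
    [GrVect V] (n : ℤ) (z : M ⊗[ℚ] V) (hz : z ∈ gr (M ⊗[ℚ] V) n) :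
    cotensorCofreeInv M V z ∈ gr (M ⊗[ℚ] (C ⊗[ℚ] V)) n := by
  refine assoc_mem n _ ?_
  have := map_mem (rightCoact M) (LinearMap.id : V →ₗ[ℚ] V) 0 0
    (fun n x hx => by simpa using rightCoact_mem M n x hx) (by simp) n z hz
  rwa [show n + (0 + 0) = n by ring] at this

variable [DGCoalgebra C] [GradedCocomm C]

/-- The linear map underlying a map from a cofree comodule. -/
def cofreeLin {K : DGComod C} (r : cofree C K ⟶ K) : C ⊗[ℚ] K →ₗ[ℚ] K := r.toLin

theorem cofreeLin_dTens {K : DGComod C} (r : cofree C K ⟶ K) (z : C ⊗[ℚ] K) :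
    cofreeLin r (dTens C K z) = dif K (cofreeLin r z) := r.map_d z

/-- For an injective comodule `K`, a retraction of `M □ K ⊆ M ⊗ K`. -/
def cotensorProj (M : DGComod C) {K : DGComod C} (r : cofree C K ⟶ K) :
    M ⊗[ℚ] K →ₗ[ℚ] cotensor M K :=
  LinearMap.codRestrict (cotensorSub M K) ((cofreeLin r).lTensor M ∘ₗ cotensorCofreeInv M K)
    fun z => by
      have h := cotensorCofreeInv_mem (N := cofree C K) (LinearEquiv.refl ℚ (C ⊗[ℚ] K))
        (fun x => (LinearMap.congr_fun (LinearMap.lTensor_id C (C ⊗[ℚ] K))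
          (cofreeCoact C K x)).symm) M z
      have h2 : (LinearEquiv.refl ℚ (C ⊗[ℚ] K)).symm.toLinearMap.lTensor M
        (cotensorCofreeInv M K z) = cotensorCofreeInv M K z :=
        LinearMap.congr_fun (LinearMap.lTensor_id M (C ⊗[ℚ] K)) _
      exact cotensorSub_map (𝟙 M) r _ (h2 ▸ h)

theorem cotensorProj_incl (M : DGComod C) {K : DGComod C} (r : cofree C K ⟶ K)
    (hr : ∀ a : K, r.toLin (K.coact a) = a) (z : cotensor M K) :
    cotensorProj M r (cotensorIncl M K z) = z := by
  apply Subtype.ext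
  have h1 : cotensorLeft M K (cotensorIncl M K z) = cotensorRight M K (cotensorIncl M K z) := z.2
  have h2 : (cofreeLin r).lTensor M (K.coact.lTensor M (cotensorIncl M K z)) =
      cotensorIncl M K z := by
    rw [← LinearMap.lTensor_comp_apply, show cofreeLin r ∘ₗ K.coact = LinearMap.id from
      LinearMap.ext hr, LinearMap.lTensor_id]
    rfl
  exact (congrArg ((cofreeLin r).lTensor M) h1.symm).trans h2

theorem cotensorProj_map {M M' : DGComod C} (f : M ⟶ M') {K : DGComod C} (r : cofree C K ⟶ K)
    (z : M ⊗[ℚ] K) : cotensorProj M' r (f.toLin.rTensor K z) =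
      (cotensorMap f (𝟙 K)).toLin (cotensorProj M r z) := by
  apply Subtype.ext
  change (cofreeLin r).lTensor M' (cotensorCofreeInv M' K (f.toLin.rTensor K z)) =
    f.toLin.rTensor K ((cofreeLin r).lTensor M (cotensorCofreeInv M K z))
  induction z using TensorProduct.induction_on with
  | zero => simp
  | add x y hx hy => simp only [map_add, hx, hy]
  | tmul m y =>
    have hf : rightCoact M' (f.toLin m) = f.toLin.rTensor C (rightCoact M m) := by
      rw [rightCoact, LinearMap.comp_apply, f.map_coact]
      exact swap_map LinearMap.id f.toLin (fun _ _ h => h) f.map_mem _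
    rw [LinearMap.rTensor_tmul, cotensorCofreeInv_tmul, cotensorCofreeInv_tmul, hf]
    generalize rightCoact M m = w
    induction w using TensorProduct.induction_on with
    | zero => simp
    | add x y hx hy => simp only [map_add, hx, hy]
    | tmul a c => rfl

theorem cotensorProj_dTens (M : DGComod C) {K : DGComod C} (r : cofree C K ⟶ K) (z : M ⊗[ℚ] K) :
    cotensorProj M r (dTens M K z) = dif (cotensor M K) (cotensorProj M r z) := by
  apply Subtype.ext
  change (cofreeLin r).lTensor M (cotensorCofreeInv M K (dTens M K z)) =
    dTens M K ((cofreeLin r).lTensor M (cotensorCofreeInv M K z))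
  rw [cotensorCofreeInv_dTens]
  generalize cotensorCofreeInv M K z = w
  induction w using TensorProduct.induction_on with
  | zero => simp
  | add x y hx hy => simp only [map_add, hx, hy]
  | tmul a c => simp [cofreeLin_dTens]

theorem cotensorProj_mem (M : DGComod C) {K : DGComod C} (r : cofree C K ⟶ K) (n : ℤ)
    (z : M ⊗[ℚ] K) (hz : z ∈ gr (M ⊗[ℚ] K) n) : cotensorProj M r z ∈ gr (cotensor M K) n := by
  have := map_mem (LinearMap.id : M →ₗ[ℚ] M) r.toLin 0 0 (by simp)
    (fun n x hx => by simpa using r.map_mem n x hx) n _ (cotensorCofreeInv_gr M K n z hz)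
  rw [show n + (0 + 0) = n by ring] at this
  exact this

/-- A contraction of a complex of comodules, as a complex of dg vector spaces. -/
structure ComodComplex.Contraction (E : ComodComplex C) where
  s : ∀ n, DGHom (E.X (n + 1)) (E.X n)
  s_δ : ∀ x : E.X 0, (s 0).toLin ((E.δ 0).toLin x) = x
  δ_s : ∀ n, ∀ x : E.X (n + 1),
    (E.δ n).toLin ((s n).toLin x) + (s (n + 1)).toLin ((E.δ (n + 1)).toLin x) = x

theorem cotensor_connective {M N : DGComod C} (hM : M.IsConnective) (hN : N.IsConnective) :
    (cotensor M N).IsConnective := by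
  intro n hn
  rw [eq_bot_iff]
  intro z hz
  have h : ∀ w ∈ gr (M ⊗[ℚ] N) n, w = 0 := by
    intro w hw
    refine Submodule.span_induction (p := fun w _ => w = 0) ?_ rfl (fun x y _ _ hx hy => by
      rw [hx, hy, add_zero]) (fun a x _ hx => by rw [hx, smul_zero]) hw
    rintro _ ⟨i, j, hij, x, hx, y, hy, rfl⟩
    rcases lt_or_ge i 0 with hi | hi
    · rw [hM i hi] at hx
      rw [(Submodule.mem_bot ℚ).1 hx, TensorProduct.zero_tmul]
    · rw [hN j (by linarith)] at hy
      rw [(Submodule.mem_bot ℚ).1 hy, TensorProduct.tmul_zero]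
  exact (Submodule.mem_bot ℚ).2 (Subtype.ext (h (cotensorIncl M N z) hz))

/-- Cotensoring a contractible complex of connective comodules with a connective injective one gives
an exact complex. -/
theorem colExact_of_injective (E : ComodComplex C) (s : E.Contraction)
    (hE : ∀ n, (E.X n).IsConnective) (K : DGComod C) (hK : K.IsConnective) (hi : IsInjective K) :
    ColExact E K := by
  obtain ⟨r, hr⟩ := hi
  intro ε k x hx hx0
  let h : ∀ n, cotensor (E.X (n + 1)) K →ₗ[ℚ] cotensor (E.X n) K := fun n =>
    cotensorProj (E.X n) r ∘ₗ (s.s n).toLin.rTensor K ∘ₗ cotensorIncl (E.X (n + 1)) K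
  have hh : ∀ n z, h n z =
    cotensorProj (E.X n) r ((s.s n).toLin.rTensor K (cotensorIncl (E.X (n + 1)) K z)) :=
    fun _ _ => rfl
  have hδ : ∀ n (z : cotensor (E.X n) K), cotensorIncl (E.X (n + 1)) K
      ((cotensorMap (E.δ n) (𝟙 K)).toLin z) =
      (E.δ n).toLin.rTensor K (cotensorIncl (E.X n) K z) := fun _ _ => rfl
  have hd : ∀ n (z : cotensor (E.X (n + 1)) K),
      h n (dif (cotensor (E.X (n + 1)) K) z) = dif (cotensor (E.X n) K) (h n z) := by
    intro n z
    rw [hh, hh, ← cotensorProj_dTens, show cotensorIncl (E.X (n + 1)) K (dif (cotensor (E.X (n + 1)) K) z) =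
      dTens (E.X (n + 1)) K (cotensorIncl (E.X (n + 1)) K z) from rfl]
    congr 1
    exact dTens_map (s.s n) (DGComod.Hom.toDGHom (𝟙 K)) _
  refine row_exact (fun n m => gr (cotensor (E.X n) K) m)
    (fun n m => if m < 0 then ⊥ else ⊤) h ?_ ?_ ?_ ?_ ?_ ?_ ?_ ?_ ?_ ?_ ?_ k x hx hx0
  · intro n m z hz
    have := DGVect.d_mem _ _ hz
    rw [add_sub_cancel_right] at this
    exact Submodule.smul_mem _ _ this
  · exact fun n m z hz => (cotensorMap (E.δ n) (𝟙 K)).map_mem m z hz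
  · intro n m z hz
    have := map_mem (s.s n).toLin (LinearMap.id : K →ₗ[ℚ] K) 0 0
      (by simpa using (s.s n).map_mem) (by simp) m (cotensorIncl (E.X (n + 1)) K z) hz
    rw [show m + (0 + 0) = m by ring] at this
    exact cotensorProj_mem _ r m _ this
  · intro n m
    split_ifs with hm
    · exact (cotensor_connective (hE n) hK m hm).le
    · exact le_top
  · exact fun n m hm => if_pos hm
  · intro n z
    simp [dif_dif]
  · exact fun n z => cotensorMap_comp_zero _ _ _ _ (Or.inl (E.δ_δ n)) z
  · intro n z
    rw [LinearMap.smul_apply, LinearMap.smul_apply, map_smul, DGHom.map_d]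
  · intro z
    have h1 : (s.s 0).toLin ∘ₗ (E.δ 0).toLin = LinearMap.id := LinearMap.ext s.s_δ
    rw [hh, hδ, ← LinearMap.rTensor_comp_apply, h1, LinearMap.rTensor_id]
    exact cotensorProj_incl _ r hr z
  · intro n z
    have h1 : (E.δ n).toLin ∘ₗ (s.s n).toLin + (s.s (n + 1)).toLin ∘ₗ (E.δ (n + 1)).toLin =
      LinearMap.id := LinearMap.ext (s.δ_s n)
    rw [hh, hh, hδ, ← cotensorProj_map, ← LinearMap.rTensor_comp_apply,
      ← LinearMap.rTensor_comp_apply, ← map_add, ← LinearMap.add_apply, ← LinearMap.rTensor_add, h1,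
      LinearMap.rTensor_id]
    exact cotensorProj_incl _ r hr z
  · intro n m z _
    rw [LinearMap.smul_apply, LinearMap.smul_apply, map_smul, hd, sub_self]
    exact Submodule.zero_mem _

end InjectiveColumns

/-! ### Injective resolutions -/

section Resolutions

variable {C : Type u} [AddCommGroup C] [Module ℚ C] [Coalgebra ℚ C] [DGVect C]
variable [DGCoalgebra C]

/-- The complex `M → A⁰ → A¹ → ⋯` of an injective resolution. -/
def InjRes.augComplex {M : DGComod C} (R : InjRes M) : ComodComplex C where
  X n := match n with
    | 0 => M
    | n + 1 => R.cx.X n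
  δ n := match n with
    | 0 => R.ι
    | n + 1 => R.cx.δ n
  δ_δ n := match n with
    | 0 => R.ι_δ
    | n + 1 => R.cx.δ_δ n

theorem InjRes.exists_contraction {M : DGComod C} (R : InjRes M) :
    Nonempty R.augComplex.Contraction := by
  obtain ⟨h₀, h, h1, h2, h3⟩ := R.split
  exact ⟨{
    s := fun n => match n with
      | 0 => h₀
      | n + 1 => h n
    s_δ := h1
    δ_s := fun n => match n with
      | 0 => h2
      | n + 1 => h3 n }⟩

theorem InjRes.isConnective {M : DGComod C} (R : InjRes M) : M.IsConnective := by
  intro n hn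
  obtain ⟨h₀, -, h1, -, -⟩ := R.split
  rw [eq_bot_iff]
  intro x hx
  have h2 := R.ι.map_mem n x hx
  rw [R.connective 0 n hn] at h2
  rw [Submodule.mem_bot, ← h1 x, (Submodule.mem_bot ℚ).1 h2, map_zero]

theorem InjRes.augComplex_isConnective {M : DGComod C} (R : InjRes M) (n : ℕ) :
    (R.augComplex.X n).IsConnective := match n with
  | 0 => R.isConnective
  | n + 1 => R.connective n

/-- Replacing `M` by an injective resolution `A` does not change the total complex of a cotensor
product `M □ B` with a complex of injective comodules. -/
theorem InjRes.quasiIso_totMap_aug [GradedCocomm C] {M : DGComod C} (R : InjRes M)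
    (B : ComodComplex C) (hB : ∀ n, (B.X n).IsConnective) (hB' : ∀ n, IsInjective (B.X n)) :
    ConeExact (totPiece _ B) (totD _ B) (totPiece _ B) (totD _ B)
      (totMapLin R.aug (ComodComplex.Hom.id B)) := by
  obtain ⟨s⟩ := R.exists_contraction
  have h := coneExact_augHom R.augComplex B (totExact_of_colExact _ _ fun j =>
    colExact_of_injective _ s R.augComplex_isConnective _ (hB j) (hB' j))
  have h1 : ∀ n, R.augComplex.augHom.f n = R.aug.f n := fun n => match n with
    | 0 => rfl
    | n + 1 => rfl
  have h2 : totMapLin R.aug (ComodComplex.Hom.id B) =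
      totMapLin R.augComplex.augHom (ComodComplex.Hom.id B) := by
    unfold totMapLin
    simp only [h1]
    rfl
  rw [h2]
  exact h

end Resolutions

section Existence

variable {C : Type u} [AddCommGroup C] [Module ℚ C] [Coalgebra ℚ C] [DGVect C]
variable [DGCoalgebra C]

theorem cofree_isConnective [TwoReduced C] (V : Type u) [AddCommGroup V] [Module ℚ V] [DGVect V]
    (hV : ∀ n < 0, gr V n = ⊥) : (cofree C V).IsConnective := by
  intro n hn
  rw [eq_bot_iff]
  intro w hw
  refine Submodule.span_induction (p := fun w _ => w ∈ (⊥ : Submodule ℚ (C ⊗[ℚ] V))) ?_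
    (Submodule.zero_mem _) (fun x y _ _ hx hy => Submodule.add_mem _ hx hy)
    (fun a x _ hx => Submodule.smul_mem _ _ hx) hw
  rintro _ ⟨i, j, hij, x, hx, y, hy, rfl⟩
  rw [Submodule.mem_bot]
  rcases lt_or_ge i 0 with hi | hi
  · rw [TwoReduced.gr_neg i hi] at hx
    rw [(Submodule.mem_bot ℚ).1 hx, TensorProduct.zero_tmul]
  · rw [hV j (by linarith)] at hy
    rw [(Submodule.mem_bot ℚ).1 hy, TensorProduct.tmul_zero]

/-- The coaction, as a map into the cofree comodule. -/
def coactHom (M : DGComod C) : M ⟶ cofree C M where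
  toLin := M.coact
  map_mem := M.coact_mem
  map_d := M.coact_d
  map_coact := M.coassoc

/-- The map of cofree comodules induced by a chain map. -/
def cofreeMap {V W : Type u} [AddCommGroup V] [Module ℚ V] [DGVect V] [AddCommGroup W] [Module ℚ W]
    [DGVect W] (f : DGHom V W) : cofree C V ⟶ cofree C W where
  toLin := f.toLin.lTensor C
  map_mem n z hz := by
    have := map_mem (LinearMap.id : C →ₗ[ℚ] C) f.toLin 0 0 (by simp)
      (by simpa using f.map_mem) n z hz
    rwa [show n + (0 + 0) = n by ring] at this
  map_d z := dTens_map (⟨LinearMap.id, fun _ _ h => h, fun _ => rfl⟩ : DGHom C C) f z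
  map_coact z := cofreeCoact_map f.toLin z

/-- The chain map `ε ⊗ V : C ⊗ V → V`. -/
def counitDGHom (V : Type u) [AddCommGroup V] [Module ℚ V] [DGVect V] :
    DGHom (cofree C V) V where
  toLin := counitMap C V
  map_mem := counitMap_mem
  map_d := counitMap_dTens

theorem cofree_isInjective (V : Type u) [AddCommGroup V] [Module ℚ V] [DGVect V] :
    IsInjective (cofree C V) :=
  ⟨cofreeMap (counitDGHom V), fun a => lTensor_counitMap_cofreeCoact a⟩

/-- The difference of two maps of comodules. -/
def DGComod.subHom {M N : DGComod C} (f g : M ⟶ N) : M ⟶ N where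
  toLin := f.toLin - g.toLin
  map_mem n x hx := Submodule.sub_mem _ (f.map_mem n x hx) (g.map_mem n x hx)
  map_d x := by simp [f.map_d, g.map_d]
  map_coact x := by
    rw [LinearMap.lTensor_sub, LinearMap.sub_apply, LinearMap.sub_apply, map_sub, f.map_coact,
      g.map_coact]

/-- The comodules `M, C ⊗ M, C ⊗ (C ⊗ M), …`. -/
def cofreeIter (M : DGComod C) : ℕ → DGComod C
  | 0 => M
  | n + 1 => cofree C (cofreeIter M n)

/-- The differential of the cofree resolution of `M`. -/
def cofreeIterD (M : DGComod C) : ∀ n, cofreeIter M n ⟶ cofreeIter M (n + 1)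
  | 0 => coactHom M
  | n + 1 => DGComod.subHom (coactHom (cofreeIter M (n + 1))) (cofreeMap (cofreeIterD M n).toDGHom)

theorem cofreeIterD_succ (M : DGComod C) (n : ℕ) (x : cofreeIter M (n + 1)) :
    (cofreeIterD M (n + 1)).toLin x = (cofreeIter M (n + 1)).coact x -
      (cofreeIterD M n).toLin.lTensor C x := rfl

theorem cofreeIterD_cofreeIterD (M : DGComod C) (n : ℕ) (x : cofreeIter M n) :
    (cofreeIterD M (n + 1)).toLin ((cofreeIterD M n).toLin x) = 0 := by
  let e : ∀ n, cofreeIter M n →ₗ[ℚ] C ⊗[ℚ] (cofreeIter M n) := fun n => (cofreeIterD M n).toLin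
  have h1 : ∀ n (x : cofreeIter M n), (cofreeIterD M (n + 1)).toLin ((cofreeIterD M n).toLin x) =
      (cofreeIterD M n).toLin.lTensor C ((cofreeIter M n).coact x - e n x) := by
    intro n x
    rw [cofreeIterD_succ, (cofreeIterD M n).map_coact]
    exact (map_sub ((cofreeIterD M n).toLin.lTensor C) _ _).symm
  induction n with
  | zero =>
    rw [h1, show (cofreeIter M 0).coact x - e 0 x = 0 from sub_self _, map_zero]
    rfl
  | succ n ih =>
    rw [h1]
    have h2 : (cofreeIter M (n + 1)).coact x - e (n + 1) x =
        (cofreeIterD M n).toLin.lTensor C x :=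
      sub_sub_cancel (G := C ⊗[ℚ] (cofreeIter M (n + 1))) _ _
    refine (congrArg ((cofreeIterD M (n + 1)).toLin.lTensor C) h2).trans ?_
    have h3 : (cofreeIterD M (n + 1)).toLin ∘ₗ (cofreeIterD M n).toLin = 0 := LinearMap.ext ih
    refine (LinearMap.lTensor_comp_apply C _ _ _).symm.trans ?_
    rw [h3, LinearMap.lTensor_zero]
    rfl

theorem cofreeIter_isConnective [TwoReduced C] {M : DGComod C} (hM : M.IsConnective) :
    ∀ n, (cofreeIter M n).IsConnective
  | 0 => hM
  | n + 1 => cofree_isConnective _ (cofreeIter_isConnective hM n)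

theorem cofreeIter_contraction (M : DGComod C) (n : ℕ) (x : cofreeIter M (n + 1)) :
    (cofreeIterD M n).toLin ((counitDGHom (C := C) (cofreeIter M n)).toLin x) +
      (counitDGHom (C := C) (cofreeIter M (n + 1))).toLin ((cofreeIterD M (n + 1)).toLin x) =
    x := by
  rw [cofreeIterD_succ]
  have h1 : ∀ y : C ⊗[ℚ] (cofreeIter M n), counitMap C (cofreeIter M (n + 1))
      ((cofreeIterD M n).toLin.lTensor C y) =
      (cofreeIterD M n).toLin (counitMap C (cofreeIter M n) y) := fun y => counitMap_lTensor _ y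
  have h2 : counitMap C (cofreeIter M (n + 1)) ((cofreeIter M (n + 1)).coact x) = x :=
    counitMap_coact _ x
  refine (congrArg₂ (· + ·) (h1 x).symm ((map_sub (counitMap C (cofreeIter M (n + 1))) _ _).trans
    (congrArg₂ (· - ·) h2 rfl))).trans ?_
  exact add_sub_cancel _ _

/-- A connective comodule has an injective resolution. -/
theorem nonempty_injRes [TwoReduced C] {M : DGComod C} (hM : M.IsConnective) :
    Nonempty (InjRes M) :=
  ⟨{ cx :=
      { X := fun n => cofreeIter M (n + 1)
        δ := fun n => cofreeIterD M (n + 1)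
        δ_δ := fun n => cofreeIterD_cofreeIterD M (n + 1) }
     ι := cofreeIterD M 0
     ι_δ := cofreeIterD_cofreeIterD M 0
     connective := fun n => cofreeIter_isConnective hM (n + 1)
     injective := fun _ => cofree_isInjective _
     split := ⟨counitDGHom _, fun _ => counitDGHom _, fun x => counitMap_coact M x,
      cofreeIter_contraction M 0, fun n => cofreeIter_contraction M (n + 1)⟩ }⟩

end Existence

/-! ### Objectwise quasi-isomorphisms of double complexes -/

section TowerD

variable {E : ℕ → Type u} [∀ i, AddCommGroup (E i)] [∀ i, Module ℚ (E i)]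

/-- The total differential `x ↦ (D x_i + a x_{i-1})_i` of a sequence of complexes. -/
def towerD (D : ∀ i, E i →ₗ[ℚ] E i) (a : ∀ i, E i →ₗ[ℚ] E (i + 1)) : (∀ i, E i) →ₗ[ℚ] (∀ i, E i) :=
  LinearMap.pi fun i => match i with
    | 0 => D 0 ∘ₗ LinearMap.proj 0
    | i + 1 => D (i + 1) ∘ₗ LinearMap.proj (i + 1) + a i ∘ₗ LinearMap.proj i

theorem towerD_zero (D : ∀ i, E i →ₗ[ℚ] E i) (a : ∀ i, E i →ₗ[ℚ] E (i + 1)) (x : ∀ i, E i) :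
    towerD D a x 0 = D 0 (x 0) := rfl

theorem towerD_succ (D : ∀ i, E i →ₗ[ℚ] E i) (a : ∀ i, E i →ₗ[ℚ] E (i + 1)) (x : ∀ i, E i) (i : ℕ) :
    towerD D a x (i + 1) = D (i + 1) (x (i + 1)) + a i (x i) := rfl

/-- A graded piece of a product. -/
def piPiece (P : ∀ i, ℤ → Submodule ℚ (E i)) (k : ℤ) : Submodule ℚ (∀ i, E i) :=
  Submodule.pi Set.univ fun i => P i k

theorem mem_piPiece {P : ∀ i, ℤ → Submodule ℚ (E i)} {k : ℤ} {x : ∀ i, E i} :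
    x ∈ piPiece P k ↔ ∀ i, x i ∈ P i k := by simp [piPiece]

theorem towerD_exact (P : ∀ i, ℤ → Submodule ℚ (E i)) (D : ∀ i, E i →ₗ[ℚ] E i)
    (a : ∀ i, E i →ₗ[ℚ] E (i + 1)) (haP : ∀ i k, ∀ x ∈ P i (k + 1), a i x ∈ P (i + 1) k)
    (haa : ∀ i x, a (i + 1) (a i x) = 0) (haD : ∀ i x, a i (D i x) = - D (i + 1) (a i x))
    (hex : ∀ i k, ∀ x ∈ P i k, D i x = 0 → ∃ y ∈ P i (k + 1), D i y = x)
    (k : ℤ) (x : ∀ i, E i) (hx : x ∈ piPiece P k) (hx0 : towerD D a x = 0) :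
    ∃ y ∈ piPiece P (k + 1), towerD D a y = x := by
  obtain ⟨y, hy, hy0, hys⟩ := tower_exact P D a haP haa haD hex k x (mem_piPiece.1 hx)
    (congrFun hx0 0) (fun i => congrFun hx0 (i + 1))
  refine ⟨y, mem_piPiece.2 hy, funext fun i => ?_⟩
  cases i with
  | zero => exact hy0
  | succ i => exact hys i

end TowerD

section Bicomplex

variable {V W : ℕ → ℕ → Type u} [∀ i j, AddCommGroup (V i j)] [∀ i j, Module ℚ (V i j)]
  [∀ i j, AddCommGroup (W i j)] [∀ i j, Module ℚ (W i j)]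

/-- The total differential of a double complex of complexes. -/
def biD (d : ∀ i j, V i j →ₗ[ℚ] V i j) (a : ∀ i j, V i j →ₗ[ℚ] V (i + 1) j)
    (b : ∀ i j, V i j →ₗ[ℚ] V i (j + 1)) (x : ∀ i j, V i j) : ∀ i j, V i j
  | 0, 0 => d 0 0 (x 0 0)
  | i + 1, 0 => a i 0 (x i 0) + (-1 : ℚ) ^ (i + 1) • d (i + 1) 0 (x (i + 1) 0)
  | 0, j + 1 => b 0 j (x 0 j) + (-1 : ℚ) ^ (j + 1) • d 0 (j + 1) (x 0 (j + 1))
  | i + 1, j + 1 => a i (j + 1) (x i (j + 1)) + (-1 : ℚ) ^ (i + 1) • b (i + 1) j (x (i + 1) j) +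
      (-1 : ℚ) ^ (i + 1 + (j + 1)) • d (i + 1) (j + 1) (x (i + 1) (j + 1))

variable (P : ∀ i j, ℤ → Submodule ℚ (V i j)) (Q : ∀ i j, ℤ → Submodule ℚ (W i j))
  (d : ∀ i j, V i j →ₗ[ℚ] V i j) (a : ∀ i j, V i j →ₗ[ℚ] V (i + 1) j)
  (b : ∀ i j, V i j →ₗ[ℚ] V i (j + 1))
  (d' : ∀ i j, W i j →ₗ[ℚ] W i j) (a' : ∀ i j, W i j →ₗ[ℚ] W (i + 1) j)
  (b' : ∀ i j, W i j →ₗ[ℚ] W i (j + 1)) (f : ∀ i j, V i j →ₗ[ℚ] W i j)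

/-- The signed differential of the cone of `f` in bidegree `(i, j)`. -/
def coneD (i j : ℕ) : V i j × W i j →ₗ[ℚ] V i j × W i j :=
  (((-1 : ℚ) ^ (i + j) • d i j) ∘ₗ LinearMap.fst ℚ _ _).prod
    (f i j ∘ₗ LinearMap.fst ℚ _ _ - ((-1 : ℚ) ^ (i + j) • d' i j) ∘ₗ LinearMap.snd ℚ _ _)

theorem coneD_apply (i j : ℕ) (x : V i j) (y : W i j) : coneD d d' f i j (x, y) =
    ((-1 : ℚ) ^ (i + j) • d i j x, f i j x - (-1 : ℚ) ^ (i + j) • d' i j y) := rfl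

/-- The first differential of the cone of `f`. -/
def coneA (i j : ℕ) : V i j × W i j →ₗ[ℚ] V (i + 1) j × W (i + 1) j := (a i j).prodMap (- a' i j)

theorem coneA_apply (i j : ℕ) (x : V i j) (y : W i j) :
    coneA a a' i j (x, y) = (a i j x, - a' i j y) := rfl

/-- The signed second differential of the cone of `f`. -/
def coneB (i j : ℕ) : V i j × W i j →ₗ[ℚ] V i (j + 1) × W i (j + 1) :=
  ((-1 : ℚ) ^ i • b i j).prodMap (- ((-1 : ℚ) ^ i • b' i j))

theorem coneB_apply (i j : ℕ) (x : V i j) (y : W i j) : coneB b b' i j (x, y) =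
    ((-1 : ℚ) ^ i • b i j x, - ((-1 : ℚ) ^ i • b' i j y)) := rfl

theorem neg_one_pow_smul_smul {X : Type u} [AddCommGroup X] [Module ℚ X] (n : ℕ) (x : X) :
    (-1 : ℚ) ^ n • (-1 : ℚ) ^ n • x = x := by
  rw [smul_smul, ← mul_pow]; simp

theorem coneD_exact (h : ∀ i j, ConeExact (P i j) (d i j) (Q i j) (d' i j) (f i j)) (i j : ℕ)
    (k : ℤ) (x : V i j × W i j) (hx : x ∈ (P i j k).prod (Q i j (k + 1)))
    (hx0 : coneD d d' f i j x = 0) :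
    ∃ y ∈ (P i j (k + 1)).prod (Q i j (k + 1 + 1)), coneD d d' f i j y = x := by
  obtain ⟨x, y⟩ := x
  rw [coneD_apply] at hx0
  have h1 : (-1 : ℚ) ^ (i + j) • d i j x = 0 := congrArg Prod.fst hx0
  have h2 : f i j x - (-1 : ℚ) ^ (i + j) • d' i j y = 0 := congrArg Prod.snd hx0
  obtain ⟨x', hx', y', hy', h3, h4⟩ := h i j k x hx.1 ((-1 : ℚ) ^ (i + j) • y)
    (Submodule.smul_mem _ _ hx.2) ((smul_eq_zero.1 h1).resolve_left (pow_ne_zero _ (by norm_num)))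
    (by rw [map_smul]; exact sub_eq_zero.1 h2)
  refine ⟨((-1 : ℚ) ^ (i + j) • x', -y'), ⟨Submodule.smul_mem _ _ hx', Submodule.neg_mem _ hy'⟩, ?_⟩
  rw [coneD_apply, map_smul, neg_one_pow_smul_smul, h3, map_neg, map_smul, smul_neg, sub_neg_eq_add,
    ← smul_add, ← h4, neg_one_pow_smul_smul]

theorem coneExact_biD (haP : ∀ i j k, ∀ x ∈ P i j k, a i j x ∈ P (i + 1) j k)
    (hbP : ∀ i j k, ∀ x ∈ P i j k, b i j x ∈ P i (j + 1) k)
    (haQ : ∀ i j k, ∀ x ∈ Q i j k, a' i j x ∈ Q (i + 1) j k)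
    (hbQ : ∀ i j k, ∀ x ∈ Q i j k, b' i j x ∈ Q i (j + 1) k)
    (haa : ∀ i j x, a (i + 1) j (a i j x) = 0) (hbb : ∀ i j x, b i (j + 1) (b i j x) = 0)
    (hab : ∀ i j x, a i (j + 1) (b i j x) = b (i + 1) j (a i j x))
    (had : ∀ i j x, a i j (d i j x) = d (i + 1) j (a i j x))
    (hbd : ∀ i j x, b i j (d i j x) = d i (j + 1) (b i j x))
    (haa' : ∀ i j x, a' (i + 1) j (a' i j x) = 0) (hbb' : ∀ i j x, b' i (j + 1) (b' i j x) = 0)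
    (hab' : ∀ i j x, a' i (j + 1) (b' i j x) = b' (i + 1) j (a' i j x))
    (had' : ∀ i j x, a' i j (d' i j x) = d' (i + 1) j (a' i j x))
    (hbd' : ∀ i j x, b' i j (d' i j x) = d' i (j + 1) (b' i j x))
    (hfa : ∀ i j x, f (i + 1) j (a i j x) = a' i j (f i j x))
    (hfb : ∀ i j x, f i (j + 1) (b i j x) = b' i j (f i j x))
    (h : ∀ i j, ConeExact (P i j) (d i j) (Q i j) (d' i j) (f i j))
    (k : ℤ) (x : ∀ i j, V i j) (hx : ∀ i j : ℕ, x i j ∈ P i j (k + i + j)) (y : ∀ i j, W i j)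
    (hy : ∀ i j : ℕ, y i j ∈ Q i j (k + 1 + i + j)) (hx0 : biD d a b x = 0)
    (hxy : (fun i j => f i j (x i j)) = biD d' a' b' y) :
    ∃ (x' : ∀ i j, V i j) (y' : ∀ i j, W i j), (∀ i j : ℕ, x' i j ∈ P i j (k + 1 + i + j)) ∧
      (∀ i j : ℕ, y' i j ∈ Q i j (k + 1 + 1 + i + j)) ∧ biD d a b x' = x ∧
      ∀ i j, y i j = f i j (x' i j) + biD d' a' b' y' i j := by
  let R : ∀ i j : ℕ, ℤ → Submodule ℚ (V i j × W i j) := fun i j k =>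
    (P i j (k + i + j)).prod (Q i j (k + i + j + 1))
  let D : ∀ j, (∀ i, V i j × W i j) →ₗ[ℚ] (∀ i, V i j × W i j) := fun j =>
    towerD (fun i => coneD d d' f i j) (fun i => coneA a a' i j)
  let c : ∀ j, (∀ i, V i j × W i j) →ₗ[ℚ] (∀ i, V i (j + 1) × W i (j + 1)) := fun j =>
    LinearMap.pi fun i => coneB b b' i j ∘ₗ LinearMap.proj i
  have hc : ∀ j z i, c j z i = coneB b b' i j (z i) := fun _ _ _ => rfl
  have tot : ∀ (x : ∀ i j, V i j) (y : ∀ i j, W i j) (i j : ℕ),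
      towerD D c (fun j i => (x i j, y i j)) j i =
        (biD d a b x i j, f i j (x i j) - biD d' a' b' y i j) := by
    intro x y i j
    match i, j with
    | 0, 0 =>
      rw [towerD_zero, towerD_zero, coneD_apply]; simp [biD]
    | i + 1, 0 =>
      rw [towerD_zero, towerD_succ, coneD_apply, coneA_apply]
      simp only [biD, Prod.mk_add_mk, add_zero, Prod.mk.injEq]
      constructor <;> abel
    | 0, j + 1 =>
      rw [towerD_succ, Pi.add_apply, hc, towerD_zero, coneD_apply, coneB_apply]
      simp only [biD, Prod.mk_add_mk, zero_add, Prod.mk.injEq, pow_zero, one_smul]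
      constructor <;> abel
    | i + 1, j + 1 =>
      rw [towerD_succ, Pi.add_apply, hc, towerD_succ, coneD_apply, coneB_apply, coneA_apply]
      simp only [biD, Prod.mk_add_mk, Prod.mk.injEq]
      constructor <;> abel
  have hAD : ∀ i j z, coneA a a' i j (coneD d d' f i j z) =
      - coneD d d' f (i + 1) j (coneA a a' i j z) := by
    rintro i j ⟨x, y⟩
    simp only [coneD_apply, coneA_apply, map_sub, map_smul, had, had', hfa, map_neg, Prod.neg_mk,
      Prod.mk.injEq, show i + 1 + j = i + j + 1 by ring, pow_succ]
    constructor <;> module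
  have hBD : ∀ i j z, coneB b b' i j (coneD d d' f i j z) =
      - coneD d d' f i (j + 1) (coneB b b' i j z) := by
    rintro i j ⟨x, y⟩
    simp only [coneD_apply, coneB_apply, map_sub, map_smul, hbd, hbd', hfb, map_neg, Prod.neg_mk,
      Prod.mk.injEq, show i + (j + 1) = i + j + 1 by ring, pow_succ]
    constructor <;> module
  have hAB : ∀ i j z, coneB b b' (i + 1) j (coneA a a' i j z) =
      - coneA a a' i (j + 1) (coneB b b' i j z) := by
    rintro i j ⟨x, y⟩
    simp only [coneA_apply, coneB_apply, map_smul, hab, hab', map_neg, Prod.neg_mk,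
      Prod.mk.injEq, pow_succ]
    constructor <;> module
  have key := towerD_exact (fun j k => piPiece (fun i => R i j) k) D c ?_ ?_ ?_ ?_ k
    (fun j i => (x i j, y i j)) ?_ ?_
  · obtain ⟨z, hz, hzx⟩ := key
    have hz' : ∀ i j, z j i ∈ R i j (k + 1) := fun i j => mem_piPiece.1 (mem_piPiece.1 hz j) i
    have htot : ∀ i j, (biD d a b (fun i j => (z j i).1) i j, f i j (z j i).1 -
        biD d' a' b' (fun i j => (z j i).2) i j) = (x i j, y i j) := fun i j =>
      (tot _ _ i j).symm.trans (congrFun (congrFun hzx j) i)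
    refine ⟨fun i j => (z j i).1, fun i j => - (z j i).2, fun i j => (hz' i j).1, fun i j => ?_,
      funext fun i => funext fun j => congrArg Prod.fst (htot i j), fun i j => ?_⟩
    · have := (hz' i j).2
      rw [show k + 1 + (i : ℤ) + j + 1 = k + 1 + 1 + i + j by ring] at this
      exact Submodule.neg_mem _ this
    · have h1 : y i j = f i j (z j i).1 - biD d' a' b' (fun i j => (z j i).2) i j :=
        (congrArg Prod.snd (htot i j)).symm
      have h2 : biD d' a' b' (fun i j => -(z j i).2) i j =
          - biD d' a' b' (fun i j => (z j i).2) i j := by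
        match i, j with
        | 0, 0 => simp [biD]
        | i + 1, 0 => simp [biD]; abel
        | 0, j + 1 => simp [biD]; abel
        | i + 1, j + 1 => simp [biD]; abel
      rw [h1, h2, sub_eq_add_neg]
  · intro j k z hz
    refine mem_piPiece.2 fun i => ?_
    have := mem_piPiece.1 hz i
    refine ⟨Submodule.smul_mem _ _ (hbP _ _ _ _ ?_),
      Submodule.neg_mem _ (Submodule.smul_mem _ _ (hbQ _ _ _ _ ?_))⟩
    · have h1 := this.1
      rwa [show k + 1 + (i : ℤ) + j = k + i + ((j + 1 : ℕ) : ℤ) by push_cast; ring] at h1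
    · have h1 := this.2
      rwa [show k + 1 + (i : ℤ) + j + 1 = k + i + ((j + 1 : ℕ) : ℤ) + 1 by push_cast; ring] at h1
  · intro j z
    funext i
    rw [hc, hc]
    generalize z i = w
    obtain ⟨x, y⟩ := w
    simp [coneB_apply, hbb, hbb']
  · intro j z
    funext i
    rw [hc, Pi.neg_apply]
    cases i with
    | zero => rw [towerD_zero, towerD_zero, hBD, hc]
    | succ i => rw [towerD_succ, towerD_succ, map_add, hBD, hAB, hc, hc, neg_add]
  · intro j k z hz hz0
    refine towerD_exact (fun i => R i j) _ _ ?_ ?_ ?_ ?_ k z hz hz0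
    · intro i k w hw
      refine ⟨haP _ _ _ _ ?_, Submodule.neg_mem _ (haQ _ _ _ _ ?_)⟩
      · have h1 := hw.1
        rwa [show k + 1 + (i : ℤ) + j = k + ((i + 1 : ℕ) : ℤ) + j by push_cast; ring] at h1
      · have h1 := hw.2
        rwa [show k + 1 + (i : ℤ) + j + 1 = k + ((i + 1 : ℕ) : ℤ) + j + 1 by push_cast; ring] at h1
    · rintro i ⟨x, y⟩
      simp [coneA_apply, haa, haa']
    · exact fun i z => hAD i j z
    · intro i k w hw hw0
      obtain ⟨v, hv, hvw⟩ := coneD_exact P Q d d' f h i j _ w hw hw0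
      refine ⟨v, ?_, hvw⟩
      rwa [show k + (i : ℤ) + j + 1 = k + 1 + i + j by ring] at hv
  · refine mem_piPiece.2 fun j => mem_piPiece.2 fun i => ⟨hx i j, ?_⟩
    have := hy i j
    rwa [show k + 1 + (i : ℤ) + j = k + i + j + 1 by ring] at this
  · funext j
    funext i
    rw [tot, hx0, ← hxy, sub_self]
    rfl

end Bicomplex

section ObjectwiseQuasiIso

variable {C : Type u} [AddCommGroup C] [Module ℚ C] [Coalgebra ℚ C] [DGVect C] [GradedCocomm C]
variable {A A' B B' : ComodComplex C}

theorem totD_eq_biD (A B : ComodComplex C) (x : TotSpace A B) : totD A B x =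
    biD (V := fun i j => cotensor (A.X i) (B.X j)) (fun i j => dif (cotensor (A.X i) (B.X j)))
      (fun i j => (cotensorMap (A.δ i) (𝟙 (B.X j))).toLin)
      (fun i j => (cotensorMap (𝟙 (A.X i)) (B.δ j)).toLin) x := by
  funext i j
  rw [totD_apply]
  match i, j with
  | 0, 0 => simp [biD]
  | i + 1, 0 => rw [totVer_zero, totHor_succ]; simp [biD]
  | 0, j + 1 => rw [totHor_zero, totVer_succ]; simp [biD]
  | i + 1, j + 1 => rw [totHor_succ, totVer_succ, biD]

/-- A map of total complexes which is a quasi-isomorphism in each bidegree is a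
quasi-isomorphism. -/
theorem coneExact_totMapLin (φ : ComodComplex.Hom A A') (ψ : ComodComplex.Hom B B')
    (h : ∀ i j, ConeExact (gr (cotensor (A.X i) (B.X j))) (dif (cotensor (A.X i) (B.X j)))
      (gr (cotensor (A'.X i) (B'.X j))) (dif (cotensor (A'.X i) (B'.X j)))
      (cotensorMap (φ.f i) (ψ.f j)).toLin) :
    ConeExact (totPiece A B) (totD A B) (totPiece A' B') (totD A' B') (totMapLin φ ψ) := by
  intro k x hx y hy hx0 hxy
  rw [totD_eq_biD] at hx0 hxy
  obtain ⟨x', y', hx', hy', h1, h2⟩ := coneExact_biD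
    (V := fun i j => cotensor (A.X i) (B.X j)) (W := fun i j => cotensor (A'.X i) (B'.X j))
    (fun i j => gr (cotensor (A.X i) (B.X j))) (fun i j => gr (cotensor (A'.X i) (B'.X j)))
    _ _ _ _ _ _ (fun i j => (cotensorMap (φ.f i) (ψ.f j)).toLin)
    (fun i j k x hx => (cotensorMap (A.δ i) (𝟙 (B.X j))).map_mem k x hx)
    (fun i j k x hx => (cotensorMap (𝟙 (A.X i)) (B.δ j)).map_mem k x hx)
    (fun i j k x hx => (cotensorMap (A'.δ i) (𝟙 (B'.X j))).map_mem k x hx)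
    (fun i j k x hx => (cotensorMap (𝟙 (A'.X i)) (B'.δ j)).map_mem k x hx)
    (fun i j x => cotensorMap_comp_zero _ _ _ _ (Or.inl (A.δ_δ i)) x)
    (fun i j x => cotensorMap_comp_zero _ _ _ _ (Or.inr (B.δ_δ j)) x)
    (fun i j x => cotensorMap_interchange _ _ x)
    (fun i j x => DGHom.map_d _ x) (fun i j x => DGHom.map_d _ x)
    (fun i j x => cotensorMap_comp_zero _ _ _ _ (Or.inl (A'.δ_δ i)) x)
    (fun i j x => cotensorMap_comp_zero _ _ _ _ (Or.inr (B'.δ_δ j)) x)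
    (fun i j x => cotensorMap_interchange _ _ x)
    (fun i j x => DGHom.map_d _ x) (fun i j x => DGHom.map_d _ x)
    (fun i j x => cotensorMap_square (A.δ i) (φ.f (i + 1)) (φ.f i) (A'.δ i) (𝟙 (B.X j)) (ψ.f j)
      (ψ.f j) (𝟙 (B'.X j)) (fun x => φ.comm i x) (fun _ => rfl) x)
    (fun i j x => cotensorMap_square (𝟙 (A.X i)) (φ.f i) (φ.f i) (𝟙 (A'.X i)) (B.δ j)
      (ψ.f (j + 1)) (ψ.f j) (B'.δ j) (fun _ => rfl) (fun x => ψ.comm j x) x)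
    h k x hx y hy hx0 hxy
  refine ⟨x', hx', y', hy', (totD_eq_biD _ _ _).trans h1, ?_⟩
  rw [totD_eq_biD]
  exact funext fun i => funext fun j => h2 i j

end ObjectwiseQuasiIso

/-! ### The unit on cotensor products of injective comodules -/

section InjectiveUnit

variable {C : Type u} [AddCommGroup C] [Module ℚ C] [Coalgebra ℚ C] [DGVect C] [DGCoalgebra C]
  [TwoReduced C]

/-- The module over the cobar construction on which all generators act trivially. -/
def trivialMod (C : Type u) [AddCommGroup C] [Module ℚ C] [Coalgebra ℚ C] [DGVect C]
    [DGCoalgebra C] [TwoReduced C] (V : Type u) [AddCommGroup V] [Module ℚ V] [DGVect V] :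
    DGMod (Cobar C) :=
  cobarMod V 0 (fun _ _ _ _ _ _ => Submodule.zero_mem _) (fun c x => by
    simp [LinearMap.zero_comp])

theorem coextTwist_trivialMod (V : Type u) [AddCommGroup V] [Module ℚ V] [DGVect V]
    (z : C ⊗[ℚ] trivialMod C V) : coextTwist (univ C) (trivialMod C V) z = 0 := by
  induction z using TensorProduct.induction_on with
  | zero => exact map_zero _
  | add x y hx hy => rw [map_add, hx, hy, add_zero]
  | tmul c m =>
    have h : smulBy m ∘ₗ (univ C).toLin = 0 := LinearMap.ext fun c =>
      cobarMod_smul V 0 _ _ (cobarProj C c) m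
    rw [coextTwist_tmul, h, TensorProduct.map_zero_right]
    rfl

theorem coextD_trivialMod (V : Type u) [AddCommGroup V] [Module ℚ V] [DGVect V] (z : C ⊗[ℚ] V) :
    dif ((tCoext C).obj (trivialMod C V)) z = dTens C V z := by
  change dTens C (trivialMod C V) z + coextTwist (univ C) (trivialMod C V) z = _
  exact (congrArg (dTens C V z + ·) (coextTwist_trivialMod V z)).trans (add_zero _)

/-- A cofree comodule is the twisted coextension of a trivial module. -/
def cofreeToCoext (V : Type u) [AddCommGroup V] [Module ℚ V] [DGVect V] :
    cofree C V ⟶ (tCoext C).obj (trivialMod C V) where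
  toLin := (LinearMap.id : C ⊗[ℚ] V →ₗ[ℚ] C ⊗[ℚ] V)
  map_mem _ _ h := h
  map_d z := (coextD_trivialMod V z).symm
  map_coact z := (LinearMap.lTensor_id_apply (M := C) (C ⊗[ℚ] V) (cofreeCoact C V z)).symm

/-- The twisted coextension of a trivial module is a cofree comodule. -/
def coextToCofree (V : Type u) [AddCommGroup V] [Module ℚ V] [DGVect V] :
    (tCoext C).obj (trivialMod C V) ⟶ cofree C V where
  toLin := (LinearMap.id : C ⊗[ℚ] V →ₗ[ℚ] C ⊗[ℚ] V)
  map_mem _ _ h := h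
  map_d := coextD_trivialMod V
  map_coact z := (LinearMap.lTensor_id_apply (M := C) (C ⊗[ℚ] V) (cofreeCoact C V z)).symm

/-- An injective comodule is a retract of a twisted coextension. -/
theorem IsInjective.exists_retract {K : DGComod C} (hK : IsInjective K) :
    ∃ (X : DGMod (Cobar C)) (i : K ⟶ (tCoext C).obj X) (p : (tCoext C).obj X ⟶ K), i ≫ p = 𝟙 K := by
  obtain ⟨r, hr⟩ := hK
  exact ⟨trivialMod C K, coactHom K ≫ cofreeToCoext K, coextToCofree K ≫ r,
    DGComod.Hom.ext (LinearMap.ext hr)⟩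

variable [GradedCocomm C]

/-- The map `M □ N → t_*t^!M □ t_*t^!N`. -/
def unitCotensor (M N : DGComod C) : cotensor M N ⟶
    cotensor ((tCoext C).obj ((tExt C).obj M)) ((tCoext C).obj ((tExt C).obj N)) :=
  cotensorMap (unitHom (univ C) M) (unitHom (univ C) N)

theorem unitCotensor_naturality {M M' N N' : DGComod C} (f : M ⟶ M') (g : N ⟶ N') :
    cotensorMap f g ≫ unitCotensor M' N' = unitCotensor M N ≫
      cotensorMap ((tCoext C).map ((tExt C).map f)) ((tCoext C).map ((tExt C).map g)) := by
  unfold unitCotensor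
  rw [cotensorMap_comp, cotensorMap_comp, unitHom_naturality,
    unitHom_naturality]

theorem cotensorMap_id (M N : DGComod C) : cotensorMap (𝟙 M) (𝟙 N) = 𝟙 (cotensor M N) :=
  CategoryTheory.Functor.map_id (cotensorFunctor C) (M, N)

/-- The quasi-isomorphisms of dg comodules. -/
abbrev comodQuasiIso (C : Type u) [AddCommGroup C] [Module ℚ C] [Coalgebra ℚ C] [DGVect C] :
    MorphismProperty (DGComod C) :=
  (HomologicalComplex.quasiIso _ _).inverseImage (DGComod.underlying C)

instance : (comodQuasiIso C).HasTwoOutOfThreeProperty :=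
  inferInstanceAs ((HomologicalComplex.quasiIso _ _).inverseImage _).HasTwoOutOfThreeProperty

theorem comodQuasiIso_kappa (X Y : DGMod (Cobar C)) : comodQuasiIso C (kappa X Y) :=
  inferInstanceAs (QuasiIso ((DGComod.underlying C).map (kappa X Y)))

theorem comodQuasiIso_cotensorMap {X X' Y Y' : DGMod (Cobar C)} (f : X ⟶ X') (g : Y ⟶ Y')
    (hf : modQuasiIso C f) (hg : modQuasiIso C g) :
    comodQuasiIso C (cotensorMap ((tCoext C).map f) ((tCoext C).map g)) := by
  refine (comodQuasiIso C).of_postcomp _ (kappa X' Y') (comodQuasiIso_kappa _ _) ?_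
  rw [kappa_naturality]
  exact (comodQuasiIso C).comp_mem _ _ (comodQuasiIso_kappa _ _)
    (tCoext_map_quasiIso _ ((modQuasiIso C).tensorHom_mem f g hf hg))

theorem comodQuasiIso_unitCotensor_tCoext (X Y : DGMod (Cobar C)) :
    comodQuasiIso C (unitCotensor ((tCoext C).obj X) ((tCoext C).obj Y)) := by
  refine (comodQuasiIso C).of_postcomp _ _
    (comodQuasiIso_cotensorMap (counitHom (univ C) X) (counitHom (univ C) Y)
      (modQuasiIso_counitHom X) (modQuasiIso_counitHom Y)) ?_
  unfold unitCotensor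
  rw [cotensorMap_comp, unitHom_coext_counitHom, unitHom_coext_counitHom, cotensorMap_id]
  exact (comodQuasiIso C).id_mem _

/-- A retract of a quasi-isomorphism is a quasi-isomorphism. -/
theorem comodQuasiIso_of_retract {M N M' N' : DGComod C} {f : M ⟶ N} {g : M' ⟶ N'}
    (i : M ⟶ M') (p : M' ⟶ M) (i' : N ⟶ N') (p' : N' ⟶ N) (hi : i ≫ p = 𝟙 M) (hi' : i' ≫ p' = 𝟙 N)
    (h : f ≫ i' = i ≫ g) (h' : g ≫ p' = p ≫ f) (hg : comodQuasiIso C g) : comodQuasiIso C f := by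
  change QuasiIso g.toDGHom.complexMap at hg
  change QuasiIso f.toDGHom.complexMap
  rw [quasiIso_iff_QI] at hg ⊢
  intro x y hx hxy
  obtain ⟨x', y', h1, h2⟩ := hg (i.toLin x) (i'.toLin y) (by rw [← i.map_d, hx, map_zero]) (by
    rw [← i'.map_d, ← hxy]
    exact congrArg (fun k : M ⟶ N' => k.toLin x) h.symm)
  refine ⟨p.toLin x', p'.toLin y', ?_, ?_⟩
  · rw [← p.map_d, h1]
    exact congrArg (fun k : M ⟶ M => k.toLin x) hi
  · have h3 : p'.toLin (i'.toLin y) = y := congrArg (fun k : N ⟶ N => k.toLin y) hi'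
    have h4 : p'.toLin (g.toLin x') = f.toLin (p.toLin x') :=
      congrArg (fun k : M' ⟶ N => k.toLin x') h'
    rw [← h3, h2, map_add, p'.map_d]
    exact congrArg (· + _) h4

/-- For injective `K` and `L`, the map `K □ L → t_*t^!K □ t_*t^!L` is a quasi-isomorphism. -/
theorem comodQuasiIso_unitCotensor {K L : DGComod C} (hK : IsInjective K)
    (hL : IsInjective L) : comodQuasiIso C (unitCotensor K L) := by
  obtain ⟨X, i, p, hip⟩ := hK.exists_retract
  obtain ⟨Y, j, q, hjq⟩ := hL.exists_retract
  refine comodQuasiIso_of_retract (cotensorMap i j) (cotensorMap p q)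
    (cotensorMap ((tCoext C).map ((tExt C).map i)) ((tCoext C).map ((tExt C).map j)))
    (cotensorMap ((tCoext C).map ((tExt C).map p)) ((tCoext C).map ((tExt C).map q))) ?_ ?_
    (unitCotensor_naturality i j).symm (unitCotensor_naturality p q).symm
    (comodQuasiIso_unitCotensor_tCoext X Y)
  · rw [cotensorMap_comp, hip, hjq, cotensorMap_id]
  · rw [cotensorMap_comp, ← Functor.map_comp, ← Functor.map_comp, ← Functor.map_comp,
      ← Functor.map_comp, hip, hjq, CategoryTheory.Functor.map_id, CategoryTheory.Functor.map_id,
      CategoryTheory.Functor.map_id, CategoryTheory.Functor.map_id, cotensorMap_id]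

end InjectiveUnit

/-! ### Filtered contractions -/

section TensorFiltration

theorem apply_mem_of_mem_map₂ {V W X : Type u} [AddCommGroup V] [Module ℚ V] [AddCommGroup W]
    [Module ℚ W] [AddCommGroup X] [Module ℚ X] (P : Submodule ℚ V) (Q : Submodule ℚ W)
    (f : V ⊗[ℚ] W →ₗ[ℚ] X) (S : Submodule ℚ X) (h : ∀ v ∈ P, ∀ w ∈ Q, f (v ⊗ₜ w) ∈ S)
    (z : V ⊗[ℚ] W) (hz : z ∈ Submodule.map₂ (TensorProduct.mk ℚ V W) P Q) : f z ∈ S := by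
  have h' : Submodule.map₂ (TensorProduct.mk ℚ V W) P Q ≤ S.comap f := Submodule.map₂_le.2 h
  exact h' hz

variable {V : Type u} [AddCommGroup V] [Module ℚ V] [DGVect V]
variable {W : Type u} [AddCommGroup W] [Module ℚ W] [DGVect W]
variable {W' : Type u} [AddCommGroup W'] [Module ℚ W'] [DGVect W']

theorem gr_tensor_le (P : Submodule ℚ (V ⊗[ℚ] W)) (n : ℤ)
    (h : ∀ i j, i + j = n → ∀ v ∈ gr V i, ∀ w ∈ gr W j, v ⊗ₜ[ℚ] w ∈ P) : gr (V ⊗[ℚ] W) n ≤ P := by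
  refine Submodule.span_le.2 ?_
  rintro _ ⟨i, j, hij, v, hv, w, hw, rfl⟩
  exact h i j hij v hv w hw

theorem gr_le_map₂_right (hV : ∀ n < 0, gr V n = ⊥) (F : ℤ → Submodule ℚ W) (hF : Monotone F)
    (hg : ∀ n, gr W n ≤ F n) (n : ℤ) :
    gr (V ⊗[ℚ] W) n ≤ Submodule.map₂ (TensorProduct.mk ℚ V W) ⊤ (F n) := by
  refine gr_tensor_le _ n fun i j hij v hv w hw => ?_
  rcases lt_or_ge i 0 with hi | hi
  · rw [hV i hi] at hv
    rw [(Submodule.mem_bot ℚ).1 hv, TensorProduct.zero_tmul]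
    exact Submodule.zero_mem _
  · exact Submodule.apply_mem_map₂ _ trivial (hF (by omega : j ≤ n) (hg j hw))

theorem gr_le_map₂_left (hW : ∀ n < 0, gr W n = ⊥) (F : ℤ → Submodule ℚ V) (hF : Monotone F)
    (hg : ∀ n, gr V n ≤ F n) (n : ℤ) :
    gr (V ⊗[ℚ] W) n ≤ Submodule.map₂ (TensorProduct.mk ℚ V W) (F n) ⊤ := by
  refine gr_tensor_le _ n fun i j hij v hv w hw => ?_
  rcases lt_or_ge j 0 with hj | hj
  · rw [hW j hj] at hw
    rw [(Submodule.mem_bot ℚ).1 hw, TensorProduct.tmul_zero]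
    exact Submodule.zero_mem _
  · exact Submodule.apply_mem_map₂ _ (hF (by omega : i ≤ n) (hg i hv)) trivial

theorem dTens_lTensor_mem (s : W' →ₗ[ℚ] W) (P' : Submodule ℚ W') (P : Submodule ℚ W)
    (h : ∀ x ∈ P', dif W (s x) - s (dif W' x) ∈ P) (z : V ⊗[ℚ] W')
    (hz : z ∈ Submodule.map₂ (TensorProduct.mk ℚ V W') ⊤ P') :
    dTens V W (s.lTensor V z) - s.lTensor V (dTens V W' z) ∈
      Submodule.map₂ (TensorProduct.mk ℚ V W) ⊤ P := by
  refine apply_mem_of_mem_map₂ _ _ (dTens V W ∘ₗ s.lTensor V - s.lTensor V ∘ₗ dTens V W') _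
    (fun v _ w hw => ?_) z hz
  have h1 : (dTens V W ∘ₗ s.lTensor V - s.lTensor V ∘ₗ dTens V W') (v ⊗ₜ w) =
      sgn v ⊗ₜ (dif W (s w) - s (dif W' w)) := by
    simp [TensorProduct.tmul_sub]
  rw [h1]
  exact Submodule.apply_mem_map₂ _ trivial (h w hw)

theorem dTens_rTensor_mem (s : W' →ₗ[ℚ] W) (hs : ∀ n, ∀ x ∈ gr W' n, s x ∈ gr W n)
    (P' : Submodule ℚ W') (P : Submodule ℚ W)
    (h : ∀ x ∈ P', dif W (s x) - s (dif W' x) ∈ P) (z : W' ⊗[ℚ] V)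
    (hz : z ∈ Submodule.map₂ (TensorProduct.mk ℚ W' V) P' ⊤) :
    dTens W V (s.rTensor V z) - s.rTensor V (dTens W' V z) ∈
      Submodule.map₂ (TensorProduct.mk ℚ W V) P ⊤ := by
  refine apply_mem_of_mem_map₂ _ _ (dTens W V ∘ₗ s.rTensor V - s.rTensor V ∘ₗ dTens W' V) _
    (fun w hw v _ => ?_) z hz
  have h1 : (dTens W V ∘ₗ s.rTensor V - s.rTensor V ∘ₗ dTens W' V) (w ⊗ₜ v) =
      (dif W (s w) - s (dif W' w)) ⊗ₜ v := by
    simp [TensorProduct.sub_tmul, sgn_map s hs]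
  rw [h1]
  exact Submodule.apply_mem_map₂ _ (h w hw) trivial

theorem lTensor_mem (s : W' →ₗ[ℚ] W) (hs : ∀ n, ∀ x ∈ gr W' n, s x ∈ gr W n) (n : ℤ)
    (z : V ⊗[ℚ] W') (hz : z ∈ gr (V ⊗[ℚ] W') n) : s.lTensor V z ∈ gr (V ⊗[ℚ] W) n := by
  have := map_mem (LinearMap.id : V →ₗ[ℚ] V) s 0 0 (by simp) (by simpa using hs) n z hz
  rwa [show n + (0 + 0) = n by ring] at this

theorem rTensor_mem (s : W' →ₗ[ℚ] W) (hs : ∀ n, ∀ x ∈ gr W' n, s x ∈ gr W n) (n : ℤ)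
    (z : W' ⊗[ℚ] V) (hz : z ∈ gr (W' ⊗[ℚ] V) n) : s.rTensor V z ∈ gr (W ⊗[ℚ] V) n := by
  have := map_mem s (LinearMap.id : V →ₗ[ℚ] V) 0 0 (by simpa using hs) (by simp) n z hz
  rwa [show n + (0 + 0) = n by ring] at this

end TensorFiltration

section FilteredContraction

variable {C : Type u} [AddCommGroup C] [Module ℚ C] [Coalgebra ℚ C] [DGVect C] [DGCoalgebra C]
  [TwoReduced C]

/-- A contraction of a sequence of modules over the cobar construction, linear over the cobar
construction, which commutes with the differentials up to terms lowering a filtration by two. -/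
structure FiltContr (X : ℕ → DGMod (Cobar C)) (β : ∀ i, X i ⟶ X (i + 1)) where
  s : ∀ i, X (i + 1) →ₗ[ℚ] X i
  F : ∀ i, ℤ → Submodule ℚ (X i)
  s_mem : ∀ i n, ∀ x ∈ gr (X (i + 1)) n, s i x ∈ gr (X i) n
  s_smul : ∀ i v x, s i (genAct (X (i + 1)) v x) = genAct (X i) v (s i x)
  s_β : ∀ x, s 0 ((β 0).toLin x) = x
  β_s : ∀ i x, (β i).toLin (s i x) + s (i + 1) ((β (i + 1)).toLin x) = x
  F_mono : ∀ i, Monotone (F i)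
  gr_le : ∀ i n, gr (X i) n ≤ F i n
  F_neg : ∀ i n, n < 0 → F i n = ⊥
  comm : ∀ i n, ∀ x ∈ F (i + 1) n, dif (X i) (s i x) - s i (dif (X (i + 1)) x) ∈ F i (n - 2)

theorem coextTwist_lTensor (X Y : DGMod (Cobar C)) (s : X →ₗ[ℚ] Y)
    (hs : ∀ v x, s (genAct X v x) = genAct Y v (s x)) (z : C ⊗[ℚ] X) :
    coextTwist (univ C) Y (s.lTensor C z) = s.lTensor C (coextTwist (univ C) X z) := by
  induction z using TensorProduct.induction_on with
  | zero => simp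
  | add x y hx hy => simp only [map_add, hx, hy]
  | tmul c m =>
    have h : s ∘ₗ smulBy m ∘ₗ (univ C).toLin = smulBy (s m) ∘ₗ (univ C).toLin :=
      LinearMap.ext fun c => hs (cobarProj C c) m
    rw [LinearMap.lTensor_tmul, coextTwist_tmul, coextTwist_tmul, ← h]
    exact (LinearMap.congr_fun (LinearMap.lTensor_comp_map C s sgn (smulBy m ∘ₗ (univ C).toLin))
      (Coalgebra.comul c)).symm

/-- The twisted coextension of a contractible sequence is exact. -/
theorem FiltContr.exists_rowD_eq {X : ℕ → DGMod (Cobar C)} {β : ∀ i, X i ⟶ X (i + 1)}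
    (c : FiltContr X β) (hβ : ∀ i x, (β (i + 1)).toLin ((β i).toLin x) = 0) (ε : ℚ) (k : ℤ)
    (x : ∀ i, C ⊗[ℚ] X i) (hx : ∀ i : ℕ, x i ∈ gr (C ⊗[ℚ] X i) (k + i))
    (hx0 : rowD (fun i => ε • coextD (univ C) (X i)) (fun i => (β i).toLin.lTensor C) x = 0) :
    ∃ y : ∀ i, C ⊗[ℚ] X i, (∀ i : ℕ, y i ∈ gr (C ⊗[ℚ] X i) (k + 1 + i)) ∧
      rowD (fun i => ε • coextD (univ C) (X i)) (fun i => (β i).toLin.lTensor C) y = x := by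
  refine row_exact (fun i n => gr (C ⊗[ℚ] X i) n)
    (fun i n => Submodule.map₂ (TensorProduct.mk ℚ C (X i)) ⊤ (c.F i n))
    (fun i => (c.s i).lTensor C) ?_ ?_ ?_ ?_ ?_ ?_ ?_ ?_ ?_ ?_ ?_ k x hx hx0
  · intro i n z hz
    have := coextD_mem (univ C) (X i) _ z hz
    rw [add_sub_cancel_right] at this
    exact Submodule.smul_mem _ _ this
  · exact fun i n z hz => lTensor_mem _ (β i).map_mem n z hz
  · exact fun i n z hz => lTensor_mem _ (c.s_mem i) n z hz
  · exact fun i n => gr_le_map₂_right TwoReduced.gr_neg (c.F i) (c.F_mono i) (c.gr_le i) n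
  · intro i n hn
    rw [c.F_neg i n hn, Submodule.map₂_bot_right]
  · intro i z
    rw [LinearMap.smul_apply, LinearMap.smul_apply, map_smul, coextD_coextD, smul_zero, smul_zero]
  · intro i z
    rw [← LinearMap.lTensor_comp_apply, show (β (i + 1)).toLin ∘ₗ (β i).toLin = 0 from
      LinearMap.ext (hβ i), LinearMap.lTensor_zero, LinearMap.zero_apply]
  · intro i z
    rw [LinearMap.smul_apply, LinearMap.smul_apply, map_smul, coext_map_d]
  · intro z
    rw [← LinearMap.lTensor_comp_apply, show c.s 0 ∘ₗ (β 0).toLin = LinearMap.id from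
      LinearMap.ext c.s_β, LinearMap.lTensor_id, LinearMap.id_apply]
  · intro i z
    rw [← LinearMap.lTensor_comp_apply, ← LinearMap.lTensor_comp_apply, ← LinearMap.add_apply,
      ← LinearMap.lTensor_add, show (β i).toLin ∘ₗ c.s i + c.s (i + 1) ∘ₗ (β (i + 1)).toLin =
        LinearMap.id from LinearMap.ext (c.β_s i), LinearMap.lTensor_id, LinearMap.id_apply]
  · intro i n z hz
    rw [LinearMap.smul_apply, LinearMap.smul_apply, map_smul, ← smul_sub]
    refine Submodule.smul_mem _ _ ?_
    have h1 : coextD (univ C) (X i) ((c.s i).lTensor C z) -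
        (c.s i).lTensor C (coextD (univ C) (X (i + 1)) z) =
        dTens C (X i) ((c.s i).lTensor C z) - (c.s i).lTensor C (dTens C (X (i + 1)) z) := by
      rw [coextD, coextD, LinearMap.add_apply, LinearMap.add_apply, map_add,
        coextTwist_lTensor _ _ _ (c.s_smul i)]
      abel
    rw [h1]
    exact dTens_lTensor_mem (c.s i) _ _ (c.comm i n) z hz

variable [GradedCocomm C]

theorem rTensor_tensorAct (X X' Y : DGMod (Cobar C)) (s : X →ₗ[ℚ] X')
    (hs : ∀ n, ∀ x ∈ gr X n, s x ∈ gr X' n)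
    (h : ∀ v x, s (genAct X v x) = genAct X' v (s x)) (v : CobarGen C) (z : X ⊗[ℚ] Y) :
    s.rTensor Y (tensorAct X Y v z) = tensorAct X' Y v (s.rTensor Y z) := by
  induction z using TensorProduct.induction_on with
  | zero => simp
  | add x y hx hy => simp only [map_add, hx, hy]
  | tmul x y =>
    simp only [tensorAct_tmul, map_add, map_smul, LinearMap.rTensor_tmul, h, map_sub,
      sgn_map s hs]

/-- Filtered contractions are preserved by tensor products with connective modules. -/
def FiltContr.tensorRight {X : ℕ → DGMod (Cobar C)} {β : ∀ i, X i ⟶ X (i + 1)}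
    (c : FiltContr X β) (Y : DGMod (Cobar C)) (hY : ∀ n < 0, gr Y n = ⊥) :
    FiltContr (fun i => tensorMod (X i) Y) (fun i => tensorModMap (β i) (𝟙 Y)) where
  s i := (c.s i).rTensor Y
  F i n := Submodule.map₂ (TensorProduct.mk ℚ (X i) Y) (c.F i n) ⊤
  s_mem i n z hz := rTensor_mem (c.s i) (c.s_mem i) n z hz
  s_smul i v z := by
    refine (congrArg ((c.s i).rTensor Y) (tensorMod_smul _ _ v z)).trans ?_
    refine Eq.trans ?_ (tensorMod_smul (X i) Y v _).symm
    exact rTensor_tensorAct _ _ _ (c.s i) (c.s_mem i) (c.s_smul i) v z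
  s_β := by
    have h : ∀ z : X 0 ⊗[ℚ] Y, (c.s 0).rTensor Y ((β 0).toLin.rTensor Y z) = z := fun z => by
      rw [← LinearMap.rTensor_comp_apply, show c.s 0 ∘ₗ (β 0).toLin = LinearMap.id from
        LinearMap.ext c.s_β, LinearMap.rTensor_id, LinearMap.id_apply]
    exact h
  β_s i := by
    have h : ∀ z : X (i + 1) ⊗[ℚ] Y, (β i).toLin.rTensor Y ((c.s i).rTensor Y z) +
        (c.s (i + 1)).rTensor Y ((β (i + 1)).toLin.rTensor Y z) = z := fun z => by
      rw [← LinearMap.rTensor_comp_apply, ← LinearMap.rTensor_comp_apply, ← LinearMap.add_apply,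
        ← LinearMap.rTensor_add, show (β i).toLin ∘ₗ c.s i + c.s (i + 1) ∘ₗ (β (i + 1)).toLin =
          LinearMap.id from LinearMap.ext (c.β_s i), LinearMap.rTensor_id, LinearMap.id_apply]
    exact h
  F_mono i _ _ h := Submodule.map₂_le_map₂_left (c.F_mono i h)
  gr_le i n := gr_le_map₂_left hY (c.F i) (c.F_mono i) (c.gr_le i) n
  F_neg i n hn := (congrArg (fun P => Submodule.map₂ (TensorProduct.mk ℚ (X i) Y) P ⊤)
    (c.F_neg i n hn)).trans (Submodule.map₂_bot_left _ _)
  comm i n z hz := dTens_rTensor_mem (c.s i) (c.s_mem i) _ _ (c.comm i n) z hz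

/-- The part of degree at most `n` of a graded vector space. -/
def grLE (V : Type u) [AddCommGroup V] [Module ℚ V] [DGVect V] (n : ℤ) : Submodule ℚ V :=
  ⨆ (m : ℤ) (_ : m ≤ n), gr V m

theorem grLE_mono (V : Type u) [AddCommGroup V] [Module ℚ V] [DGVect V] : Monotone (grLE V) :=
  fun _ _ h => iSup₂_mono' fun m hm => ⟨m, hm.trans h, le_rfl⟩

theorem gr_le_grLE (V : Type u) [AddCommGroup V] [Module ℚ V] [DGVect V] {m n : ℤ} (h : m ≤ n) :
    gr V m ≤ grLE V n := le_iSup₂_of_le m h le_rfl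

theorem extTwist_tmul_mem (N : DGComod C) (P : Submodule ℚ (Cobar C ⊗[ℚ] N)) (a : Cobar C) (m : ℤ)
    (x : N) (hx : x ∈ gr N m) (hP : ∀ (b : Cobar C), ∀ y ∈ grLE N (m - 2), b ⊗ₜ[ℚ] y ∈ P) :
    extTwist (univ C) N (a ⊗ₜ x) ∈ P := by
  rw [extTwist_tmul]
  have key : gr (C ⊗[ℚ] N) m ≤
      P.comap ((LinearMap.mulLeft ℚ (sgn a) ∘ₗ (univ C).toLin).rTensor N) := by
    refine gr_tensor_le _ m fun i j hij c hc y hy => ?_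
    rw [Submodule.mem_comap, LinearMap.rTensor_tmul, LinearMap.comp_apply]
    rcases lt_or_ge i 2 with hi | hi
    · have h0 : (univ C).toLin c = 0 := by
        rcases lt_trichotomy i 0 with h | h | h
        · rw [TwoReduced.gr_neg i h] at hc
          rw [(Submodule.mem_bot ℚ).1 hc, map_zero]
        · exact univLin_zero c (h ▸ hc)
        · obtain rfl : i = 1 := by omega
          rw [TwoReduced.gr_one] at hc
          rw [(Submodule.mem_bot ℚ).1 hc, map_zero]
      rw [h0, map_zero, TensorProduct.zero_tmul]
      exact Submodule.zero_mem _
    · exact hP _ y (gr_le_grLE N (by omega) hy)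
  exact key (N.coact_mem m x hx)

theorem extTwist_mem_grLE (N : DGComod C) (n : ℤ) (z : Cobar C ⊗[ℚ] N)
    (hz : z ∈ Submodule.map₂ (TensorProduct.mk ℚ (Cobar C) N) ⊤ (grLE N n)) :
    extTwist (univ C) N z ∈
      Submodule.map₂ (TensorProduct.mk ℚ (Cobar C) N) ⊤ (grLE N (n - 2)) := by
  set P := Submodule.map₂ (TensorProduct.mk ℚ (Cobar C) N) ⊤ (grLE N (n - 2)) with hP
  refine apply_mem_of_mem_map₂ _ _ (extTwist (univ C) N) P (fun a _ x hx => ?_) z hz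
  have hle : grLE N n ≤ P.comap (extTwist (univ C) N ∘ₗ TensorProduct.mk ℚ (Cobar C) N a) := by
    refine iSup₂_le fun m hm x hx => ?_
    rw [Submodule.mem_comap, LinearMap.comp_apply, TensorProduct.mk_apply]
    exact extTwist_tmul_mem N P a m x hx
      (fun c y hy => Submodule.apply_mem_map₂ _ trivial (grLE_mono N (by omega) hy))
  exact hle hx

theorem cobar_connective (n : ℤ) (hn : n < 0) : gr (Cobar C) n = ⊥ := by
  have h : ∀ n x, IsMonomial (CobarGen C) n x → n < 0 → x = 0 := by
    intro n x hx
    induction hx with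
    | one => intro h; omega
    | mul m k v x hv _ ih =>
      intro h
      rcases lt_or_ge k 0 with hk | hk
      · rw [ih hk, mul_zero]
      · obtain ⟨c, hc, rfl⟩ := hv
        have : cobarProj C c = 0 := by
          rcases eq_or_ne m (-1) with rfl | hm
          · exact cobarProj_of_mem hc
          · rw [TwoReduced.gr_neg (m + 1) (by omega)] at hc
            rw [(Submodule.mem_bot ℚ).1 hc, map_zero]
        rw [this, map_zero, zero_mul]
  rw [eq_bot_iff]
  exact Submodule.span_le.2 fun x hx => (Submodule.mem_bot ℚ).2 (h n x hx hn)

theorem ext_connective {N : DGComod C} (hN : N.IsConnective) (n : ℤ) (hn : n < 0) :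
    gr ((tExt C).obj N) n = ⊥ := by
  rw [eq_bot_iff]
  refine gr_tensor_le (V := Cobar C) (W := N) ⊥ n fun i j hij v hv w hw => ?_
  rw [Submodule.mem_bot]
  rcases lt_or_ge i 0 with hi | hi
  · rw [cobar_connective i hi] at hv
    rw [(Submodule.mem_bot ℚ).1 hv, TensorProduct.zero_tmul]
  · rw [hN j (by omega)] at hw
    rw [(Submodule.mem_bot ℚ).1 hw, TensorProduct.tmul_zero]

theorem extD_lTensor_mem {N N' : DGComod C} (s : DGHom N' N) (n : ℤ) (z : Cobar C ⊗[ℚ] N')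
    (hz : z ∈ Submodule.map₂ (TensorProduct.mk ℚ (Cobar C) N') ⊤ (grLE N' n)) :
    extD (univ C) N (s.toLin.lTensor (Cobar C) z) -
      s.toLin.lTensor (Cobar C) (extD (univ C) N' z) ∈
      Submodule.map₂ (TensorProduct.mk ℚ (Cobar C) N) ⊤ (grLE N (n - 2)) := by
  have h1 : s.toLin.lTensor (Cobar C) (dTens (Cobar C) N' z) =
      dTens (Cobar C) N (s.toLin.lTensor (Cobar C) z) :=
    dTens_map (⟨LinearMap.id, fun _ _ h => h, fun _ => rfl⟩ : DGHom (Cobar C) (Cobar C)) s z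
  have h2 : ∀ k, (grLE N' k).map s.toLin ≤ grLE N k := by
    intro k
    rw [Submodule.map_le_iff_le_comap]
    exact iSup₂_le fun m hm x hx => gr_le_grLE N hm (s.map_mem m x hx)
  have h3 : ∀ k, ∀ w ∈ Submodule.map₂ (TensorProduct.mk ℚ (Cobar C) N') ⊤ (grLE N' k),
      s.toLin.lTensor (Cobar C) w ∈
        Submodule.map₂ (TensorProduct.mk ℚ (Cobar C) N) ⊤ (grLE N k) := by
    intro k w hw
    refine apply_mem_of_mem_map₂ _ _ (s.toLin.lTensor (Cobar C)) _ (fun a _ x hx => ?_) w hw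
    exact Submodule.apply_mem_map₂ _ trivial (h2 k ⟨x, hx, rfl⟩)
  rw [extD, extD, LinearMap.sub_apply, LinearMap.sub_apply, map_sub, h1, sub_sub_sub_cancel_left]
  exact Submodule.sub_mem _ (h3 _ _ (extTwist_mem_grLE N' n z hz))
    (extTwist_mem_grLE N n _ (h3 _ _ hz))

/-- The twisted extension of a contractible complex of connective comodules. -/
def ComodComplex.Contraction.ext {E : ComodComplex C} (c : E.Contraction)
    (hE : ∀ n, (E.X n).IsConnective) :
    FiltContr (fun i => (tExt C).obj (E.X i)) (fun i => (tExt C).map (E.δ i)) where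
  s i := (c.s i).toLin.lTensor (Cobar C)
  F i n := Submodule.map₂ (TensorProduct.mk ℚ (Cobar C) (E.X i)) ⊤ (grLE (E.X i) n)
  s_mem i n z hz := lTensor_mem (V := Cobar C) _ (c.s i).map_mem n z hz
  s_smul i v z := lTensor_smul (A := Cobar C) (c.s i).toLin (TensorAlgebra.ι ℚ v) z
  s_β := by
    have h : ∀ z : Cobar C ⊗[ℚ] E.X 0, (c.s 0).toLin.lTensor (Cobar C)
        ((E.δ 0).toLin.lTensor (Cobar C) z) = z := fun z => by
      rw [← LinearMap.lTensor_comp_apply, show (c.s 0).toLin ∘ₗ (E.δ 0).toLin = LinearMap.id from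
        LinearMap.ext c.s_δ, LinearMap.lTensor_id, LinearMap.id_apply]
    exact h
  β_s i := by
    have h : ∀ z : Cobar C ⊗[ℚ] E.X (i + 1), (E.δ i).toLin.lTensor (Cobar C)
        ((c.s i).toLin.lTensor (Cobar C) z) + (c.s (i + 1)).toLin.lTensor (Cobar C)
        ((E.δ (i + 1)).toLin.lTensor (Cobar C) z) = z := fun z => by
      rw [← LinearMap.lTensor_comp_apply, ← LinearMap.lTensor_comp_apply, ← LinearMap.add_apply,
        ← LinearMap.lTensor_add, show (E.δ i).toLin ∘ₗ (c.s i).toLin +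
          (c.s (i + 1)).toLin ∘ₗ (E.δ (i + 1)).toLin = LinearMap.id from
          LinearMap.ext (c.δ_s i), LinearMap.lTensor_id, LinearMap.id_apply]
    exact h
  F_mono i _ _ h := Submodule.map₂_le_map₂_right (grLE_mono _ h)
  gr_le i n := gr_le_map₂_right (V := Cobar C) cobar_connective _ (grLE_mono _)
    (fun _ => gr_le_grLE _ le_rfl) n
  F_neg i n hn := by
    have h : grLE (E.X i) n = ⊥ := by
      rw [eq_bot_iff]
      exact iSup₂_le fun m hm => (hE i m (by omega)).le
    exact (congrArg (Submodule.map₂ (TensorProduct.mk ℚ (Cobar C) (E.X i)) ⊤) h).trans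
      (Submodule.map₂_bot_right _ _)
  comm i n z hz := extD_lTensor_mem (c.s i) n z hz

end FilteredContraction

/-! ### Homology of the derived cotensor product -/

section Row

variable {R S : ℕ → Type u} [∀ i, AddCommGroup (R i)] [∀ i, Module ℚ (R i)]
  [∀ i, AddCommGroup (S i)] [∀ i, Module ℚ (S i)]
  {d : ∀ j, R j →ₗ[ℚ] R j} {b : ∀ j, R j →ₗ[ℚ] R (j + 1)}
  {d' : ∀ j, S j →ₗ[ℚ] S j} {b' : ∀ j, S j →ₗ[ℚ] S (j + 1)}

theorem rowD_map (f : ∀ i, R i →ₗ[ℚ] S i) (hd : ∀ i x, f i (d i x) = d' i (f i x))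
    (hb : ∀ i x, f (i + 1) (b i x) = b' i (f i x)) (x : ∀ i, R i) :
    rowD d' b' (fun i => f i (x i)) = fun i => f i (rowD d b x i) := by
  funext i
  match i with
  | 0 => exact (hd 0 (x 0)).symm
  | i + 1 => simp only [rowD_succ, map_add, map_smul, hd, hb]

/-- Exactness of a row is invariant under isomorphism. -/
theorem exists_rowD_eq_of_equiv {P : ∀ i, ℤ → Submodule ℚ (R i)} {Q : ∀ i, ℤ → Submodule ℚ (S i)}
    (f : ∀ i, R i →ₗ[ℚ] S i) (g : ∀ i, S i →ₗ[ℚ] R i) (hfg : ∀ i, f i ∘ₗ g i = LinearMap.id)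
    (hf : ∀ i, Function.Injective (f i)) (hfP : ∀ i n, ∀ x ∈ P i n, f i x ∈ Q i n)
    (hgP : ∀ i n, ∀ x ∈ Q i n, g i x ∈ P i n) (hd : ∀ i x, f i (d i x) = d' i (f i x))
    (hb : ∀ i x, f (i + 1) (b i x) = b' i (f i x))
    (h : ∀ (k : ℤ) (x : ∀ i, S i), (∀ i : ℕ, x i ∈ Q i (k + i)) → rowD d' b' x = 0 →
      ∃ y : ∀ i, S i, (∀ i : ℕ, y i ∈ Q i (k + 1 + i)) ∧ rowD d' b' y = x)
    (k : ℤ) (x : ∀ i, R i) (hx : ∀ i : ℕ, x i ∈ P i (k + i)) (hx0 : rowD d b x = 0) :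
    ∃ y : ∀ i, R i, (∀ i : ℕ, y i ∈ P i (k + 1 + i)) ∧ rowD d b y = x := by
  obtain ⟨y, hy, hyx⟩ := h k (fun i => f i (x i)) (fun i => hfP i _ _ (hx i)) (by
    rw [rowD_map f hd hb, hx0]
    exact funext fun i => map_zero _)
  refine ⟨fun i => g i (y i), fun i => hgP i _ _ (hy i), funext fun i => hf i ?_⟩
  have h1 := congrFun (rowD_map f hd hb fun i => g i (y i)) i
  rw [show (fun i => f i (g i (y i))) = y from
    funext fun i => LinearMap.congr_fun (hfg i) (y i), hyx] at h1
  exact h1.symm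

end Row

section DerivedHomology

variable {C : Type u} [AddCommGroup C] [Module ℚ C] [Coalgebra ℚ C] [DGVect C] [DGCoalgebra C]
  [TwoReduced C]

/-- The complex obtained by applying `t_* t^!` in each cohomological degree. -/
def ComodComplex.derived (E : ComodComplex C) : ComodComplex C where
  X n := (tCoext C).obj ((tExt C).obj (E.X n))
  δ n := (tCoext C).map ((tExt C).map (E.δ n))
  δ_δ n := by
    have h1 : (E.δ (n + 1)).toLin ∘ₗ (E.δ n).toLin = 0 := LinearMap.ext (E.δ_δ n)
    have h : ∀ z : C ⊗[ℚ] (Cobar C ⊗[ℚ] E.X n),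
        ((E.δ (n + 1)).toLin.lTensor (Cobar C)).lTensor C
          (((E.δ n).toLin.lTensor (Cobar C)).lTensor C z) = 0 := fun z => by
      rw [← LinearMap.lTensor_comp_apply, ← LinearMap.lTensor_comp, h1, LinearMap.lTensor_zero,
        LinearMap.lTensor_zero, LinearMap.zero_apply]
    exact h

/-- The functoriality of `ComodComplex.derived`. -/
def ComodComplex.Hom.derived {E E' : ComodComplex C} (F : ComodComplex.Hom E E') :
    ComodComplex.Hom E.derived E'.derived where
  f n := (tCoext C).map ((tExt C).map (F.f n))
  comm n := by
    have h1 : (F.f (n + 1)).toLin ∘ₗ (E.δ n).toLin = (E'.δ n).toLin ∘ₗ (F.f n).toLin :=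
      LinearMap.ext (F.comm n)
    have h : ∀ z : C ⊗[ℚ] (Cobar C ⊗[ℚ] E.X n),
        ((F.f (n + 1)).toLin.lTensor (Cobar C)).lTensor C
          (((E.δ n).toLin.lTensor (Cobar C)).lTensor C z) =
        ((E'.δ n).toLin.lTensor (Cobar C)).lTensor C
          (((F.f n).toLin.lTensor (Cobar C)).lTensor C z) := fun z => by
      rw [← LinearMap.lTensor_comp_apply, ← LinearMap.lTensor_comp_apply, ← LinearMap.lTensor_comp,
        ← LinearMap.lTensor_comp, h1]
    exact h

/-- The unit maps, as a morphism of complexes. -/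
def ComodComplex.unit (E : ComodComplex C) : ComodComplex.Hom E E.derived where
  f n := unitHom (univ C) (E.X n)
  comm n x := congrArg (fun k : E.X n ⟶ E.derived.X (n + 1) => k.toLin x)
    (unitHom_naturality (univ C) (E.δ n))

/-- The augmentation obtained from an injective resolution by applying `t_* t^!`. -/
def InjRes.derivedAug {M : DGComod C} (R : InjRes M) :
    ComodComplex.Hom (ComodComplex.single ((tCoext C).obj ((tExt C).obj M))) R.cx.derived where
  f n := match n with
    | 0 => (tCoext C).map ((tExt C).map R.ι)
    | _ + 1 => zeroHom _ _
  comm n x := match n with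
    | 0 => (R.augComplex.derived.δ_δ 0 x).symm
    | _ + 1 => (map_zero _).symm

variable [GradedCocomm C]

theorem kappa_cotensorMap_left {X X' : DGMod (Cobar C)} (Y : DGMod (Cobar C)) (f : X ⟶ X')
    (z : cotensor ((tCoext C).obj X) ((tCoext C).obj Y)) :
    (kappa X' Y).toLin ((cotensorMap ((tCoext C).map f) (𝟙 ((tCoext C).obj Y))).toLin z) =
      ((tCoext C).map (tensorModMap f (𝟙 Y))).toLin ((kappa X Y).toLin z) := by
  have h := kappa_naturality f (𝟙 Y)
  rw [CategoryTheory.Functor.map_id] at h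
  exact congrArg (fun k : cotensor ((tCoext C).obj X) ((tCoext C).obj Y) ⟶
    (tCoext C).obj (tensorMod X' Y) => k.toLin z) h

/-- Applying `t_* t^!` to a contractible complex of connective comodules gives a complex that
remains exact after cotensoring with `t_* t^! K`, for connective `K`. -/
theorem colExact_derived (E : ComodComplex C) (c : E.Contraction)
    (hE : ∀ n, (E.X n).IsConnective) (K : DGComod C) (hK : K.IsConnective) :
    ColExact E.derived ((tCoext C).obj ((tExt C).obj K)) := by
  intro ε k x hx hx0
  have hβ : ∀ i z, (tensorModMap ((tExt C).map (E.δ (i + 1))) (𝟙 ((tExt C).obj K))).toLin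
      ((tensorModMap ((tExt C).map (E.δ i)) (𝟙 ((tExt C).obj K))).toLin z) = 0 := by
    intro i
    have h1 : (E.δ (i + 1)).toLin ∘ₗ (E.δ i).toLin = 0 := LinearMap.ext (E.δ_δ i)
    have h : ∀ z : (Cobar C ⊗[ℚ] E.X i) ⊗[ℚ] (tExt C).obj K,
        ((E.δ (i + 1)).toLin.lTensor (Cobar C)).rTensor ((tExt C).obj K)
          (((E.δ i).toLin.lTensor (Cobar C)).rTensor ((tExt C).obj K) z) = 0 := fun z => by
      rw [← LinearMap.rTensor_comp_apply, ← LinearMap.lTensor_comp, h1, LinearMap.lTensor_zero,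
        LinearMap.rTensor_zero, LinearMap.zero_apply]
    exact h
  let κ := fun i => kappa ((tExt C).obj (E.X i)) ((tExt C).obj K)
  have hd : ∀ i (z : cotensor (E.derived.X i) ((tCoext C).obj ((tExt C).obj K))),
      (κ i).toLin (dif (cotensor (E.derived.X i) ((tCoext C).obj ((tExt C).obj K))) z) =
      coextD (univ C) (tensorMod ((tExt C).obj (E.X i)) ((tExt C).obj K)) ((κ i).toLin z) :=
    fun i z => (κ i).map_d z
  have hex := ((c.ext hE).tensorRight ((tExt C).obj K) (ext_connective hK)).exists_rowD_eq hβ ε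
  have hfg : ∀ i, (κ i).toLin ∘ₗ (inv (κ i)).toLin = LinearMap.id :=
    fun i => congrArg (fun k => k.toLin) (IsIso.inv_hom_id (κ i))
  have hinj : ∀ i, Function.Injective (κ i).toLin := fun i => (kappa_bijective _ _).1
  have hP : ∀ i n z, z ∈ _ → _ := fun i => (κ i).map_mem
  have hQ : ∀ i n z, z ∈ _ → _ := fun i => (inv (κ i)).map_mem
  have hb : ∀ i (z : cotensor (E.derived.X i) ((tCoext C).obj ((tExt C).obj K))),
      (κ (i + 1)).toLin ((cotensorMap (E.derived.δ i)
        (𝟙 ((tCoext C).obj ((tExt C).obj K)))).toLin z) =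
      (tensorModMap ((tExt C).map (E.δ i)) (𝟙 ((tExt C).obj K))).toLin.lTensor C
        ((κ i).toLin z) := fun i z => kappa_cotensorMap_left _ _ z
  refine exists_rowD_eq_of_equiv
    (R := fun i => cotensor (E.derived.X i) ((tCoext C).obj ((tExt C).obj K)))
    (S := fun i => C ⊗[ℚ] tensorMod ((tExt C).obj (E.X i)) ((tExt C).obj K))
    (P := fun i => gr (cotensor (E.derived.X i) ((tCoext C).obj ((tExt C).obj K))))
    (Q := fun i => gr (C ⊗[ℚ] tensorMod ((tExt C).obj (E.X i)) ((tExt C).obj K)))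
    (d' := fun i => ε • coextD (univ C) (tensorMod ((tExt C).obj (E.X i)) ((tExt C).obj K)))
    (b' := fun i =>
      (tensorModMap ((tExt C).map (E.δ i)) (𝟙 ((tExt C).obj K))).toLin.lTensor C)
    (fun i => (κ i).toLin) (fun i => (inv (κ i)).toLin)
    ?_ ?_ ?_ ?_ ?_ ?_ ?_ k x hx hx0
  · exact hfg
  · exact hinj
  · exact hP
  · exact hQ
  · exact fun i z => ((κ i).toLin.map_smul ε _).trans (congrArg (ε • ·) (hd i z))
  · exact hb
  · exact hex

theorem InjRes.coneExact_derivedAug {M : DGComod C} (R : InjRes M) (B : ComodComplex C)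
    (h : ∀ j, ColExact R.augComplex.derived (B.X j)) :
    ConeExact (totPiece _ B) (totD _ B) (totPiece _ B) (totD _ B)
      (totMapLin R.derivedAug (ComodComplex.Hom.id B)) := by
  have h0 := coneExact_augHom R.augComplex.derived B (totExact_of_colExact _ _ h)
  have h1 : ∀ n, R.augComplex.derived.augHom.f n = R.derivedAug.f n := fun n => match n with
    | 0 => rfl
    | n + 1 => rfl
  have h2 : totMapLin R.derivedAug (ComodComplex.Hom.id B) =
      totMapLin R.augComplex.derived.augHom (ComodComplex.Hom.id B) := by
    unfold totMapLin
    simp only [h1]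
    rfl
  rw [h2]
  exact h0

instance subsingleton_cotensor_zeroComod_right (M : DGComod C) :
    Subsingleton (cotensor M (zeroComod C)) :=
  ⟨fun x y => by
    apply Subtype.ext
    have : Subsingleton (M ⊗[ℚ] (zeroComod C)) := (inferInstance : Subsingleton (M ⊗[ℚ] PUnit.{u + 1}))
    exact Subsingleton.elim (α := M ⊗[ℚ] (zeroComod C)) _ _⟩

/-- The inclusion of `A⁰ □ B⁰` in the product total complex. -/
def totIncl (A B : ComodComplex C) : cotensor (A.X 0) (B.X 0) →ₗ[ℚ] TotSpace A B :=
  LinearMap.pi fun i => LinearMap.pi fun j => match i, j with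
    | 0, 0 => LinearMap.id
    | 0, _ + 1 => 0
    | _ + 1, _ => 0

@[simp] theorem totIncl_zero_zero (A B : ComodComplex C) (z : cotensor (A.X 0) (B.X 0)) :
    totIncl A B z 0 0 = z := rfl

theorem totMapLin_totIncl {A A' B B' : ComodComplex C} (φ : ComodComplex.Hom A A')
    (ψ : ComodComplex.Hom B B') (z : cotensor (A.X 0) (B.X 0)) :
    totMapLin φ ψ (totIncl A B z) = totIncl A' B' ((cotensorMap (φ.f 0) (ψ.f 0)).toLin z) := by
  funext i j
  match i, j with
  | 0, 0 => rfl
  | 0, j + 1 => exact map_zero (cotensorMap (φ.f 0) (ψ.f (j + 1))).toLin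
  | i + 1, j => exact map_zero (cotensorMap (φ.f (i + 1)) (ψ.f j)).toLin

theorem totD_zero_zero (A B : ComodComplex C) (x : TotSpace A B) :
    totD A B x 0 0 = dif (cotensor (A.X 0) (B.X 0)) (x 0 0) := by
  rw [totD_apply, totHor_zero, totVer_zero]
  simp

theorem totIncl_mem (A B : ComodComplex C) (n : ℤ) (z : cotensor (A.X 0) (B.X 0))
    (hz : z ∈ gr (cotensor (A.X 0) (B.X 0)) n) : totIncl A B z ∈ totPiece A B n := by
  intro i j
  match i, j with
  | 0, 0 => simpa using hz
  | 0, j + 1 => exact Submodule.zero_mem _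
  | i + 1, j => exact Submodule.zero_mem _

theorem single_ext {M N : DGComod C}
    {x y : TotSpace (ComodComplex.single M) (ComodComplex.single N)} (h : x 0 0 = y 0 0) :
    x = y := by
  funext i j
  match i, j with
  | 0, 0 => exact h
  | 0, j + 1 => exact (subsingleton_cotensor_zeroComod_right M).elim _ _
  | i + 1, j => exact (subsingleton_cotensor_zeroComod _).elim _ _

theorem coneExact_totIncl_single (M N : DGComod C) :
    ConeExact (gr (cotensor M N)) (dif (cotensor M N))
      (totPiece (ComodComplex.single M) (ComodComplex.single N))
      (totD (ComodComplex.single M) (ComodComplex.single N))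
      (totIncl (ComodComplex.single M) (ComodComplex.single N)) := by
  intro k x _ y hy _ hxy
  refine ⟨y 0 0, ?_, 0, Submodule.zero_mem _, ?_, ?_⟩
  · have h := hy 0 0
    rw [Nat.cast_zero, add_zero, add_zero] at h
    exact h
  · exact (totD_zero_zero _ _ y).symm.trans (congrFun (congrFun hxy 0) 0).symm
  · rw [map_zero, add_zero]
    exact single_ext rfl

theorem totIncl_single_dif (M N : DGComod C) (z : cotensor M N) :
    totIncl (ComodComplex.single M) (ComodComplex.single N) (dif (cotensor M N) z) =
      totD _ _ (totIncl (ComodComplex.single M) (ComodComplex.single N) z) :=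
  single_ext (totD_zero_zero _ _ (totIncl (ComodComplex.single M) (ComodComplex.single N) z)).symm

/-- The map from the derived cotensor product to the total complex of the resolutions. -/
def totAug {M N : DGComod C} (R : InjRes M) (S : InjRes N) :
    complex (cotensor ((tCoext C).obj ((tExt C).obj M)) ((tCoext C).obj ((tExt C).obj N))) ⟶
      totComplex R.cx.derived S.cx.derived :=
  complexMap (totIncl (ComodComplex.single _) (ComodComplex.single _))
    (totIncl_mem (ComodComplex.single _) (ComodComplex.single _)) (totIncl_single_dif _ _) ≫
    totMap R.derivedAug (ComodComplex.Hom.id _) ≫ totMap (ComodComplex.Hom.id _) S.derivedAug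

instance quasiIso_totAug {M N : DGComod C} (R : InjRes M) (S : InjRes N) :
    QuasiIso (totAug R S) := by
  obtain ⟨c⟩ := R.exists_contraction
  obtain ⟨c'⟩ := S.exists_contraction
  have h1 : QuasiIso (totMap R.derivedAug
      (ComodComplex.Hom.id (ComodComplex.single ((tCoext C).obj ((tExt C).obj N))))) :=
    (quasiIso_complexMap_iff _ _ _).2 (R.coneExact_derivedAug _ fun j => match j with
      | 0 => colExact_derived _ c R.augComplex_isConnective N S.isConnective
      | j + 1 => colExact_zeroComod _)
  have h2 : QuasiIso (totMap (ComodComplex.Hom.id R.cx.derived) S.derivedAug) :=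
    (quasiIso_complexMap_iff _ _ _).2 (coneExact_totMapLin_swap _ _
      (S.coneExact_derivedAug _ fun j =>
        colExact_derived _ c' S.augComplex_isConnective _ (R.connective j)))
  have h3 : QuasiIso (complexMap (hP := DGVect.d_mem) (hD := DGVect.d_d)
      (hP' := totD_mem _ _) (hD' := totD_totD _ _)
      (totIncl (ComodComplex.single ((tCoext C).obj ((tExt C).obj M)))
        (ComodComplex.single ((tCoext C).obj ((tExt C).obj N))))
      (totIncl_mem (ComodComplex.single _) (ComodComplex.single _)) (totIncl_single_dif _ _)) :=
    (quasiIso_complexMap_iff _ _ _).2 (coneExact_totIncl_single _ _)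
  have h4 := quasiIso_comp (hφ := h1) (hφ' := h2)
  exact quasiIso_comp (hφ := h3) (hφ' := h4)

/-- The map of total complexes induced by the unit maps. -/
abbrev totUnit {M N : DGComod C} (R : InjRes M) (S : InjRes N) :
    totComplex R.cx S.cx ⟶ totComplex R.cx.derived S.cx.derived :=
  totMap R.cx.unit S.cx.unit

instance quasiIso_totUnit {M N : DGComod C} (R : InjRes M) (S : InjRes N) :
    QuasiIso (totUnit R S) :=
  (quasiIso_complexMap_iff _ _ _).2 (coneExact_totMapLin _ _ fun i j =>
    (quasiIso_complexMap_iff _ (unitCotensor (R.cx.X i) (S.cx.X j)).map_mem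
      (unitCotensor (R.cx.X i) (S.cx.X j)).map_d).1
      (comodQuasiIso_unitCotensor (R.injective i) (S.injective j)))

theorem totMapLin_derivedAug {M N : DGComod C} (R : InjRes M) (S : InjRes N)
    (z : cotensor ((tCoext C).obj ((tExt C).obj M)) ((tCoext C).obj ((tExt C).obj N))) :
    totMapLin (ComodComplex.Hom.id _) S.derivedAug
        (totMapLin R.derivedAug (ComodComplex.Hom.id _)
          (totIncl (ComodComplex.single _) (ComodComplex.single _) z)) =
      totIncl R.cx.derived S.cx.derived
        ((cotensorMap ((tCoext C).map ((tExt C).map R.ι)) (𝟙 _) ≫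
          cotensorMap (𝟙 _) ((tCoext C).map ((tExt C).map S.ι))).toLin z) := by
  have h1 := totMapLin_totIncl R.derivedAug
    (ComodComplex.Hom.id (ComodComplex.single ((tCoext C).obj ((tExt C).obj N)))) z
  have h2 := totMapLin_totIncl (ComodComplex.Hom.id R.cx.derived) S.derivedAug
    ((cotensorMap ((tCoext C).map ((tExt C).map R.ι))
      (𝟙 ((tCoext C).obj ((tExt C).obj N)))).toLin z)
  exact (congrArg (totMapLin (ComodComplex.Hom.id R.cx.derived) S.derivedAug) h1).trans h2

theorem InjRes.LiesOver.comp_eq {M M' : DGComod C} {R : InjRes M} {R' : InjRes M'}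
    {F : ComodComplex.Hom R.cx R'.cx} {f : M ⟶ M'} (h : InjRes.LiesOver F f) :
    R.ι ≫ F.f 0 = f ≫ R'.ι := DGComod.Hom.ext (LinearMap.ext h)

theorem totAug_naturality {M M' N N' : DGComod C} (f : M ⟶ M') (g : N ⟶ N') {R : InjRes M}
    {R' : InjRes M'} {S : InjRes N} {S' : InjRes N'} (F : ComodComplex.Hom R.cx R'.cx)
    (G : ComodComplex.Hom S.cx S'.cx) (hF : InjRes.LiesOver F f) (hG : InjRes.LiesOver G g) :
    (DGComod.underlying C).map (cotensorMap ((tCoext C).map ((tExt C).map f))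
        ((tCoext C).map ((tExt C).map g))) ≫ totAug R' S' =
      totAug R S ≫ totMap F.derived G.derived := by
  have h : (cotensorMap ((tCoext C).map ((tExt C).map f)) ((tCoext C).map ((tExt C).map g)) ≫
      cotensorMap ((tCoext C).map ((tExt C).map R'.ι)) (𝟙 _)) ≫
        cotensorMap (𝟙 _) ((tCoext C).map ((tExt C).map S'.ι)) =
      (cotensorMap ((tCoext C).map ((tExt C).map R.ι)) (𝟙 _) ≫
        cotensorMap (𝟙 _) ((tCoext C).map ((tExt C).map S.ι))) ≫
        cotensorMap ((tCoext C).map ((tExt C).map (F.f 0)))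
          ((tCoext C).map ((tExt C).map (G.f 0))) := by
    simp only [cotensorMap_comp, Category.comp_id, Category.id_comp,
      ← Functor.map_comp, hF.comp_eq, hG.comp_eq]
  have key : ∀ z : cotensor ((tCoext C).obj ((tExt C).obj M)) ((tCoext C).obj ((tExt C).obj N)),
      totMapLin (ComodComplex.Hom.id _) S'.derivedAug
        (totMapLin R'.derivedAug (ComodComplex.Hom.id _)
          (totIncl (ComodComplex.single _) (ComodComplex.single _)
            ((cotensorMap ((tCoext C).map ((tExt C).map f))
              ((tCoext C).map ((tExt C).map g))).toLin z))) =
      totMapLin F.derived G.derived (totMapLin (ComodComplex.Hom.id _) S.derivedAug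
        (totMapLin R.derivedAug (ComodComplex.Hom.id _)
          (totIncl (ComodComplex.single _) (ComodComplex.single _) z))) := by
    intro z
    refine (totMapLin_derivedAug R' S' _).trans ?_
    refine Eq.trans ?_ (congrArg (totMapLin F.derived G.derived)
      (totMapLin_derivedAug R S z)).symm
    refine Eq.trans ?_ (totMapLin_totIncl F.derived G.derived _).symm
    exact congrArg (fun k => totIncl R'.cx.derived S'.cx.derived (k.toLin z)) h
  exact HomologicalComplex.hom_ext _ _ fun n =>
    ModuleCat.hom_ext (LinearMap.ext fun z => Subtype.ext (key z.1))

theorem totUnit_naturality {M M' N N' : DGComod C} {R : InjRes M}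
    {R' : InjRes M'} {S : InjRes N} {S' : InjRes N'} (F : ComodComplex.Hom R.cx R'.cx)
    (G : ComodComplex.Hom S.cx S'.cx) :
    totMap F G ≫ totUnit R' S' = totUnit R S ≫ totMap F.derived G.derived := by
  have key : ∀ z, totMapLin R'.cx.unit S'.cx.unit (totMapLin F G z) =
      totMapLin F.derived G.derived (totMapLin R.cx.unit S.cx.unit z) := fun z =>
    funext fun i => funext fun j => congrArg
      (fun k : cotensor (R.cx.X i) (S.cx.X j) ⟶
        cotensor ((tCoext C).obj ((tExt C).obj (R'.cx.X i)))
          ((tCoext C).obj ((tExt C).obj (S'.cx.X j))) => k.toLin (z i j))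
      (unitCotensor_naturality (F.f i) (G.f j))
  exact HomologicalComplex.hom_ext _ _ fun n =>
    ModuleCat.hom_ext (LinearMap.ext fun z => Subtype.ext (key z.1))

theorem homologyMap_zigzag {A A' T T' L L' : ChainComplex (ModuleCat.{u} ℚ) ℤ} (a : A ⟶ T)
    (a' : A' ⟶ T') (b : L ⟶ T) (b' : L' ⟶ T') [QuasiIso a] [QuasiIso a'] [QuasiIso b] [QuasiIso b']
    (p : A ⟶ A') (t : T ⟶ T') (l : L ⟶ L') (h : p ≫ a' = a ≫ t) (h' : l ≫ b' = b ≫ t) (k : ℤ) :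
    HomologicalComplex.homologyMap p k ≫
        (isoOfQuasiIsoAt a' k ≪≫ (isoOfQuasiIsoAt b' k).symm).hom =
      (isoOfQuasiIsoAt a k ≪≫ (isoOfQuasiIsoAt b k).symm).hom ≫
        HomologicalComplex.homologyMap l k := by
  have h1 := congrArg (fun φ => HomologicalComplex.homologyMap φ k) h
  have h2 := congrArg (fun φ => HomologicalComplex.homologyMap φ k) h'
  simp only [HomologicalComplex.homologyMap_comp] at h1 h2
  have h3 : (isoOfQuasiIsoAt b k).inv ≫ HomologicalComplex.homologyMap l k =
      HomologicalComplex.homologyMap t k ≫ (isoOfQuasiIsoAt b' k).inv := by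
    rw [Iso.inv_comp_eq, ← Category.assoc, Iso.eq_comp_inv]
    exact h2
  simp only [Iso.trans_hom, Iso.symm_hom, isoOfQuasiIsoAt_hom, Category.assoc, h3]
  rw [← Category.assoc, h1, Category.assoc]

/-- The homology of the derived cotensor product is the cotorsion. -/
def homologyIsoCotor {M N : DGComod C} (R : InjRes M) (S : InjRes N) (k : ℤ) :
    (DGComod.homology C k).obj ((derivedCotensor C).obj (M, N)) ≅ Cotor R S k :=
  isoOfQuasiIsoAt (totAug R S) k ≪≫ (isoOfQuasiIsoAt (totUnit R S) k).symm

theorem homologyIsoCotor_naturality {M M' N N' : DGComod C} (f : M ⟶ M') (g : N ⟶ N')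
    {R : InjRes M} {R' : InjRes M'} {S : InjRes N} {S' : InjRes N'}
    (F : ComodComplex.Hom R.cx R'.cx) (G : ComodComplex.Hom S.cx S'.cx)
    (hF : InjRes.LiesOver F f) (hG : InjRes.LiesOver G g) (k : ℤ) :
    (DGComod.homology C k).map ((derivedCotensor C).map
        (X := (M, N)) (Y := (M', N')) (Prod.mkHom f g)) ≫ (homologyIsoCotor R' S' k).hom =
      (homologyIsoCotor R S k).hom ≫ Cotor.map F G k :=
  homologyMap_zigzag (totAug R S) (totAug R' S') (totUnit R S) (totUnit R' S') _ _ (totMap F G)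
    (totAug_naturality f g F G hF hG) (totUnit_naturality F G) k

end DerivedHomology

end

end DGKoszul

theorem mainTheorem7 (C : Type u) [AddCommGroup C] [Module ℚ C] [Coalgebra ℚ C] [DGVect C]
    [DGCoalgebra C] [TwoReduced C] [GradedCocomm C] :
    -- the derived cotensor product preserves `t`-equivalences in both variables
    (∀ {M M' N N' : DGComod C} (f : M ⟶ M') (g : N ⟶ N'), tEquiv C f → tEquiv C g →
      tEquiv C ((derivedCotensor C).map (X := (M, N)) (Y := (M', N')) (Prod.mkHom f g))) ∧
    -- and the induced bifunctor on the homotopy category is a symmetric monoidal structure, with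
    -- unit `C` and with structure isomorphisms compatible with those of the cotensor product
    (∃ (_ : MonoidalCategory (HoComod C)) (_ : SymmetricCategory (HoComod C))
      (μ : (toHo C).prod (toHo C) ⋙ tensor (HoComod C) ≅ derivedCotensor C ⋙ toHo C)
      (e : 𝟙_ (HoComod C) ≅ (toHo C).obj (regular C)),
      (∀ (M N P X : DGComod C) (a : X ⟶ cotensor (cotensor M N) P)
        (b : X ⟶ cotensor M (cotensor N P)),
        (∀ x : X, TensorProduct.assoc ℚ M N P
            ((cotensorIncl M N).rTensor P (cotensorIncl (cotensor M N) P (a.toLin x))) =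
          (cotensorIncl N P).lTensor M (cotensorIncl M (cotensor N P) (b.toLin x))) →
        (toHo C).map a ≫ laxMap μ (cotensor M N) P ≫ (laxMap μ M N ▷ (toHo C).obj P) ≫
            (α_ ((toHo C).obj M) ((toHo C).obj N) ((toHo C).obj P)).hom =
          (toHo C).map b ≫ laxMap μ M (cotensor N P) ≫ ((toHo C).obj M ◁ laxMap μ N P)) ∧
      (∀ (M X : DGComod C) (a : X ⟶ cotensor (regular C) M) (b : X ⟶ M),
        (∀ x : X, TensorProduct.lid ℚ M ((Coalgebra.counit (R := ℚ) (A := C)).rTensor M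
            (cotensorIncl (regular C) M (a.toLin x))) = b.toLin x) →
        (toHo C).map a ≫ laxMap μ (regular C) M ≫ (e.inv ▷ (toHo C).obj M) ≫
            (λ_ ((toHo C).obj M)).hom = (toHo C).map b) ∧
      (∀ (M N X : DGComod C) (a : X ⟶ cotensor M N) (b : X ⟶ cotensor N M),
        (∀ x : X, swap M N (cotensorIncl M N (a.toLin x)) = cotensorIncl N M (b.toLin x)) →
        (toHo C).map a ≫ laxMap μ M N ≫ (β_ ((toHo C).obj M) ((toHo C).obj N)).hom =
          (toHo C).map b ≫ laxMap μ N M)) ∧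
    -- injective resolutions of connective comodules exist, and each of the three total complexes
    -- `Tot^∏ (A □ N) → Tot^∏ (A □ B) ← Tot^∏ (M □ B)` computes the cotorsion groups
    (∀ M : DGComod C, M.IsConnective → Nonempty (InjRes M)) ∧
    (∀ (M N : DGComod C) (R : InjRes M) (S : InjRes N),
      QuasiIso (totMap (ComodComplex.Hom.id R.cx) S.aug) ∧
      QuasiIso (totMap R.aug (ComodComplex.Hom.id S.cx))) ∧
    -- the homology of the derived cotensor product of connective comodules is the cotorsion groups,
    -- naturally in the two comodules
    (∃ φ : ∀ (M N : DGComod C) (R : InjRes M) (S : InjRes N) (k : ℤ),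
        (DGComod.homology C k).obj ((derivedCotensor C).obj (M, N)) ≅ Cotor R S k,
      ∀ (M M' N N' : DGComod C) (f : M ⟶ M') (g : N ⟶ N') (R : InjRes M) (R' : InjRes M')
        (S : InjRes N) (S' : InjRes N') (F : ComodComplex.Hom R.cx R'.cx)
        (G : ComodComplex.Hom S.cx S'.cx),
        InjRes.LiesOver F f → InjRes.LiesOver G g → ∀ k : ℤ,
        (DGComod.homology C k).map ((derivedCotensor C).map
            (X := (M, N)) (Y := (M', N')) (Prod.mkHom f g)) ≫ (φ M' N' R' S' k).hom =
          (φ M N R S k).hom ≫ Cotor.map F G k) := by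
  refine ⟨fun f g hf hg => tEquiv_derivedCotensor_map f g hf hg, exists_isCotensorStructure C, ?_, ?_, ?_⟩
  · exact fun M hM => nonempty_injRes hM
  · intro M N R S
    exact ⟨(quasiIso_complexMap_iff _ _ _).2 (coneExact_totMapLin_swap _ _
        (S.quasiIso_totMap_aug R.cx R.connective R.injective)),
      (quasiIso_complexMap_iff _ _ _).2 (R.quasiIso_totMap_aug S.cx S.connective S.injective)⟩
  · exact ⟨fun M N R S k => homologyIsoCotor R S k, fun M M' N N' f g R R' S S' F G hF hG k =>
      homologyIsoCotor_naturality f g F G hF hG k⟩
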